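/- Let $n\ge 1$ and write points of $\mathbb R^{n-1}\times\mathbb R$ as $(x,t)$. For $r>0$ let $Q_r(x,t)=J_r\times I_r$ be the parabolic cube with $J_r=\{y:|x_i-y_i|<r\ \text{for all } i\}$, $I_r=\{s:|t-s|^{1/2}<r\}$. For a set $S$ let $\|f\|_{*,S}=\sup_{Q\subset S}\frac1{|Q|}\int_Q|f-f_Q|\,dx\,dt$, the supremum being over all parabolic cubes $Q\subset S$, where $f_Q$ is the mean of $f$ over $Q$; write $\|f\|_*$ if $S=\mathbb R^{n-1}\times\mathbb R$. A function $\phi$ is $\mathrm{Lip}(1,1/2)$ with constant $\ell$ if $|\phi(x,t)-\phi(y,s)|\le \ell(|x-y|+|t-s|^{1/2})$; $\nabla\phi$ denotes its gradient in $x$. For $\delta:[0,\infty)\to[0,\infty)$ with $\delta(0)=0$, continuous at $0$ (a modulus of continuity), let $C_\delta$ be the set of functions $h$ on $Q_{8d}$ with $|h(p)-h(q)|\le\delta(|p-q|)$ for all $p,q$, and $d(f,C_\delta)=\inf_{h\in C_\delta}\|f-h\|_{*,Q_{8d}}$ (here $f$ and $h$ are $\mathbb R^{n-1}$-valued). Let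 $\mathbb D$ be the parabolic derivative, $\widehat{\mathbb D\Phi}(\xi,\tau)=(|\xi|+|\tau|^{1/2})\,\widehat\Phi(\xi,\tau)$; for $\mathrm{Lip}(1,1/2)$ functions $\Phi$ it is understood by duality against test functions of mean zero, hence modulo additive constants. **Theorem.** There are constants $C_\epsilon$ ($0<\epsilon<1$), depending only on $n$ and $\epsilon$, and $C_0$, depending only on $n$, such that the following holds. Let $d,r_1,\eta>0$ and let $\delta$ be a modulus of continuity. There is a scale $0<d'\le d$, depending only on $n,d,\delta,\eta,r_1$, such that whenever $Q_{8d}$ and $Q_{4d}$ are concentric parabolic cubes, $\phi:Q_{8d}\to\mathbb R$ is $\mathrm{Lip}(1,1/2)$ with constant $\ell$, $$\sup_{Q_s=J_s\times I_s\subset Q_{8d},\ s\le r_1}\ \frac1{|Q_s|}\int_{Q_s}\int_{I_s}\frac{|\phi(x,t)-\phi(x,\tau)|^2}{|t-\tau|^2}\,d\tau\,dt\,dx\le\eta^2\qquad\text{and}\qquad d(\nabla\phi,C_\delta)\le\eta,$$ then for every parabolic cube $Q_r\subset Q_{4d}$ with $r\le d'$ there is a function $\Phi:\mathbb R^{n-1}\times\mathbb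 R\to\mathbb R$ with the following properties: 1. $\Phi=\phi$ on $Q_r$; 2. $\Phi$ is $\mathrm{Lip}(1,1/2)$ on $\mathbb R^{n-1}\times\mathbb R$ with the same constant $\ell$; 3. $\|\nabla\Phi\|_*\le C_\epsilon(\eta^{1-\epsilon}+\eta\ell)$ for all $0<\epsilon<1$; 4. $\displaystyle\sup_{Q_s=J_s\times I_s}\frac1{|Q_s|}\int_{Q_s}\int_{I_s}\frac{|\Phi(x,t)-\Phi(x,\tau)|^2}{|t-\tau|^2}\,d\tau\,dt\,dx\le C_0\,\eta^2$, the supremum being over all parabolic cubes; 5. $\mathbb D\Phi$ is represented by a locally integrable function with $\|\mathbb D\Phi\|_*\le C_\epsilon(\eta^{1-\epsilon}+\eta\ell)$ for all $0<\epsilon<1$ if $\eta<1$, and $\|\mathbb D\Phi\|_*\le C_0(\eta+\ell)$ if $\eta\ge1$. -/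

import Mathlib

open MeasureTheory
open scoped NNReal ENNReal ContDiff FourierTransform

noncomputable section

/-- Space-time `ℝ^m × ℝ` (space variable, time variable). With `m = n - 1` this is the `ℝ^{n-1} × ℝ`
over which the boundary graphs are defined. Its measure is Lebesgue measure. -/
abbrev SpaceTime (m : ℕ) : Type := EuclideanSpace ℝ (Fin m) × ℝ

/-- The time interval `I_r(t) = {s : |t - s|^{1/2} < r}`. -/
def timeInterval (t r : ℝ) : Set ℝ := {s | √|t - s| < r}

/-- The spatial cube `J_r(x) = {y : |x_i - y_i| < r for all i}`. -/
def spatialCube {m : ℕ} (x : EuclideanSpace ℝ (Fin m)) (r : ℝ) : Set (EuclideanSpace ℝ (Fin m)) :=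
  {y | ∀ i, |x i - y i| < r}

/-- The parabolic cube `Q_r(x,t) = J_r(x) × I_r(t)`. -/
def parabolicCube {m : ℕ} (z : SpaceTime m) (r : ℝ) : Set (SpaceTime m) :=
  spatialCube z.1 r ×ˢ timeInterval z.2 r

/-- `φ` is `Lip(1,1/2)` on `S` with constant `ℓ`. -/
def IsLipHalfOn {m : ℕ} (ℓ : ℝ) (φ : SpaceTime m → ℝ) (S : Set (SpaceTime m)) : Prop :=
  ∀ p ∈ S, ∀ q ∈ S, |φ p - φ q| ≤ ℓ * (‖p.1 - q.1‖ + √|p.2 - q.2|)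

/-- The gradient `∇φ` in the space variables. For a `Lip(1,1/2)` function it exists almost everywhere
(and is then the weak gradient). -/
def spatialGradient {m : ℕ} (φ : SpaceTime m → ℝ) (p : SpaceTime m) : EuclideanSpace ℝ (Fin m) :=
  gradient (fun x => φ (x, p.2)) p.1

/-- The parabolic `BMO` norm on `S`: the supremum over all parabolic cubes `Q ⊆ S` of the mean
oscillation `|Q|⁻¹ ∫_Q |f - f_Q|`, with values in `[0, ∞]`. -/
def bmoNormOn {m : ℕ} {V : Type*} [NormedAddCommGroup V] [NormedSpace ℝ V]
    (f : SpaceTime m → V) (S : Set (SpaceTime m)) : ℝ≥0∞ :=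
  ⨆ (z : SpaceTime m) (r : ℝ) (_ : 0 < r) (_ : parabolicCube z r ⊆ S),
    ⨍⁻ p in parabolicCube z r, ‖f p - ⨍ q in parabolicCube z r, f q ∂volume‖ₑ ∂volume

/-- The parabolic `BMO` norm `‖f‖_*` on the whole space. -/
def bmoNorm {m : ℕ} {V : Type*} [NormedAddCommGroup V] [NormedSpace ℝ V]
    (f : SpaceTime m → V) : ℝ≥0∞ :=
  bmoNormOn f Set.univ

/-- The class `C_δ` on `S`: functions with `|h(p) - h(q)| ≤ δ(|p - q|)`, where `|p - q|` is the
Euclidean distance in `ℝ^m × ℝ`. Values outside `S` are irrelevant. -/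
def modulusClass {m : ℕ} {V : Type*} [NormedAddCommGroup V]
    (δ : ℝ≥0 → ℝ≥0) (S : Set (SpaceTime m)) : Set (SpaceTime m → V) :=
  {h | ∀ p ∈ S, ∀ q ∈ S, nndist (h p) (h q) ≤ δ (nndist (WithLp.toLp 2 p) (WithLp.toLp 2 q))}

/-- `d(f, C_δ) = inf_{h ∈ C_δ} ‖f - h‖_{*,S}`. -/
def bmoDistModulusClass {m : ℕ} {V : Type*} [NormedAddCommGroup V] [NormedSpace ℝ V]
    (f : SpaceTime m → V) (δ : ℝ≥0 → ℝ≥0) (S : Set (SpaceTime m)) : ℝ≥0∞ :=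
  ⨅ h ∈ modulusClass (V := V) δ S, bmoNormOn (fun p => f p - h p) S

/-- `|Q_s|⁻¹ ∫_{Q_s} ∫_{I_s} |φ(x,t) - φ(x,τ)|² / |t - τ|² dτ dt dx` for the cube
`Q_s = J_s × I_s` centred at `z`, with values in `[0, ∞]`. -/
def timeDifference {m : ℕ} (φ : SpaceTime m → ℝ) (z : SpaceTime m) (s : ℝ) : ℝ≥0∞ :=
  ⨍⁻ p in parabolicCube z s, ∫⁻ τ in timeInterval z.2 s,
    ENNReal.ofReal (|φ (p.1, p.2) - φ (p.1, τ)| ^ 2 / |p.2 - τ| ^ 2) ∂volume ∂volume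

/-- The Fourier multiplier operator with symbol `|τ|^{1/2}` (`τ` the temporal angular frequency, so
`2π` times the frequency variable of `𝓕`) on a test function. The symbol does not involve `ξ`, so the
Fourier transform may be taken in `t` alone. -/
def timeHalfDerivative {m : ℕ} (g : SpaceTime m → ℂ) (p : SpaceTime m) : ℂ :=
  𝓕⁻ (fun τ : ℝ => ((√(2 * Real.pi * |τ|) : ℝ) : ℂ) * 𝓕 (fun s : ℝ => g (p.1, s)) τ) p.2

/-- The Fourier multiplier operator with symbol `|ξ|` (`ξ` the spatial angular frequency) on a test
function. The symbol does not involve `τ`, so the Fourier transform may be taken in `x` alone. -/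
def spaceAbsDerivative {m : ℕ} (g : SpaceTime m → ℂ) (p : SpaceTime m) : ℂ :=
  𝓕⁻ (fun ξ : EuclideanSpace ℝ (Fin m) => ((2 * Real.pi * ‖ξ‖ : ℝ) : ℂ) *
    𝓕 (fun y : EuclideanSpace ℝ (Fin m) => g (y, p.2)) ξ) p.1

/-- The locally integrable function `F` represents the parabolic derivative `𝔻Φ` of a `Lip(1,1/2)`
function `Φ`. Here `𝔻` has the symbol `‖(ξ,τ)‖ = |ξ| + |τ|^{1/2}`, so it is the sum of the
operators with symbols `|τ|^{1/2}` and `|ξ|`; it is even, so it acts on `Φ` by duality,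
`⟨𝔻Φ, g⟩ = ⟨Φ, 𝔻g⟩`.
As `Φ` may grow linearly in `x` and like `|t|^{1/2}` in `t`, `𝔻Φ` is determined modulo additive
constants (which `‖·‖_*` does not see): the test functions have mean zero. For these each of the two
iterated integrals below converges absolutely step by step, in the given order of integration. -/
def IsParabolicDerivative {m : ℕ} (Φ F : SpaceTime m → ℝ) : Prop :=
  LocallyIntegrable F volume ∧
  ∀ g : SpaceTime m → ℂ, ContDiff ℝ ∞ g → HasCompactSupport g → ∫ p, g p = 0 →
    ∫ p, (F p : ℂ) * g p =
      (∫ t : ℝ, ∫ x : EuclideanSpace ℝ (Fin m), (Φ (x, t) : ℂ) * timeHalfDerivative g (x, t)) +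
      ∫ x : EuclideanSpace ℝ (Fin m), ∫ t : ℝ, (Φ (x, t) : ℂ) * spaceAbsDerivative g (x, t)

end

set_option linter.unusedSectionVars false

open ENNReal (ofReal ofReal_mul ofReal_le_ofReal ofReal_add ofReal_toReal ofReal_pow ofReal_le_ofReal_iff ofReal_ne_top)
open ContinuousLinearMap (inl)
open Set (univ indicator_of_mem indicator_of_notMem)

noncomputable section

local notation "𝒬" => parabolicCube
local notation "∇ₓ" => spatialGradient
local notation:max "𝕏" n:max => EuclideanSpace ℝ (Fin n)

/-! ### Parabolic cubes -/

section Cubes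

variable {m : ℕ}

/-! Everything is reduced to one number A, a multiple of η, which controls the function at small
scales: the mean oscillation of the spatial gradient is at most A and the time square function is at
most A². This is `OscControl`. On small cubes it follows from the hypotheses because ∇φ is, up to a
BMO error comparable to η, a function whose own oscillation is below η once the scale is small
relative to δ (`exists_oscControl_of_bmoDist`). A McShane extension is taken first; it keeps ℓ but
says nothing about oscillation off the original cube.

A Poincaré inequality, in which the time square function replaces a time derivative, and summation
over concentric dyadic cubes turn these averaged bounds into pointwise ones: at scale s the function
is within C A s of a function of x alone which is affine, and it is Hölder 1/2 in time with constant
C A (`OscControl.abs_subAffine_sub_le`, `OscControl.abs_time_sub_le`). No power of ℓ enters.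

The extension must keep the Lipschitz constant exactly (`OscControl.exists_extension`). If ℓ ≤ C A,
then φ - φ(z) is clamped between ±ℓ times a tent; lattice operations preserve ℓ, and the gradient is
bounded by a multiple of A, so its oscillation needs no further argument. If ℓ > C A, then φ is
interpolated by a cutoff to its affine approximation. The cutoff raises the spatial constant from ℓ
to ℓ + O(A), but only at distance more than 2R from the centre. Precomposition with a map of space
that is the identity on the ball of radius R and contracts by a factor 1 - θ/2 beyond 2R, with θ
comparable to A/ℓ, removes the excess. The map is so close to the identity that the gradient changes
by O(θℓ) = O(A), and it distorts volumes boundedly, so the two oscillation conditions survive.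

For 𝔻Φ, each of the multipliers |ξ| and |τ|^{1/2} is up to a constant a singular integral of second
differences (`fracOp_eq_fourierInv`), since the symbol of the latter is homogeneous and rotation
invariant (`exists_diffSymbol_eq`). The pairing of Φ with such an operator applied to a mean-zero
test function g supported in a cube Q is shown to be at most C A |Q|^{1/2} ‖g‖₂
(`OscControl.exists_space_pairing`, `OscControl.exists_time_pairing`). After subtraction of terms
the pairing annihilates, the near part is bounded by Plancherel: in space by the L² oscillation of
the gradient (John–Nirenberg, `HasMeanOscLE.sq_average_le`), in time by the square function itself.
The far part converges because mean zero gains one power of decay, while the pointwise estimates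
limit the growth of Φ.

A functional with these bounds is represented on each cube by an L² function through the Riesz
theorem; the local representatives agree up to constants, are glued, and the cubewise bound becomes
a BMO bound (`IsTestFunctional.exists_representation`). All oscillations so obtained are linear in
η; the form η^{1-ε} + ηℓ enters only by an elementary comparison at the end. -/

theorem mem_parabolicCube {z p : SpaceTime m} {r : ℝ} :
    p ∈ 𝒬 z r ↔ (∀ i, |z.1 i - p.1 i| < r) ∧ √|z.2 - p.2| < r := Iff.rfl

theorem mem_parabolicCube_comm {z p : SpaceTime m} {r : ℝ} :
    p ∈ 𝒬 z r ↔ z ∈ 𝒬 p r := by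
  simp only [mem_parabolicCube, abs_sub_comm]

theorem self_mem_parabolicCube (z : SpaceTime m) {r : ℝ} (hr : 0 < r) : z ∈ 𝒬 z r := by
  simp [mem_parabolicCube, hr]

/-- Subadditivity of the square root: parabolic time distance obeys the triangle inequality, so
parabolic cubes compose like metric balls. -/
theorem sqrt_abs_sub_le (a b c : ℝ) : √|a - c| ≤ √|a - b| + √|b - c| :=
  (Real.sqrt_le_sqrt (abs_sub_le a b c)).trans (Real.sqrt_le_iff.2 ⟨by positivity, by
    nlinarith [Real.sq_sqrt (abs_nonneg (a - b)), Real.sq_sqrt (abs_nonneg (b - c)),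
      Real.sqrt_nonneg |a - b|, Real.sqrt_nonneg |b - c|,
      mul_nonneg (Real.sqrt_nonneg |a - b|) (Real.sqrt_nonneg |b - c|)]⟩)

theorem parabolicCube_mem_trans {z w p : SpaceTime m} {r s : ℝ} (h : w ∈ 𝒬 z r)
    (h' : p ∈ 𝒬 w s) : p ∈ 𝒬 z (r + s) :=
  ⟨fun i => (abs_sub_le _ (w.1 i) _).trans_lt (add_lt_add (h.1 i) (h'.1 i)),
    (sqrt_abs_sub_le _ w.2 _).trans_lt (add_lt_add h.2 h'.2)⟩

theorem parabolicCube_mono {z : SpaceTime m} {r s : ℝ} (h : s ≤ r) :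
    𝒬 z s ⊆ 𝒬 z r :=
  fun _ hp => ⟨fun i => (hp.1 i).trans_le h, hp.2.trans_le h⟩

theorem parabolicCube_subset_of_mem {z w : SpaceTime m} {r s t : ℝ} (h : w ∈ 𝒬 z r)
    (hst : r + s ≤ t) : 𝒬 w s ⊆ 𝒬 z t :=
  fun _ hp => parabolicCube_mono hst (parabolicCube_mem_trans h hp)

theorem timeInterval_eq_Ioo (t : ℝ) {r : ℝ} (hr : 0 < r) :
    timeInterval t r = Set.Ioo (t - r ^ 2) (t + r ^ 2) := by
  ext s
  simp only [timeInterval, Set.mem_ofPred_eq, Set.mem_Ioo]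
  rw [Real.sqrt_lt' hr, abs_lt]
  constructor <;> rintro ⟨h1, h2⟩ <;> constructor <;> linarith

theorem mem_timeInterval {t s r : ℝ} (hr : 0 < r) : s ∈ timeInterval t r ↔ |t - s| < r ^ 2 := by
  simp only [timeInterval, Set.mem_ofPred_eq]
  rw [Real.sqrt_lt' hr]

theorem isOpen_timeInterval (t r : ℝ) : IsOpen (timeInterval t r) :=
  isOpen_lt (by fun_prop) continuous_const

theorem isOpen_spatialCube (x : 𝕏 m) (r : ℝ) : IsOpen (spatialCube x r) := by
  simp only [spatialCube, Set.ofPred_forall]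
  exact isOpen_iInter_of_finite fun i => isOpen_lt (by fun_prop) continuous_const

theorem isOpen_parabolicCube (z : SpaceTime m) (r : ℝ) : IsOpen (𝒬 z r) :=
  (isOpen_spatialCube _ _).prod (isOpen_timeInterval _ _)

theorem measurableSet_timeInterval (t r : ℝ) : MeasurableSet (timeInterval t r) :=
  (isOpen_timeInterval t r).measurableSet

theorem measurableSet_spatialCube (x : 𝕏 m) (r : ℝ) :
    MeasurableSet (spatialCube x r) := (isOpen_spatialCube x r).measurableSet

theorem measurableSet_parabolicCube (z : SpaceTime m) (r : ℝ) :
    MeasurableSet (𝒬 z r) := (isOpen_parabolicCube z r).measurableSet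

theorem volume_timeInterval (t : ℝ) {r : ℝ} (hr : 0 < r) :
    volume (timeInterval t r) = ofReal (2 * r ^ 2) := by
  rw [timeInterval_eq_Ioo t hr, Real.volume_Ioo]
  congr 1; ring

theorem volume_spatialCube (x : 𝕏 m) {r : ℝ} (hr : 0 < r) :
    volume (spatialCube x r) = ofReal ((2 * r) ^ m) := by
  have h := (EuclideanSpace.volume_preserving_symm_measurableEquiv_toLp (Fin m)).measure_preimage
    (s := Metric.ball (x : Fin m → ℝ) r) Metric.isOpen_ball.measurableSet.nullMeasurableSet
  rw [Real.volume_pi_ball _ hr, Fintype.card_fin] at h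
  rw [← h]
  congr 1
  ext y
  simp only [spatialCube, Set.mem_ofPred_eq, Set.mem_preimage, Metric.mem_ball]
  rw [dist_pi_lt_iff hr]
  simp [Real.dist_eq, abs_sub_comm]

theorem volume_parabolicCube (z : SpaceTime m) {r : ℝ} (hr : 0 < r) :
    volume (𝒬 z r) = ofReal (2 ^ (m + 1) * r ^ (m + 2)) := by
  rw [parabolicCube, Measure.volume_eq_prod, Measure.prod_prod, volume_spatialCube _ hr,
    volume_timeInterval _ hr, ← ofReal_mul (by positivity)]
  congr 1; ring

theorem measureReal_parabolicCube (z : SpaceTime m) {r : ℝ} (hr : 0 < r) :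
    volume.real (𝒬 z r) = 2 ^ (m + 1) * r ^ (m + 2) := by
  rw [Measure.real, volume_parabolicCube z hr, ENNReal.toReal_ofReal (by positivity)]

theorem volume_parabolicCube_lt_top (z : SpaceTime m) (r : ℝ) :
    volume (𝒬 z r) < ⊤ := by
  rcases lt_or_ge 0 r with h | h
  · rw [volume_parabolicCube z h]; exact ENNReal.ofReal_lt_top
  · have : 𝒬 z r = ∅ := by
      ext p
      simp only [mem_parabolicCube, Set.mem_empty_iff_false, iff_false, not_and, not_lt]
      exact fun _ => h.trans (Real.sqrt_nonneg _)
    simp [this]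

theorem volume_parabolicCube_pos (z : SpaceTime m) {r : ℝ} (hr : 0 < r) :
    0 < volume (𝒬 z r) := by
  rw [volume_parabolicCube z hr, ENNReal.ofReal_pos]; positivity

theorem measureReal_parabolicCube_pos (z : SpaceTime m) {r : ℝ} (hr : 0 < r) :
    0 < volume.real (𝒬 z r) := by
  rw [measureReal_parabolicCube z hr]; positivity

/-- The sharp factor is √m; the cruder m keeps later dilation factors, such as m + 1, free of roots
and also covers m = 0. -/
theorem norm_sub_le_of_mem_spatialCube {x y : 𝕏 m} {r : ℝ} (hr : 0 ≤ r)
    (h : y ∈ spatialCube x r) : ‖x - y‖ ≤ m * r := by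
  rw [EuclideanSpace.norm_eq]
  apply Real.sqrt_le_iff.2 ⟨by positivity, ?_⟩
  calc ∑ i, ‖(x - y) i‖ ^ 2 ≤ ∑ _i : Fin m, r ^ 2 := by
        apply Finset.sum_le_sum
        intro i _
        have := h i
        rw [Real.norm_eq_abs, PiLp.sub_apply]
        gcongr
    _ = m * r ^ 2 := by simp
    _ ≤ (m * r) ^ 2 := by
        rcases Nat.eq_zero_or_pos m with rfl | hm
        · simp
        · have : (1 : ℝ) ≤ m := by exact_mod_cast hm
          nlinarith [sq_nonneg r]

theorem abs_apply_sub_le_norm (x y : 𝕏 m) (i : Fin m) :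
    |x i - y i| ≤ ‖x - y‖ := by
  have := PiLp.norm_apply_le (x - y) i
  simpa using this

theorem mem_spatialCube_of_norm_lt {x y : 𝕏 m} {r : ℝ}
    (h : ‖x - y‖ < r) : y ∈ spatialCube x r :=
  fun i => (abs_apply_sub_le_norm x y i).trans_lt h

theorem restrict_parabolicCube (z : SpaceTime m) (r : ℝ) :
    (volume.restrict (𝒬 z r) : Measure (SpaceTime m)) =
      (volume.restrict (spatialCube z.1 r)).prod (volume.restrict (timeInterval z.2 r)) := by
  rw [parabolicCube, Measure.volume_eq_prod, Measure.prod_restrict]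

end Cubes

/-! ### Averages over parabolic cubes -/

section Averages

variable {m : ℕ} {V : Type*} [NormedAddCommGroup V] [NormedSpace ℝ V]

theorem norm_setIntegral_sub_le {α : Type*} [MeasurableSpace α] {μ : Measure α}
    {f : α → V} {s : Set α} (hf : IntegrableOn f s μ) (c : V) (hs : μ s ≠ ⊤) (h0 : μ s ≠ 0)
    [CompleteSpace V] :
    ‖(⨍ x in s, f x ∂μ) - c‖ ≤ ⨍ x in s, ‖f x - c‖ ∂μ := by
  have hpos : 0 < μ.real s := ENNReal.toReal_pos h0 hs
  have h1 : (⨍ x in s, f x ∂μ) - c = (μ.real s)⁻¹ • ∫ x in s, (f x - c) ∂μ := by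
    rw [setAverage_eq, integral_sub hf (integrableOn_const hs), setIntegral_const, smul_sub,
      smul_smul, inv_mul_cancel₀ hpos.ne', one_smul]
  rw [h1, setAverage_eq, norm_smul, norm_inv, Real.norm_of_nonneg hpos.le, smul_eq_mul]
  gcongr
  exact norm_integral_le_integral_norm _

/-- The mean lies within the average deviation from any constant. Hence mean oscillation can be
bounded by exhibiting whatever constant is convenient, at the price of a factor 2. -/
theorem setAverage_norm_sub_average_le {α : Type*} [MeasurableSpace α] {μ : Measure α}
    {f : α → V} {s : Set α} (hf : IntegrableOn f s μ) (c : V) (hs : μ s ≠ ⊤) (h0 : μ s ≠ 0)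
    [CompleteSpace V] :
    ⨍ x in s, ‖f x - ⨍ y in s, f y ∂μ‖ ∂μ ≤ 2 * ⨍ x in s, ‖f x - c‖ ∂μ := by
  have hpos : 0 < μ.real s := ENNReal.toReal_pos h0 hs
  set a := ⨍ y in s, f y ∂μ
  have hc : ∀ c : V, IntegrableOn (fun x => f x - c) s μ :=
    fun c => hf.sub (integrableOn_const hs)
  have h1 : ∫ x in s, ‖f x - a‖ ∂μ ≤ ∫ x in s, (‖f x - c‖ + ‖a - c‖) ∂μ := by
    apply integral_mono (hc a).norm ((hc c).norm.add (integrableOn_const hs))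
    intro x
    calc ‖f x - a‖ = ‖(f x - c) - (a - c)‖ := by abel_nf
      _ ≤ _ := norm_sub_le _ _
  rw [integral_add (hc c).norm (integrableOn_const hs), setIntegral_const] at h1
  have h2 := norm_setIntegral_sub_le hf c hs h0
  change ‖a - c‖ ≤ _ at h2
  clear_value a
  rw [setAverage_eq, smul_eq_mul, inv_mul_le_iff₀ hpos]
  rw [setAverage_eq, smul_eq_mul] at h2 ⊢
  have h3 : μ.real s * ‖a - c‖ ≤ ∫ x in s, ‖f x - c‖ ∂μ := by
    rwa [← le_inv_mul_iff₀ hpos]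
  have h4 : μ.real s * (2 * ((μ.real s)⁻¹ * ∫ x in s, ‖f x - c‖ ∂μ))
      = 2 * ∫ x in s, ‖f x - c‖ ∂μ := by field_simp
  rw [h4]
  simp only [smul_eq_mul] at h1
  linarith

/-- Averages of nonnegative functions over nested sets of comparable measure. -/
theorem setAverage_le_of_subset {α : Type*} [MeasurableSpace α] {μ : Measure α}
    {f : α → ℝ} {s t : Set α} (hf : IntegrableOn f t μ) (h : ∀ x, 0 ≤ f x)
    (hst : s ⊆ t) {K : ℝ} (ht : μ t ≠ ⊤) (h0 : μ s ≠ 0) (hK : μ.real t ≤ K * μ.real s) :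
    ⨍ x in s, f x ∂μ ≤ K * ⨍ x in t, f x ∂μ := by
  have hs : μ s ≠ ⊤ := ne_top_of_le_ne_top ht (measure_mono hst)
  have hpos : 0 < μ.real s := ENNReal.toReal_pos h0 hs
  have hpos' : 0 < μ.real t := hpos.trans_le (measureReal_mono hst ht)
  have h1 : ∫ x in s, f x ∂μ ≤ ∫ x in t, f x ∂μ :=
    setIntegral_mono_set hf (Filter.Eventually.of_forall h) hst.eventuallyLE
  have h2 : 0 ≤ ∫ x in t, f x ∂μ := integral_nonneg h
  rw [setAverage_eq, setAverage_eq, smul_eq_mul, smul_eq_mul, inv_mul_le_iff₀ hpos]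
  calc ∫ x in s, f x ∂μ ≤ ∫ x in t, f x ∂μ := h1
    _ = (μ.real t * (μ.real t)⁻¹) * ∫ x in t, f x ∂μ := by
        rw [mul_inv_cancel₀ hpos'.ne', one_mul]
    _ ≤ ((K * μ.real s) * (μ.real t)⁻¹) * ∫ x in t, f x ∂μ := by gcongr
    _ = _ := by ring

theorem measureReal_parabolicCube_mul (z w : SpaceTime m) {r s : ℝ} (hr : 0 < r) (hs : 0 < s) :
    volume.real (𝒬 z r) = (r / s) ^ (m + 2) * volume.real (𝒬 w s) := by
  rw [measureReal_parabolicCube z hr, measureReal_parabolicCube w hs, div_pow]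
  field_simp

theorem cubeAverage_le_of_subset {f : SpaceTime m → ℝ} {z w : SpaceTime m} {r s : ℝ}
    (hf : IntegrableOn f (𝒬 z r)) (h : ∀ x, 0 ≤ f x) (hr : 0 < r) (hs : 0 < s)
    (hst : 𝒬 w s ⊆ 𝒬 z r) :
    ⨍ p in 𝒬 w s, f p ≤ (r / s) ^ (m + 2) * ⨍ p in 𝒬 z r, f p :=
  setAverage_le_of_subset hf h hst (volume_parabolicCube_lt_top _ _).ne
    (volume_parabolicCube_pos _ hs).ne' (measureReal_parabolicCube_mul z w hr hs).le

theorem setAverage_mono {α : Type*} [MeasurableSpace α] {μ : Measure α} {f g : α → ℝ} {s : Set α}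
    (hs : MeasurableSet s) (hf : IntegrableOn f s μ) (hg : IntegrableOn g s μ)
    (h : ∀ x ∈ s, f x ≤ g x) : ⨍ x in s, f x ∂μ ≤ ⨍ x in s, g x ∂μ := by
  rw [setAverage_eq, setAverage_eq, smul_eq_mul, smul_eq_mul]
  exact mul_le_mul_of_nonneg_left (setIntegral_mono_on hf hg hs h) (by positivity)

theorem setAverage_add {α : Type*} [MeasurableSpace α] {μ : Measure α} {f g : α → ℝ} {s : Set α}
    (hf : IntegrableOn f s μ) (hg : IntegrableOn g s μ) :
    ⨍ x in s, (f x + g x) ∂μ = ⨍ x in s, f x ∂μ + ⨍ x in s, g x ∂μ := by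
  simp only [setAverage_eq, integral_add hf hg, smul_add]

theorem setAverage_nonneg {α : Type*} [MeasurableSpace α] {μ : Measure α} {f : α → ℝ} {s : Set α}
    (h : ∀ x, 0 ≤ f x) : 0 ≤ ⨍ x in s, f x ∂μ := by
  rw [setAverage_eq, smul_eq_mul]
  exact mul_nonneg (by positivity) (integral_nonneg h)

theorem setAverage_le_const {α : Type*} [MeasurableSpace α] {μ : Measure α} {f : α → ℝ} {s : Set α}
    (hs : MeasurableSet s) (hf : IntegrableOn f s μ) (hs' : μ s ≠ ⊤) (h0 : μ s ≠ 0) {M : ℝ}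
    (h : ∀ x ∈ s, f x ≤ M) : ⨍ x in s, f x ∂μ ≤ M := by
  refine (setAverage_mono hs hf (integrableOn_const hs') h).trans_eq ?_
  exact setAverage_const h0 hs' M

/-- A bounded measurable function. -/
structure IsBddMeas {α : Type*} [MeasurableSpace α] {V : Type*} [NormedAddCommGroup V] (f : α → V)
    (M : ℝ) : Prop where
  meas : StronglyMeasurable f
  bound : ∀ x, ‖f x‖ ≤ M

theorem IsBddMeas.integrableOn {α : Type*} [MeasurableSpace α] {μ : Measure α} {f : α → V} {M : ℝ}
    (hf : IsBddMeas f M) {s : Set α} (hs : μ s ≠ ⊤) : IntegrableOn f s μ :=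
  Measure.integrableOn_of_bounded hs hf.meas.aestronglyMeasurable
    (Filter.Eventually.of_forall hf.bound)

theorem IsBddMeas.sub_const {α : Type*} [MeasurableSpace α] {f : α → V} {M : ℝ}
    (hf : IsBddMeas f M) (c : V) : IsBddMeas (fun x => f x - c) (M + ‖c‖) :=
  ⟨hf.meas.sub stronglyMeasurable_const, fun x => (norm_sub_le _ _).trans (by gcongr; exact hf.bound x)⟩

theorem IsBddMeas.norm {α : Type*} [MeasurableSpace α] {f : α → V} {M : ℝ}
    (hf : IsBddMeas f M) : IsBddMeas (fun x => ‖f x‖) M :=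
  ⟨hf.meas.norm, fun x => by simpa using hf.bound x⟩

/-- The mean oscillation of `f` over every parabolic cube contained in `S` is at most `A`. -/
def HasMeanOscLE (A : ℝ) (f : SpaceTime m → V) (S : Set (SpaceTime m)) : Prop :=
  ∀ (z : SpaceTime m) (r : ℝ), 0 < r → 𝒬 z r ⊆ S →
    ⨍ p in 𝒬 z r, ‖f p - ⨍ q in 𝒬 z r, f q‖ ≤ A

theorem laverage_enorm_eq_ofReal {f : SpaceTime m → V} {z : SpaceTime m} {r : ℝ} (hr : 0 < r)
    (hf : IntegrableOn f (𝒬 z r)) :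
    ⨍⁻ p in 𝒬 z r, ‖f p‖ₑ ∂volume
      = ofReal (⨍ p in 𝒬 z r, ‖f p‖) := by
  rw [setLAverage_eq, setAverage_eq, smul_eq_mul, ofReal_mul (by positivity),
    ofReal_integral_norm_eq_lintegral_enorm hf, mul_comm, ENNReal.div_eq_inv_mul, mul_comm]
  congr 1
  rw [ENNReal.ofReal_inv_of_pos (measureReal_parabolicCube_pos z hr), Measure.real,
    ofReal_toReal (volume_parabolicCube_lt_top _ _).ne]

theorem MeasureTheory.LocallyIntegrable.integrableOn_parabolicCube {f : SpaceTime m → V}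
    (hf : LocallyIntegrable f) (z : SpaceTime m) (r : ℝ) : IntegrableOn f (𝒬 z r) := by
  rcases le_or_gt r 0 with h | h
  · have : 𝒬 z r = ∅ := by
      ext p
      simp only [mem_parabolicCube, Set.mem_empty_iff_false, iff_false, not_and, not_lt]
      exact fun _ => h.trans (Real.sqrt_nonneg _)
    simp [this]
  · apply (hf.integrableOn_isCompact ((isCompact_closedBall z.1 (m * r)).prod
      (isCompact_Icc (a := z.2 - r^2) (b := z.2 + r^2)))).mono_set
    rintro p ⟨h1, h2⟩
    refine ⟨?_, ?_⟩
    · rw [Metric.mem_closedBall, dist_comm, dist_eq_norm]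
      exact norm_sub_le_of_mem_spatialCube h.le h1
    · rw [timeInterval_eq_Ioo _ h] at h2
      exact Set.Ioo_subset_Icc_self h2

/-- Local integrability makes all averages finite, so that the extended-valued supremum of the
statement can be replaced by real inequalities. -/
theorem hasMeanOscLE_iff {f : SpaceTime m → V} {S : Set (SpaceTime m)} {A : ℝ} (hA : 0 ≤ A)
    (hf : LocallyIntegrable f)  :
    HasMeanOscLE A f S ↔ bmoNormOn f S ≤ ofReal A := by
  simp only [HasMeanOscLE, bmoNormOn, iSup_le_iff]
  refine forall₂_congr fun z r => forall₂_congr fun hr hS => ?_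
  have := laverage_enorm_eq_ofReal hr ((hf.integrableOn_parabolicCube z r).sub (integrableOn_const
    (C := ⨍ q in 𝒬 z r, f q) (volume_parabolicCube_lt_top _ _).ne))
  simp only [Pi.sub_apply] at this
  rw [this, ofReal_le_ofReal_iff hA]

theorem IsBddMeas.locallyIntegrable {f : SpaceTime m → V} {M : ℝ} (hf : IsBddMeas f M) :
    LocallyIntegrable f := by
  rw [locallyIntegrable_iff]
  intro k hk
  exact hf.integrableOn hk.measure_lt_top.ne

variable [CompleteSpace V]

/-- Comparison of the averages over two nested cubes. -/
theorem norm_cubeAverage_sub_le {f : SpaceTime m → V} {z w : SpaceTime m} {r s : ℝ} (c : V)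
    (hf : IntegrableOn f (𝒬 z r)) (hr : 0 < r) (hs : 0 < s)
    (hst : 𝒬 w s ⊆ 𝒬 z r) :
    ‖(⨍ p in 𝒬 w s, f p) - c‖
      ≤ (r / s) ^ (m + 2) * ⨍ p in 𝒬 z r, ‖f p - c‖ := by
  refine (norm_setIntegral_sub_le (hf.mono_set hst) c (volume_parabolicCube_lt_top _ _).ne
    (volume_parabolicCube_pos _ hs).ne').trans ?_
  exact cubeAverage_le_of_subset
    (hf.sub (integrableOn_const (volume_parabolicCube_lt_top _ _).ne)).norm
    (fun _ => norm_nonneg _) hr hs hst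

end Averages

/-! ### Lebesgue differentiation along parabolic cubes -/

section Lebesgue

variable {m : ℕ} {V : Type*} [NormedAddCommGroup V] [NormedSpace ℝ V]

/-- The space `ℝ^m × ℝ` with the parabolic metric `max(|x - y|_∞, |t - s|^{1/2})`. -/
abbrev ParabolicSpace (m : ℕ) : Type :=
  (Fin m → ℝ) × Metric.Snowflaking ℝ (1 / 2) (by norm_num) (by norm_num)

/-- The identity map from `SpaceTime m` to the parabolic metric space. -/
def toParabolic (m : ℕ) : SpaceTime m ≃ₜ ParabolicSpace m :=
  (EuclideanSpace.equiv (Fin m) ℝ).toHomeomorph.prodCongr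
    { toEquiv := Metric.Snowflaking.toSnowflaking
      continuous_toFun := Metric.Snowflaking.continuous_toSnowflaking
      continuous_invFun := Metric.Snowflaking.continuous_ofSnowflaking }

theorem mem_closedBall_toParabolic {p q : SpaceTime m} {r : ℝ} (hr : 0 ≤ r) :
    toParabolic m q ∈ Metric.closedBall (toParabolic m p) r ↔
      (∀ i, |p.1 i - q.1 i| ≤ r) ∧ √|p.2 - q.2| ≤ r := by
  rw [Metric.mem_closedBall, dist_comm, Prod.dist_eq, max_le_iff]
  refine and_congr ?_ ?_
  · rw [dist_pi_le_iff hr]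
    rfl
  · change dist (Metric.Snowflaking.toSnowflaking p.2) (Metric.Snowflaking.toSnowflaking q.2) ≤ r ↔ _
    rw [Metric.Snowflaking.dist_toSnowflaking_toSnowflaking, Real.dist_eq, Real.sqrt_eq_rpow]

theorem parabolicCube_subset_closedBall {p : SpaceTime m} {r : ℝ} (hr : 0 ≤ r) :
    𝒬 p r ⊆ toParabolic m ⁻¹' Metric.closedBall (toParabolic m p) r := by
  intro q hq
  rw [Set.mem_preimage, mem_closedBall_toParabolic hr]
  exact ⟨fun i => (hq.1 i).le, hq.2.le⟩

theorem closedBall_subset_parabolicCube {p : SpaceTime m} {r s : ℝ} (hr : 0 ≤ r) (h : r < s) :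
    toParabolic m ⁻¹' Metric.closedBall (toParabolic m p) r ⊆ 𝒬 p s := by
  intro q hq
  rw [Set.mem_preimage, mem_closedBall_toParabolic hr] at hq
  exact ⟨fun i => (hq.1 i).trans_lt h, hq.2.trans_lt h⟩

/-- With time snowflaked, Lebesgue measure is doubling for a genuine metric whose balls are, up to
the boundary, the parabolic cubes. Lebesgue differentiation for doubling measures then applies, and
comparison of a ball with the cube of the same radius transfers it to cubes. -/
theorem ae_tendsto_cubeAverage_norm_sub {f : SpaceTime m → V} (hf : LocallyIntegrable f) :
    ∀ᵐ p : SpaceTime m, ∀ ρ : ℝ, 0 < ρ →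
      Filter.Tendsto (fun k : ℕ => ⨍ q in 𝒬 p (ρ / 2 ^ k), ‖f q - f p‖)
        Filter.atTop (nhds 0) := by
  letI : MeasurableSpace (ParabolicSpace m) := borel _
  haveI : BorelSpace (ParabolicSpace m) := ⟨rfl⟩
  let e := (toParabolic m).toMeasurableEquiv
  have he : ⇑e = toParabolic m := rfl
  let μ : Measure (ParabolicSpace m) := Measure.map e volume
  have hμ : ∀ s, μ s = volume (toParabolic m ⁻¹' s) := fun s => e.map_apply s
  haveI : IsUnifLocDoublingMeasure μ := by
    -- The factor is 3 and not 2 because a closed ball of radius 2ε is enclosed in an open cube,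
    -- which needs a slightly larger radius.
    refine ⟨(3 : ℝ≥0) ^ (m + 2), ?_⟩
    filter_upwards [self_mem_nhdsWithin] with ε hε x
    obtain ⟨p, rfl⟩ := (toParabolic m).surjective x
    have hε : 0 < ε := hε
    rw [hμ, hμ]
    calc _ ≤ volume (𝒬 p (3 * ε)) :=
          measure_mono (closedBall_subset_parabolicCube (by positivity) (by linarith))
      _ = (3 : ℝ≥0) ^ (m + 2) * volume (𝒬 p ε) := by
          rw [volume_parabolicCube _ hε, volume_parabolicCube _ (by positivity)]
          rw [show (2 : ℝ) ^ (m + 1) * (3 * ε) ^ (m + 2)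
            = 3 ^ (m + 2) * (2 ^ (m + 1) * ε ^ (m + 2)) by ring,
            ofReal_mul (by positivity), ofReal_pow (by norm_num)]
          norm_num
      _ ≤ _ := by
          push_cast
          gcongr
          exact parabolicCube_subset_closedBall hε.le
  haveI : IsLocallyFiniteMeasure μ := by
    refine ⟨fun x => ?_⟩
    obtain ⟨p, rfl⟩ := (toParabolic m).surjective x
    refine ⟨Metric.closedBall (toParabolic m p) 1, Metric.closedBall_mem_nhds _ one_pos, ?_⟩
    rw [hμ]
    exact (measure_mono (closedBall_subset_parabolicCube zero_le_one (by norm_num : (1:ℝ) < 2))).trans_lt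
      (volume_parabolicCube_lt_top _ _)
  haveI : LocallyCompactSpace (ParabolicSpace m) :=
    (toParabolic m).symm.isClosedEmbedding.locallyCompactSpace
  have hf' : LocallyIntegrable (f ∘ (toParabolic m).symm) μ := by
    rw [locallyIntegrable_iff]
    intro k hk
    have hk' : IsCompact (toParabolic m ⁻¹' k) := (toParabolic m).isCompact_preimage.2 hk
    have h2 := hf.integrableOn_isCompact hk'
    have := (e.measurableEmbedding.integrableOn_map_iff (μ := volume)
      (f := f ∘ (toParabolic m).symm) (s := k)).2
    apply this
    have h3 : (f ∘ (toParabolic m).symm) ∘ e = f := by ext p; simp [he]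
    rw [h3]
    exact h2
  have key := IsUnifLocDoublingMeasure.ae_tendsto_average_norm_sub (μ := μ) hf' 1
  have key2 := (e.measurableEmbedding.ae_map_iff (μ := volume)).1 key
  filter_upwards [key2] with p hp ρ hρ
  have hδ : Filter.Tendsto (fun k : ℕ => ρ / 2 ^ k) Filter.atTop (nhdsWithin 0 (Set.Ioi 0)) := by
    rw [tendsto_nhdsWithin_iff]
    refine ⟨?_, Filter.Eventually.of_forall fun k => Set.mem_Ioi.2 (by positivity)⟩
    have := (tendsto_pow_atTop_nhds_zero_of_lt_one (r := (1/2 : ℝ)) (by norm_num) (by norm_num)).const_mul ρ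
    simpa [div_eq_mul_inv] using this
  have h1 := hp (fun _ : ℕ => e p) _ hδ (.of_forall fun k => by
    rw [one_mul]; exact Metric.mem_closedBall_self (by positivity))
  have h2 := h1.const_mul ((2 : ℝ) ^ (m + 2))
  rw [mul_zero] at h2
  refine squeeze_zero (fun k => setAverage_nonneg fun _ => norm_nonneg _) (fun k => ?_) h2
  have hk : 0 < ρ / 2 ^ k := by positivity
  set s := ρ / 2 ^ k
  set B := toParabolic m ⁻¹' Metric.closedBall (toParabolic m p) s
  have hB : volume B ≠ ⊤ := ne_top_of_le_ne_top (volume_parabolicCube_lt_top p (2 * s)).ne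
    (measure_mono (closedBall_subset_parabolicCube hk.le (by linarith)))
  have h3 : ⨍ y in Metric.closedBall (e p) s, ‖(f ∘ (toParabolic m).symm) y
      - (f ∘ (toParabolic m).symm) (e p)‖ ∂μ = ⨍ q in B, ‖f q - f p‖ := by
    rw [setAverage_eq, setAverage_eq, Measure.real, Measure.real, hμ,
      e.measurableEmbedding.setIntegral_map]
    simp [he, B]
  rw [h3]
  have hint : IntegrableOn (fun q => ‖f q - f p‖) B := by
    have : IsCompact (closure (𝒬 p (2 * s))) := by
      apply ((isCompact_closedBall p.1 (m * (2 * s))).prod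
        (isCompact_Icc (a := p.2 - (2*s)^2) (b := p.2 + (2*s)^2))).of_isClosed_subset isClosed_closure
      apply closure_minimal _ (Metric.isClosed_closedBall.prod isClosed_Icc)
      rintro q ⟨h1, h2⟩
      refine ⟨?_, ?_⟩
      · rw [Metric.mem_closedBall, dist_comm, dist_eq_norm]
        exact norm_sub_le_of_mem_spatialCube (by positivity) h1
      · rw [timeInterval_eq_Ioo _ (by positivity)] at h2
        exact Set.Ioo_subset_Icc_self h2
    have h4 := ((hf.integrableOn_isCompact this).mono_set (subset_closure)).mono_set
      (closedBall_subset_parabolicCube hk.le (by linarith : s < 2 * s))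
    exact (h4.sub (integrableOn_const hB)).norm
  refine setAverage_le_of_subset hint (fun _ => norm_nonneg _)
    (parabolicCube_subset_closedBall hk.le) hB (volume_parabolicCube_pos _ hk).ne' ?_
  calc volume.real B ≤ volume.real (𝒬 p (2 * s)) :=
        measureReal_mono (closedBall_subset_parabolicCube hk.le (by linarith))
          (volume_parabolicCube_lt_top _ _).ne
    _ = _ := by
        rw [measureReal_parabolicCube_mul p p (by positivity : 0 < 2 * s) hk,
          mul_div_assoc, div_self hk.ne', mul_one]

end Lebesgue

/-! ### Square integrability of functions of bounded mean oscillation -/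

section JohnNirenberg

variable {m : ℕ} {V : Type*} [NormedAddCommGroup V] [NormedSpace ℝ V] [CompleteSpace V]

theorem HasMeanOscLE.double_average_le {f : SpaceTime m → V} {A M : ℝ} (hf : IsBddMeas f M)
    (hA : HasMeanOscLE A f univ) (z : SpaceTime m) {r : ℝ} (hr : 0 < r) :
    ⨍ p in 𝒬 z (2 * r), ‖f p - ⨍ q in 𝒬 z r, f q‖
      ≤ (1 + 2 ^ (m + 2)) * A := by
  have h2r : 0 < 2 * r := by positivity
  have hfin := (volume_parabolicCube_lt_top z (2 * r)).ne
  set a := ⨍ q in 𝒬 z (2 * r), f q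
  set c := ⨍ q in 𝒬 z r, f q
  have hA' := hA z (2 * r) h2r (Set.subset_univ _)
  have h1 : ‖c - a‖ ≤ 2 ^ (m + 2) * A := by
    have := norm_cubeAverage_sub_le a (hf.integrableOn hfin) h2r hr
      (parabolicCube_mono (z := z) (by linarith : r ≤ 2 * r))
    rw [mul_div_assoc, div_self hr.ne', mul_one] at this
    exact this.trans (mul_le_mul_of_nonneg_left hA' (by positivity))
  have hint : ∀ c, IntegrableOn (fun p => ‖f p - c‖) (𝒬 z (2 * r)) :=
    fun c => (hf.sub_const c).norm.integrableOn hfin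
  calc _ ≤ ⨍ p in 𝒬 z (2 * r), (‖f p - a‖ + ‖c - a‖) := by
        refine setAverage_mono (measurableSet_parabolicCube _ _) (hint c)
          ((hint a).add (integrableOn_const hfin)) fun p _ => ?_
        calc ‖f p - c‖ = ‖(f p - a) - (c - a)‖ := by abel_nf
          _ ≤ _ := norm_sub_le _ _
    _ = (⨍ p in 𝒬 z (2 * r), ‖f p - a‖) + ‖c - a‖ := by
        rw [setAverage_add (hint a) (integrableOn_const hfin),
          setAverage_const (volume_parabolicCube_pos _ h2r).ne' hfin]
    _ ≤ A + 2 ^ (m + 2) * A := by gcongr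
    _ = _ := by ring

/-- The bad set in the Calderón–Zygmund decomposition is covered by countably many cubes of small
total measure on which the average of `f` deviates from `c` by a controlled amount. -/
theorem HasMeanOscLE.exists_stopping_cubes {f : SpaceTime m → V} {A M lam : ℝ} (hf : IsBddMeas f M)
    (z : SpaceTime m) {r : ℝ} (hr : 0 < r) (c : V)
    (hlam : 2 ^ (m + 2) * ⨍ p in 𝒬 z (2 * r), ‖f p - c‖ ≤ lam) :
    ∃ (u : Set (SpaceTime m)) (s : SpaceTime m → ℝ), u.Countable ∧
      (∀ p ∈ u, 0 < s p) ∧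
      (u.PairwiseDisjoint fun p => 𝒬 p (s p)) ∧
      (∀ p ∈ u, 𝒬 p (s p) ⊆ 𝒬 z (2 * r)) ∧
      (∀ p ∈ u, lam < ⨍ q in 𝒬 p (s p), ‖f q - c‖) ∧
      (∀ p ∈ u, ⨍ q in 𝒬 p (2 * s p), ‖f q - c‖ ≤ lam) ∧
      ∀ᵐ p, p ∈ 𝒬 z r → ‖f p - c‖ ≤ lam ∨ ∃ b ∈ u, p ∈ 𝒬 b (3 * s b) := by
  classical
  have hint : ∀ (w : SpaceTime m) (s : ℝ), IntegrableOn (fun p => ‖f p - c‖) (𝒬 w s) :=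
    fun w s => (hf.sub_const c).norm.integrableOn (volume_parabolicCube_lt_top w s).ne
  -- Stopping time: N p is the first dyadic scale at which the average of |f - c| exceeds lam. The
  -- hypothesis on lam rules out the initial scale, so the cube of doubled radius still has average
  -- at most lam.
  let P : SpaceTime m → ℕ → Prop := fun p k => lam < ⨍ q in 𝒬 p (r / 2 ^ k), ‖f q - c‖
  let t : Set (SpaceTime m) := {p | p ∈ 𝒬 z r ∧ ∃ k, P p k}
  let N : SpaceTime m → ℕ := fun p => if h : ∃ k, P p k then Nat.find h else 0
  let s : SpaceTime m → ℝ := fun p => r / 2 ^ N p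
  have hs : ∀ p, 0 < s p := fun p => by positivity
  have hsr : ∀ p, s p ≤ r := fun p => div_le_self hr.le (one_le_pow₀ (by norm_num))
  have hN : ∀ p ∈ t, P p (N p) := by
    rintro p ⟨_, h⟩
    simp only [N, dif_pos h]
    exact Nat.find_spec h
  have hN0 : ∀ p ∈ t, N p ≠ 0 := by
    intro p hp h0
    have h1 := hN p hp
    rw [h0] at h1
    simp only [P, pow_zero, div_one] at h1
    have h2 := cubeAverage_le_of_subset (hint z (2 * r)) (fun _ => norm_nonneg _)
      (by positivity : 0 < 2 * r) hr (parabolicCube_subset_of_mem hp.1 (by linarith : r + r ≤ 2 * r))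
    rw [mul_div_assoc, div_self hr.ne', mul_one] at h2
    linarith
  have hpar : ∀ p ∈ t, ⨍ q in 𝒬 p (2 * s p), ‖f q - c‖ ≤ lam := by
    intro p hp
    obtain ⟨k, hk⟩ := Nat.exists_eq_succ_of_ne_zero (hN0 p hp)
    have h1 : 2 * s p = r / 2 ^ k := by
      simp only [s, hk, pow_succ]; field_simp
    rw [h1]
    have h2 : ¬ P p k := by
      have : k < N p := by omega
      simp only [N, dif_pos hp.2] at this
      exact Nat.find_min hp.2 this
    exact not_lt.1 h2
  -- Vitali with ratio 2: the centre of a discarded cube lies within s + 2s of the centre of a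
  -- selected cube of radius s, whence the dilation 3 in the covering. Points where |f - c| > lam
  -- are centres of stopping cubes by Lebesgue differentiation.
  obtain ⟨u, hut, hdisj, hcov⟩ := Vitali.exists_disjoint_subfamily_covering_enlargement
    (fun p => 𝒬 p (s p)) t s 2 (by norm_num) (fun p _ => (hs p).le) r
    (fun p _ => hsr p) (fun p _ => ⟨p, self_mem_parabolicCube p (hs p)⟩)
  refine ⟨u, s, hdisj.countable_of_isOpen (fun p _ => isOpen_parabolicCube _ _)
    (fun p _ => ⟨p, self_mem_parabolicCube p (hs p)⟩), fun p _ => hs p, hdisj, ?_,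
    fun p hp => hN p (hut hp), fun p hp => hpar p (hut hp), ?_⟩
  · intro p hp
    exact parabolicCube_subset_of_mem (hut hp).1 (by linarith [hsr p])
  · filter_upwards [ae_tendsto_cubeAverage_norm_sub hf.locallyIntegrable] with p hp hpz
    by_cases hle : ‖f p - c‖ ≤ lam
    · exact Or.inl hle
    right
    have hpt : p ∈ t := by
      refine ⟨hpz, ?_⟩
      have h1 : Filter.Tendsto (fun k : ℕ => ‖f p - c‖ - ⨍ q in 𝒬 p (r / 2 ^ k), ‖f q - f p‖)
          Filter.atTop (nhds (‖f p - c‖ - 0)) := (hp r hr).const_sub _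
      rw [sub_zero] at h1
      obtain ⟨k, hk⟩ := (h1.eventually (lt_mem_nhds (not_le.1 hle))).exists
      refine ⟨k, hk.trans_le ?_⟩
      have hpos : 0 < r / 2 ^ k := by positivity
      have hfin := (volume_parabolicCube_lt_top p (r / 2 ^ k)).ne
      have hi := (hf.sub_const (f p)).norm.integrableOn (μ := volume) hfin
      rw [sub_le_iff_le_add, ← setAverage_add (hint p _) hi,
        ← setAverage_const (μ := volume) (volume_parabolicCube_pos p hpos).ne' hfin ‖f p - c‖]
      refine setAverage_mono (measurableSet_parabolicCube _ _) (integrableOn_const hfin)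
        ((hint p _).add hi) fun q _ => ?_
      calc ‖f p - c‖ = ‖(f q - c) - (f q - f p)‖ := by abel_nf
        _ ≤ _ := norm_sub_le _ _
    obtain ⟨b, hb, ⟨q, hq1, hq2⟩, hb2⟩ := hcov p hpt
    exact ⟨b, hb, parabolicCube_mono (by linarith)
      (parabolicCube_mem_trans hq2 (mem_parabolicCube_comm.1 hq1))⟩

/-- Chebyshev summed over disjoint cubes: each stopping cube carries more than lam times its volume
of the integral of |f - c|. -/
theorem HasMeanOscLE.stopping_measure_le {f : SpaceTime m → V} {M lam I : ℝ} (hf : IsBddMeas f M)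
    (z : SpaceTime m) {r : ℝ} (c : V) (hlam : 0 < lam) {u : Set (SpaceTime m)}
    {s : SpaceTime m → ℝ} (hu : u.Countable) (hs : ∀ p ∈ u, 0 < s p)
    (hd : u.PairwiseDisjoint fun p => 𝒬 p (s p))
    (hsub : ∀ p ∈ u, 𝒬 p (s p) ⊆ 𝒬 z (2 * r))
    (hl : ∀ p ∈ u, lam < ⨍ q in 𝒬 p (s p), ‖f q - c‖)
    (hI : ∫ p in 𝒬 z (2 * r), ‖f p - c‖ ≤ lam * I) :
    ∑' p : u, volume (𝒬 (p : SpaceTime m) (s p)) ≤ ofReal I := by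
  have hint : ∀ (w : SpaceTime m) (s : ℝ), IntegrableOn (fun p => f p - c) (𝒬 w s) :=
    fun w s => (hf.sub_const c).integrableOn (volume_parabolicCube_lt_top w s).ne
  haveI := hu.to_subtype
  have h1 : ∀ p : u, ofReal lam * volume (𝒬 (p : SpaceTime m) (s p)) ≤
      ∫⁻ q in 𝒬 (p : SpaceTime m) (s p), ‖f q - c‖ₑ := by
    intro p
    have h2 := hl p p.2
    have hpos := measureReal_parabolicCube_pos (p : SpaceTime m) (hs p p.2)
    rw [setAverage_eq, smul_eq_mul, lt_inv_mul_iff₀ hpos] at h2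
    rw [← ofReal_integral_norm_eq_lintegral_enorm (hint _ _)]
    calc _ = ofReal (volume.real (𝒬 (p : SpaceTime m) (s p)) * lam) := by
          rw [ofReal_mul measureReal_nonneg, Measure.real,
            ofReal_toReal (volume_parabolicCube_lt_top _ _).ne, mul_comm]
      _ ≤ _ := ofReal_le_ofReal h2.le
  have h2 : ofReal lam * ∑' p : u, volume (𝒬 (p : SpaceTime m) (s p))
      ≤ ofReal lam * ofReal I := by
    rw [← ENNReal.tsum_mul_left]
    calc _ ≤ ∑' p : u, ∫⁻ q in 𝒬 (p : SpaceTime m) (s p), ‖f q - c‖ₑ :=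
          ENNReal.tsum_le_tsum h1
      _ = ∫⁻ q in ⋃ p : u, 𝒬 (p : SpaceTime m) (s p), ‖f q - c‖ₑ := by
          rw [lintegral_iUnion (fun p => measurableSet_parabolicCube _ _)]
          exact fun p q hpq => hd p.2 q.2 (fun h => hpq (Subtype.ext h))
      _ ≤ ∫⁻ q in 𝒬 z (2 * r), ‖f q - c‖ₑ :=
          lintegral_mono_set (Set.iUnion_subset fun p => hsub p p.2)
      _ = ofReal (∫ p in 𝒬 z (2 * r), ‖f p - c‖) :=
          (ofReal_integral_norm_eq_lintegral_enorm (hint _ _)).symm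
      _ ≤ _ := by
          rw [← ofReal_mul hlam.le]
          exact ofReal_le_ofReal hI
  exact (ENNReal.mul_le_mul_iff_right (by simpa using hlam) ofReal_ne_top).1 h2

/-- Self-improvement. Given any uniform bound X for the mean square oscillation, a Calderón–Zygmund
decomposition at height lam bounds it by C A² + X/2: off the bad cubes |f - c| ≤ lam, and on the bad
cubes, of small total volume, X is used again. -/
theorem HasMeanOscLE.sq_step {f : SpaceTime m → V} {A M X : ℝ} (hf : IsBddMeas f M) (hA0 : 0 < A)
    (hA : HasMeanOscLE A f univ)
    (hX : ∀ (z : SpaceTime m) (r : ℝ), 0 < r →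
      ⨍ p in 𝒬 z r, ‖f p - ⨍ q in 𝒬 z r, f q‖ ^ 2 ≤ X)
    (z : SpaceTime m) {r : ℝ} (hr : 0 < r) :
    ⨍ p in 𝒬 z r, ‖f p - ⨍ q in 𝒬 z r, f q‖ ^ 2
      ≤ 2 * (8 * (2 ^ (m + 2)) ^ 4 + 2 ^ (m + 2)) ^ 2 * A ^ 2 + X / 2 := by
  set D : ℝ := 2 ^ (m + 2) with hD
  have hD1 : 1 ≤ D := one_le_pow₀ (by norm_num)
  -- Chosen so that the stopping cubes have total volume at most v/(4D²). Tripling the radii costs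
  -- at most D², since 3 ≤ 4, and Y contains 2X; the bad part therefore contributes X/2.
  set K := 8 * D ^ 4 with hK
  set c := ⨍ q in 𝒬 z r, f q with hc
  have hX0 : 0 ≤ X := (setAverage_nonneg fun _ => by positivity).trans (hX z r hr)
  set lam := K * A with hlam
  have hlam0 : 0 < lam := by positivity
  set v := volume.real (𝒬 z r)
  have hv : 0 < v := measureReal_parabolicCube_pos z hr
  have hd := hA.double_average_le hf z hr
  rw [← hc, ← hD] at hd
  have hD2 : D ≤ D ^ 2 := by nlinarith
  have hD4 : D ^ 2 ≤ D ^ 4 := by nlinarith [sq_nonneg (D^2)]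
  have hl : D * ⨍ p in 𝒬 z (2 * r), ‖f p - c‖ ≤ lam := by
    calc _ ≤ D * ((1 + D) * A) := by gcongr
      _ ≤ K * A := by
        rw [← mul_assoc]; gcongr; nlinarith
  obtain ⟨u, s, huc, hs, hdis, hsub, hbig, hsmall, hcov⟩ :=
    HasMeanOscLE.exists_stopping_cubes (A := A) hf z hr c hl
  have hI : ∫ p in 𝒬 z (2 * r), ‖f p - c‖ ≤ lam * (v / (4 * D ^ 2)) := by
    have hpos := measureReal_parabolicCube_pos z (by positivity : 0 < 2 * r)
    rw [setAverage_eq, smul_eq_mul, inv_mul_le_iff₀ hpos] at hd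
    have h2 : volume.real (𝒬 z (2 * r)) = D * v := by
      rw [measureReal_parabolicCube_mul z z (by positivity : 0 < 2 * r) hr, mul_div_assoc,
        div_self hr.ne', mul_one]
    rw [h2] at hd
    refine hd.trans ?_
    have h3 : lam * (v / (4 * D ^ 2)) = v * A * (2 * D ^ 2) := by
      rw [hlam, hK]; field_simp; norm_num
    rw [h3]
    have : D * v * ((1 + D) * A) = v * A * (D * (1 + D)) := by ring
    rw [this]
    exact mul_le_mul_of_nonneg_left (by nlinarith) (by positivity)
  have hmeas := HasMeanOscLE.stopping_measure_le hf z c hlam0 huc hs hdis hsub hbig hI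
  -- square integral over one stopping cube
  have hint2 : ∀ (a : V) (w : SpaceTime m) (s : ℝ),
      IntegrableOn (fun p => ‖f p - a‖ ^ 2) (𝒬 w s) := by
    intro a w s
    refine Measure.integrableOn_of_bounded (volume_parabolicCube_lt_top w s).ne
      ((hf.sub_const a).meas.norm.pow 2).aestronglyMeasurable (M := (M + ‖a‖) ^ 2)
      (ae_of_all _ fun x => ?_)
    rw [norm_pow, norm_norm]
    exact pow_le_pow_left₀ (norm_nonneg _) ((hf.sub_const a).bound x) 2
  set Y := 2 * (X + (lam + D * A) ^ 2) with hY
  have hY0 : 0 ≤ Y := by positivity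
  have hone : ∀ p ∈ u, ∫ q in 𝒬 p (3 * s p), ‖f q - c‖ ^ 2
      ≤ Y * (D ^ 2 * volume.real (𝒬 p (s p))) := by
    intro p hp
    have hsp := hs p hp
    have h3 : 0 < 3 * s p := by positivity
    have h2 : 0 < 2 * s p := by positivity
    have hfin := (volume_parabolicCube_lt_top p (3 * s p)).ne
    set a := ⨍ q in 𝒬 p (3 * s p), f q
    set b := ⨍ q in 𝒬 p (2 * s p), f q
    have hab : ‖b - a‖ ≤ D * A := by
      have h1 := norm_cubeAverage_sub_le a (hf.integrableOn hfin) h3 h2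
        (parabolicCube_mono (z := p) (by linarith : 2 * s p ≤ 3 * s p))
      have h4 := hA p _ h3 (Set.subset_univ _)
      refine h1.trans ?_
      gcongr
      · exact setAverage_nonneg fun _ => norm_nonneg _
      · rw [hD, mul_div_mul_right _ _ hsp.ne']; gcongr; norm_num
    have hbc : ‖b - c‖ ≤ lam :=
      (norm_setIntegral_sub_le (hf.integrableOn (volume_parabolicCube_lt_top _ _).ne) c
        (volume_parabolicCube_lt_top _ _).ne (volume_parabolicCube_pos _ h2).ne').trans (hsmall p hp)
    have hac : ‖a - c‖ ≤ lam + D * A := by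
      calc ‖a - c‖ = ‖(b - c) - (b - a)‖ := by abel_nf
        _ ≤ _ := norm_sub_le _ _
        _ ≤ _ := by gcongr
    have h5 : ⨍ q in 𝒬 p (3 * s p), ‖f q - c‖ ^ 2 ≤ Y := by
      calc _ ≤ ⨍ q in 𝒬 p (3 * s p), (2 * ‖f q - a‖ ^ 2 + 2 * (lam + D * A) ^ 2) := by
            refine setAverage_mono (measurableSet_parabolicCube _ _) (hint2 _ _ _)
              (((hint2 a _ _).const_mul 2).add (integrableOn_const hfin)) fun q _ => ?_
            have h6 : ‖f q - c‖ ≤ ‖f q - a‖ + (lam + D * A) := by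
              calc ‖f q - c‖ = ‖(f q - a) + (a - c)‖ := by abel_nf
                _ ≤ _ := norm_add_le _ _
                _ ≤ _ := by gcongr
            calc _ ≤ (‖f q - a‖ + (lam + D * A)) ^ 2 := by gcongr
              _ ≤ _ := by nlinarith [sq_nonneg (‖f q - a‖ - (lam + D * A))]
        _ = 2 * (⨍ q in 𝒬 p (3 * s p), ‖f q - a‖ ^ 2) + 2 * (lam + D * A) ^ 2 := by
            rw [setAverage_add ((hint2 a _ _).const_mul 2) (integrableOn_const hfin),
              setAverage_const (volume_parabolicCube_pos _ h3).ne' hfin, setAverage_eq,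
              integral_const_mul, setAverage_eq]
            simp only [smul_eq_mul]; ring
        _ ≤ Y := by
            have := hX p _ h3
            rw [hY]; linarith
    have hpos := measureReal_parabolicCube_pos p h3
    rw [setAverage_eq, smul_eq_mul, inv_mul_le_iff₀ hpos] at h5
    refine h5.trans ?_
    rw [mul_comm]
    refine mul_le_mul_of_nonneg_left ?_ hY0
    rw [measureReal_parabolicCube_mul p p h3 hsp, mul_div_assoc, div_self hsp.ne', mul_one]
    gcongr
    rw [hD, ← pow_mul, mul_comm, pow_mul]
    gcongr; norm_num
  haveI := huc.to_subtype
  have hE : ∀ (w : SpaceTime m) (s : ℝ), ofReal (∫ q in 𝒬 w s, ‖f q - c‖ ^ 2)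
      = ∫⁻ q in 𝒬 w s, ofReal (‖f q - c‖ ^ 2) := fun w s =>
    ofReal_integral_eq_lintegral_ofReal (hint2 c w s) (ae_of_all _ fun _ => by positivity)
  have hmain : ofReal (∫ q in 𝒬 z r, ‖f q - c‖ ^ 2)
      ≤ ofReal (lam ^ 2 * v + Y * (v / 4)) := by
    rw [hE]
    have h1 : ∫⁻ q in 𝒬 z r, ofReal (‖f q - c‖ ^ 2)
        ≤ (∫⁻ _q in 𝒬 z r, ofReal (lam ^ 2)) +
          ∫⁻ q in ⋃ p : u, 𝒬 (p : SpaceTime m) (3 * s p), ofReal (‖f q - c‖ ^ 2) := by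
      have hmU : MeasurableSet (⋃ p : u, 𝒬 (p : SpaceTime m) (3 * s p)) :=
        MeasurableSet.iUnion fun p => measurableSet_parabolicCube _ _
      rw [← lintegral_indicator (measurableSet_parabolicCube _ _),
        ← lintegral_indicator (measurableSet_parabolicCube _ _), ← lintegral_indicator hmU,
        ← lintegral_add_left (measurable_const.indicator (measurableSet_parabolicCube _ _))]
      refine lintegral_mono_ae ?_
      filter_upwards [hcov] with p hp
      by_cases hpz : p ∈ 𝒬 z r
      · simp only [indicator_of_mem hpz]
        rcases hp hpz with h | ⟨b, hb, hpb⟩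
        · exact (ofReal_le_ofReal (by gcongr)).trans le_self_add
        · have : p ∈ ⋃ p : u, 𝒬 (p : SpaceTime m) (3 * s p) :=
            Set.mem_iUnion.2 ⟨⟨b, hb⟩, hpb⟩
          rw [indicator_of_mem this]
          exact le_add_self
      · simp [indicator_of_notMem hpz]
    have h2 : ∫⁻ q in ⋃ p : u, 𝒬 (p : SpaceTime m) (3 * s p), ofReal (‖f q - c‖ ^ 2)
        ≤ ofReal (Y * (v / 4)) := by
      calc _ ≤ ∑' p : u, ∫⁻ q in 𝒬 (p : SpaceTime m) (3 * s p),
              ofReal (‖f q - c‖ ^ 2) := lintegral_iUnion_le _ _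
        _ ≤ ∑' p : u, ofReal (Y * D ^ 2) * volume (𝒬 (p : SpaceTime m) (s p)) := by
            refine ENNReal.tsum_le_tsum fun p => ?_
            rw [← hE]
            refine (ofReal_le_ofReal (hone p p.2)).trans_eq ?_
            rw [← mul_assoc, ofReal_mul (by positivity), Measure.real,
              ofReal_toReal (volume_parabolicCube_lt_top _ _).ne]
        _ = ofReal (Y * D ^ 2) * ∑' p : u, volume (𝒬 (p : SpaceTime m) (s p)) :=
            ENNReal.tsum_mul_left
        _ ≤ ofReal (Y * D ^ 2) * ofReal (v / (4 * D ^ 2)) := by gcongr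
        _ = _ := by
            rw [← ofReal_mul (by positivity)]
            congr 1; field_simp
    refine h1.trans ?_
    rw [ofReal_add (by positivity) (by positivity), setLIntegral_const,
      ofReal_mul (by positivity),
      show ofReal v = volume (𝒬 z r) from
        ofReal_toReal (volume_parabolicCube_lt_top _ _).ne]
    gcongr
  rw [ofReal_le_ofReal_iff (by positivity)] at hmain
  rw [setAverage_eq, smul_eq_mul, inv_mul_le_iff₀ hv]
  refine hmain.trans ?_
  rw [hY, hlam]
  have hKD : K ^ 2 * A ^ 2 ≤ (K + D) ^ 2 * A ^ 2 := by gcongr; linarith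
  nlinarith [mul_nonneg hv.le (sub_nonneg.2 hKD), mul_nonneg hv.le (by positivity : 0 ≤ (K + D) ^ 2 * A ^ 2)]

/-- Functions of bounded mean oscillation are square integrable on cubes, with a norm bound. -/
theorem HasMeanOscLE.sq_average_le {f : SpaceTime m → V} {A M : ℝ} (hf : IsBddMeas f M) (hA0 : 0 < A)
    (hA : HasMeanOscLE A f univ) (z : SpaceTime m) {r : ℝ} (hr : 0 < r) :
    ⨍ p in 𝒬 z r, ‖f p - ⨍ q in 𝒬 z r, f q‖ ^ 2
      ≤ 4 * (8 * (2 ^ (m + 2)) ^ 4 + 2 ^ (m + 2)) ^ 2 * A ^ 2 := by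
  let I := SpaceTime m × {r : ℝ // 0 < r}
  let F : I → ℝ := fun i =>
    ⨍ p in 𝒬 i.1 i.2.1, ‖f p - ⨍ q in 𝒬 i.1 i.2.1, f q‖ ^ 2
  -- The a priori bound M serves only to make the supremum finite, so that the term X/2 of
  -- `HasMeanOscLE.sq_step` can be absorbed. It leaves no trace in the final constant.
  have hbdd : BddAbove (Set.range F) := by
    refine ⟨(2 * M) ^ 2, ?_⟩
    rintro _ ⟨⟨w, s, hs⟩, rfl⟩
    have hfin := (volume_parabolicCube_lt_top w s).ne
    set a := ⨍ q in 𝒬 w s, f q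
    have hM : 0 ≤ M := (norm_nonneg _).trans (hf.bound w)
    have ha : ‖a‖ ≤ M := by
      have := norm_setIntegral_sub_le (hf.integrableOn hfin) 0 hfin (volume_parabolicCube_pos w hs).ne'
      simp only [sub_zero] at this
      exact this.trans (setAverage_le_const (measurableSet_parabolicCube _ _)
        (hf.norm.integrableOn hfin) hfin (volume_parabolicCube_pos w hs).ne' fun x _ => hf.bound x)
    have hb : ∀ x, ‖f x - a‖ ≤ 2 * M := fun x => ((hf.sub_const a).bound x).trans (by linarith)
    refine setAverage_le_const (measurableSet_parabolicCube _ _) ?_ hfin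
      (volume_parabolicCube_pos w hs).ne' fun x _ => pow_le_pow_left₀ (norm_nonneg _) (hb x) 2
    refine Measure.integrableOn_of_bounded hfin
      ((hf.sub_const a).meas.norm.pow 2).aestronglyMeasurable (M := (2 * M) ^ 2)
      (ae_of_all _ fun x => ?_)
    rw [norm_pow, norm_norm]
    exact pow_le_pow_left₀ (norm_nonneg _) (hb x) 2
  have hX : ∀ (w : SpaceTime m) (s : ℝ), 0 < s →
      ⨍ p in 𝒬 w s, ‖f p - ⨍ q in 𝒬 w s, f q‖ ^ 2 ≤ ⨆ i, F i :=
    fun w s hs => le_ciSup hbdd (⟨w, s, hs⟩ : I)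
  haveI : Nonempty I := ⟨⟨z, r, hr⟩⟩
  have h1 : ⨆ i, F i ≤ 2 * (8 * (2 ^ (m + 2)) ^ 4 + 2 ^ (m + 2)) ^ 2 * A ^ 2 + (⨆ i, F i) / 2 :=
    ciSup_le fun i => HasMeanOscLE.sq_step hf hA0 hA hX i.1 i.2.2
  exact (hX z r hr).trans (by linarith)

end JohnNirenberg

/-! ### Functions in the class `Lip(1,1/2)` -/

section LipHalf

variable {m : ℕ}

theorem IsLipHalfOn.mono {ℓ : ℝ} {φ : SpaceTime m → ℝ} {S T : Set (SpaceTime m)}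
    (h : IsLipHalfOn ℓ φ S) (hT : T ⊆ S) : IsLipHalfOn ℓ φ T :=
  fun p hp q hq => h p (hT hp) q (hT hq)

/-- The two points compared differ in time only, so the argument also works when there is no space
variable. -/
theorem IsLipHalfOn.nonneg {ℓ : ℝ} {φ : SpaceTime m → ℝ} {z : SpaceTime m} {r : ℝ} (hr : 0 < r)
    (h : IsLipHalfOn ℓ φ (𝒬 z r)) : 0 ≤ ℓ := by
  have h2 : ((z.1, z.2 + r ^ 2 / 2) : SpaceTime m) ∈ 𝒬 z r := by
    refine ⟨fun i => by simpa using hr, ?_⟩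
    rw [mem_timeInterval hr]
    simp only [sub_add_cancel_left, abs_neg]
    rw [abs_of_pos (by positivity)]
    have := pow_pos hr 2
    linarith
  have h1 := h z (self_mem_parabolicCube z hr) _ h2
  simp only [sub_self, norm_zero, zero_add, sub_add_cancel_left, abs_neg] at h1
  have h3 : 0 < √|r ^ 2 / 2| := Real.sqrt_pos.2 (abs_pos.2 (by positivity))
  by_contra hneg
  have := (abs_nonneg _).trans h1
  nlinarith

/-- McShane's extension theorem for the class `Lip(1,1/2)`. -/
theorem IsLipHalfOn.exists_extension {ℓ : ℝ} (hℓ : 0 ≤ ℓ) {φ : SpaceTime m → ℝ}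
    {S : Set (SpaceTime m)} (h : IsLipHalfOn ℓ φ S) (hS : S.Nonempty) :
    ∃ ψ : SpaceTime m → ℝ, IsLipHalfOn ℓ ψ univ ∧ Set.EqOn ψ φ S := by
  haveI := hS.to_subtype
  obtain ⟨q₀, hq₀⟩ := hS
  let d : SpaceTime m → SpaceTime m → ℝ := fun p q => ‖p.1 - q.1‖ + √|p.2 - q.2|
  have hd : ∀ p q w, d p w ≤ d p q + d q w := by
    intro p q w
    have h1 := norm_sub_le_norm_sub_add_norm_sub p.1 q.1 w.1
    have h2 := sqrt_abs_sub_le p.2 q.2 w.2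
    simp only [d]; linarith
  have hb : ∀ p, BddBelow (Set.range fun q : S => φ q + ℓ * d p q) := by
    intro p
    refine ⟨φ q₀ - ℓ * d p q₀, ?_⟩
    rintro _ ⟨q, rfl⟩
    have h1 := (abs_le.1 (h q₀ hq₀ q q.2)).2
    have h2 := mul_le_mul_of_nonneg_left (hd q₀ p q) hℓ
    have h3 : d q₀ p = d p q₀ := by simp only [d, norm_sub_rev, abs_sub_comm]
    change φ q₀ - φ q ≤ ℓ * d q₀ q at h1
    simp only
    rw [h3] at h2
    linarith
  let ψ : SpaceTime m → ℝ := fun p => ⨅ q : S, (φ q + ℓ * d p q)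
  have hψ : ∀ p q, ψ p ≤ ψ q + ℓ * d p q := by
    intro p q
    rw [← sub_le_iff_le_add]
    refine le_ciInf fun w => ?_
    rw [sub_le_iff_le_add]
    refine (ciInf_le (hb p) w).trans ?_
    have := mul_le_mul_of_nonneg_left (hd p q w) hℓ
    linarith
  refine ⟨ψ, fun p _ q _ => ?_, fun p hp => ?_⟩
  · rw [abs_le]
    have h1 := hψ p q
    have h2 := hψ q p
    have h3 : d q p = d p q := by simp only [d, norm_sub_rev, abs_sub_comm]
    rw [h3] at h2
    change -(ℓ * d p q) ≤ _ ∧ _ ≤ ℓ * d p q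
    constructor <;> linarith
  · apply le_antisymm
    · refine (ciInf_le (hb p) ⟨p, hp⟩).trans ?_
      simp [d]
    · refine le_ciInf fun q => ?_
      have := (abs_le.1 (h p hp q q.2)).2
      change φ p - φ q ≤ ℓ * d p q at this
      linarith

variable {ℓ : ℝ} {Φ : SpaceTime m → ℝ}

theorem IsLipHalfOn.nonneg_of_univ (h : IsLipHalfOn ℓ Φ univ) : 0 ≤ ℓ :=
  IsLipHalfOn.nonneg (z := 0) one_pos (h.mono (Set.subset_univ _))

theorem IsLipHalfOn.space (h : IsLipHalfOn ℓ Φ univ) (x y : 𝕏 m) (t : ℝ) :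
    |Φ (x, t) - Φ (y, t)| ≤ ℓ * ‖x - y‖ := by
  simpa using h (x, t) trivial (y, t) trivial

theorem IsLipHalfOn.time (h : IsLipHalfOn ℓ Φ univ) (x : 𝕏 m) (t s : ℝ) :
    |Φ (x, t) - Φ (x, s)| ≤ ℓ * √|t - s| := by
  simpa using h (x, t) trivial (x, s) trivial

theorem isLipHalfOn_univ_of_space_time
    (h1 : ∀ x y t, |Φ (x, t) - Φ (y, t)| ≤ ℓ * ‖x - y‖)
    (h2 : ∀ x t s, |Φ (x, t) - Φ (x, s)| ≤ ℓ * √|t - s|) : IsLipHalfOn ℓ Φ univ := by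
  rintro ⟨x, t⟩ _ ⟨y, s⟩ _
  calc _ ≤ |Φ (x, t) - Φ (y, t)| + |Φ (y, t) - Φ (y, s)| := abs_sub_le _ _ _
    _ ≤ ℓ * ‖x - y‖ + ℓ * √|t - s| := add_le_add (h1 x y t) (h2 y t s)
    _ = _ := by ring

theorem IsLipHalfOn.lipschitzWith (h : IsLipHalfOn ℓ Φ univ) (t : ℝ) :
    LipschitzWith ℓ.toNNReal (fun x => Φ (x, t)) :=
  LipschitzWith.of_dist_le_mul fun x y => by
    rw [Real.coe_toNNReal _ h.nonneg_of_univ, Real.dist_eq, dist_eq_norm]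
    exact h.space x y t

theorem IsLipHalfOn.continuous (h : IsLipHalfOn ℓ Φ univ) : Continuous Φ := by
  rw [continuous_iff_continuousAt]
  intro p
  rw [ContinuousAt, tendsto_iff_dist_tendsto_zero]
  have h0 : Filter.Tendsto (fun q : SpaceTime m => ℓ * (‖q.1 - p.1‖ + √|q.2 - p.2|)) (nhds p)
      (nhds (ℓ * (‖p.1 - p.1‖ + √|p.2 - p.2|))) :=
    Continuous.tendsto (by fun_prop) p
  simp only [sub_self, norm_zero, abs_zero, Real.sqrt_zero, add_zero, mul_zero] at h0
  exact squeeze_zero (fun _ => dist_nonneg) (fun q => h q trivial p trivial) h0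

theorem continuous_uncurry_swap (h : Continuous Φ) :
    Continuous (Function.uncurry fun (t : ℝ) (x : 𝕏 m) => Φ (x, t)) :=
  h.comp continuous_swap

theorem stronglyMeasurable_spatialGradient (h : Continuous Φ) :
    StronglyMeasurable (∇ₓ Φ) := by
  have h1 := measurable_fderiv_with_param ℝ (continuous_uncurry_swap h)
  have h2 := (InnerProductSpace.toDual ℝ 𝕏 m).symm.continuous.measurable.comp
    (h1.comp measurable_swap)
  exact h2.stronglyMeasurable

theorem IsLipHalfOn.norm_spatialGradient_le (h : IsLipHalfOn ℓ Φ univ) (p : SpaceTime m) :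
    ‖∇ₓ Φ p‖ ≤ ℓ := by
  have := norm_fderiv_le_of_lipschitz ℝ (h.lipschitzWith p.2) (x₀ := p.1)
  rw [Real.coe_toNNReal _ h.nonneg_of_univ] at this
  rw [spatialGradient, gradient, LinearIsometryEquiv.norm_map]
  exact this

theorem IsLipHalfOn.isBddMeas (h : IsLipHalfOn ℓ Φ univ) : IsBddMeas (∇ₓ Φ) ℓ :=
  ⟨stronglyMeasurable_spatialGradient h.continuous, h.norm_spatialGradient_le⟩

/-- Rademacher's theorem on every time slice, put together by Fubini; joint continuity makes the set
of differentiability points measurable. -/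
theorem IsLipHalfOn.ae_differentiableAt (h : IsLipHalfOn ℓ Φ univ) :
    ∀ᵐ p : SpaceTime m, DifferentiableAt ℝ (fun x => Φ (x, p.2)) p.1 := by
  have h1 : ∀ᵐ p : ℝ × 𝕏 m ∂(volume.prod volume),
      DifferentiableAt ℝ (fun x => Φ (x, p.1)) p.2 := by
    rw [Measure.ae_prod_iff_ae_ae
      (measurableSet_of_differentiableAt_with_param ℝ (continuous_uncurry_swap h.continuous))]
    exact Filter.Eventually.of_forall fun t => (h.lipschitzWith t).ae_differentiableAt
  rw [← Measure.prod_swap, ae_map_iff measurable_swap.aemeasurable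
    (measurableSet_of_differentiableAt_with_param ℝ (continuous_uncurry_swap h.continuous))] at h1
  exact h1

end LipHalf

/-! ### A Poincaré inequality -/

section Poincare

variable {E : Type*} [NormedAddCommGroup E] [InnerProductSpace ℝ E] [FiniteDimensional ℝ E]
  [MeasurableSpace E] [BorelSpace E]

/-- The fundamental theorem of calculus along a segment. It holds for every x, since the restriction
to a line is absolutely continuous; the line derivative is used because Fréchet differentiability
may fail on the whole segment. -/
theorem LipschitzWith.enorm_sub_le_lintegral_lineDeriv {f : E → ℝ} {K : ℝ≥0} (hf : LipschitzWith K f)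
    (x v : E) : ‖f (x + v) - f x‖ₑ ≤ ∫⁻ τ in Set.Ioc (0 : ℝ) 1, ‖lineDeriv ℝ f (x + τ • v) v‖ₑ := by
  let g : ℝ → ℝ := fun τ => f (x + τ • v)
  have hg : LipschitzWith (K * ‖v‖₊) g := by
    refine LipschitzWith.of_dist_le_mul fun a b => ?_
    refine (hf.dist_le_mul _ _).trans ?_
    rw [dist_add_left, dist_eq_norm, ← sub_smul, norm_smul, Real.dist_eq, Real.norm_eq_abs]
    push_cast
    rw [mul_assoc, mul_comm |a - b|]
  have hg1 := (hg.lipschitzOnWith (s := Set.uIcc 0 1)).absolutelyContinuousOnInterval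
  have h1 := hg1.integral_deriv_eq_sub
  have h2 : f (x + v) - f x = ∫ τ in Set.Ioc (0 : ℝ) 1, deriv g τ := by
    rw [← intervalIntegral.integral_of_le zero_le_one, h1]
    simp [g]
  rw [h2]
  refine (enorm_integral_le_lintegral_enorm _).trans (le_of_eq ?_)
  refine lintegral_congr fun τ => ?_
  congr 1
  rw [lineDeriv]
  have h3 : g = fun t => (fun t => f (x + τ • v + t • v)) (t - τ) := by
    ext t; simp only [g]; congr 1; rw [sub_smul]; abel
  conv_lhs => rw [h3]
  rw [deriv_comp_sub_const (f := fun t => f (x + τ • v + t • v))]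
  simp

/-- After Fubini, x is integrated for a fixed position τ on the segment: convexity keeps x + τv in J
and translation invariance removes τ. Almost everywhere on J the line derivative is then the Fréchet
derivative. -/
theorem LipschitzWith.lintegral_translate_sub_le {f : E → ℝ} {K : ℝ≥0} (hf : LipschitzWith K f)
    {J : Set E} (hJ : Convex ℝ J) (hJm : MeasurableSet J) (v : E) :
    ∫⁻ x, J.indicator 1 x * J.indicator 1 (x + v) * ‖f (x + v) - f x‖ₑ
      ≤ ‖v‖ₑ * ∫⁻ x in J, ‖fderiv ℝ f x‖ₑ := by
  have hm : Measurable fun p : E × ℝ => ‖lineDeriv ℝ f (p.1 + p.2 • v) v‖ₑ :=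
    ((measurable_lineDeriv (v := v) hf.continuous).comp
      (by fun_prop : Measurable fun p : E × ℝ => p.1 + p.2 • v)).enorm
  have hind : Measurable (J.indicator (1 : E → ℝ≥0∞)) := measurable_one.indicator hJm
  calc _ ≤ ∫⁻ x, ∫⁻ τ in Set.Ioc (0 : ℝ) 1, J.indicator 1 x * J.indicator 1 (x + v) *
            ‖lineDeriv ℝ f (x + τ • v) v‖ₑ := by
        refine lintegral_mono fun x => ?_
        have hmx : Measurable fun τ : ℝ => ‖lineDeriv ℝ f (x + τ • v) v‖ₑ :=
          ((measurable_lineDeriv (v := v) hf.continuous).comp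
            (by fun_prop : Measurable fun τ : ℝ => x + τ • v)).enorm
        rw [lintegral_const_mul _ hmx]
        gcongr
        exact hf.enorm_sub_le_lintegral_lineDeriv x v
    _ = ∫⁻ τ in Set.Ioc (0 : ℝ) 1, ∫⁻ x, J.indicator 1 x * J.indicator 1 (x + v) *
            ‖lineDeriv ℝ f (x + τ • v) v‖ₑ := by
        apply lintegral_lintegral_swap
        refine Measurable.aemeasurable ?_
        refine Measurable.mul (Measurable.mul (hind.comp measurable_fst) ?_) hm
        exact hind.comp (measurable_fst.add_const v)
    _ ≤ ∫⁻ τ in Set.Ioc (0 : ℝ) 1, ‖v‖ₑ * ∫⁻ x in J, ‖fderiv ℝ f x‖ₑ := by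
        refine setLIntegral_mono measurable_const fun τ hτ => ?_
        calc _ ≤ ∫⁻ x, (fun y => J.indicator (fun y => ‖lineDeriv ℝ f y v‖ₑ) y) (x + τ • v) := by
              refine lintegral_mono fun x => ?_
              by_cases h1 : x ∈ J
              · by_cases h2 : x + v ∈ J
                · have h3 : x + τ • v ∈ J := by
                    have := hJ h1 h2 (sub_nonneg.2 hτ.2) hτ.1.le (by ring)
                    convert this using 1
                    rw [sub_smul, smul_add, one_smul]; abel
                  simp [h1, h2, h3]
                · simp [h2]
              · simp [h1]
          _ = ∫⁻ y in J, ‖lineDeriv ℝ f y v‖ₑ := by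
              rw [lintegral_add_right_eq_self (fun y => J.indicator (fun y => ‖lineDeriv ℝ f y v‖ₑ) y),
                lintegral_indicator hJm]
          _ ≤ ∫⁻ y in J, ‖v‖ₑ * ‖fderiv ℝ f y‖ₑ := by
              refine lintegral_mono_ae (ae_restrict_of_ae ?_)
              filter_upwards [hf.ae_differentiableAt (μ := (volume : Measure E))] with y hy
              rw [hy.lineDeriv_eq_fderiv, mul_comm]
              exact ContinuousLinearMap.le_opENorm _ _
          _ = _ := lintegral_const_mul _ (measurable_fderiv ℝ f).enorm
    _ = _ := by simp

/-- A Poincaré inequality on convex sets. -/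
theorem LipschitzWith.lintegral_lintegral_enorm_sub_le {f : E → ℝ} {K : ℝ≥0} (hf : LipschitzWith K f)
    {J W : Set E} (hJ : Convex ℝ J) (hJm : MeasurableSet J) (hW : MeasurableSet W) {R : ℝ}
    (hR : ∀ v ∈ W, ‖v‖ ≤ R) (hJW : ∀ x ∈ J, ∀ y ∈ J, y - x ∈ W) :
    ∫⁻ x in J, ∫⁻ y in J, ‖f y - f x‖ₑ ≤
      volume W * ofReal R * ∫⁻ x in J, ‖fderiv ℝ f x‖ₑ := by
  have hind : Measurable (J.indicator (1 : E → ℝ≥0∞)) := measurable_one.indicator hJm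
  have hfc := hf.continuous
  calc _ = ∫⁻ x, ∫⁻ y, J.indicator 1 x * J.indicator 1 y * ‖f y - f x‖ₑ := by
        rw [← lintegral_indicator hJm]
        refine lintegral_congr fun x => ?_
        by_cases hx : x ∈ J
        · simp only [indicator_of_mem hx, Pi.one_apply, one_mul]
          rw [← lintegral_indicator hJm]
          refine lintegral_congr fun y => ?_
          by_cases hy : y ∈ J <;> simp [hy]
        · simp [hx]
    _ = ∫⁻ x, ∫⁻ v, J.indicator 1 x * J.indicator 1 (x + v) * ‖f (x + v) - f x‖ₑ := by
        refine lintegral_congr fun x => ?_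
        exact (lintegral_add_left_eq_self (fun y => J.indicator 1 x * J.indicator 1 y * ‖f y - f x‖ₑ) x).symm
    _ = ∫⁻ v, ∫⁻ x, J.indicator 1 x * J.indicator 1 (x + v) * ‖f (x + v) - f x‖ₑ := by
        apply lintegral_lintegral_swap
        refine Measurable.aemeasurable ?_
        refine Measurable.mul (Measurable.mul (hind.comp measurable_fst)
          (hind.comp (measurable_fst.add measurable_snd))) ?_
        exact (by fun_prop : Continuous fun p : E × E => f (p.1 + p.2) - f p.1).measurable.enorm
    _ ≤ ∫⁻ v in W, ofReal R * ∫⁻ x in J, ‖fderiv ℝ f x‖ₑ := by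
        rw [← lintegral_indicator hW]
        refine lintegral_mono fun v => ?_
        by_cases hv : v ∈ W
        · rw [indicator_of_mem hv]
          refine (hf.lintegral_translate_sub_le hJ hJm v).trans ?_
          gcongr
          rw [← ofReal_norm]
          exact ofReal_le_ofReal (hR v hv)
        · rw [indicator_of_notMem hv, nonpos_iff_eq_zero]
          refine (lintegral_congr fun x => ?_).trans lintegral_zero
          by_cases h1 : x ∈ J
          · by_cases h2 : x + v ∈ J
            · exact absurd (by simpa using hJW x h1 _ h2) hv
            · simp [h2]
          · simp [h1]
    _ = _ := by rw [setLIntegral_const]; ring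

end Poincare

/-! ### Mean differences over parabolic cubes. -/

section MeanDifference

variable {m : ℕ}

theorem convex_spatialCube (x : 𝕏 m) (r : ℝ) : Convex ℝ (spatialCube x r) := by
  have : spatialCube x r = ⋂ i, {y : 𝕏 m | y i ∈ Set.Ioo (x i - r) (x i + r)} := by
    ext y
    simp only [spatialCube, Set.mem_ofPred_eq, Set.mem_iInter, Set.mem_Ioo, abs_lt]
    exact forall_congr' fun i => ⟨fun h => ⟨by linarith, by linarith⟩, fun h => ⟨by linarith, by linarith⟩⟩
  rw [this]
  exact convex_iInter fun i => (convex_Ioo _ _).linear_preimage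
    (EuclideanSpace.proj i : 𝕏 m →L[ℝ] ℝ).toLinearMap

theorem timeDifference_congr {Φ Ψ : SpaceTime m → ℝ} (z : SpaceTime m) (s : ℝ)
    (h : ∀ x t τ, Φ (x, t) - Φ (x, τ) = Ψ (x, t) - Ψ (x, τ)) :
    timeDifference Φ z s = timeDifference Ψ z s := by
  simp only [timeDifference, h]

theorem lintegral_parabolicCube_snd (z : SpaceTime m) (s : ℝ) {g : ℝ → ℝ≥0∞} (hg : Measurable g) :
    ∫⁻ p in 𝒬 z s, g p.2 = volume (spatialCube z.1 s) * ∫⁻ t in timeInterval z.2 s, g t := by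
  have hm : Measurable fun p : SpaceTime m => g p.2 := hg.comp measurable_snd
  rw [restrict_parabolicCube, lintegral_prod _ hm.aemeasurable]
  simp only [lintegral_const, Measure.restrict_apply_univ]
  rw [mul_comm]

/-- The Poincaré inequality on each time slice of the cube, where J is convex and the differences of
its points lie in the cube of radius 2s about the origin; integration in t restores the full
gradient integral. -/
theorem IsLipHalfOn.lintegral_space_sub_le {ℓ A s : ℝ} {ψ : SpaceTime m → ℝ}
    (h : IsLipHalfOn ℓ ψ univ) (z : SpaceTime m) (hs : 0 < s)
    (hgrad : ∫⁻ p in 𝒬 z s, ‖∇ₓ ψ p‖ₑ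
      ≤ ofReal A * volume (𝒬 z s)) :
    ∫⁻ p in 𝒬 z s, ∫⁻ q in 𝒬 z s, ‖ψ (q.1, p.2) - ψ p‖ₑ
      ≤ ofReal (2 ^ m * (2 * m) * A * s) * volume (𝒬 z s) ^ 2 := by
  have hc := h.continuous
  set J := spatialCube z.1 s with hJ
  set I := timeInterval z.2 s with hI
  set Q := 𝒬 z s with hQ
  have hQJI : volume Q = volume J * volume I := by
    rw [hQ, parabolicCube, Measure.volume_eq_prod, Measure.prod_prod]
  have hrest : (volume.restrict Q : Measure (SpaceTime m)) = (volume.restrict J).prod (volume.restrict I) :=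
    restrict_parabolicCube z s
  have hvI : volume I = ofReal (2 * s ^ 2) := volume_timeInterval _ hs
  have hin : ∀ p : SpaceTime m, ∫⁻ q in Q, ‖ψ (q.1, p.2) - ψ p‖ₑ
      = volume I * ∫⁻ y in J, ‖ψ (y, p.2) - ψ p‖ₑ := by
    intro p
    rw [hrest, lintegral_prod _ (by
      exact (by fun_prop : Continuous fun q : SpaceTime m => ψ (q.1, p.2) - ψ p).measurable.enorm.aemeasurable)]
    simp only [lintegral_const, Measure.restrict_apply_univ]
    rw [lintegral_mul_const _ (by
      exact (by fun_prop : Continuous fun y => ψ (y, p.2) - ψ p).measurable.enorm), mul_comm]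
  have hmeas : Measurable fun p : SpaceTime m => ∫⁻ y in J, ‖ψ (y, p.2) - ψ p‖ₑ := by
    apply Measurable.lintegral_prod_right' (f := fun q : SpaceTime m × 𝕏 m =>
      ‖ψ (q.2, q.1.2) - ψ q.1‖ₑ)
    exact (by fun_prop : Continuous fun q : SpaceTime m × 𝕏 m =>
      ψ (q.2, q.1.2) - ψ q.1).measurable.enorm
  simp only [hin]
  rw [lintegral_const_mul _ hmeas, hrest, lintegral_prod_symm _ hmeas.aemeasurable]
  have hslice : ∀ t, ∫⁻ x in J, ∫⁻ y in J, ‖ψ (y, t) - ψ (x, t)‖ₑ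
      ≤ volume J * ofReal (2 ^ m * (2 * m) * s) * ∫⁻ x in J, ‖∇ₓ ψ (x, t)‖ₑ := by
    intro t
    refine (LipschitzWith.lintegral_lintegral_enorm_sub_le (h.lipschitzWith t) (convex_spatialCube _ _)
      (measurableSet_spatialCube _ _) (measurableSet_spatialCube 0 (2 * s)) (R := m * (2 * s)) ?_ ?_).trans ?_
    · intro v hv
      simpa using norm_sub_le_of_mem_spatialCube (x := 0) (by positivity) hv
    · intro x hx y hy i
      have := hx i
      have h3 := hy i
      simp only [PiLp.zero_apply, PiLp.sub_apply, zero_sub, abs_neg]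
      calc |y i - x i| ≤ |y i - z.1 i| + |z.1 i - x i| := abs_sub_le _ _ _
        _ < s + s := add_lt_add (by rwa [abs_sub_comm]) this
        _ = 2 * s := by ring
    · have e1 : ∀ x, ‖fderiv ℝ (fun x => ψ (x, t)) x‖ₑ = ‖∇ₓ ψ (x, t)‖ₑ := by
        intro x
        simp only [spatialGradient, gradient]
        rw [← ofReal_norm, ← ofReal_norm, LinearIsometryEquiv.norm_map]
      simp only [e1]
      refine mul_le_mul_left ?_ _
      rw [hJ, volume_spatialCube _ hs, volume_spatialCube _ (by positivity),
        ← ofReal_mul (by positivity), ← ofReal_mul (by positivity)]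
      apply ofReal_le_ofReal
      apply le_of_eq
      rw [mul_pow, mul_pow 2 s]; ring
  have hgm : Measurable fun p : SpaceTime m => ‖∇ₓ ψ p‖ₑ :=
    (stronglyMeasurable_spatialGradient hc).measurable.enorm
  calc _ ≤ volume I * ∫⁻ t in I, (volume J * ofReal (2 ^ m * (2 * m) * s) *
          ∫⁻ x in J, ‖∇ₓ ψ (x, t)‖ₑ) := by
        gcongr with t
        exact hslice t
    _ = volume I * (volume J * ofReal (2 ^ m * (2 * m) * s) *
          ∫⁻ p in Q, ‖∇ₓ ψ p‖ₑ) := by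
        rw [hrest, lintegral_prod_symm _ hgm.aemeasurable, lintegral_const_mul]
        exact Measurable.lintegral_prod_left' hgm
    _ ≤ volume I * (volume J * ofReal (2 ^ m * (2 * m) * s) *
          (ofReal A * volume Q)) := by gcongr
    _ = _ := by
        rw [hQJI, show (2 : ℝ) ^ m * (2 * m) * A * s = (2 ^ m * (2 * m) * s) * A by ring,
          ofReal_mul (p := (2 : ℝ) ^ m * (2 * m) * s) (by positivity)]
        ring

theorem lintegral_lintegral_le_affine {α β : Type*} [MeasurableSpace α] [MeasurableSpace β]
    {μ : Measure α} {ν : Measure β} [SFinite ν] {Q : Set α} {I : Set β} (hQ : MeasurableSet Q)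
    (hI : MeasurableSet I) {F G : α → β → ℝ≥0∞} (hF : Measurable (Function.uncurry F)) {c d : ℝ≥0∞}
    (h : ∀ q ∈ Q, ∀ t ∈ I, G q t ≤ c * F q t + d) :
    ∫⁻ q in Q, ∫⁻ t in I, G q t ∂ν ∂μ ≤ c * (∫⁻ q in Q, ∫⁻ t in I, F q t ∂ν ∂μ) + d * ν I * μ Q := by
  calc _ ≤ ∫⁻ q in Q, (c * (∫⁻ t in I, F q t ∂ν) + d * ν I) ∂μ := by
        refine setLIntegral_mono' hQ fun q hq => ?_
        calc _ ≤ ∫⁻ t in I, (c * F q t + d) ∂ν := setLIntegral_mono' hI fun t ht => h q hq t ht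
          _ = _ := by
            rw [lintegral_add_right _ measurable_const, lintegral_const_mul _ hF.of_uncurry_left,
              setLIntegral_const]
    _ = _ := by
        rw [lintegral_add_right _ measurable_const, lintegral_const_mul _ hF.lintegral_prod_right,
          setLIntegral_const]

/-- Weighted arithmetic-geometric mean: with a = D/u one has D ≤ 2s²a ≤ (2s³/A)a² + As/2. The
weights are balanced so that a mean square of a of order A² produces a first-order bound of order A
s. -/
theorem le_weighted_sq {D u s A : ℝ} (hs : 0 < s) (hA : 0 < A) (hD0 : 0 ≤ D) (hu0 : 0 ≤ u)
    (hu2 : u ≤ 2 * s ^ 2) (h0 : u = 0 → D = 0) :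
    D ≤ 2 * s ^ 3 / A * (D ^ 2 / u ^ 2) + A * s / 2 := by
  rcases hu0.eq_or_lt with h | hu
  · rw [h0 h.symm]; positivity
  rw [← div_pow]
  obtain ⟨a, ha⟩ : ∃ a, a = D / u := ⟨_, rfl⟩
  have hD : D = a * u := by rw [ha]; field_simp
  have ha0 : 0 ≤ a := by rw [ha]; positivity
  rw [← ha, hD]
  have h5 : a * u ≤ a * (2 * s ^ 2) := by gcongr
  have e : 2 * s ^ 3 / A * a ^ 2 + A * s / 2 - a * (2 * s ^ 2) = s / (2 * A) * (2 * s * a - A) ^ 2 := by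
    field_simp; ring
  have : 0 ≤ s / (2 * A) * (2 * s * a - A) ^ 2 := by positivity
  linarith

/-- There is no time derivative to integrate. The squared difference quotient of `timeDifference`
takes its place, linearised by `le_weighted_sq`. -/
theorem IsLipHalfOn.lintegral_time_sub_le {ℓ A s : ℝ} {ψ : SpaceTime m → ℝ}
    (h : IsLipHalfOn ℓ ψ univ) (z : SpaceTime m) (hs : 0 < s) (hA : 0 < A)
    (htime : timeDifference ψ z s ≤ ofReal (A ^ 2)) :
    ∫⁻ p in 𝒬 z s, ∫⁻ q in 𝒬 z s, ‖ψ q - ψ (q.1, p.2)‖ₑ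
      ≤ ofReal (2 * A * s) * volume (𝒬 z s) ^ 2 := by
  have hc := h.continuous
  set J := spatialCube z.1 s with hJ
  set I := timeInterval z.2 s with hI
  set Q := 𝒬 z s with hQ
  have hQJI : volume Q = volume J * volume I := by
    rw [hQ, parabolicCube, Measure.volume_eq_prod, Measure.prod_prod]
  have hrest : (volume.restrict Q : Measure (SpaceTime m)) = (volume.restrict J).prod (volume.restrict I) :=
    restrict_parabolicCube z s
  have hvI : volume I = ofReal (2 * s ^ 2) := volume_timeInterval _ hs
  have hcont : Continuous fun w : SpaceTime m × ℝ => ψ w.1 - ψ (w.1.1, w.2) := by fun_prop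
  have hcont' : Continuous fun w : ℝ × SpaceTime m => ψ w.2 - ψ (w.2.1, w.1) := by fun_prop
  have hmeas : Measurable fun t : ℝ => ∫⁻ q in Q, ‖ψ q - ψ (q.1, t)‖ₑ :=
    Measurable.lintegral_prod_right' (f := fun w : ℝ × SpaceTime m => ‖ψ w.2 - ψ (w.2.1, w.1)‖ₑ)
      hcont'.measurable.enorm
  have e1 : ∫⁻ p in Q, ∫⁻ q in Q, ‖ψ q - ψ (q.1, p.2)‖ₑ
      = volume J * ∫⁻ q in Q, ∫⁻ t in I, ‖ψ q - ψ (q.1, t)‖ₑ := by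
    rw [hQ, lintegral_parabolicCube_snd z s (g := fun t => ∫⁻ q in Q, ‖ψ q - ψ (q.1, t)‖ₑ) hmeas]
    congr 1
    exact lintegral_lintegral_swap hcont'.measurable.enorm.aemeasurable
  have hpt : ∀ q ∈ Q, ∀ t ∈ I, ‖ψ q - ψ (q.1, t)‖ₑ ≤ ofReal (2 * s ^ 3 / A) *
      ofReal (|ψ (q.1, q.2) - ψ (q.1, t)| ^ 2 / |q.2 - t| ^ 2) + ofReal (A * s / 2) := by
    intro q hq t ht
    rw [← ofReal_norm, ← ofReal_mul (by positivity),
      ← ofReal_add (by positivity) (by positivity)]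
    apply ofReal_le_ofReal
    rw [Real.norm_eq_abs]
    change |ψ (q.1, q.2) - ψ (q.1, t)| ≤ _
    have a1 := (mem_timeInterval hs).1 hq.2
    have a2 := (mem_timeInterval hs).1 ht
    refine le_weighted_sq hs hA (abs_nonneg _) (abs_nonneg _) ?_ fun h0 => ?_
    · calc |q.2 - t| ≤ |q.2 - z.2| + |z.2 - t| := abs_sub_le _ _ _
        _ ≤ _ := by rw [abs_sub_comm q.2]; linarith
    · rw [sub_eq_zero.1 (abs_eq_zero.1 h0), sub_self, abs_zero]
  have hmt : Measurable fun w : SpaceTime m × ℝ =>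
      ofReal (|ψ (w.1.1, w.1.2) - ψ (w.1.1, w.2)| ^ 2 / |w.1.2 - w.2| ^ 2) := by
    apply ENNReal.measurable_ofReal.comp
    apply Measurable.div
    · exact (by fun_prop : Continuous fun w : SpaceTime m × ℝ =>
        |ψ (w.1.1, w.1.2) - ψ (w.1.1, w.2)| ^ 2).measurable
    · exact (by fun_prop : Continuous fun w : SpaceTime m × ℝ => |w.1.2 - w.2| ^ 2).measurable
  have hT : ∫⁻ q in Q, ∫⁻ t in I,
      ofReal (|ψ (q.1, q.2) - ψ (q.1, t)| ^ 2 / |q.2 - t| ^ 2)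
        ≤ ofReal (A ^ 2) * volume Q := by
    rw [timeDifference, setLAverage_eq] at htime
    exact (ENNReal.div_le_iff (volume_parabolicCube_pos _ hs).ne'
      (volume_parabolicCube_lt_top _ _).ne).1 htime
  have h3 := lintegral_lintegral_le_affine (measurableSet_parabolicCube z s)
    (measurableSet_timeInterval z.2 s) (μ := volume) (ν := volume)
    (F := fun q t => ofReal (|ψ (q.1, q.2) - ψ (q.1, t)| ^ 2 / |q.2 - t| ^ 2))
    (G := fun q t => ‖ψ q - ψ (q.1, t)‖ₑ) hmt hpt
  have h4 : ofReal (2 * s ^ 3 / A) * ofReal (A ^ 2) +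
      ofReal (A * s / 2) * volume I ≤ ofReal (2 * A * s) * volume I := by
    rw [hvI, ← ofReal_mul (by positivity), ← ofReal_mul (by positivity),
      ← ofReal_mul (by positivity), ← ofReal_add (by positivity) (by positivity)]
    apply ofReal_le_ofReal
    have e : 2 * s ^ 3 / A * A ^ 2 = 2 * s ^ 3 * A := by field_simp
    rw [e]
    nlinarith [mul_pos (pow_pos hs 3) hA]
  have h5 := h3.trans (add_le_add_left (mul_le_mul_right hT _) _)
  rw [e1]
  refine (mul_le_mul_right h5 _).trans ?_
  rw [← mul_assoc (ofReal (2 * s ^ 3 / A)), ← add_mul]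
  refine (mul_le_mul_right (mul_le_mul_left h4 _) _).trans (le_of_eq ?_)
  generalize ofReal (2 * A * s) = c
  rw [hQJI]
  ring

/-- Mean difference of a `Lip(1,1/2)` function over a parabolic cube. -/
theorem IsLipHalfOn.lintegral_lintegral_sub_le {ℓ A s : ℝ} {ψ : SpaceTime m → ℝ}
    (h : IsLipHalfOn ℓ ψ univ) (z : SpaceTime m) (hs : 0 < s) (hA : 0 < A)
    (hgrad : ∫⁻ p in 𝒬 z s, ‖∇ₓ ψ p‖ₑ
      ≤ ofReal A * volume (𝒬 z s))
    (htime : timeDifference ψ z s ≤ ofReal (A ^ 2)) :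
    ∫⁻ p in 𝒬 z s, ∫⁻ q in 𝒬 z s, ‖ψ q - ψ p‖ₑ
      ≤ ofReal ((2 ^ m * (2 * m) + 2) * A * s) * volume (𝒬 z s) ^ 2 := by
  have hc := h.continuous
  set Q := 𝒬 z s with hQ
  -- One moves first in space and then in time; the corner point stays in the cube because the cube
  -- is a product.
  calc _ ≤ ∫⁻ p in Q, ∫⁻ q in Q, (‖ψ (q.1, p.2) - ψ p‖ₑ + ‖ψ q - ψ (q.1, p.2)‖ₑ) := by
        gcongr with p q
        calc ‖ψ q - ψ p‖ₑ = ‖(ψ (q.1, p.2) - ψ p) + (ψ q - ψ (q.1, p.2))‖ₑ := by congr 1; ring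
          _ ≤ _ := enorm_add_le _ _
    _ = (∫⁻ p in Q, ∫⁻ q in Q, ‖ψ (q.1, p.2) - ψ p‖ₑ) + ∫⁻ p in Q, ∫⁻ q in Q, ‖ψ q - ψ (q.1, p.2)‖ₑ := by
        have hm1 : Measurable fun w : SpaceTime m × SpaceTime m => ‖ψ (w.2.1, w.1.2) - ψ w.1‖ₑ :=
          (by fun_prop : Continuous fun w : SpaceTime m × SpaceTime m =>
            ψ (w.2.1, w.1.2) - ψ w.1).measurable.enorm
        rw [← lintegral_add_left (Measurable.lintegral_prod_right' hm1)]
        refine lintegral_congr fun p => ?_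
        rw [lintegral_add_left]
        exact hm1.comp (measurable_prodMk_left (x := p))
    _ ≤ _ := add_le_add (h.lintegral_space_sub_le z hs hgrad) (h.lintegral_time_sub_le z hs hA htime)
    _ = _ := by
        rw [← add_mul, ← ofReal_add (by positivity) (by positivity)]
        congr 2; ring

end MeanDifference

/-! ### Affine approximation of `Lip(1,1/2)` functions -/

section Affine

variable {m : ℕ} {ℓ A : ℝ} {Φ : SpaceTime m → ℝ} {S : Set (SpaceTime m)}

/-- Quantitative control of a `Lip(1,1/2)` function on the parabolic cubes inside `S`. -/
structure OscControl (ℓ A : ℝ) (Φ : SpaceTime m → ℝ) (S : Set (SpaceTime m)) : Prop where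
  lip : IsLipHalfOn ℓ Φ univ
  pos : 0 < A
  osc : HasMeanOscLE A (∇ₓ Φ) S
  time : ∀ (z : SpaceTime m) (s : ℝ), 0 < s → 𝒬 z s ⊆ S →
    timeDifference Φ z s ≤ ofReal (A ^ 2)

/-- `Φ` minus a function that is affine in the space variable. -/
def subAffine (Φ : SpaceTime m → ℝ) (a c : 𝕏 m) (p : SpaceTime m) : ℝ :=
  Φ p - inner ℝ a (p.1 - c)

theorem IsLipHalfOn.subAffine (h : IsLipHalfOn ℓ Φ univ) (a c : 𝕏 m) :
    IsLipHalfOn (ℓ + ‖a‖) (subAffine Φ a c) univ := by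
  intro p _ q _
  have h1 := h p trivial q trivial
  have h2 : |(inner ℝ a (p.1 - q.1) : ℝ)| ≤ ‖a‖ * ‖p.1 - q.1‖ := abs_real_inner_le_norm _ _
  have h3 : _root_.subAffine Φ a c p - _root_.subAffine Φ a c q
      = (Φ p - Φ q) - inner ℝ a (p.1 - q.1) := by
    simp only [_root_.subAffine, inner_sub_right]; ring
  rw [h3]
  calc _ ≤ |Φ p - Φ q| + |(inner ℝ a (p.1 - q.1) : ℝ)| := abs_sub _ _
    _ ≤ ℓ * (‖p.1 - q.1‖ + √|p.2 - q.2|) + ‖a‖ * ‖p.1 - q.1‖ := add_le_add h1 h2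
    _ ≤ _ := by nlinarith [mul_nonneg (norm_nonneg a) (Real.sqrt_nonneg |p.2 - q.2|)]

theorem spatialGradient_subAffine (a c : 𝕏 m) {p : SpaceTime m}
    (h : DifferentiableAt ℝ (fun x => Φ (x, p.2)) p.1) :
    ∇ₓ (subAffine Φ a c) p = ∇ₓ Φ p - a := by
  have h1 : HasGradientAt (fun x => Φ (x, p.2)) (∇ₓ Φ p) p.1 := h.hasGradientAt
  have h2 := ((innerSL ℝ a).hasFDerivAt (x := p.1)).sub_const (inner ℝ a c)
  have h3 := h1.hasFDerivAt.sub h2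
  have h4 : (fun x => subAffine Φ a c (x, p.2))
      = (fun x => Φ (x, p.2)) - fun x => (innerSL ℝ a x - inner ℝ a c : ℝ) := by
    ext x
    simp [subAffine, inner_sub_right]
  have h5 : HasGradientAt (fun x => subAffine Φ a c (x, p.2)) (∇ₓ Φ p - a) p.1 := by
    rw [hasGradientAt_iff_hasFDerivAt, h4]
    have h6 : (InnerProductSpace.toDual ℝ 𝕏 m) (∇ₓ Φ p - a)
        = (InnerProductSpace.toDual ℝ 𝕏 m) (∇ₓ Φ p)
          - (innerSL ℝ a : 𝕏 m →L[ℝ] ℝ) := by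
      ext v
      simp
    rw [h6]
    exact h3
  exact h5.gradient

/-- Averages of affine functions over centred cubes. -/
theorem setIntegral_inner_sub_center (p : SpaceTime m) (s : ℝ) (a : 𝕏 m) :
    ∫ q in 𝒬 p s, (inner ℝ a (q.1 - p.1) : ℝ) = 0 := by
  haveI : (volume : Measure (SpaceTime m)).IsAddHaarMeasure :=
    inferInstanceAs ((volume : Measure 𝕏 m).prod
      (volume : Measure ℝ)).IsAddHaarMeasure
  -- The reflection q ↦ 2p - q preserves the cube and changes the sign of the integrand.
  have h1 := integral_sub_left_eq_self (fun q : SpaceTime m =>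
    (𝒬 p s).indicator (fun q => (inner ℝ a (q.1 - p.1) : ℝ)) q) volume (p + p)
  rw [← integral_indicator (measurableSet_parabolicCube _ _)]
  have h2 : ∀ q : SpaceTime m, (𝒬 p s).indicator (fun q => (inner ℝ a (q.1 - p.1) : ℝ))
      (p + p - q) = - (𝒬 p s).indicator (fun q => (inner ℝ a (q.1 - p.1) : ℝ)) q := by
    intro q
    have hmem : p + p - q ∈ 𝒬 p s ↔ q ∈ 𝒬 p s := by
      simp only [mem_parabolicCube]
      refine and_congr (forall_congr' fun i => ?_) ?_
      · rw [show p.1 i - (p + p - q).1 i = -(p.1 i - q.1 i) by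
          simp only [Prod.fst_sub, Prod.fst_add, PiLp.sub_apply, PiLp.add_apply]; ring, abs_neg]
      · rw [show p.2 - (p + p - q).2 = -(p.2 - q.2) by
          simp only [Prod.snd_sub, Prod.snd_add]; ring, abs_neg]
    by_cases hq : q ∈ 𝒬 p s
    · rw [indicator_of_mem hq, indicator_of_mem (hmem.2 hq), ← inner_neg_right]
      congr 1
      simp only [Prod.fst_sub, Prod.fst_add]; abel
    · rw [indicator_of_notMem hq, indicator_of_notMem (fun h => hq (hmem.1 h)), neg_zero]
  simp only [h2, integral_neg] at h1
  linarith

/-- The mean value of `Φ` over a parabolic cube. -/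
abbrev cubeMean (Φ : SpaceTime m → ℝ) (p : SpaceTime m) (s : ℝ) : ℝ := ⨍ q in 𝒬 p s, Φ q

theorem IsLipHalfOn.integrableOn (h : IsLipHalfOn ℓ Φ univ) (p : SpaceTime m) (s : ℝ) :
    IntegrableOn Φ (𝒬 p s) :=
  h.continuous.locallyIntegrable.integrableOn_parabolicCube p s

theorem cubeMean_subAffine (h : IsLipHalfOn ℓ Φ univ) (a c : 𝕏 m)
    (p : SpaceTime m) {s : ℝ} (hs : 0 < s) :
    cubeMean (subAffine Φ a c) p s = cubeMean Φ p s - inner ℝ a (p.1 - c) := by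
  have hpos := measureReal_parabolicCube_pos p hs
  have h0 : IntegrableOn (fun q : SpaceTime m => (inner ℝ a (q.1 - p.1) : ℝ)) (𝒬 p s) :=
    (Continuous.locallyIntegrable (by fun_prop)).integrableOn_parabolicCube p s
  have hfin := (volume_parabolicCube_lt_top p s).ne
  have h1 : ∀ q, subAffine Φ a c q = Φ q - (inner ℝ a (q.1 - p.1) + inner ℝ a (p.1 - c)) := by
    intro q; rw [subAffine, ← inner_add_right]; congr 2; abel
  simp only [cubeMean, setAverage_eq, smul_eq_mul, h1]
  rw [integral_sub (g := fun q : SpaceTime m => inner ℝ a (q.1 - p.1) + inner ℝ a (p.1 - c))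
    (h.integrableOn p s) (h0.add (integrableOn_const hfin)),
    integral_add h0 (integrableOn_const hfin), setIntegral_inner_sub_center, setIntegral_const,
    smul_eq_mul]
  field_simp
  ring

/-- The constant in the parabolic Poincaré inequality. -/
def poincareConst (m : ℕ) : ℝ := 2 ^ m * (2 * m) + 2

theorem poincareConst_pos (m : ℕ) : 0 < poincareConst m := by unfold poincareConst; positivity

/-- A parabolic Poincaré inequality. -/
theorem OscControl.meanOsc_subAffine_le (h : OscControl ℓ A Φ S) {z : SpaceTime m} {s : ℝ} (hs : 0 < s)
    (hS : 𝒬 z s ⊆ S) (c : 𝕏 m) :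
    ⨍ p in 𝒬 z s, ‖subAffine Φ (⨍ q in 𝒬 z s, ∇ₓ Φ q) c p
      - cubeMean (subAffine Φ (⨍ q in 𝒬 z s, ∇ₓ Φ q) c) z s‖
      ≤ poincareConst m * A * s := by
  set a := ⨍ q in 𝒬 z s, ∇ₓ Φ q with ha
  set ψ := subAffine Φ a c with hψ
  set Q := 𝒬 z s
  have hlip : IsLipHalfOn (ℓ + ‖a‖) ψ univ := h.lip.subAffine a c
  have hpos := measureReal_parabolicCube_pos z hs
  have hfin := (volume_parabolicCube_lt_top z s).ne
  have hne := (volume_parabolicCube_pos z hs).ne'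
  have hA := h.pos
  have hgrad : ∫⁻ p in Q, ‖∇ₓ ψ p‖ₑ ≤ ofReal A * volume Q := by
    have h1 := h.osc z s hs hS
    rw [setAverage_eq, smul_eq_mul, inv_mul_le_iff₀ hpos] at h1
    have h2 : ∫⁻ p in Q, ‖∇ₓ ψ p‖ₑ = ∫⁻ p in Q, ‖∇ₓ Φ p - a‖ₑ := by
      refine lintegral_congr_ae (ae_restrict_of_ae ?_)
      filter_upwards [h.lip.ae_differentiableAt] with p hp
      rw [hψ, spatialGradient_subAffine a c hp]
    rw [h2, ← ofReal_integral_norm_eq_lintegral_enorm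
      ((h.lip.isBddMeas.sub_const a).integrableOn hfin)]
    refine (ofReal_le_ofReal h1).trans_eq ?_
    rw [ofReal_mul hpos.le, Measure.real, ofReal_toReal hfin, mul_comm]
  have htime : timeDifference ψ z s ≤ ofReal (A ^ 2) := by
    rw [timeDifference_congr (Ψ := Φ) z s (fun x t τ => by simp [hψ, subAffine])]
    exact h.time z s hs hS
  have hmain := hlip.lintegral_lintegral_sub_le z hs hA hgrad htime
  have hint : IntegrableOn ψ Q := hlip.integrableOn z s
  have h3 : ofReal (∫ p in Q, ‖ψ p - cubeMean ψ z s‖)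
      ≤ ofReal (volume.real Q * (poincareConst m * A * s)) := by
    rw [ofReal_integral_norm_eq_lintegral_enorm (f := fun p => ψ p - cubeMean ψ z s)
      (hint.sub (integrableOn_const hfin))]
    calc _ ≤ ∫⁻ p in Q, (volume Q)⁻¹ * ∫⁻ q in Q, ‖ψ q - ψ p‖ₑ := by
          refine lintegral_mono fun p => ?_
          have h4 := norm_setIntegral_sub_le hint (ψ p) hfin hne
          have h5 : ‖ψ p - cubeMean ψ z s‖ₑ ≤ ofReal (⨍ q in Q, ‖ψ q - ψ p‖) := by
            rw [← ofReal_norm, norm_sub_rev]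
            exact ofReal_le_ofReal h4
          refine h5.trans_eq ?_
          rw [setAverage_eq, smul_eq_mul, ofReal_mul (by positivity),
            ENNReal.ofReal_inv_of_pos hpos, Measure.real, ofReal_toReal hfin,
            ofReal_integral_norm_eq_lintegral_enorm (f := fun q => ψ q - ψ p)
              (hint.sub (integrableOn_const hfin))]
      _ = (volume Q)⁻¹ * ∫⁻ p in Q, ∫⁻ q in Q, ‖ψ q - ψ p‖ₑ :=
          lintegral_const_mul' _ _ (ENNReal.inv_ne_top.2 hne)
      _ ≤ (volume Q)⁻¹ * (ofReal (poincareConst m * A * s) * volume Q ^ 2) := by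
          gcongr
          exact hmain
      _ = ((volume Q)⁻¹ * volume Q) * (volume Q * ofReal (poincareConst m * A * s)) := by ring
      _ = _ := by
          rw [ENNReal.inv_mul_cancel hne hfin, one_mul, ofReal_mul hpos.le, Measure.real,
            ofReal_toReal hfin]
  have hC := poincareConst_pos m
  rw [ofReal_le_ofReal_iff (by positivity)] at h3
  rw [setAverage_eq, smul_eq_mul, inv_mul_le_iff₀ hpos]
  exact h3

/-- Comparison of mean values over nested cubes, after subtraction of an affine function. -/
theorem OscControl.abs_cubeMean_sub_le (h : OscControl ℓ A Φ S) {z w : SpaceTime m} {s t : ℝ}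
    (hs : 0 < s) (ht : 0 < t) (hS : 𝒬 z s ⊆ S) (hw : 𝒬 w t ⊆ 𝒬 z s)
    (c : 𝕏 m) :
    |cubeMean (subAffine Φ (⨍ q in 𝒬 z s, ∇ₓ Φ q) c) w t
      - cubeMean (subAffine Φ (⨍ q in 𝒬 z s, ∇ₓ Φ q) c) z s|
      ≤ (s / t) ^ (m + 2) * (poincareConst m * A * s) := by
  have h1 := h.meanOsc_subAffine_le hs hS c
  refine (norm_cubeAverage_sub_le _ ((h.lip.subAffine _ c).integrableOn z s) hs ht hw).trans ?_
  gcongr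

theorem IsLipHalfOn.abs_cubeMean_sub_le (h : IsLipHalfOn ℓ Φ univ) (p : SpaceTime m) {s : ℝ}
    (hs : 0 < s) : |cubeMean Φ p s - Φ p| ≤ ℓ * ((m + 1) * s) := by
  have hfin := (volume_parabolicCube_lt_top p s).ne
  have hne := (volume_parabolicCube_pos p hs).ne'
  refine (norm_setIntegral_sub_le (h.integrableOn p s) (Φ p) hfin hne).trans ?_
  refine setAverage_le_const (measurableSet_parabolicCube _ _)
    ((h.integrableOn p s).sub (integrableOn_const hfin)).norm hfin hne fun q hq => ?_
  refine (h q trivial p trivial).trans ?_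
  refine mul_le_mul_of_nonneg_left ?_ h.nonneg_of_univ
  have h1 := norm_sub_le_of_mem_spatialCube hs.le hq.1
  have h2 := hq.2
  simp only [timeInterval, Set.mem_ofPred_eq] at h2
  rw [norm_sub_rev, abs_sub_comm]
  linarith

/-- The deviation of `Φ` from its mean value over a centred cube. -/
theorem OscControl.abs_sub_cubeMean_le (h : OscControl ℓ A Φ S) {p : SpaceTime m} {s : ℝ}
    (hs : 0 < s) (hS : 𝒬 p s ⊆ S) :
    |Φ p - cubeMean Φ p s| ≤ 2 * (2 ^ (m + 2) * poincareConst m) * A * s := by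
  set f : ℕ → ℝ := fun k => cubeMean Φ p (s / 2 ^ k) with hf
  have hA := h.pos
  have hstep : ∀ k, dist (f k) (f (k + 1)) ≤ (2 * (2 ^ (m + 2) * poincareConst m) * A * s) / 2 / 2 ^ k := by
    intro k
    have hk : 0 < s / 2 ^ k := by positivity
    have hk1 : 0 < s / 2 ^ (k + 1) := by positivity
    have hle : s / 2 ^ (k + 1) ≤ s / 2 ^ k := by
      rw [pow_succ]; gcongr; nlinarith [pow_pos (two_pos : (0:ℝ) < 2) k]
    have hsub : 𝒬 p (s / 2 ^ k) ⊆ S :=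
      (parabolicCube_mono (div_le_self hs.le (one_le_pow₀ (by norm_num)))).trans hS
    -- Consecutive dyadic cubes are concentric. With base point p.1 both affine corrections vanish,
    -- and the means of Φ itself are compared although the slopes change with the scale; the errors
    -- then sum geometrically.
    have h1 := h.abs_cubeMean_sub_le hk hk1 hsub (parabolicCube_mono hle) p.1
    rw [cubeMean_subAffine h.lip _ _ _ hk, cubeMean_subAffine h.lip _ _ _ hk1] at h1
    simp only [sub_self, inner_zero_right, sub_zero] at h1
    rw [dist_comm, Real.dist_eq]
    refine h1.trans (le_of_eq ?_)
    rw [show s / 2 ^ k / (s / 2 ^ (k + 1)) = 2 by rw [pow_succ]; field_simp]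
    field_simp
  have hlim : Filter.Tendsto f Filter.atTop (nhds (Φ p)) := by
    rw [tendsto_iff_dist_tendsto_zero]
    have h0 : Filter.Tendsto (fun k : ℕ => ℓ * ((m + 1) * (s / 2 ^ k))) Filter.atTop (nhds 0) := by
      have := ((tendsto_pow_atTop_nhds_zero_of_lt_one (r := (1/2 : ℝ)) (by norm_num)
        (by norm_num)).const_mul (ℓ * ((m + 1) * s)))
      rw [mul_zero] at this
      refine this.congr fun k => ?_
      rw [one_div, inv_pow]; field_simp
    refine squeeze_zero (fun _ => dist_nonneg) (fun k => ?_) h0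
    rw [Real.dist_eq]
    exact h.lip.abs_cubeMean_sub_le p (by positivity)
  have := dist_le_of_le_geometric_two_of_tendsto₀ hstep hlim
  simp only [hf, pow_zero, div_one] at this
  rwa [dist_comm, Real.dist_eq] at this

/-- The constant in the pointwise estimates. -/
def zygmundConst (m : ℕ) : ℝ := 8 * 2 ^ (m + 2) * poincareConst m

theorem zygmundConst_pos (m : ℕ) : 0 < zygmundConst m :=
  mul_pos (by positivity) (poincareConst_pos m)

/-- The value at p is compared with the mean over the cube of radius s about p, and that mean with
the mean over the large cube. In the first comparison the affine term is invisible, being equal to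
its own mean over a centred cube. -/
theorem OscControl.abs_subAffine_sub_cubeMean_le (h : OscControl ℓ A Φ S) {z p : SpaceTime m} {s : ℝ}
    (hs : 0 < s) (hS : 𝒬 z (2 * s) ⊆ S)
    (hp : 𝒬 p s ⊆ 𝒬 z (2 * s)) (c : 𝕏 m) :
    |subAffine Φ (⨍ q in 𝒬 z (2 * s), ∇ₓ Φ q) c p -
      cubeMean (subAffine Φ (⨍ q in 𝒬 z (2 * s), ∇ₓ Φ q) c) z (2 * s)|
      ≤ zygmundConst m * A * s / 2 := by
  have hA := h.pos
  have h1 := h.abs_sub_cubeMean_le hs (hp.trans hS)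
  have h2 := h.abs_cubeMean_sub_le (by positivity : 0 < 2 * s) hs hS hp c
  rw [mul_div_assoc, div_self hs.ne', mul_one] at h2
  set a := ⨍ q in 𝒬 z (2 * s), ∇ₓ Φ q
  have h3 := cubeMean_subAffine h.lip a c p hs
  have h4 : subAffine Φ a c p - cubeMean (subAffine Φ a c) p s = Φ p - cubeMean Φ p s := by
    rw [h3, subAffine]; ring
  rw [← h4] at h1
  calc _ ≤ _ := abs_sub_le _ (cubeMean (subAffine Φ a c) p s) _
    _ ≤ _ := add_le_add h1 h2
    _ = _ := by rw [zygmundConst]; ring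

/-- Affine approximation in space and near constancy in time. -/
theorem OscControl.abs_subAffine_sub_le (h : OscControl ℓ A Φ S) {z p q : SpaceTime m} {s : ℝ}
    (hs : 0 < s) (hS : 𝒬 z (2 * s) ⊆ S) (hp : p ∈ 𝒬 z s)
    (hq : q ∈ 𝒬 z s) (c : 𝕏 m) :
    |subAffine Φ (⨍ q in 𝒬 z (2 * s), ∇ₓ Φ q) c p -
      subAffine Φ (⨍ q in 𝒬 z (2 * s), ∇ₓ Φ q) c q|
      ≤ zygmundConst m * A * s := by
  have h1 := h.abs_subAffine_sub_cubeMean_le hs hS (parabolicCube_subset_of_mem hp (by linarith)) c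
  have h2 := h.abs_subAffine_sub_cubeMean_le hs hS (parabolicCube_subset_of_mem hq (by linarith)) c
  rw [abs_sub_comm] at h2
  calc _ ≤ _ := abs_sub_le _ (cubeMean (subAffine Φ (⨍ q in 𝒬 z (2 * s),
          ∇ₓ Φ q) c) z (2 * s)) _
    _ ≤ _ := add_le_add h1 h2
    _ = _ := by ring

/-- The Hölder constant in time is controlled by the mean oscillations. -/
theorem OscControl.abs_time_sub_le (h : OscControl ℓ A Φ S) {x : 𝕏 m} {t τ s : ℝ}
    (hs : 0 < s) (hS : 𝒬 (x, t) (2 * s) ⊆ S) (hτ : √|t - τ| ≤ s) :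
    |Φ (x, t) - Φ (x, τ)| ≤ zygmundConst m * A * s := by
  have hsub : 𝒬 ((x, τ) : SpaceTime m) s ⊆ 𝒬 (x, t) (2 * s) := by
    intro q hq
    refine ⟨fun i => (hq.1 i).trans (by linarith), ?_⟩
    have h1 := sqrt_abs_sub_le t τ q.2
    have h2 : √|τ - q.2| < s := hq.2
    change √|t - q.2| < 2 * s
    linarith
  have h1 := h.abs_subAffine_sub_cubeMean_le hs hS (parabolicCube_mono (by linarith)) x
  have h2 := h.abs_subAffine_sub_cubeMean_le hs hS hsub x
  set a := ⨍ q in 𝒬 ((x, t) : SpaceTime m) (2 * s), ∇ₓ Φ q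
  rw [abs_sub_comm] at h2
  have h3 : Φ (x, t) - Φ (x, τ) = subAffine Φ a x (x, t) - subAffine Φ a x (x, τ) := by
    simp [subAffine]
  rw [h3]
  calc _ ≤ _ := abs_sub_le _ (cubeMean (subAffine Φ a x) (x, t) (2 * s)) _
    _ ≤ _ := add_le_add h1 h2
    _ = _ := by ring

theorem OscControl.abs_time_sub_le_sqrt (h : OscControl ℓ A Φ S) {x : 𝕏 m} {t τ : ℝ}
    (hS : 𝒬 (x, t) (2 * √|t - τ|) ⊆ S) :
    |Φ (x, t) - Φ (x, τ)| ≤ zygmundConst m * A * √|t - τ| := by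
  rcases eq_or_ne t τ with rfl | hne
  · simp
  · exact h.abs_time_sub_le (Real.sqrt_pos.2 (abs_pos.2 (sub_ne_zero.2 hne))) hS le_rfl

theorem IsLipHalfOn.norm_cubeAverage_spatialGradient_le (h : IsLipHalfOn ℓ Φ univ) (z : SpaceTime m)
    {s : ℝ} (hs : 0 < s) : ‖⨍ q in 𝒬 z s, ∇ₓ Φ q‖ ≤ ℓ := by
  have hfin := (volume_parabolicCube_lt_top z s).ne
  have hne := (volume_parabolicCube_pos z hs).ne'
  have h1 := norm_setIntegral_sub_le (h.isBddMeas.integrableOn hfin) 0 hfin hne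
  simp only [sub_zero] at h1
  exact h1.trans (setAverage_le_const (measurableSet_parabolicCube _ _)
    (h.isBddMeas.norm.integrableOn hfin) hfin hne fun p _ => h.norm_spatialGradient_le p)

end Affine

/-! ### Time differences over large and small cubes -/

section TimeDifference

variable {m : ℕ} {Ψ φ : SpaceTime m → ℝ}

/-- The integrand of `timeDifference`. -/
def timeQuotient (Ψ : SpaceTime m → ℝ) (p : SpaceTime m) (τ : ℝ) : ℝ≥0∞ :=
  ofReal (|Ψ (p.1, p.2) - Ψ (p.1, τ)| ^ 2 / |p.2 - τ| ^ 2)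

theorem timeDifference_eq (Ψ : SpaceTime m → ℝ) (z : SpaceTime m) (s : ℝ) :
    timeDifference Ψ z s = (volume (𝒬 z s))⁻¹ *
      ∫⁻ p in 𝒬 z s, ∫⁻ τ in timeInterval z.2 s, timeQuotient Ψ p τ := by
  rw [timeDifference, setLAverage_eq, ENNReal.div_eq_inv_mul]
  rfl

theorem measurable_timeQuotient (h : Continuous Ψ) :
    Measurable (Function.uncurry (timeQuotient Ψ)) := by
  have h1 : Continuous fun q : SpaceTime m × ℝ => |Ψ (q.1.1, q.1.2) - Ψ (q.1.1, q.2)| ^ 2 := by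
    fun_prop
  have h2 : Continuous fun q : SpaceTime m × ℝ => |q.1.2 - q.2| ^ 2 := by fun_prop
  exact (h1.measurable.div h2.measurable).ennreal_ofReal

theorem timeDifference_le_iff (Ψ : SpaceTime m → ℝ) (z : SpaceTime m) {s : ℝ} (hs : 0 < s) (B : ℝ≥0∞) :
    timeDifference Ψ z s ≤ B ↔
      ∫⁻ p in 𝒬 z s, ∫⁻ τ in timeInterval z.2 s, timeQuotient Ψ p τ
        ≤ B * volume (𝒬 z s) := by
  rw [timeDifference_eq, ← ENNReal.div_eq_inv_mul,
    ENNReal.div_le_iff_le_mul (Or.inl (volume_parabolicCube_pos z hs).ne')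
      (Or.inl (volume_parabolicCube_lt_top z s).ne)]

theorem lintegral_Ioi_inv_sq {ρ D : ℝ} (hρ : 0 < ρ) :
    ∫⁻ τ in Set.Ioi ρ, ofReal (D ^ 2 / |τ| ^ 2) = ofReal (D ^ 2 / ρ) := by
  have h1 : ∀ τ ∈ Set.Ioi ρ, D ^ 2 / |τ| ^ 2 = D ^ 2 * τ ^ (-2 : ℝ) := by
    intro τ hτ
    have hτ0 : 0 < τ := hρ.trans hτ
    rw [sq_abs, Real.rpow_neg hτ0.le, div_eq_mul_inv]
    norm_num
  have hint := (integrableOn_Ioi_rpow_of_lt (a := -2) (by norm_num) hρ).const_mul (D ^ 2)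
  rw [setLIntegral_congr_fun measurableSet_Ioi (fun τ hτ => congrArg ofReal (h1 τ hτ)),
    ← ofReal_integral_eq_lintegral_ofReal hint, integral_const_mul,
    integral_Ioi_rpow_of_lt (by norm_num) hρ]
  · congr 1
    norm_num
    rw [Real.rpow_neg_one, div_eq_mul_inv]
  · refine (ae_restrict_iff' measurableSet_Ioi).2 (ae_of_all _ fun τ hτ => ?_)
    have hτ0 : 0 < τ := hρ.trans hτ
    change 0 ≤ D ^ 2 * τ ^ (-2 : ℝ)
    positivity

/-- Tail integral of `D² / |t - τ|²`. -/
theorem lintegral_tail_inv_sq (t : ℝ) {ρ D : ℝ} (hρ : 0 < ρ) :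
    ∫⁻ τ in {τ : ℝ | ρ ≤ |t - τ|}, ofReal (D ^ 2 / |t - τ| ^ 2)
      ≤ ofReal (2 * D ^ 2 / ρ) := by
  have hset : MeasurableSet {u : ℝ | ρ ≤ |u|} := (isClosed_le continuous_const continuous_abs).measurableSet
  have hset' : MeasurableSet {τ : ℝ | ρ ≤ |t - τ|} :=
    (isClosed_le continuous_const (by fun_prop)).measurableSet
  have h1 : ∫⁻ τ in {τ : ℝ | ρ ≤ |t - τ|}, ofReal (D ^ 2 / |t - τ| ^ 2)
      = ∫⁻ u in {u : ℝ | ρ ≤ |u|}, ofReal (D ^ 2 / |u| ^ 2) := by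
    rw [← lintegral_indicator hset, ← lintegral_indicator hset',
      ← lintegral_sub_left_eq_self _ t]
    simp [Set.indicator]
  have hsub : {u : ℝ | ρ ≤ |u|} =ᵐ[volume] (Set.Iio (-ρ) ∪ Set.Ioi ρ : Set ℝ) := by
    have h2 : {u : ℝ | ρ ≤ |u|} = Set.Iic (-ρ) ∪ Set.Ici ρ := by
      ext u
      simp only [Set.mem_ofPred_eq, Set.mem_union, Set.mem_Iic, Set.mem_Ici, le_abs]
      constructor
      · rintro (h | h)
        · exact Or.inr h
        · exact Or.inl (by linarith)
      · rintro (h | h)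
        · exact Or.inr (by linarith)
        · exact Or.inl h
    rw [h2]
    exact Iio_ae_eq_Iic.symm.union Ioi_ae_eq_Ici.symm
  have hneg : ∫⁻ τ in Set.Iio (-ρ), ofReal (D ^ 2 / |τ| ^ 2) = ofReal (D ^ 2 / ρ) := by
    rw [← lintegral_Ioi_inv_sq hρ, ← lintegral_indicator measurableSet_Ioi,
      ← lintegral_indicator measurableSet_Iio, ← lintegral_neg_eq_self]
    refine lintegral_congr fun u => ?_
    simp only [Set.indicator, Set.mem_Iio, Set.mem_Ioi, neg_lt_neg_iff, abs_neg]
  rw [h1, setLIntegral_congr hsub]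
  refine (lintegral_union_le _ _ _).trans ?_
  rw [hneg, lintegral_Ioi_inv_sq hρ, ← ofReal_add (by positivity) (by positivity)]
  exact ofReal_le_ofReal (by rw [← add_div]; gcongr; linarith)

/-- Passage from small to large cubes. -/
theorem timeDifference_le_of_small (hΨ : Continuous Ψ) {s₁ D : ℝ} (hs₁ : 0 < s₁) {B : ℝ≥0∞}
    (hsmall : ∀ w s, 0 < s → s ≤ s₁ → timeDifference Ψ w s ≤ B)
    (hD : ∀ x t τ, |Ψ (x, t) - Ψ (x, τ)| ≤ D) (w : SpaceTime m) {s : ℝ} (hs : 0 < s) :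
    timeDifference Ψ w s ≤ 4 ^ (m + 2) * B + ofReal (8 * D ^ 2 / s₁ ^ 2) := by
  rcases le_or_gt s s₁ with hle | hlt
  · refine (hsmall w s hs hle).trans (le_add_right ?_)
    exact le_mul_of_one_le_left' (one_le_pow₀ (by norm_num))
  have hρ : 0 < (s₁ / 2) ^ 2 := by positivity
  set ρ := (s₁ / 2) ^ 2 with hρd
  have hF := measurable_timeQuotient hΨ
  have hS : MeasurableSet {q : SpaceTime m × ℝ | |q.1.2 - q.2| < ρ} :=
    (isOpen_lt (by fun_prop) continuous_const).measurableSet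
  -- N is the part near the diagonal, |t - τ| < (s₁/2)²; the rest is a convergent tail controlled by
  -- the global bound D.
  set N : SpaceTime m → ℝ≥0∞ := fun p => ∫⁻ τ in {τ : ℝ | |p.2 - τ| < ρ}, timeQuotient Ψ p τ with hN
  have hNm : Measurable N := by
    have : N = fun p => ∫⁻ τ, {q : SpaceTime m × ℝ | |q.1.2 - q.2| < ρ}.indicator
        (Function.uncurry (timeQuotient Ψ)) (p, τ) := by
      funext p
      rw [hN]
      simp only
      rw [← lintegral_indicator (measurableSet_lt (by fun_prop) measurable_const)]
      rfl
    rw [this]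
    exact (hF.indicator hS).lintegral_prod_right'
  have hsplit : ∀ p : SpaceTime m, ∫⁻ τ in timeInterval w.2 s, timeQuotient Ψ p τ
      ≤ N p + ofReal (8 * D ^ 2 / s₁ ^ 2) := by
    intro p
    calc _ ≤ ∫⁻ τ, timeQuotient Ψ p τ := setLIntegral_le_lintegral _ _
      _ ≤ N p + ∫⁻ τ in {τ : ℝ | |p.2 - τ| < ρ}ᶜ, timeQuotient Ψ p τ := by
          rw [lintegral_add_compl _ (measurableSet_lt (by fun_prop) measurable_const)]
      _ ≤ N p + ofReal (2 * D ^ 2 / ρ) := by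
          gcongr
          refine le_trans ?_ (lintegral_tail_inv_sq p.2 hρ)
          have hset : {τ : ℝ | |p.2 - τ| < ρ}ᶜ = {τ : ℝ | ρ ≤ |p.2 - τ|} := by
            ext τ; simp
          rw [hset]
          refine lintegral_mono fun τ => ofReal_le_ofReal ?_
          gcongr
          exact hD _ _ _
      _ = _ := by rw [hρd]; congr 2; field_simp; ring
  -- A continuous covering argument: each p is averaged over the centres u with p in the cube of
  -- radius s₁/2 about u. The times relevant to N p all lie in the interval of radius s₁ about u, so
  -- for each u the small-scale hypothesis applies.
  have hnear : (∫⁻ p in 𝒬 w s, N p) * volume (𝒬 w (s₁ / 2))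
      ≤ volume (𝒬 w (2 * s)) * (B * volume (𝒬 w s₁)) := by
    have hv : ∀ (p : SpaceTime m) (t : ℝ), 0 < t → volume (𝒬 p t) = volume (𝒬 w t) :=
      fun p t ht => by rw [volume_parabolicCube p ht, volume_parabolicCube w ht]
    have hm2 : MeasurableSet {q : SpaceTime m × SpaceTime m | q.2 ∈ 𝒬 q.1 (s₁ / 2)} := by
      have : {q : SpaceTime m × SpaceTime m | q.2 ∈ 𝒬 q.1 (s₁ / 2)}
          = (⋂ i : Fin m, {q | |q.1.1 i - q.2.1 i| < s₁ / 2}) ∩ {q | √|q.1.2 - q.2.2| < s₁ / 2} := by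
        ext q
        simp only [mem_parabolicCube, Set.mem_ofPred_eq, Set.mem_inter_iff, Set.mem_iInter]
      rw [this]
      refine (MeasurableSet.iInter fun i => ?_).inter ?_
      · exact (isOpen_lt (by fun_prop) continuous_const).measurableSet
      · exact (isOpen_lt (by fun_prop) continuous_const).measurableSet
    set G : SpaceTime m × SpaceTime m → ℝ≥0∞ :=
      {q : SpaceTime m × SpaceTime m | q.2 ∈ 𝒬 q.1 (s₁ / 2)}.indicator fun q => N q.1 with hG
    have hGm : Measurable G := (hNm.comp measurable_fst).indicator hm2
    calc _ = ∫⁻ p in 𝒬 w s, ∫⁻ u in 𝒬 w (2 * s), G (p, u) := by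
          rw [← lintegral_mul_const _ hNm]
          refine setLIntegral_congr_fun (measurableSet_parabolicCube _ _) fun p hp => ?_
          have h1 : ∀ u, G (p, u) = (𝒬 p (s₁ / 2)).indicator (fun _ => N p) u := by
            intro u
            by_cases hu : u ∈ 𝒬 p (s₁ / 2)
            · rw [indicator_of_mem hu, hG, indicator_of_mem (by exact hu)]
            · rw [indicator_of_notMem hu, hG, indicator_of_notMem (by exact hu)]
          simp only [h1]
          rw [lintegral_indicator (measurableSet_parabolicCube _ _), Measure.restrict_restrict
            (measurableSet_parabolicCube _ _), Set.inter_eq_left.2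
            (parabolicCube_subset_of_mem hp (by linarith)), setLIntegral_const,
            hv p _ (by positivity)]
      _ = ∫⁻ u in 𝒬 w (2 * s), ∫⁻ p in 𝒬 w s, G (p, u) :=
          lintegral_lintegral_swap hGm.aemeasurable
      _ ≤ ∫⁻ u in 𝒬 w (2 * s), B * volume (𝒬 w s₁) := by
          refine lintegral_mono fun u => ?_
          have h2 := (timeDifference_le_iff Ψ u hs₁ B).1 (hsmall u s₁ hs₁ le_rfl)
          rw [hv u _ hs₁] at h2
          refine le_trans ?_ h2
          calc _ ≤ ∫⁻ p, G (p, u) := setLIntegral_le_lintegral _ _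
            _ ≤ ∫⁻ p, (𝒬 u s₁).indicator
                (fun p => ∫⁻ τ in timeInterval u.2 s₁, timeQuotient Ψ p τ) p := by
                refine lintegral_mono fun p => ?_
                by_cases hu : u ∈ 𝒬 p (s₁ / 2)
                · have hpu := mem_parabolicCube_comm.1 hu
                  rw [hG]
                  simp only
                  rw [indicator_of_mem (by exact hu), indicator_of_mem
                    (parabolicCube_mono (by linarith) hpu)]
                  refine lintegral_mono_set fun τ hτ => ?_
                  have h3 : √|p.2 - τ| < s₁ / 2 := by
                    rw [Real.sqrt_lt' (by positivity)]; exact hτ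
                  have h4 : √|u.2 - p.2| < s₁ / 2 := hpu.2
                  have h5 := sqrt_abs_sub_le u.2 p.2 τ
                  change √|u.2 - τ| < s₁
                  linarith
                · rw [hG]
                  simp only
                  rw [indicator_of_notMem (by exact hu)]
                  exact bot_le
            _ = _ := lintegral_indicator (measurableSet_parabolicCube _ _) _
      _ = _ := by rw [setLIntegral_const, mul_comm]
  rw [timeDifference_le_iff Ψ w hs]
  have hne : volume (𝒬 w (s₁ / 2)) ≠ 0 := (volume_parabolicCube_pos w (by positivity)).ne'
  have hnt : volume (𝒬 w (s₁ / 2)) ≠ ⊤ := (volume_parabolicCube_lt_top w _).ne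
  have hdil : ∀ t : ℝ, 0 < t → volume (𝒬 w (2 * t)) = 2 ^ (m + 2) * volume (𝒬 w t) := by
    intro t ht
    rw [volume_parabolicCube w ht, volume_parabolicCube w (by positivity : 0 < 2 * t),
      show ((2 : ℝ≥0∞) ^ (m + 2)) = ofReal (2 ^ (m + 2)) by
        rw [ofReal_pow (by norm_num)]; norm_num, ← ofReal_mul (by positivity)]
    congr 1; ring
  -- One factor 2^{m+2} comes from letting the centres range over the cube of radius 2s, the other
  -- from comparing radii s₁ and s₁/2.
  have hnear' : ∫⁻ p in 𝒬 w s, N p ≤ 4 ^ (m + 2) * B * volume (𝒬 w s) := by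
    rw [← ENNReal.mul_le_mul_iff_left hne hnt]
    refine hnear.trans_eq ?_
    have := hdil (s₁ / 2) (by positivity)
    rw [mul_div_cancel₀ _ two_ne_zero] at this
    rw [hdil s hs, this, show (4 : ℝ≥0∞) = 2 * 2 by norm_num, mul_pow]
    ring
  calc _ ≤ ∫⁻ p in 𝒬 w s, (N p + ofReal (8 * D ^ 2 / s₁ ^ 2)) :=
        lintegral_mono hsplit
    _ = (∫⁻ p in 𝒬 w s, N p)
        + ofReal (8 * D ^ 2 / s₁ ^ 2) * volume (𝒬 w s) := by
        rw [lintegral_add_left hNm, setLIntegral_const]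
    _ ≤ _ := by rw [add_mul]; gcongr

/-- Local comparison of time differences. -/
theorem timeDifference_le_of_abs_sub_le (hφ : Continuous φ) {b s : ℝ} (hb : 0 ≤ b) (hs : 0 < s)
    (w : SpaceTime m)
    (h : ∀ x ∈ spatialCube w.1 s, ∀ t ∈ timeInterval w.2 s, ∀ τ ∈ timeInterval w.2 s,
      |Ψ (x, t) - Ψ (x, τ)| ≤ |φ (x, t) - φ (x, τ)| + b * |t - τ|) :
    timeDifference Ψ w s ≤ 2 * timeDifference φ w s + ofReal (4 * b ^ 2 * s ^ 2) := by
  have h1 : ∀ p ∈ 𝒬 w s, ∀ τ ∈ timeInterval w.2 s,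
      timeQuotient Ψ p τ ≤ 2 * timeQuotient φ p τ + ofReal (2 * b ^ 2) := by
    intro p hp τ hτ
    have h2 := h p.1 hp.1 p.2 hp.2 τ hτ
    rw [timeQuotient, timeQuotient, show (2 : ℝ≥0∞) = ofReal 2 by simp,
      ← ofReal_mul (by norm_num), ← ofReal_add (by positivity) (by positivity)]
    refine ofReal_le_ofReal ?_
    rcases eq_or_ne (|p.2 - τ|) 0 with h0 | h0
    · rw [h0]; simp; positivity
    · have hpos : 0 < |p.2 - τ| := lt_of_le_of_ne (abs_nonneg _) h0.symm
      rw [div_le_iff₀ (by positivity), add_mul, mul_assoc, div_mul_cancel₀ _ (by positivity)]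
      have h3 : |Ψ (p.1, p.2) - Ψ (p.1, τ)| ^ 2
          ≤ (|φ (p.1, p.2) - φ (p.1, τ)| + b * |p.2 - τ|) ^ 2 := by gcongr
      nlinarith [sq_nonneg (|φ (p.1, p.2) - φ (p.1, τ)| - b * |p.2 - τ|)]
  have h2 := lintegral_lintegral_le_affine (μ := volume) (ν := volume)
    (measurableSet_parabolicCube w s) (measurableSet_timeInterval w.2 s)
    (measurable_timeQuotient hφ) h1
  have hne := (volume_parabolicCube_pos w hs).ne'
  have hnt := (volume_parabolicCube_lt_top w s).ne
  rw [timeDifference_le_iff Ψ w hs]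
  refine h2.trans_eq ?_
  rw [timeDifference_eq, volume_timeInterval _ hs, add_mul, ← ofReal_mul (by positivity)]
  congr 1
  · rw [mul_assoc, mul_comm _ (volume _), ← mul_assoc (volume _), ENNReal.mul_inv_cancel hne hnt,
      one_mul]
  · congr 2; ring

theorem timeDifference_eq_zero (w : SpaceTime m) (s : ℝ)
    (h : ∀ x ∈ spatialCube w.1 s, ∀ t ∈ timeInterval w.2 s, ∀ τ ∈ timeInterval w.2 s,
      Ψ (x, t) = Ψ (x, τ)) : timeDifference Ψ w s = 0 := by
  rw [timeDifference_eq, setLIntegral_congr_fun (g := fun _ => 0) (measurableSet_parabolicCube w s),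
    lintegral_zero, mul_zero]
  intro p hp
  simp only
  rw [setLIntegral_congr_fun (g := fun _ => 0) (measurableSet_timeInterval w.2 s), lintegral_zero]
  intro τ hτ
  simp [timeQuotient, h p.1 hp.1 p.2 hp.2 τ hτ]

/-- Time differences of a function which is localised near a cube. -/
theorem timeDifference_le_of_localized (hΨ : Continuous Ψ) (hφ : Continuous φ) {z : SpaceTime m}
    {σ b D : ℝ} {B : ℝ≥0∞} (hσ : 0 < σ) (hb : 0 ≤ b)
    (hφB : ∀ w s, 0 < s → 𝒬 w s ⊆ 𝒬 z (2 * σ) → timeDifference φ w s ≤ B)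
    (hloc : ∀ x t τ, (x, t) ∈ 𝒬 z (2 * σ) → (x, τ) ∈ 𝒬 z (2 * σ) →
      |Ψ (x, t) - Ψ (x, τ)| ≤ |φ (x, t) - φ (x, τ)| + b * |t - τ|)
    (hout : ∀ x t τ, (x, t) ∉ 𝒬 z σ → (x, τ) ∉ 𝒬 z σ → Ψ (x, t) = Ψ (x, τ))
    (hD : ∀ x t τ, |Ψ (x, t) - Ψ (x, τ)| ≤ D) (w : SpaceTime m) {s : ℝ} (hs : 0 < s) :
    timeDifference Ψ w s ≤ 4 ^ (m + 2) * (2 * B + ofReal (b ^ 2 * σ ^ 2)) +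
      ofReal (32 * D ^ 2 / σ ^ 2) := by
  -- A cube of radius at most σ/2 that meets the cube of radius σ lies in the cube of radius 2σ,
  -- where the comparison with φ is available; on any other such cube Ψ is constant in time.
  have h1 := timeDifference_le_of_small hΨ (s₁ := σ / 2) (D := D) (by positivity)
    (B := 2 * B + ofReal (b ^ 2 * σ ^ 2)) (fun w s hs hle => ?_) hD w hs
  · refine h1.trans_eq ?_
    congr 2
    field_simp
    ring
  by_cases hne : (𝒬 w s ∩ 𝒬 z σ).Nonempty
  · obtain ⟨p, hp1, hp2⟩ := hne
    have hw : w ∈ 𝒬 z (σ + s) := parabolicCube_mem_trans hp2 (mem_parabolicCube_comm.1 hp1)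
    have hsub : 𝒬 w s ⊆ 𝒬 z (2 * σ) :=
      parabolicCube_subset_of_mem hw (by linarith)
    refine (timeDifference_le_of_abs_sub_le hφ hb hs w fun x hx t ht τ hτ =>
      hloc x t τ (hsub ⟨hx, ht⟩) (hsub ⟨hx, hτ⟩)).trans ?_
    refine add_le_add (by gcongr; exact hφB w s hs hsub) (ofReal_le_ofReal ?_)
    · have : s ^ 2 ≤ (σ / 2) ^ 2 := by gcongr
      nlinarith [mul_le_mul_of_nonneg_left this (sq_nonneg b)]
  · rw [timeDifference_eq_zero]
    · exact bot_le
    · intro x hx t ht τ hτ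
      exact hout x t τ (fun h => hne ⟨_, ⟨hx, ht⟩, h⟩) (fun h => hne ⟨_, ⟨hx, hτ⟩, h⟩)

end TimeDifference

/-! ### A contraction which is the identity near the origin -/

section Contraction

variable {E : Type*} [NormedAddCommGroup E] [InnerProductSpace ℝ E]

/-- The nearest point retraction onto the closed ball of radius `R`. -/
def ballRetract (R : ℝ) (x : E) : E := min 1 (R / ‖x‖) • x

theorem ballRetract_of_norm_le {R : ℝ} {x : E} (h : ‖x‖ ≤ R) : ballRetract R x = x := by
  rcases eq_or_ne x 0 with rfl | hx
  · simp [ballRetract]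
  · have : 1 ≤ R / ‖x‖ := (one_le_div (norm_pos_iff.2 hx)).2 h
    rw [ballRetract, min_eq_left this, one_smul]

theorem ballRetract_of_le_norm {R : ℝ} (hR : 0 < R) {x : E} (h : R ≤ ‖x‖) :
    ballRetract R x = (R / ‖x‖) • x := by
  have : R / ‖x‖ ≤ 1 := (div_le_one (hR.trans_le h)).2 h
  rw [ballRetract, min_eq_right this]

/-- Expanding both squares, the right side minus the left is exactly R²(‖x‖ - ‖y‖)²/(‖x‖‖y‖), which
is nonnegative. -/
theorem norm_ballRetract_sub_sq_le {R : ℝ} (hR : 0 < R) {x y : E} (hx : R ≤ ‖x‖) (hy : R ≤ ‖y‖) :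
    ‖ballRetract R x - ballRetract R y‖ ^ 2 ≤ R ^ 2 / (‖x‖ * ‖y‖) * ‖x - y‖ ^ 2 := by
  have ha : 0 < ‖x‖ := hR.trans_le hx
  have hb : 0 < ‖y‖ := hR.trans_le hy
  rw [ballRetract_of_le_norm hR hx, ballRetract_of_le_norm hR hy, norm_sub_sq_real, norm_sub_sq_real,
    norm_smul, norm_smul, inner_smul_left, inner_smul_right, Real.norm_of_nonneg (by positivity),
    Real.norm_of_nonneg (by positivity), div_mul_cancel₀ _ ha.ne', div_mul_cancel₀ _ hb.ne']
  simp only [conj_trivial]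
  have h1 : R ^ 2 / (‖x‖ * ‖y‖) * (‖x‖ ^ 2 - 2 * inner ℝ x y + ‖y‖ ^ 2)
      - (R ^ 2 - 2 * (R / ‖x‖ * (R / ‖y‖ * inner ℝ x y)) + R ^ 2)
      = R ^ 2 / (‖x‖ * ‖y‖) * (‖x‖ - ‖y‖) ^ 2 := by
    field_simp
    ring
  have h2 : 0 ≤ R ^ 2 / (‖x‖ * ‖y‖) * (‖x‖ - ‖y‖) ^ 2 := by positivity
  linarith

theorem norm_ballRetract_sub_le {R : ℝ} (hR : 0 < R) (x y : E) :
    ‖ballRetract R x - ballRetract R y‖ ≤ ‖x - y‖ := by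
  have key : ∀ x y : E, ‖x‖ ≤ R → R ≤ ‖y‖ → ‖ballRetract R x - ballRetract R y‖ ≤ ‖x - y‖ := by
    intro x y hx hy
    have hb : 0 < ‖y‖ := hR.trans_le hy
    refine (sq_le_sq₀ (norm_nonneg _) (norm_nonneg _)).1 ?_
    rw [ballRetract_of_norm_le hx, ballRetract_of_le_norm hR hy, norm_sub_sq_real, norm_sub_sq_real,
      norm_smul, inner_smul_right, Real.norm_of_nonneg (by positivity), div_mul_cancel₀ _ hb.ne']
    have h1 : (inner ℝ x y : ℝ) ≤ R * ‖y‖ :=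
      (real_inner_le_norm x y).trans (by gcongr)
    have h2 : R / ‖y‖ ≤ 1 := (div_le_one hb).2 hy
    have h3 : (1 - R / ‖y‖) * inner ℝ x y ≤ (1 - R / ‖y‖) * (R * ‖y‖) :=
      mul_le_mul_of_nonneg_left h1 (by linarith)
    have h4 : (1 - R / ‖y‖) * (R * ‖y‖) = R * ‖y‖ - R ^ 2 := by field_simp
    nlinarith [sq_nonneg (‖y‖ - R)]
  rcases le_total ‖x‖ R with hx | hx <;> rcases le_total ‖y‖ R with hy | hy
  · rw [ballRetract_of_norm_le hx, ballRetract_of_norm_le hy]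
  · exact key x y hx hy
  · rw [norm_sub_rev, norm_sub_rev x]; exact key y x hy hx
  · refine (sq_le_sq₀ (norm_nonneg _) (norm_nonneg _)).1 ?_
    refine (norm_ballRetract_sub_sq_le hR hx hy).trans ?_
    refine mul_le_of_le_one_left (by positivity) ?_
    rw [div_le_one (mul_pos (hR.trans_le hx) (hR.trans_le hy)), sq]
    gcongr

theorem norm_ballRetract_sub_le_half {R : ℝ} (hR : 0 < R) {x y : E} (hx : 2 * R ≤ ‖x‖)
    (hy : 2 * R ≤ ‖y‖) : ‖ballRetract R x - ballRetract R y‖ ≤ ‖x - y‖ / 2 := by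
  refine (sq_le_sq₀ (norm_nonneg _) (by positivity)).1 ?_
  refine (norm_ballRetract_sub_sq_le hR (by linarith) (by linarith)).trans ?_
  have : R ^ 2 / (‖x‖ * ‖y‖) ≤ 1 / 4 := by
    rw [div_le_iff₀ (mul_pos (by linarith) (by linarith))]
    nlinarith [mul_le_mul hx hy (by positivity) (norm_nonneg x)]
  rw [div_pow]
  nlinarith [sq_nonneg ‖x - y‖]

/-- The contraction with centre `c`. -/
def contraction (θ R : ℝ) (c x : E) : E := x - θ • ((x - c) - ballRetract R (x - c))

variable {θ R : ℝ} {c : E}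

theorem contraction_of_norm_le {x : E} (h : ‖x - c‖ ≤ R) : contraction θ R c x = x := by
  rw [contraction, ballRetract_of_norm_le h, sub_self, smul_zero, sub_zero]

theorem norm_contraction_sub_sub_le (hθ : 0 ≤ θ) (hR : 0 < R) (x y : E) :
    ‖(contraction θ R c x - x) - (contraction θ R c y - y)‖ ≤ 2 * θ * ‖x - y‖ := by
  have h1 : (contraction θ R c x - x) - (contraction θ R c y - y)
      = θ • ((ballRetract R (x - c) - ballRetract R (y - c)) - (x - y)) := by
    simp only [contraction]; module
  have h2 := norm_ballRetract_sub_le hR (x - c) (y - c)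
  rw [sub_sub_sub_cancel_right] at h2
  rw [h1, norm_smul, Real.norm_of_nonneg hθ]
  nlinarith [norm_sub_le (ballRetract R (x - c) - ballRetract R (y - c)) (x - y)]

theorem norm_contraction_sub_le_aux (hθ : 0 ≤ θ) (hθ1 : θ ≤ 1) (x y : E) :
    ‖contraction θ R c x - contraction θ R c y‖ ≤
      (1 - θ) * ‖x - y‖ + θ * ‖ballRetract R (x - c) - ballRetract R (y - c)‖ := by
  have h1 : contraction θ R c x - contraction θ R c y
      = (1 - θ) • (x - y) + θ • (ballRetract R (x - c) - ballRetract R (y - c)) := by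
    simp only [contraction]; module
  rw [h1]
  refine (norm_add_le _ _).trans_eq ?_
  rw [norm_smul, norm_smul, Real.norm_of_nonneg hθ, Real.norm_of_nonneg (by linarith)]

theorem norm_contraction_sub_le (hθ : 0 ≤ θ) (hθ1 : θ ≤ 1) (hR : 0 < R) (x y : E) :
    ‖contraction θ R c x - contraction θ R c y‖ ≤ ‖x - y‖ := by
  refine (norm_contraction_sub_le_aux hθ hθ1 x y).trans ?_
  have h2 := norm_ballRetract_sub_le hR (x - c) (y - c)
  rw [sub_sub_sub_cancel_right] at h2
  nlinarith

/-- Beyond twice the radius the retraction halves distances, so a weight θ on it gains 1 - θ/2. This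
gain pays for the Lipschitz excess created by the cutoff. -/
theorem norm_contraction_sub_le_of_far (hθ : 0 ≤ θ) (hθ1 : θ ≤ 1) (hR : 0 < R) {x y : E}
    (hx : 2 * R ≤ ‖x - c‖) (hy : 2 * R ≤ ‖y - c‖) :
    ‖contraction θ R c x - contraction θ R c y‖ ≤ (1 - θ / 2) * ‖x - y‖ := by
  refine (norm_contraction_sub_le_aux hθ hθ1 x y).trans ?_
  have h2 := norm_ballRetract_sub_le_half hR hx hy
  rw [sub_sub_sub_cancel_right] at h2
  nlinarith

theorem norm_contraction_sub_center_le (hθ : 0 ≤ θ) (hθ1 : θ ≤ 1) (hR : 0 < R) (x : E) :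
    ‖contraction θ R c x - c‖ ≤ ‖x - c‖ := by
  have := norm_contraction_sub_le hθ hθ1 hR (c := c) x c
  rwa [contraction_of_norm_le (x := c) (by simpa using hR.le)] at this

/-- The map is the identity plus a 2θ-Lipschitz perturbation, and 2θ ≤ 1/2. The lower bound controls
how volumes and null sets pull back. -/
theorem antilipschitzWith_contraction (hθ : 0 ≤ θ) (hθ1 : θ ≤ 1 / 4) (hR : 0 < R) :
    AntilipschitzWith 2 (contraction θ R c) := by
  refine AntilipschitzWith.of_le_mul_dist fun x y => ?_
  rw [dist_eq_norm, dist_eq_norm]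
  have h1 := norm_contraction_sub_sub_le (c := c) hθ hR x y
  have h2 : x - y = (contraction θ R c x - contraction θ R c y)
      - ((contraction θ R c x - x) - (contraction θ R c y - y)) := by abel
  have h3 : ‖x - y‖ ≤ ‖contraction θ R c x - contraction θ R c y‖
      + ‖(contraction θ R c x - x) - (contraction θ R c y - y)‖ := by
    conv_lhs => rw [h2]
    exact norm_sub_le _ _
  have h4 : 2 * θ * ‖x - y‖ ≤ 1 / 2 * ‖x - y‖ := by gcongr; linarith
  simp only [NNReal.coe_ofNat]
  linarith

theorem lipschitzWith_contraction (hθ : 0 ≤ θ) (hθ1 : θ ≤ 1) (hR : 0 < R) :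
    LipschitzWith 1 (contraction θ R c) :=
  LipschitzWith.of_dist_le_mul fun x y => by
    rw [dist_eq_norm, dist_eq_norm]; simpa using norm_contraction_sub_le hθ hθ1 hR x y

theorem norm_fderiv_contraction_sub_id_le (hθ : 0 ≤ θ) (hR : 0 < R) {x : E}
    (h : DifferentiableAt ℝ (contraction θ R c) x) :
    ‖fderiv ℝ (contraction θ R c) x - ContinuousLinearMap.id ℝ E‖ ≤ 2 * θ := by
  have h1 : LipschitzWith (2 * θ).toNNReal (fun x => contraction θ R c x - x) :=
    LipschitzWith.of_dist_le_mul fun x y => by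
      rw [dist_eq_norm, dist_eq_norm, Real.coe_toNNReal _ (by positivity)]
      exact norm_contraction_sub_sub_le hθ hR x y
  have h2 := norm_fderiv_le_of_lipschitz ℝ h1 (x₀ := x)
  rw [Real.coe_toNNReal _ (by positivity), 
    show (fun x => contraction θ R c x - x) = contraction θ R c - id from rfl,
    fderiv_sub h differentiableAt_id, fderiv_id] at h2
  exact h2

end Contraction

/-! ### Change of variables for expanding maps -/

section Antilipschitz

variable {m : ℕ}

/-- The constant in the comparison of volumes. -/
def expansionConst (m : ℕ) : ℝ≥0 := (2 * (m : ℝ≥0) ^ (1 / 2 : ℝ)) ^ (m : ℝ)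

/-- Hausdorff measure scales under antilipschitz maps. It is identified with Lebesgue measure for
the sup norm, and passing between the two norms accounts for the power of m in `expansionConst`. -/
theorem volume_preimage_le_of_antilipschitz {P : 𝕏 m → 𝕏 m}
    (hP : AntilipschitzWith 2 P) (s : Set 𝕏 m) :
    volume (P ⁻¹' s) ≤ expansionConst m * volume s := by
  set e := MeasurableEquiv.toLp 2 (Fin m → ℝ)
  have hv : ∀ u : Set 𝕏 m, volume u = μH[(m : ℝ)] (e ⁻¹' u) := by
    intro u
    have h0 : MeasurePreserving e volume volume := PiLp.volume_preserving_toLp (Fin m)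
    have h1 := h0.measure_preimage_equiv u
    rw [← h1]
    have h2 := hausdorffMeasure_pi_real (ι := Fin m)
    rw [Fintype.card_fin] at h2
    rw [h2]
  have hA : AntilipschitzWith (1 * (2 * (m : ℝ≥0) ^ (1 / 2 : ℝ)))
      (fun u : Fin m → ℝ => (P (e u) : Fin m → ℝ)) := by
    have h1 := PiLp.antilipschitzWith_ofLp 2 (fun _ : Fin m => ℝ)
    have h2 := PiLp.antilipschitzWith_toLp 2 (fun _ : Fin m => ℝ)
    have h3 := (h1.comp hP).comp h2
    simp only [Fintype.card_fin, ENNReal.toReal_div, ENNReal.toReal_one, ENNReal.toReal_ofNat,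
      mul_one] at h3
    exact h3
  have h4 := hA.hausdorffMeasure_preimage_le (d := (m : ℝ)) (by positivity) (e ⁻¹' s)
  rw [hv, hv, expansionConst, ENNReal.coe_rpow_of_nonneg _ (by positivity)]
  rw [one_mul] at h4
  exact h4

/-- The map of space-time which acts on the space variable only. -/
def spaceMap (P : 𝕏 m → 𝕏 m) (p : SpaceTime m) :
    SpaceTime m := (P p.1, p.2)

variable {P : 𝕏 m → 𝕏 m}

/-- Domination of the pushforward replaces a change of variables: integrals of nonnegative functions
transfer without a Jacobian. -/
theorem map_spaceMap_le (hP : AntilipschitzWith 2 P) (hPc : Continuous P) :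
    Measure.map (spaceMap P) volume ≤ (expansionConst m : ℝ≥0∞) • volume := by
  have h1 : Measure.map P volume ≤ (expansionConst m : ℝ≥0∞) • volume := by
    refine Measure.le_iff.2 fun s hs => ?_
    rw [Measure.map_apply hPc.measurable hs, Measure.smul_apply, smul_eq_mul]
    exact volume_preimage_le_of_antilipschitz hP s
  haveI : SFinite ((expansionConst m : ℝ≥0∞) • (volume : Measure 𝕏 m)) :=
    inferInstance
  have h2 : Measure.map (spaceMap P) volume = (Measure.map P volume).prod (volume : Measure ℝ) := by
    have := Measure.map_prod_map (volume : Measure 𝕏 m) (volume : Measure ℝ)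
      hPc.measurable measurable_id
    rw [Measure.map_id] at this
    rw [this]
    rfl
  rw [h2, Measure.volume_eq_prod, ← Measure.prod_smul_left]
  exact Measure.prod_mono h1 le_rfl

theorem measurable_spaceMap (hPc : Continuous P) : Measurable (spaceMap P) :=
  (hPc.measurable.comp measurable_fst).prodMk measurable_snd

/-- Preimages of null sets are null. Without this the chain rule could fail on a set of positive
measure sent into the exceptional set of Φ. -/
theorem ae_comp_spaceMap (hP : AntilipschitzWith 2 P) (hPc : Continuous P) {q : SpaceTime m → Prop}
    (h : ∀ᵐ p, q p) : ∀ᵐ p, q (spaceMap P p) := by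
  have h1 : ∀ᵐ p ∂(Measure.map (spaceMap P) volume), q p :=
    (Measure.absolutelyContinuous_of_le (map_spaceMap_le hP hPc)).ae_le
      ((Measure.smul_absolutelyContinuous (c := (expansionConst m : ℝ≥0∞))).ae_le h)
  exact ae_of_ae_map (measurable_spaceMap hPc).aemeasurable h1

theorem spaceMap_mem_parabolicCube (hP : LipschitzWith 1 P) {w p : SpaceTime m} {s : ℝ} (hs : 0 < s)
    (hp : p ∈ 𝒬 w s) : spaceMap P p ∈ 𝒬 (spaceMap P w) ((m + 1) * s) := by
  refine ⟨mem_spatialCube_of_norm_lt ?_, ?_⟩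
  · have h1 := hP.dist_le_mul w.1 p.1
    rw [dist_eq_norm, dist_eq_norm, NNReal.coe_one, one_mul] at h1
    have h2 := norm_sub_le_of_mem_spatialCube hs.le hp.1
    change ‖P w.1 - P p.1‖ < _
    linarith
  · have h1 : √|w.2 - p.2| < s := hp.2
    have h2 : (0 : ℝ) ≤ m := Nat.cast_nonneg m
    change √|w.2 - p.2| < _
    nlinarith

theorem lintegral_cube_comp_spaceMap_le (hP : AntilipschitzWith 2 P) (hP1 : LipschitzWith 1 P)
    (w : SpaceTime m) {s : ℝ} (hs : 0 < s) {f : SpaceTime m → ℝ≥0∞} (hf : Measurable f) :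
    ∫⁻ p in 𝒬 w s, f (spaceMap P p)
      ≤ expansionConst m * ∫⁻ p in 𝒬 (spaceMap P w) ((m + 1) * s), f p := by
  set Q' := 𝒬 (spaceMap P w) ((m + 1) * s)
  have hQ' : MeasurableSet Q' := measurableSet_parabolicCube _ _
  calc _ ≤ ∫⁻ p, Q'.indicator f (spaceMap P p) := by
        rw [← lintegral_indicator (measurableSet_parabolicCube _ _)]
        refine lintegral_mono fun p => ?_
        by_cases hp : p ∈ 𝒬 w s
        · rw [indicator_of_mem hp, indicator_of_mem (spaceMap_mem_parabolicCube hP1 hs hp)]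
        · rw [indicator_of_notMem hp]; exact bot_le
    _ = ∫⁻ p, Q'.indicator f p ∂(Measure.map (spaceMap P) volume) :=
        (lintegral_map (hf.indicator hQ') (measurable_spaceMap hP1.continuous)).symm
    _ ≤ ∫⁻ p, Q'.indicator f p ∂((expansionConst m : ℝ≥0∞) • volume) :=
        lintegral_mono' (map_spaceMap_le hP hP1.continuous) le_rfl
    _ = _ := by rw [lintegral_smul_measure, lintegral_indicator hQ', smul_eq_mul]

theorem volume_parabolicCube_mul (w z : SpaceTime m) {s k : ℝ} (hs : 0 < s) (hk : 0 < k) :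
    volume (𝒬 w (k * s)) = ofReal (k ^ (m + 2)) * volume (𝒬 z s) := by
  rw [volume_parabolicCube w (by positivity), volume_parabolicCube z hs,
    ← ofReal_mul (by positivity)]
  congr 1; ring

/-- The constant in the invariance of the oscillation conditions. -/
def pullbackConst (m : ℕ) : ℝ := expansionConst m * ((m : ℝ) + 1) ^ (m + 2)

theorem pullbackConst_nonneg (m : ℕ) : 0 ≤ pullbackConst m := by unfold pullbackConst; positivity

theorem laverage_comp_spaceMap_le (hP : AntilipschitzWith 2 P) (hP1 : LipschitzWith 1 P)
    (w : SpaceTime m) {s : ℝ} (hs : 0 < s) {f : SpaceTime m → ℝ≥0∞} (hf : Measurable f) :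
    (volume (𝒬 w s))⁻¹ * ∫⁻ p in 𝒬 w s, f (spaceMap P p)
      ≤ ofReal (pullbackConst m) * ((volume (𝒬 (spaceMap P w) ((m + 1) * s)))⁻¹ *
        ∫⁻ p in 𝒬 (spaceMap P w) ((m + 1) * s), f p) := by
  have h1 := lintegral_cube_comp_spaceMap_le hP hP1 w hs hf
  set I := ∫⁻ p in 𝒬 (spaceMap P w) ((m + 1) * s), f p
  have hm : (0 : ℝ) < m + 1 := by positivity
  rw [volume_parabolicCube_mul (spaceMap P w) w hs hm, pullbackConst,
    ofReal_mul (by positivity), ENNReal.ofReal_coe_nnreal]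
  have h0 : ofReal (((m : ℝ) + 1) ^ (m + 2)) ≠ 0 := by
    rw [Ne, ENNReal.ofReal_eq_zero, not_le]; positivity
  rw [ENNReal.mul_inv (Or.inl h0) (Or.inl ofReal_ne_top)]
  calc _ ≤ (volume (𝒬 w s))⁻¹ * (expansionConst m * I) := mul_le_mul_right h1 _
    _ = (ofReal (((m : ℝ) + 1) ^ (m + 2)) * (ofReal (((m : ℝ) + 1) ^ (m + 2)))⁻¹) *
        (expansionConst m * ((volume (𝒬 w s))⁻¹ * I)) := by
        rw [ENNReal.mul_inv_cancel h0 ofReal_ne_top]; ring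
    _ = _ := by ring

theorem timeDifference_comp_spaceMap_le (hP : AntilipschitzWith 2 P) (hP1 : LipschitzWith 1 P)
    {Ψ : SpaceTime m → ℝ} (hΨ : Continuous Ψ) (w : SpaceTime m) {s : ℝ} (hs : 0 < s) :
    timeDifference (fun p => Ψ (spaceMap P p)) w s ≤ ofReal (pullbackConst m) *
      timeDifference Ψ (spaceMap P w) ((m + 1) * s) := by
  have hF := measurable_timeQuotient hΨ
  rw [timeDifference_eq, timeDifference_eq]
  have h1 := laverage_comp_spaceMap_le hP hP1 w hs
    (f := fun p => ∫⁻ τ in timeInterval w.2 s, timeQuotient Ψ p τ) hF.lintegral_prod_right'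
  refine h1.trans (mul_le_mul_right (mul_le_mul_right ?_ _) _)
  refine lintegral_mono fun p => lintegral_mono_set fun τ hτ => ?_
  have h1 : √|w.2 - τ| < s := hτ
  have h2 : (0 : ℝ) ≤ m := Nat.cast_nonneg m
  change √|w.2 - τ| < _
  nlinarith

end Antilipschitz

/-! ### Truncation -/

section Truncation

variable {m : ℕ} {ℓ : ℝ} {φ : SpaceTime m → ℝ}

/-- Lattice operations give a maximum of increments and not a sum. This is why truncation keeps the
constant ℓ exactly. -/
theorem abs_symmClamp_sub_le (u g u' g' : ℝ) :
    |max (min u g) (-g) - max (min u' g') (-g')| ≤ max |u - u'| |g - g'| := by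
  refine (abs_max_sub_max_le_max _ _ _ _).trans (max_le (abs_min_sub_min_le_max _ _ _ _) ?_)
  rw [neg_sub_neg, abs_sub_comm]
  exact le_max_right _ _

/-- A tent function on the parabolic cube of centre `z` and radius `σ`, of `Lip(1,1/2)` constant `1`. -/
def tent (z : SpaceTime m) (σ : ℝ) (p : SpaceTime m) : ℝ :=
  max 0 (σ - ‖p.1 - z.1‖ - min (|p.2 - z.2| / σ) σ)

theorem tent_nonneg (z : SpaceTime m) (σ : ℝ) (p : SpaceTime m) : 0 ≤ tent z σ p := le_max_left _ _

theorem tent_le (z : SpaceTime m) {σ : ℝ} (hσ : 0 < σ) (p : SpaceTime m) : tent z σ p ≤ σ := by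
  refine max_le hσ.le ?_
  have h1 : 0 ≤ min (|p.2 - z.2| / σ) σ := by positivity
  linarith [norm_nonneg (p.1 - z.1)]

theorem abs_tent_space_sub_le (z : SpaceTime m) (σ : ℝ) (x y : 𝕏 m) (t : ℝ) :
    |tent z σ (x, t) - tent z σ (y, t)| ≤ ‖x - y‖ := by
  refine (abs_max_sub_max_le_max _ _ _ _).trans (max_le (by simp) ?_)
  simp only
  rw [show σ - ‖x - z.1‖ - min (|t - z.2| / σ) σ - (σ - ‖y - z.1‖ - min (|t - z.2| / σ) σ)
    = ‖y - z.1‖ - ‖x - z.1‖ by ring]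
  refine (abs_norm_sub_norm_le _ _).trans ?_
  rw [sub_sub_sub_cancel_right, norm_sub_rev]

theorem abs_tent_time_sub_le (z : SpaceTime m) {σ : ℝ} (hσ : 0 < σ) (x : 𝕏 m)
    (t τ : ℝ) : |tent z σ (x, t) - tent z σ (x, τ)| ≤ |t - τ| / σ := by
  refine (abs_max_sub_max_le_max _ _ _ _).trans (max_le (by simp; positivity) ?_)
  simp only
  rw [sub_sub_sub_cancel_left]
  refine (abs_min_sub_min_le_max _ _ _ _).trans (max_le ?_ (by simp; positivity))
  rw [← sub_div, abs_div, abs_of_pos hσ]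
  refine div_le_div_of_nonneg_right ?_ hσ.le
  have h := abs_abs_sub_abs_le_abs_sub (τ - z.2) (t - z.2)
  rwa [sub_sub_sub_cancel_right, abs_sub_comm τ t] at h

/-- For √|t - τ| ≤ σ the slope 1/σ is at most 1/√|t - τ|; for larger time differences the range [0,
σ] of the tent suffices. -/
theorem abs_tent_time_sub_le_sqrt (z : SpaceTime m) {σ : ℝ} (hσ : 0 < σ)
    (x : 𝕏 m) (t τ : ℝ) :
    |tent z σ (x, t) - tent z σ (x, τ)| ≤ √|t - τ| := by
  rcases le_total √|t - τ| σ with h | h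
  · refine (abs_tent_time_sub_le z hσ x t τ).trans ?_
    rw [div_le_iff₀ hσ]
    nlinarith [Real.mul_self_sqrt (abs_nonneg (t - τ)), Real.sqrt_nonneg |t - τ|]
  · refine le_trans ?_ h
    rw [abs_sub_le_iff]
    constructor <;> linarith [tent_nonneg z σ (x, t), tent_nonneg z σ (x, τ), tent_le z hσ (x, t),
      tent_le z hσ (x, τ)]

theorem tent_eq_zero {z : SpaceTime m} {σ : ℝ} (hσ : 0 < σ) {p : SpaceTime m}
    (hp : p ∉ 𝒬 z σ) : tent z σ p = 0 := by
  refine max_eq_left ?_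
  by_contra! h
  have h1 : 0 ≤ min (|p.2 - z.2| / σ) σ := by positivity
  refine hp ⟨mem_spatialCube_of_norm_lt ?_, (mem_timeInterval hσ).2 ?_⟩
  · rw [norm_sub_rev]; linarith
  · have h2 : min (|p.2 - z.2| / σ) σ < σ := by linarith [norm_nonneg (p.1 - z.1)]
    rw [min_lt_iff, div_lt_iff₀ hσ] at h2
    rw [abs_sub_comm, sq]
    exact h2.resolve_right (lt_irrefl _)

/-- Truncation of a `Lip(1,1/2)` function outside a parabolic cube. -/
def truncateOutside (ℓ : ℝ) (φ : SpaceTime m → ℝ) (z : SpaceTime m) (σ : ℝ) (p : SpaceTime m) : ℝ :=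
  φ z + max (min (φ p - φ z) (ℓ * tent z σ p)) (-(ℓ * tent z σ p))

theorem abs_truncateOutside_sub_le (z : SpaceTime m) (σ : ℝ) (p q : SpaceTime m) (hℓ : 0 ≤ ℓ) :
    |truncateOutside ℓ φ z σ p - truncateOutside ℓ φ z σ q|
      ≤ max |φ p - φ q| (ℓ * |tent z σ p - tent z σ q|) := by
  rw [truncateOutside, truncateOutside, add_sub_add_left_eq_sub]
  refine (abs_symmClamp_sub_le _ _ _ _).trans_eq ?_
  rw [sub_sub_sub_cancel_right, ← mul_sub, abs_mul, abs_of_nonneg hℓ]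

theorem IsLipHalfOn.truncateOutside (h : IsLipHalfOn ℓ φ univ) (z : SpaceTime m) {σ : ℝ} (hσ : 0 < σ) :
    IsLipHalfOn ℓ (truncateOutside ℓ φ z σ) univ := by
  have hℓ := h.nonneg_of_univ
  refine isLipHalfOn_univ_of_space_time (fun x y t => ?_) fun x t τ => ?_
  · refine (abs_truncateOutside_sub_le z σ _ _ hℓ).trans (max_le (h.space x y t) ?_)
    gcongr
    exact abs_tent_space_sub_le z σ x y t
  · refine (abs_truncateOutside_sub_le z σ _ _ hℓ).trans (max_le (h.time x t τ) ?_)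
    gcongr
    exact abs_tent_time_sub_le_sqrt z hσ x t τ

/-- On the cube of radius r the tent is at least σ - (m+1)r ≥ (m+1)r, which exceeds the parabolic
distance to z. The Lipschitz bound then makes the clamp inactive. -/
theorem IsLipHalfOn.eqOn_truncateOutside (h : IsLipHalfOn ℓ φ univ) (z : SpaceTime m) {r σ : ℝ}
    (hr : 0 < r) (hσ : (2 * m + 2) * r ≤ σ) :
    Set.EqOn (_root_.truncateOutside ℓ φ z σ) φ (𝒬 z r) := by
  intro p hp
  have hℓ := h.nonneg_of_univ
  have hm : (0 : ℝ) ≤ m := Nat.cast_nonneg m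
  have hσ0 : 0 < σ := lt_of_lt_of_le (by positivity) hσ
  have h1 := norm_sub_le_of_mem_spatialCube hr.le hp.1
  rw [norm_sub_rev] at h1
  have h2 : √|z.2 - p.2| < r := hp.2
  have h3 := (mem_timeInterval hr).1 hp.2
  rw [abs_sub_comm] at h2 h3
  have h4 : |p.2 - z.2| / σ ≤ r := by
    rw [div_le_iff₀ hσ0]; nlinarith
  have h5 : min (|p.2 - z.2| / σ) σ ≤ r := (min_le_left _ _).trans h4
  have h6 : m * r + r ≤ tent z σ p := by
    refine le_max_of_le_right ?_
    nlinarith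
  have h7 : |φ p - φ z| ≤ ℓ * tent z σ p := by
    refine (h p trivial z trivial).trans ?_
    gcongr
    linarith
  rw [abs_le] at h7
  rw [_root_.truncateOutside, min_eq_left h7.2, max_eq_left h7.1]
  ring

/-- The tent adds a term of time slope ℓ/σ, and the truncation has time differences at most 2ℓσ. By
scaling both contribute multiples of ℓ², which is why ℓ ≤ M A is needed. -/
theorem timeDifference_truncateOutside_le (h : IsLipHalfOn ℓ φ univ) {A M σ : ℝ} (hσ : 0 < σ)
    (hA : ℓ ≤ M * A) {z : SpaceTime m}
    (htime : ∀ w s, 0 < s → 𝒬 w s ⊆ 𝒬 z (2 * σ) →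
      timeDifference φ w s ≤ ofReal (A ^ 2)) (w : SpaceTime m) {s : ℝ} (hs : 0 < s) :
    timeDifference (truncateOutside ℓ φ z σ) w s
      ≤ ofReal ((4 ^ (m + 2) * (2 + M ^ 2) + 128 * M ^ 2) * A ^ 2) := by
  have hℓ := h.nonneg_of_univ
  have hD : ∀ p, |truncateOutside ℓ φ z σ p - φ z| ≤ ℓ * σ := by
    intro p
    have h1 := mul_nonneg hℓ (tent_nonneg z σ p)
    have h2 : ℓ * tent z σ p ≤ ℓ * σ := by gcongr; exact tent_le z hσ p
    rw [truncateOutside, add_sub_cancel_left, abs_le]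
    constructor
    · exact (by linarith : -(ℓ * σ) ≤ -(ℓ * tent z σ p)).trans (le_max_right _ _)
    · exact (max_le (min_le_right _ _) (by linarith)).trans h2
  refine (timeDifference_le_of_localized (h.truncateOutside z hσ).continuous h.continuous
    (b := ℓ / σ) (D := 2 * (ℓ * σ)) hσ (by positivity) htime (fun x t τ _ _ => ?_) (fun x t τ h1 h2 => ?_)
    (fun x t τ => ?_) w hs).trans ?_
  · refine (abs_truncateOutside_sub_le z σ _ _ hℓ).trans ?_
    refine max_le (by linarith [show 0 ≤ ℓ / σ * |t - τ| by positivity]) ?_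
    have := mul_le_mul_of_nonneg_left (abs_tent_time_sub_le z hσ x t τ) hℓ
    have h2 : ℓ / σ * |t - τ| = ℓ * (|t - τ| / σ) := by ring
    rw [h2]
    linarith [abs_nonneg (φ (x, t) - φ (x, τ))]
  · simp [truncateOutside, tent_eq_zero hσ h1, tent_eq_zero hσ h2]
  · have h1 := abs_sub_le (truncateOutside ℓ φ z σ (x, t)) (φ z) (truncateOutside ℓ φ z σ (x, τ))
    have h2 := hD (x, τ)
    rw [abs_sub_comm] at h2
    linarith [hD (x, t)]
  · have hM : ℓ ^ 2 ≤ M ^ 2 * A ^ 2 := by rw [← mul_pow]; gcongr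
    rw [show (4 : ℝ≥0∞) = ofReal 4 by simp, show (2 : ℝ≥0∞) = ofReal 2 by simp,
      ← ofReal_pow (by norm_num), ← ofReal_mul (by norm_num),
      ← ofReal_add (by positivity) (by positivity), ← ofReal_mul (by positivity),
      ← ofReal_add (by positivity) (by positivity)]
    refine ofReal_le_ofReal ?_
    have h1 : (ℓ / σ) ^ 2 * σ ^ 2 = ℓ ^ 2 := by field_simp
    have h2 : 32 * (2 * (ℓ * σ)) ^ 2 / σ ^ 2 = 128 * ℓ ^ 2 := by field_simp; ring
    rw [h1, h2]
    have h3 : (4 : ℝ) ^ (m + 2) * ℓ ^ 2 ≤ 4 ^ (m + 2) * (M ^ 2 * A ^ 2) := by gcongr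
    nlinarith

end Truncation

/-! ### Localisation near an affine function -/

section Localization

variable {m : ℕ} {ℓ R N N₁ θ : ℝ} {φ : SpaceTime m → ℝ} {z : SpaceTime m} {a : 𝕏 m}

theorem abs_unitClamp_sub_le (u v : ℝ) :
    |max 0 (min 1 u) - max 0 (min 1 v)| ≤ |u - v| :=
  (abs_max_sub_max_le_max _ _ _ _).trans (max_le (by simp) ((abs_min_sub_min_le_max _ _ _ _).trans
    (max_le (by simp) le_rfl)))

theorem unitClamp_mem (u : ℝ) : 0 ≤ max 0 (min 1 u) ∧ max 0 (min 1 u) ≤ 1 :=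
  ⟨le_max_left _ _, max_le zero_le_one (min_le_left _ _)⟩

/-- A Lipschitz cutoff function in space. -/
def spaceCutoff (c : 𝕏 m) (R : ℝ) (x : 𝕏 m) : ℝ :=
  max 0 (min 1 (2 - ‖x - c‖ / (2 * R)))

/-- A Lipschitz cutoff function in time. -/
def timeCutoff (t₀ R t : ℝ) : ℝ := max 0 (min 1 (2 - |t - t₀| / R ^ 2))

/-- The product of the two cutoff functions. -/
def cutoff (z : SpaceTime m) (R : ℝ) (p : SpaceTime m) : ℝ :=
  spaceCutoff z.1 R p.1 * timeCutoff z.2 R p.2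

theorem abs_spaceCutoff_sub_le (c : 𝕏 m) (hR : 0 < R)
    (x y : 𝕏 m) :
    |spaceCutoff c R x - spaceCutoff c R y| ≤ ‖x - y‖ / (2 * R) := by
  refine (abs_unitClamp_sub_le _ _).trans ?_
  rw [sub_sub_sub_cancel_left, ← sub_div, abs_div, abs_of_pos (by positivity : 0 < 2 * R)]
  gcongr
  refine (abs_norm_sub_norm_le _ _).trans ?_
  rw [sub_sub_sub_cancel_right, norm_sub_rev]

theorem abs_timeCutoff_sub_le (t₀ : ℝ) (hR : 0 < R) (t τ : ℝ) :
    |timeCutoff t₀ R t - timeCutoff t₀ R τ| ≤ |t - τ| / R ^ 2 := by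
  refine (abs_unitClamp_sub_le _ _).trans ?_
  rw [sub_sub_sub_cancel_left, ← sub_div, abs_div, abs_of_pos (by positivity : 0 < R ^ 2)]
  refine div_le_div_of_nonneg_right ?_ (by positivity)
  have h := abs_abs_sub_abs_le_abs_sub (τ - t₀) (t - t₀)
  rwa [sub_sub_sub_cancel_right, abs_sub_comm τ t] at h

theorem spaceCutoff_eq_one {c x : 𝕏 m} (hR : 0 < R) (h : ‖x - c‖ ≤ 2 * R) :
    spaceCutoff c R x = 1 := by
  have : ‖x - c‖ / (2 * R) ≤ 1 := (div_le_one (by positivity)).2 h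
  rw [spaceCutoff, min_eq_left (by linarith), max_eq_right zero_le_one]

theorem spaceCutoff_eq_zero {c x : 𝕏 m} (hR : 0 < R) (h : 4 * R ≤ ‖x - c‖) :
    spaceCutoff c R x = 0 := by
  have : 2 ≤ ‖x - c‖ / (2 * R) := (le_div_iff₀ (by positivity)).2 (by linarith)
  rw [spaceCutoff, max_eq_left ((min_le_right _ _).trans (by linarith))]

theorem timeCutoff_eq_one {t₀ t : ℝ} (hR : 0 < R) (h : |t - t₀| ≤ R ^ 2) : timeCutoff t₀ R t = 1 := by
  have : |t - t₀| / R ^ 2 ≤ 1 := (div_le_one (by positivity)).2 h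
  rw [timeCutoff, min_eq_left (by linarith), max_eq_right zero_le_one]

theorem timeCutoff_eq_zero {t₀ t : ℝ} (hR : 0 < R) (h : 2 * R ^ 2 ≤ |t - t₀|) :
    timeCutoff t₀ R t = 0 := by
  have : 2 ≤ |t - t₀| / R ^ 2 := (le_div_iff₀ (by positivity)).2 h
  rw [timeCutoff, max_eq_left ((min_le_right _ _).trans (by linarith))]

theorem cutoff_nonneg (z : SpaceTime m) (R : ℝ) (p : SpaceTime m) : 0 ≤ cutoff z R p :=
  mul_nonneg (unitClamp_mem _).1 (unitClamp_mem _).1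

theorem cutoff_le_one (z : SpaceTime m) (R : ℝ) (p : SpaceTime m) : cutoff z R p ≤ 1 :=
  mul_le_one₀ (unitClamp_mem _).2 (unitClamp_mem _).1 (unitClamp_mem _).2

theorem mem_of_cutoff_ne_zero (hR : 0 < R) {p : SpaceTime m} (h : cutoff z R p ≠ 0) :
    p ∈ 𝒬 z (4 * R) := by
  rw [cutoff, mul_ne_zero_iff] at h
  refine ⟨mem_spatialCube_of_norm_lt ?_, (mem_timeInterval (by positivity)).2 ?_⟩
  · by_contra! h1
    rw [norm_sub_rev] at h1
    exact h.1 (spaceCutoff_eq_zero hR h1)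
  · by_contra! h1
    rw [abs_sub_comm] at h1
    exact h.2 (timeCutoff_eq_zero hR (by nlinarith))

theorem abs_cutoff_space_sub_le (hR : 0 < R) (x y : 𝕏 m) (t : ℝ) :
    |cutoff z R (x, t) - cutoff z R (y, t)| ≤ ‖x - y‖ / (2 * R) := by
  simp only [cutoff]
  rw [← sub_mul, abs_mul, abs_of_nonneg (unitClamp_mem _).1 (a := timeCutoff z.2 R t)]
  exact (mul_le_of_le_one_right (abs_nonneg _) (unitClamp_mem _).2).trans
    (abs_spaceCutoff_sub_le _ hR x y)

theorem abs_cutoff_time_sub_le (hR : 0 < R) (x : 𝕏 m) (t τ : ℝ) :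
    |cutoff z R (x, t) - cutoff z R (x, τ)| ≤ |t - τ| / R ^ 2 := by
  simp only [cutoff]
  rw [← mul_sub, abs_mul, abs_of_nonneg (unitClamp_mem _).1 (a := spaceCutoff z.1 R x)]
  exact (mul_le_of_le_one_left (abs_nonneg _) (unitClamp_mem _).2).trans
    (abs_timeCutoff_sub_le _ hR t τ)

/-- The affine function through the centre with gradient `a`. -/
def affineAt (φ : SpaceTime m → ℝ) (z : SpaceTime m) (a x : 𝕏 m) : ℝ :=
  φ z + inner ℝ a (x - z.1)

/-- Interpolation between `φ` and an affine function. -/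
def localize (φ : SpaceTime m → ℝ) (z : SpaceTime m) (a : 𝕏 m) (R : ℝ)
    (p : SpaceTime m) : ℝ :=
  affineAt φ z a p.1 + cutoff z R p * (φ p - affineAt φ z a p.1)

theorem abs_affineAt_sub_le (ha : ‖a‖ ≤ ℓ) (x y : 𝕏 m) :
    |affineAt φ z a x - affineAt φ z a y| ≤ ℓ * ‖x - y‖ := by
  rw [affineAt, affineAt, add_sub_add_left_eq_sub, ← inner_sub_right, sub_sub_sub_cancel_right]
  exact (abs_real_inner_le_norm _ _).trans (by gcongr)

theorem abs_localize_sub_affineAt_le (hR : 0 < R) (hN : 0 ≤ N)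
    (hψ : ∀ p ∈ 𝒬 z (8 * R), |φ p - affineAt φ z a p.1| ≤ N) (p : SpaceTime m) :
    |localize φ z a R p - affineAt φ z a p.1| ≤ N := by
  rw [localize, add_sub_cancel_left, abs_mul, abs_of_nonneg (cutoff_nonneg _ _ _)]
  by_cases h : cutoff z R p = 0
  · rw [h, zero_mul]; exact hN
  · exact (mul_le_of_le_one_left (abs_nonneg _) (cutoff_le_one _ _ _)).trans
      (hψ p (parabolicCube_mono (by linarith) (mem_of_cutoff_ne_zero hR h)))

theorem abs_convex_comb_le {η d₁ d₂ B : ℝ} (h0 : 0 ≤ η) (h1 : η ≤ 1) (hd₁ : |d₁| ≤ B) (hd₂ : |d₂| ≤ B) :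
    |η * d₁ + (1 - η) * d₂| ≤ B := by
  rw [abs_le] at *
  constructor <;> nlinarith

/-- With the cutoff frozen at x, the increment is a convex combination of increments of φ and of the
affine function, each at most ℓ‖x - y‖. What is left is an increment of the cutoff times the
remainder at y, so y is taken where the cutoff is nonzero. -/
theorem abs_localize_space_sub_le (hφ : IsLipHalfOn ℓ φ univ) (ha : ‖a‖ ≤ ℓ) (hR : 0 < R)
    (hN : 0 ≤ N) (hψ : ∀ p ∈ 𝒬 z (8 * R), |φ p - affineAt φ z a p.1| ≤ N)
    (x y : 𝕏 m) (t : ℝ) :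
    |localize φ z a R (x, t) - localize φ z a R (y, t)| ≤ (ℓ + N / (2 * R)) * ‖x - y‖ := by
  have key : ∀ x y, cutoff z R (y, t) ≠ 0 →
      |localize φ z a R (x, t) - localize φ z a R (y, t)| ≤ (ℓ + N / (2 * R)) * ‖x - y‖ := by
    intro x y hy
    have h1 := hψ _ (parabolicCube_mono (by linarith) (mem_of_cutoff_ne_zero hR hy))
    have h2 := abs_convex_comb_le (cutoff_nonneg z R (x, t)) (cutoff_le_one z R (x, t))
      (hφ.space x y t) (abs_affineAt_sub_le (φ := φ) (z := z) ha x y)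
    have h3 := abs_cutoff_space_sub_le (z := z) hR x y t
    have h4 : localize φ z a R (x, t) - localize φ z a R (y, t) =
        (cutoff z R (x, t) * (φ (x, t) - φ (y, t))
          + (1 - cutoff z R (x, t)) * (affineAt φ z a x - affineAt φ z a y))
        + (cutoff z R (x, t) - cutoff z R (y, t)) * (φ (y, t) - affineAt φ z a y) := by
      simp only [localize]; ring
    rw [h4]
    refine (abs_add_le _ _).trans ?_
    rw [abs_mul]
    have h5 := mul_le_mul h3 h1 (abs_nonneg _) (by positivity)
    have h6 : ‖x - y‖ / (2 * R) * N = N / (2 * R) * ‖x - y‖ := by ring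
    rw [add_mul]
    simp only at h5
    linarith
  by_cases hy : cutoff z R (y, t) = 0
  · by_cases hx : cutoff z R (x, t) = 0
    · simp only [localize, hx, hy, zero_mul, add_zero]
      refine (abs_affineAt_sub_le ha x y).trans ?_
      gcongr
      linarith [show 0 ≤ N / (2 * R) by positivity]
    · rw [abs_sub_comm, norm_sub_rev]; exact key y x hx
  · exact key x y hy

/-- Within 2R of the centre the spatial cutoff equals 1, so the cutoff depends on t only and the
increment is a pure convex combination: no loss in the constant. -/
theorem abs_localize_space_sub_le_of_near (hφ : IsLipHalfOn ℓ φ univ) (ha : ‖a‖ ≤ ℓ) (hR : 0 < R)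
    {x y : 𝕏 m} (hx : ‖x - z.1‖ ≤ 2 * R) (hy : ‖y - z.1‖ ≤ 2 * R) (t : ℝ) :
    |localize φ z a R (x, t) - localize φ z a R (y, t)| ≤ ℓ * ‖x - y‖ := by
  have hc : cutoff z R (y, t) = cutoff z R (x, t) := by
    simp only [cutoff, spaceCutoff_eq_one hR hx, spaceCutoff_eq_one hR hy]
  have h2 := abs_convex_comb_le (cutoff_nonneg z R (x, t)) (cutoff_le_one z R (x, t))
    (hφ.space x y t) (abs_affineAt_sub_le (φ := φ) (z := z) ha x y)
  have h4 : localize φ z a R (x, t) - localize φ z a R (y, t) =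
      cutoff z R (x, t) * (φ (x, t) - φ (y, t))
        + (1 - cutoff z R (x, t)) * (affineAt φ z a x - affineAt φ z a y) := by
    simp only [localize, hc]; ring
  rw [h4]
  exact h2

theorem localize_time_sub (x : 𝕏 m) (t τ : ℝ) :
    localize φ z a R (x, t) - localize φ z a R (x, τ) = cutoff z R (x, t) * (φ (x, t) - φ (x, τ))
      + (cutoff z R (x, t) - cutoff z R (x, τ)) * (φ (x, τ) - affineAt φ z a x) := by
  simp only [localize]; ring

theorem abs_localize_time_sub_le (hR : 0 < R)
    (hψ : ∀ p ∈ 𝒬 z (8 * R), |φ p - affineAt φ z a p.1| ≤ N)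
    {x : 𝕏 m} {t τ : ℝ} (hτ : (x, τ) ∈ 𝒬 z (8 * R)) :
    |localize φ z a R (x, t) - localize φ z a R (x, τ)|
      ≤ |φ (x, t) - φ (x, τ)| + N / R ^ 2 * |t - τ| := by
  rw [localize_time_sub]
  refine (abs_add_le _ _).trans ?_
  rw [abs_mul, abs_mul, abs_of_nonneg (cutoff_nonneg _ _ _)]
  have h1 := mul_le_of_le_one_left (abs_nonneg (φ (x, t) - φ (x, τ))) (cutoff_le_one z R (x, t))
  have h2 := mul_le_mul (abs_cutoff_time_sub_le (z := z) hR x t τ) (hψ _ hτ) (abs_nonneg _)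
    (by positivity)
  have h3 : |t - τ| / R ^ 2 * N = N / R ^ 2 * |t - τ| := by ring
  simp only at h2
  linarith

/-- For times closer than (2R)² the product rule applies and |t - τ| ≤ 2R√|t - τ|. For distant times
both values are within N of the same affine value. -/
theorem abs_localize_time_sub_le_sqrt (hR : 0 < R) (hN : 0 ≤ N) (hN₁ : 0 ≤ N₁)
    (hψ : ∀ p ∈ 𝒬 z (8 * R), |φ p - affineAt φ z a p.1| ≤ N)
    (hz : ∀ x t τ, (x, t) ∈ 𝒬 z (4 * R) → √|t - τ| ≤ 2 * R →
      |φ (x, t) - φ (x, τ)| ≤ N₁ * √|t - τ|)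
    (x : 𝕏 m) (t τ : ℝ) :
    |localize φ z a R (x, t) - localize φ z a R (x, τ)| ≤ (N₁ + 2 * N / R) * √|t - τ| := by
  have key : ∀ t τ, cutoff z R (x, t) ≠ 0 →
      |localize φ z a R (x, t) - localize φ z a R (x, τ)| ≤ (N₁ + 2 * N / R) * √|t - τ| := by
    intro t τ ht
    have ht' := mem_of_cutoff_ne_zero hR ht
    have hs := Real.sqrt_nonneg |t - τ|
    rcases le_or_gt √|t - τ| (2 * R) with h | h
    · have hτ : (x, τ) ∈ 𝒬 z (8 * R) := by
        refine ⟨fun i => (ht'.1 i).trans (by linarith), ?_⟩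
        have h1 := sqrt_abs_sub_le z.2 t τ
        have h2 : √|z.2 - t| < 4 * R := ht'.2
        change √|z.2 - τ| < 8 * R
        linarith
      have h1 := abs_localize_time_sub_le (t := t) hR hψ hτ
      have h2 := hz x t τ ht' h
      have h3 : N / R ^ 2 * |t - τ| ≤ 2 * N / R * √|t - τ| := by
        rw [div_mul_eq_mul_div, div_mul_eq_mul_div, div_le_div_iff₀ (by positivity) hR]
        have h4 := Real.mul_self_sqrt (abs_nonneg (t - τ))
        have h5 : |t - τ| ≤ 2 * R * √|t - τ| := by nlinarith
        calc N * |t - τ| * R ≤ N * (2 * R * √|t - τ|) * R := by gcongr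
          _ = _ := by ring
      rw [add_mul]
      linarith
    · have h1 := abs_localize_sub_affineAt_le hR hN hψ (x, t)
      have h2 := abs_localize_sub_affineAt_le hR hN hψ (x, τ)
      rw [abs_sub_comm] at h2
      have h3 := abs_sub_le (localize φ z a R (x, t)) (affineAt φ z a x) (localize φ z a R (x, τ))
      have h4 : 2 * N ≤ 2 * N / R * √|t - τ| := by
        rw [div_mul_eq_mul_div, le_div_iff₀ hR]
        gcongr
        linarith
      rw [add_mul]
      simp only at h1 h2
      linarith [mul_nonneg hN₁ hs]
  by_cases ht : cutoff z R (x, t) = 0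
  · by_cases hτ : cutoff z R (x, τ) = 0
    · simp only [localize, ht, hτ, zero_mul, sub_self, abs_zero]
      positivity
    · rw [abs_sub_comm, abs_sub_comm t]; exact key τ t hτ
  · exact key t τ ht

/-- The localisation composed with the contraction. -/
def localizeContract (φ : SpaceTime m → ℝ) (z : SpaceTime m) (a : 𝕏 m) (R θ : ℝ)
    (p : SpaceTime m) : ℝ := localize φ z a R (spaceMap (contraction θ R z.1) p)

theorem localizeContract_eqOn (hR : 0 < R) {r : ℝ} (hr : 0 < r) (hrR : (m + 1) * r ≤ R) :
    Set.EqOn (localizeContract φ z a R θ) φ (𝒬 z r) := by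
  intro p hp
  have hm : (0 : ℝ) ≤ m := Nat.cast_nonneg m
  have h1 := norm_sub_le_of_mem_spatialCube hr.le hp.1
  rw [norm_sub_rev] at h1
  have h2 : ‖p.1 - z.1‖ ≤ R := by linarith
  have h3 := (mem_timeInterval hr).1 hp.2
  rw [abs_sub_comm] at h3
  have h4 : r ≤ R := by nlinarith
  rw [localizeContract, spaceMap, contraction_of_norm_le h2, localize, cutoff,
    spaceCutoff_eq_one hR (by linarith), timeCutoff_eq_one hR (h3.le.trans (by gcongr))]
  ring

/-- Both points within 2R: interpolation costs nothing and the map does not expand. Both beyond 2R: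
the gain 1 - θ/2 absorbs N/(2R). Since the map acts on space only, the time constant is unaffected.
-/
theorem isLipHalfOn_localizeContract (hφ : IsLipHalfOn ℓ φ univ) (ha : ‖a‖ ≤ ℓ) (hR : 0 < R)
    (hN : 0 ≤ N) (hN₁ : 0 ≤ N₁) (hθ : 0 ≤ θ) (hθ1 : θ ≤ 1)
    (hψ : ∀ p ∈ 𝒬 z (8 * R), |φ p - affineAt φ z a p.1| ≤ N)
    (hz : ∀ x t τ, (x, t) ∈ 𝒬 z (4 * R) → √|t - τ| ≤ 2 * R →
      |φ (x, t) - φ (x, τ)| ≤ N₁ * √|t - τ|)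
    (hNℓ : N₁ + 2 * N / R ≤ ℓ) (hθℓ : (ℓ + N / (2 * R)) * (1 - θ / 2) ≤ ℓ) :
    IsLipHalfOn ℓ (localizeContract φ z a R θ) univ := by
  have hℓ := hφ.nonneg_of_univ
  refine isLipHalfOn_univ_of_space_time (fun x y t => ?_) fun x t τ => ?_
  · have hnear : ∀ x y, ‖x - z.1‖ ≤ 2 * R → ‖y - z.1‖ ≤ 2 * R →
        |localizeContract φ z a R θ (x, t) - localizeContract φ z a R θ (y, t)| ≤ ℓ * ‖x - y‖ := by
      intro x y hx hy
      refine (abs_localize_space_sub_le_of_near hφ ha hR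
        ((norm_contraction_sub_center_le hθ hθ1 hR x).trans hx)
        ((norm_contraction_sub_center_le hθ hθ1 hR y).trans hy) t).trans ?_
      gcongr
      exact norm_contraction_sub_le hθ hθ1 hR x y
    have hfar : ∀ x y, 2 * R ≤ ‖x - z.1‖ → 2 * R ≤ ‖y - z.1‖ →
        |localizeContract φ z a R θ (x, t) - localizeContract φ z a R θ (y, t)| ≤ ℓ * ‖x - y‖ := by
      intro x y hx hy
      refine (abs_localize_space_sub_le hφ ha hR hN hψ _ _ t).trans ?_
      calc _ ≤ (ℓ + N / (2 * R)) * ((1 - θ / 2) * ‖x - y‖) := by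
            gcongr
            exact norm_contraction_sub_le_of_far hθ hθ1 hR hx hy
        _ = (ℓ + N / (2 * R)) * (1 - θ / 2) * ‖x - y‖ := by ring
        _ ≤ _ := by gcongr
    have hmix : ∀ x y, ‖x - z.1‖ ≤ 2 * R → 2 * R ≤ ‖y - z.1‖ →
        |localizeContract φ z a R θ (x, t) - localizeContract φ z a R θ (y, t)| ≤ ℓ * ‖x - y‖ := by
      intro x y hx hy
      -- A mixed pair is split where its segment crosses the sphere of radius 2R; lengths add along
      -- a segment, so no constant is lost.
      have hcont : ContinuousOn (fun τ : ℝ => ‖x + τ • (y - x) - z.1‖) (Set.Icc 0 1) :=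
        Continuous.continuousOn (by fun_prop)
      obtain ⟨τ, hτ, hτe⟩ := intermediate_value_Icc zero_le_one hcont
        (show 2 * R ∈ Set.Icc _ _ by simpa using ⟨hx, hy⟩)
      simp only at hτe
      set w := x + τ • (y - x) with hw
      have h1 := hnear x w hx hτe.le
      have h2 := hfar w y hτe.ge hy
      have h3 : ‖x - w‖ = τ * ‖x - y‖ := by
        rw [show x - w = τ • (x - y) by rw [hw]; module, norm_smul, Real.norm_of_nonneg hτ.1]
      have h4 : ‖w - y‖ = (1 - τ) * ‖x - y‖ := by
        rw [show w - y = (1 - τ) • (x - y) by rw [hw]; module, norm_smul,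
          Real.norm_of_nonneg (by linarith [hτ.2])]
      rw [h3] at h1
      rw [h4] at h2
      refine (abs_sub_le _ _ _).trans ((add_le_add h1 h2).trans_eq ?_)
      ring
    rcases le_total ‖x - z.1‖ (2 * R) with hx | hx <;> rcases le_total ‖y - z.1‖ (2 * R) with hy | hy
    · exact hnear x y hx hy
    · exact hmix x y hx hy
    · rw [abs_sub_comm, norm_sub_rev]; exact hmix y x hy hx
    · exact hfar x y hx hy
  · refine (abs_localize_time_sub_le_sqrt hR hN hN₁ hψ hz _ t τ).trans ?_
    gcongr

end Localization

/-! ### Oscillation of the gradient of the localised function -/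

section LocalizedGradient

variable {m : ℕ} {ℓ A R N θ : ℝ} {φ : SpaceTime m → ℝ} {z : SpaceTime m} {a : 𝕏 m}

theorem isLipHalfOn_spaceCutoff (c : 𝕏 m) (hR : 0 < R) :
    IsLipHalfOn (1 / (2 * R)) (fun p : SpaceTime m => spaceCutoff c R p.1) univ := by
  refine isLipHalfOn_univ_of_space_time (fun x y t => ?_) fun x t τ => ?_
  · refine (abs_spaceCutoff_sub_le c hR x y).trans_eq (by ring)
  · rw [sub_self, abs_zero]; positivity

theorem norm_spatialGradient_sub_eq {Φ : SpaceTime m → ℝ} {p : SpaceTime m}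
    {g : 𝕏 m} {D : 𝕏 m →L[ℝ] ℝ}
    (h : HasFDerivAt (fun x => Φ (x, p.2)) D p.1) :
    ‖∇ₓ Φ p - g‖ = ‖D - InnerProductSpace.toDual ℝ _ g‖ := by
  rw [spatialGradient, gradient, h.fderiv,
    ← (InnerProductSpace.toDual ℝ 𝕏 m).norm_map, map_sub,
    LinearIsometryEquiv.apply_symm_apply]

theorem hasFDerivAt_affineAt (φ : SpaceTime m → ℝ) (z : SpaceTime m) (a x : 𝕏 m) :
    HasFDerivAt (affineAt φ z a) (InnerProductSpace.toDual ℝ 𝕏 m a) x := by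
  have h2 := (((innerSL ℝ a).hasFDerivAt (x := x)).sub_const (inner ℝ a z.1)).const_add (φ z)
  have h3 : affineAt φ z a = fun x => φ z + (innerSL ℝ a x - inner ℝ a z.1 : ℝ) := by
    ext x
    simp [affineAt, inner_sub_right]
  have h4 : InnerProductSpace.toDual ℝ 𝕏 m a
      = (innerSL ℝ a : 𝕏 m →L[ℝ] ℝ) := by ext v; simp
  rw [h3, h4]
  exact h2

/-- The product rule: the only other term is the gradient of the cutoff, of size 1/(2R), times the
affine remainder, of size N wherever that gradient and the time cutoff are both nonzero. -/
theorem norm_spatialGradient_localize_sub_le (hR : 0 < R) (hN : 0 ≤ N)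
    (hψ : ∀ p ∈ 𝒬 z (8 * R), |φ p - affineAt φ z a p.1| ≤ N) {p : SpaceTime m}
    (hp : DifferentiableAt ℝ (fun x => φ (x, p.2)) p.1)
    (hc : DifferentiableAt ℝ (spaceCutoff z.1 R) p.1) :
    ‖∇ₓ (localize φ z a R) p - (a + cutoff z R p • (∇ₓ φ p - a))‖
      ≤ N / (2 * R) := by
  set T := InnerProductSpace.toDual ℝ 𝕏 m
  have h1 := hasFDerivAt_affineAt φ z a p.1
  have h2 : HasFDerivAt (fun x => φ (x, p.2)) (T (∇ₓ φ p)) p.1 :=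
    hp.hasGradientAt.hasFDerivAt
  have h3 := (hc.hasFDerivAt.mul_const (timeCutoff z.2 R p.2)).mul (h2.fun_sub h1)
  have h4 : HasFDerivAt (fun x => localize φ z a R (x, p.2)) _ p.1 := h1.add h3
  rw [norm_spatialGradient_sub_eq h4]
  have h5 : ‖fderiv ℝ (spaceCutoff z.1 R) p.1‖ ≤ 1 / (2 * R) := by
    have := (isLipHalfOn_spaceCutoff (m := m) z.1 hR).lipschitzWith 0
    have h6 := norm_fderiv_le_of_lipschitz ℝ this (x₀ := p.1)
    rwa [Real.coe_toNNReal _ (by positivity)] at h6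
  have h7 : ‖(timeCutoff z.2 R p.2 * (φ p - affineAt φ z a p.1)) • fderiv ℝ (spaceCutoff z.1 R) p.1‖
      ≤ N / (2 * R) := by
    rw [norm_smul, norm_mul]
    by_cases ht : timeCutoff z.2 R p.2 = 0
    · rw [ht]; simp; positivity
    by_cases hx : ‖p.1 - z.1‖ ≤ 4 * R
    · have hmem : p ∈ 𝒬 z (8 * R) := by
        refine ⟨mem_spatialCube_of_norm_lt ?_, (mem_timeInterval (by positivity)).2 ?_⟩
        · rw [norm_sub_rev]; linarith
        · by_contra! h8
          rw [abs_sub_comm] at h8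
          exact ht (timeCutoff_eq_zero hR (by nlinarith))
      have h8 := hψ p hmem
      have h9 : ‖timeCutoff z.2 R p.2‖ ≤ 1 := by
        rw [Real.norm_of_nonneg (by exact (unitClamp_mem _).1)]; exact (unitClamp_mem _).2
      calc _ ≤ 1 * N * (1 / (2 * R)) := by
            gcongr
            exact h8
        _ = _ := by ring
    · have h8 : fderiv ℝ (spaceCutoff z.1 R) p.1 = 0 := by
        have : spaceCutoff z.1 R =ᶠ[nhds p.1] fun _ => (0 : ℝ) := by
          have ho : IsOpen {x : 𝕏 m | 4 * R < ‖x - z.1‖} :=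
            isOpen_lt continuous_const (by fun_prop)
          filter_upwards [ho.mem_nhds (not_le.1 hx)] with x hx
          exact spaceCutoff_eq_zero hR (le_of_lt hx)
        rw [this.fderiv_eq]
        simp
      rw [h8, norm_zero, mul_zero]
      positivity
  refine le_trans (le_of_eq ?_) h7
  congr 1
  ext v
  simp only [map_add, map_smul, map_sub, ContinuousLinearMap.sub_apply, ContinuousLinearMap.add_apply,
    ContinuousLinearMap.smul_apply, smul_eq_mul, cutoff, T, Pi.sub_apply]
  ring

theorem setAverage_le_of_ae_le_add {f g : SpaceTime m → ℝ} {B : ℝ} {w : SpaceTime m} {s : ℝ} (hs : 0 < s)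
    (hf : IntegrableOn f (𝒬 w s)) (hg : IntegrableOn g (𝒬 w s))
    (h : ∀ᵐ p, p ∈ 𝒬 w s → f p ≤ g p + B) :
    ⨍ p in 𝒬 w s, f p ≤ (⨍ p in 𝒬 w s, g p) + B := by
  have hfin := (volume_parabolicCube_lt_top w s).ne
  have hne := (volume_parabolicCube_pos w hs).ne'
  have h1 : ⨍ p in 𝒬 w s, f p ≤ ⨍ p in 𝒬 w s, (g p + B) := by
    rw [setAverage_eq, setAverage_eq, smul_eq_mul, smul_eq_mul]
    refine mul_le_mul_of_nonneg_left ?_ (by positivity)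
    refine setIntegral_mono_ae_restrict hf (hg.add (integrableOn_const hfin)) ?_
    exact (ae_restrict_iff' (measurableSet_parabolicCube w s)).2 h
  refine h1.trans_eq ?_
  rw [setAverage_add hg (integrableOn_const hfin), setAverage_const hne hfin]

/-- Slopes at a small scale are controlled by those at a large scale. -/
theorem OscControl.norm_slope_sub_le {S : Set (SpaceTime m)} (h : OscControl ℓ A φ S) {σ s : ℝ}
    (hs : 0 < s) {w z : SpaceTime m} (hz : 𝒬 z (4 * σ) ⊆ S) (hw : 𝒬 w s ⊆ 𝒬 z (2 * σ))
    (hsσ : s ≤ σ) :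
    s * ‖(⨍ q in 𝒬 w s, ∇ₓ φ q) - ⨍ q in 𝒬 z (4 * σ), ∇ₓ φ q‖
      ≤ 10 * zygmundConst m * A * σ := by
  have hσ : 0 < σ := hs.trans_le hsσ
  have hA := h.pos
  have hZ := zygmundConst_pos m
  have h24 : 𝒬 z (2 * σ) ⊆ 𝒬 z (4 * σ) := parabolicCube_mono (by linarith)
  set b := ⨍ q in 𝒬 w s, ∇ₓ φ q with hb
  set a := ⨍ q in 𝒬 z (4 * σ), ∇ₓ φ q with ha
  rcases eq_or_ne (b - a) 0 with h0 | h0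
  · rw [h0, norm_zero, mul_zero]; positivity
  -- The two affine approximations, at scales s/2 and 2σ, are compared along a vector of length s/4
  -- in the direction b - a. The bound on s‖b - a‖ is weaker than the logarithmic one from
  -- telescoping, but it is later multiplied only by an increment of the cutoff, which is O(s/R).
  set v := (s / 4) • (‖b - a‖⁻¹ • (b - a)) with hv
  have hv0 : ‖b - a‖ ≠ 0 := norm_ne_zero_iff.2 h0
  have hvn : ‖v‖ = s / 4 := by
    rw [hv, norm_smul, norm_smul, norm_inv, norm_norm, inv_mul_cancel₀ hv0, mul_one,
      Real.norm_of_nonneg (by positivity)]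
  set p : SpaceTime m := w
  set q : SpaceTime m := (w.1 + v, w.2)
  have hp : p ∈ 𝒬 w (s / 2) := self_mem_parabolicCube w (by positivity)
  have hq : q ∈ 𝒬 w (s / 2) := by
    refine ⟨mem_spatialCube_of_norm_lt ?_, ?_⟩
    · simp only [q, sub_add_cancel_left, norm_neg, hvn]; linarith
    · simp [q, timeInterval, hs]
  have hhalf : 𝒬 w (s / 2) ⊆ 𝒬 z (2 * σ) :=
    (parabolicCube_mono (by linarith)).trans hw
  have e1 : 2 * (s / 2) = s := by ring
  have e2 : 2 * (2 * σ) = 4 * σ := by ring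
  have h1 := h.abs_subAffine_sub_le (z := w) (s := s / 2) (by positivity)
    (by rw [e1]; exact hw.trans (h24.trans hz)) hp hq w.1
  have h2 := h.abs_subAffine_sub_le (z := z) (s := 2 * σ) (by positivity)
    (by rw [e2]; exact hz) (hhalf hp) (hhalf hq) w.1
  rw [e1, ← hb] at h1
  rw [e2, ← ha] at h2
  have h3 : (inner ℝ (b - a) v : ℝ) = s / 4 * ‖b - a‖ := by
    rw [hv, inner_smul_right, inner_smul_right, real_inner_self_eq_norm_sq]
    field_simp
  have h4 : (inner ℝ (b - a) v : ℝ) = (subAffine φ b w.1 p - subAffine φ b w.1 q)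
      - (subAffine φ a w.1 p - subAffine φ a w.1 q) := by
    simp only [subAffine, p, q, sub_self, inner_zero_right, add_sub_cancel_left, inner_sub_left]
    ring
  have h5 := abs_sub (subAffine φ b w.1 p - subAffine φ b w.1 q) (subAffine φ a w.1 p - subAffine φ a w.1 q)
  rw [← h4, h3, abs_of_nonneg (by positivity)] at h5
  have h6 : zygmundConst m * A * (s / 2) ≤ zygmundConst m * A * (σ / 2) := by gcongr
  linarith

theorem abs_cutoff_sub_le_of_mem {w p : SpaceTime m} {s : ℝ} (hR : 0 < R) (hs : 0 < s) (hsR : s ≤ R)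
    (hp : p ∈ 𝒬 w s) : |cutoff z R p - cutoff z R w| ≤ (m + 1) * s / R := by
  have h1 := abs_cutoff_space_sub_le (z := z) hR p.1 w.1 p.2
  have h2 := abs_cutoff_time_sub_le (z := z) hR w.1 p.2 w.2
  have h3 := norm_sub_le_of_mem_spatialCube hs.le hp.1
  have h4 := (mem_timeInterval hs).1 hp.2
  rw [norm_sub_rev] at h3
  rw [abs_sub_comm] at h4
  have h5 := abs_sub_le (cutoff z R p) (cutoff z R (w.1, p.2)) (cutoff z R w)
  have h6 : ‖p.1 - w.1‖ / (2 * R) ≤ m * s / R := by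
    rw [div_le_div_iff₀ (by positivity) hR]
    have : 0 ≤ m * s * R := by positivity
    nlinarith
  have h7 : |p.2 - w.2| / R ^ 2 ≤ s / R := by
    rw [div_le_div_iff₀ (by positivity) hR]
    have : s ^ 2 ≤ s * R := by nlinarith
    calc _ ≤ s ^ 2 * R := by gcongr
      _ ≤ s * R * R := by gcongr
      _ = _ := by ring
  have h8 : (m + 1) * s / R = m * s / R + s / R := by ring
  rw [h8]
  simp only [Prod.mk.eta] at h1 h2
  linarith

/-- The constant in the oscillation estimate for the localised function. -/
def localizeConst (m : ℕ) : ℝ := 16 ^ (m + 2) + 160 * (m + 1) * zygmundConst m + 4 * zygmundConst m + 1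

/-- Three regimes. On a cube with s ≤ R meeting the support, the cutoff is nearly constant and the
comparison gradient is a plus the cutoff at w times the local slope deviation. On a small cube off
the support it is a itself. On a large cube the whole deviation sits in the fixed cube of radius
16R, of volume at most 16^{m+2} times that of the given cube. -/
theorem OscControl.exists_average_localize_le (h : OscControl ℓ A φ (𝒬 z (16 * R)))
    (hR : 0 < R) (ha : a = ⨍ q in 𝒬 z (16 * R), ∇ₓ φ q)
    {M : ℝ} (hlip : IsLipHalfOn M (localize φ z a R) univ)
    (hψ : ∀ p ∈ 𝒬 z (8 * R), |φ p - affineAt φ z a p.1| ≤ 8 * zygmundConst m * A * R)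
    (w : SpaceTime m) {s : ℝ} (hs : 0 < s) :
    ∃ c, ⨍ p in 𝒬 w s, ‖∇ₓ (localize φ z a R) p - c‖ ≤ localizeConst m * A := by
  have hA := h.pos
  have hZ := zygmundConst_pos m
  have hm : (0 : ℝ) ≤ m := Nat.cast_nonneg m
  have hfin : ∀ w s, volume (parabolicCube (m := m) w s) ≠ ⊤ := fun w s => (volume_parabolicCube_lt_top w s).ne
  have hne := (volume_parabolicCube_pos w hs).ne'
  have hae : ∀ᵐ p : SpaceTime m, ‖∇ₓ (localize φ z a R) p
      - (a + cutoff z R p • (∇ₓ φ p - a))‖ ≤ 4 * zygmundConst m * A := by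
    filter_upwards [h.lip.ae_differentiableAt, (isLipHalfOn_spaceCutoff z.1 hR).ae_differentiableAt]
      with p hp1 hp2
    refine (norm_spatialGradient_localize_sub_le hR (by positivity) hψ hp1 hp2).trans_eq ?_
    field_simp
    norm_num
  have hint1 : ∀ c, IntegrableOn (fun p => ‖∇ₓ (localize φ z a R) p - c‖) (𝒬 w s) :=
    fun c => (hlip.isBddMeas.sub_const c).norm.integrableOn (hfin w s)
  have hint2 : ∀ w s c, IntegrableOn (fun p => ‖∇ₓ φ p - c‖) (𝒬 w s) :=
    fun w s c => (h.lip.isBddMeas.sub_const c).norm.integrableOn (hfin w s)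
  rcases le_or_gt s R with hsR | hsR
  · by_cases hmeet : (𝒬 w s ∩ 𝒬 z (4 * R)).Nonempty
    · obtain ⟨p₀, hp1, hp2⟩ := hmeet
      have hw : w ∈ 𝒬 z (4 * R + s) :=
        parabolicCube_mem_trans hp2 (mem_parabolicCube_comm.1 hp1)
      have hsub : 𝒬 w s ⊆ 𝒬 z (2 * (4 * R)) :=
        parabolicCube_subset_of_mem hw (by linarith)
      have e4 : 4 * (4 * R) = 16 * R := by ring
      have hslope := h.norm_slope_sub_le (σ := 4 * R) hs (z := z) (by rw [e4]) hsub (by linarith)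
      rw [e4, ← ha] at hslope
      set b := ⨍ q in 𝒬 w s, ∇ₓ φ q with hb
      refine ⟨a + cutoff z R w • (b - a), ?_⟩
      have hosc := h.osc w s hs (hsub.trans (parabolicCube_mono (by linarith)))
      rw [← hb] at hosc
      refine (setAverage_le_of_ae_le_add hs (hint1 _) (hint2 w s b)
        (B := 40 * (m + 1) * zygmundConst m * A + 4 * zygmundConst m * A) ?_).trans ?_
      · filter_upwards [hae] with p hp hpQ
        have h1 := abs_cutoff_sub_le_of_mem (z := z) hR hs hsR hpQ
        have h2 : ∇ₓ (localize φ z a R) p - (a + cutoff z R w • (b - a))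
            = (∇ₓ (localize φ z a R) p - (a + cutoff z R p • (∇ₓ φ p - a)))
              + cutoff z R p • (∇ₓ φ p - b) + (cutoff z R p - cutoff z R w) • (b - a) := by
          module
        rw [h2]
        refine (norm_add_le _ _).trans ?_
        have h3 := norm_add_le (∇ₓ (localize φ z a R) p
          - (a + cutoff z R p • (∇ₓ φ p - a))) (cutoff z R p • (∇ₓ φ p - b))
        have h4 : ‖cutoff z R p • (∇ₓ φ p - b)‖ ≤ ‖∇ₓ φ p - b‖ := by
          rw [norm_smul, Real.norm_of_nonneg (cutoff_nonneg _ _ _)]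
          exact mul_le_of_le_one_left (norm_nonneg _) (cutoff_le_one _ _ _)
        have h5 : ‖(cutoff z R p - cutoff z R w) • (b - a)‖ ≤ 40 * (m + 1) * zygmundConst m * A := by
          rw [norm_smul, Real.norm_eq_abs]
          calc _ ≤ (m + 1) * s / R * ‖b - a‖ := by gcongr
            _ = (m + 1) / R * (s * ‖b - a‖) := by ring
            _ ≤ (m + 1) / R * (10 * zygmundConst m * A * (4 * R)) := by gcongr
            _ = _ := by field_simp; ring
        linarith
      · rw [localizeConst]
        have : (0 : ℝ) ≤ 16 ^ (m + 2) * A := by positivity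
        nlinarith [mul_nonneg (mul_nonneg hm hZ.le) hA.le, mul_nonneg hZ.le hA.le]
    · refine ⟨a, ?_⟩
      refine (setAverage_le_of_ae_le_add hs (hint1 _) (g := fun _ => 0) (integrableOn_const (hfin w s))
        (B := 4 * zygmundConst m * A) ?_).trans ?_
      · filter_upwards [hae] with p hp hpQ
        have h1 : cutoff z R p = 0 := by
          by_contra h2
          exact hmeet ⟨p, hpQ, mem_of_cutoff_ne_zero hR h2⟩
        rw [h1, zero_smul, add_zero] at hp
        linarith
      · rw [setAverage_const hne (hfin w s), localizeConst]
        have : (0 : ℝ) ≤ 16 ^ (m + 2) * A := by positivity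
        nlinarith [mul_nonneg (mul_nonneg hm hZ.le) hA.le, mul_nonneg hZ.le hA.le]
  · refine ⟨a, ?_⟩
    have hosc := h.osc z (16 * R) (by positivity) subset_rfl
    rw [← ha] at hosc
    set Q := 𝒬 z (16 * R) with hQ
    have hQm : MeasurableSet Q := measurableSet_parabolicCube _ _
    have hint3 : Integrable (Q.indicator fun p => ‖∇ₓ φ p - a‖) :=
      (integrable_indicator_iff hQm).2 (hint2 z _ a)
    refine (setAverage_le_of_ae_le_add hs (hint1 _) (g := Q.indicator fun p => ‖∇ₓ φ p - a‖)
      hint3.integrableOn (B := 4 * zygmundConst m * A) ?_).trans ?_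
    · filter_upwards [hae] with p hp _
      have h2 : ∇ₓ (localize φ z a R) p - a
            = (∇ₓ (localize φ z a R) p - (a + cutoff z R p • (∇ₓ φ p - a)))
              + cutoff z R p • (∇ₓ φ p - a) := by module
      rw [h2]
      refine (norm_add_le _ _).trans ?_
      rw [add_comm]
      refine add_le_add ?_ hp
      by_cases hpQ : p ∈ Q
      · rw [indicator_of_mem hpQ, norm_smul, Real.norm_of_nonneg (cutoff_nonneg _ _ _)]
        exact mul_le_of_le_one_left (norm_nonneg _) (cutoff_le_one _ _ _)
      · have h1 : cutoff z R p = 0 := by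
          by_contra h2
          exact hpQ (parabolicCube_mono (by linarith) (mem_of_cutoff_ne_zero hR h2))
        rw [indicator_of_notMem hpQ, h1, zero_smul, norm_zero]
    · have h1 : ⨍ p in 𝒬 w s, Q.indicator (fun p => ‖∇ₓ φ p - a‖) p
          ≤ 16 ^ (m + 2) * A := by
        have hv := measureReal_parabolicCube_mul z w (r := 16 * R) (s := s) (by positivity) hs
        have hpos := measureReal_parabolicCube_pos w hs
        have hpos' := measureReal_parabolicCube_pos z (r := 16 * R) (by positivity)
        rw [setAverage_eq, smul_eq_mul, inv_mul_le_iff₀ hpos]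
        rw [setAverage_eq, smul_eq_mul, inv_mul_le_iff₀ hpos'] at hosc
        calc _ ≤ ∫ p, Q.indicator (fun p => ‖∇ₓ φ p - a‖) p :=
              setIntegral_le_integral hint3 (ae_of_all _ fun p =>
                Set.indicator_nonneg (fun _ _ => norm_nonneg _) p)
          _ ≤ volume.real Q * A := by rw [integral_indicator hQm]; exact hosc
          _ ≤ _ := by
              rw [hQ, hv]
              have h3 : (16 * R / s) ^ (m + 2) ≤ 16 ^ (m + 2) := by
                gcongr
                rw [div_le_iff₀ hs]; linarith
              calc _ = (16 * R / s) ^ (m + 2) * (volume.real (𝒬 w s) * A) := by ring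
                _ ≤ 16 ^ (m + 2) * (volume.real (𝒬 w s) * A) := by gcongr
                _ = _ := by ring
      rw [localizeConst]
      nlinarith [mul_nonneg (mul_nonneg hm hZ.le) hA.le, mul_nonneg hZ.le hA.le]

/-- By the chain rule the error is the derivative of Φ composed with the derivative of the
contraction minus the identity, of norms M and 2θ. -/
theorem norm_spatialGradient_comp_sub_le {Φ : SpaceTime m → ℝ} {M : ℝ} (hΦ : IsLipHalfOn M Φ univ)
    (hθ : 0 ≤ θ) (hR : 0 < R) {c : 𝕏 m} {p : SpaceTime m}
    (h1 : DifferentiableAt ℝ (contraction θ R c) p.1)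
    (h2 : DifferentiableAt ℝ (fun x => Φ (x, p.2)) (contraction θ R c p.1)) :
    ‖∇ₓ (fun p => Φ (spaceMap (contraction θ R c) p)) p
      - ∇ₓ Φ (spaceMap (contraction θ R c) p)‖ ≤ 2 * θ * M := by
  have h3 : HasFDerivAt (fun x => Φ (x, p.2)) (InnerProductSpace.toDual ℝ _
      (∇ₓ Φ (spaceMap (contraction θ R c) p))) (contraction θ R c p.1) :=
    h2.hasGradientAt.hasFDerivAt
  have h4 : HasFDerivAt (fun x => Φ (spaceMap (contraction θ R c) (x, p.2))) _ p.1 :=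
    h3.comp p.1 h1.hasFDerivAt
  rw [norm_spatialGradient_sub_eq (Φ := fun p => Φ (spaceMap (contraction θ R c) p)) h4]
  set D := InnerProductSpace.toDual ℝ 𝕏 m
    (∇ₓ Φ (spaceMap (contraction θ R c) p))
  have h5 : D.comp (fderiv ℝ (contraction θ R c) p.1) - D
      = D.comp (fderiv ℝ (contraction θ R c) p.1 - ContinuousLinearMap.id ℝ _) := by
    rw [ContinuousLinearMap.comp_sub, ContinuousLinearMap.comp_id]
  rw [h5]
  refine (ContinuousLinearMap.opNorm_comp_le _ _).trans ?_
  have h6 : ‖D‖ ≤ M := by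
    rw [LinearIsometryEquiv.norm_map]; exact hΦ.norm_spatialGradient_le _
  rw [mul_comm]
  exact mul_le_mul (norm_fderiv_contraction_sub_id_le hθ hR h1) h6 (norm_nonneg _) (by positivity)

/-- Oscillation of the gradient after composition with the contraction. -/
theorem average_spatialGradient_comp_le {Φ : SpaceTime m → ℝ} {M M' B : ℝ} (hΦ : IsLipHalfOn M Φ univ)
    (hθ : 0 ≤ θ) (hθ1 : θ ≤ 1 / 4) (hR : 0 < R) {c : 𝕏 m}
    (hΦ' : IsLipHalfOn M' (fun p => Φ (spaceMap (contraction θ R c) p)) univ)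
    {w : SpaceTime m} {s : ℝ} (hs : 0 < s) {v : 𝕏 m}
    (h : ⨍ p in 𝒬 (spaceMap (contraction θ R c) w) ((m + 1) * s),
      ‖∇ₓ Φ p - v‖ ≤ B) :
    ⨍ p in 𝒬 w s, ‖∇ₓ (fun p => Φ (spaceMap (contraction θ R c) p)) p - v‖
      ≤ pullbackConst m * B + 2 * θ * M := by
  have hP := antilipschitzWith_contraction (c := c) hθ hθ1 hR
  have hP1 := lipschitzWith_contraction (c := c) hθ (by linarith) hR
  have hs' : 0 < (m + 1) * s := by positivity
  set P := contraction θ R c with hPd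
  have hfin := (volume_parabolicCube_lt_top w s).ne
  have hG := hΦ.isBddMeas.sub_const v
  have hGm : StronglyMeasurable fun p => ∇ₓ Φ (spaceMap P p) - v :=
    hG.meas.comp_measurable (measurable_spaceMap hP1.continuous)
  have hGb : IsBddMeas (fun p => ∇ₓ Φ (spaceMap P p) - v) (M + ‖v‖) :=
    ⟨hGm, fun p => hG.bound _⟩
  have hdiff : ∀ᵐ p : SpaceTime m, DifferentiableAt ℝ P p.1 := by
    have h1 : ∀ᵐ p : SpaceTime m ∂(volume.prod volume), DifferentiableAt ℝ P p.1 :=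
      Measure.quasiMeasurePreserving_fst.ae (hP1.ae_differentiableAt (μ := volume))
    exact h1
  have hB : 0 ≤ B := (setAverage_nonneg fun _ => norm_nonneg _).trans h
  refine (setAverage_le_of_ae_le_add hs ((hΦ'.isBddMeas.sub_const v).norm.integrableOn hfin)
    (hGb.norm.integrableOn hfin) (B := 2 * θ * M) ?_).trans ?_
  · filter_upwards [hdiff, ae_comp_spaceMap hP hP1.continuous hΦ.ae_differentiableAt] with p hp1 hp2 _
    have h1 := norm_spatialGradient_comp_sub_le hΦ hθ hR hp1 hp2
    have h2 := norm_sub_le_norm_sub_add_norm_sub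
      (∇ₓ (fun p => Φ (spaceMap P p)) p) (∇ₓ Φ (spaceMap P p)) v
    linarith
  · gcongr
    have h1 := laverage_comp_spaceMap_le hP hP1 w hs (f := fun p => ‖∇ₓ Φ p - v‖ₑ)
      hG.meas.enorm
    have h2 := laverage_enorm_eq_ofReal hs (hGb.integrableOn hfin)
    have h3 := laverage_enorm_eq_ofReal hs' (z := spaceMap P w)
      (hG.integrableOn (volume_parabolicCube_lt_top _ _).ne)
    rw [setLAverage_eq, ENNReal.div_eq_inv_mul] at h2 h3
    rw [h2, h3, ← ofReal_mul (pullbackConst_nonneg m)] at h1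
    refine ((ofReal_le_ofReal_iff ?_).1 h1).trans ?_
    · exact mul_nonneg (pullbackConst_nonneg m) (setAverage_nonneg fun _ => norm_nonneg _)
    · exact mul_le_mul_of_nonneg_left h (pullbackConst_nonneg m)

end LocalizedGradient

/-! ### Extension of `Lip(1,1/2)` functions with control of the oscillation -/

section Extension

variable {m : ℕ} {ℓ A R r : ℝ} {φ : SpaceTime m → ℝ} {z : SpaceTime m}

theorem hasMeanOscLE_of_exists {f : SpaceTime m → 𝕏 m} {M B : ℝ} (hf : IsBddMeas f M)
    (h : ∀ w s, 0 < s → ∃ c, ⨍ p in 𝒬 w s, ‖f p - c‖ ≤ B) :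
    HasMeanOscLE (2 * B) f univ := by
  intro w s hs _
  obtain ⟨c, hc⟩ := h w s hs
  have hfin := (volume_parabolicCube_lt_top w s).ne
  exact (setAverage_norm_sub_average_le (hf.integrableOn hfin) c hfin
    (volume_parabolicCube_pos w hs).ne').trans (by gcongr)

/-- The constant for the truncated extension. -/
def truncateConst (m : ℕ) : ℝ :=
  4 ^ (m + 2) * (2 + (32 * zygmundConst m) ^ 2) + 128 * (32 * zygmundConst m) ^ 2

/-- The constant for the time differences of the localised extension. -/
def localizeTimeConst (m : ℕ) : ℝ :=
  pullbackConst m * (4 ^ (m + 2) * (2 + 1024 * zygmundConst m ^ 2) + 512 * zygmundConst m ^ 2)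

/-- The constant for the gradient of the localised extension. -/
def localizeOscConst (m : ℕ) : ℝ := 2 * (pullbackConst m * localizeConst m + 32 * zygmundConst m)

/-- When ℓ is comparable to A, a global gradient bound by ℓ already gives oscillation of order A.
The truncation radius 2R = (2m+2)r is the smallest allowed by `IsLipHalfOn.eqOn_truncateOutside`. -/
theorem OscControl.exists_extension_of_le (h : OscControl ℓ A φ (𝒬 z (16 * R))) (hr : 0 < r)
    (hR : R = (m + 1) * r) (hℓ : ℓ ≤ 32 * zygmundConst m * A) :
    ∃ Φ, Set.EqOn Φ φ (𝒬 z r) ∧ IsLipHalfOn ℓ Φ univ ∧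
      HasMeanOscLE (64 * zygmundConst m * A) (∇ₓ Φ) univ ∧
      ∀ w s, 0 < s → timeDifference Φ w s ≤ ofReal (truncateConst m * A ^ 2) := by
  have hR0 : 0 < R := by rw [hR]; positivity
  have hlip := h.lip.truncateOutside z (by positivity : 0 < 2 * R)
  refine ⟨truncateOutside ℓ φ z (2 * R), h.lip.eqOn_truncateOutside z hr (by rw [hR]; linarith),
    hlip, ?_, fun w s hs => ?_⟩
  · have h1 := hasMeanOscLE_of_exists hlip.isBddMeas (B := 32 * zygmundConst m * A) fun w s hs => ?_
    · intro w s hs hS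
      refine (h1 w s hs hS).trans_eq (by ring)
    · refine ⟨0, ?_⟩
      have hfin := (volume_parabolicCube_lt_top w s).ne
      refine setAverage_le_const (measurableSet_parabolicCube w s)
        ((hlip.isBddMeas.sub_const 0).norm.integrableOn hfin) hfin (volume_parabolicCube_pos w hs).ne' ?_
      intro p _
      rw [sub_zero]
      exact (hlip.norm_spatialGradient_le p).trans hℓ
  · exact timeDifference_truncateOutside_le h.lip (by positivity) hℓ (fun w s hs hw =>
      h.time w s hs (hw.trans (parabolicCube_mono (by linarith)))) w hs

theorem timeDifference_localize_le {N a} (hR : 0 < R) (hN : 0 ≤ N)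
    (hφ : IsLipHalfOn ℓ φ univ)
    (hψ : ∀ p ∈ 𝒬 z (8 * R), |φ p - affineAt φ z a p.1| ≤ N)
    (htime : ∀ w s, 0 < s → 𝒬 w s ⊆ 𝒬 z (8 * R) →
      timeDifference φ w s ≤ ofReal (A ^ 2)) {M : ℝ}
    (hlip : IsLipHalfOn M (localize φ z a R) univ) (w : SpaceTime m) {s : ℝ} (hs : 0 < s) :
    timeDifference (localize φ z a R) w s ≤
      ofReal (4 ^ (m + 2) * (2 * A ^ 2 + 16 * (N / R) ^ 2) + 8 * (N / R) ^ 2) := by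
  have e1 : 2 * (4 * R) = 8 * R := by ring
  refine (timeDifference_le_of_localized hlip.continuous hφ.continuous
    (b := N / R ^ 2) (D := 2 * N) (σ := 4 * R) (z := z) (B := ofReal (A ^ 2)) (by positivity)
    (by positivity) (by rw [e1]; exact htime)
    (fun x t τ _ hτ => ?_) (fun x t τ h1 h2 => ?_)
    (fun x t τ => ?_) w hs).trans ?_
  · rw [e1] at hτ
    exact abs_localize_time_sub_le hR hψ hτ
  · have h3 : cutoff z R (x, t) = 0 := by by_contra h; exact h1 (mem_of_cutoff_ne_zero hR h)
    have h4 : cutoff z R (x, τ) = 0 := by by_contra h; exact h2 (mem_of_cutoff_ne_zero hR h)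
    simp [localize, h3, h4]
  · have h1 := abs_localize_sub_affineAt_le hR hN hψ (x, t)
    have h2 := abs_localize_sub_affineAt_le hR hN hψ (x, τ)
    rw [abs_sub_comm] at h2
    have h3 := abs_sub_le (localize φ z a R (x, t)) (affineAt φ z a x) (localize φ z a R (x, τ))
    simp only at h1 h2
    linarith
  · rw [show (4 : ℝ≥0∞) = ofReal 4 by simp, show (2 : ℝ≥0∞) = ofReal 2 by simp,
      ← ofReal_pow (by norm_num), ← ofReal_mul (by norm_num),
      ← ofReal_add (by positivity) (by positivity), ← ofReal_mul (by positivity),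
      ← ofReal_add (by positivity) (by positivity)]
    refine ofReal_le_ofReal (le_of_eq ?_)
    have h1 : (N / R ^ 2) ^ 2 * (4 * R) ^ 2 = 16 * (N / R) ^ 2 := by field_simp; ring
    have h2 : 32 * (2 * N) ^ 2 / (4 * R) ^ 2 = 8 * (N / R) ^ 2 := by field_simp; ring
    rw [h1, h2]

/-- When ℓ dominates A there is room in the time direction, where the interpolated function needs
only 17ZA < ℓ. In space the excess over ℓ is 4ZA, to be removed by the contraction. -/
theorem OscControl.exists_extension_of_lt (h : OscControl ℓ A φ (𝒬 z (16 * R))) (hr : 0 < r)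
    (hR : R = (m + 1) * r) (hℓ : 32 * zygmundConst m * A < ℓ) :
    ∃ Φ, Set.EqOn Φ φ (𝒬 z r) ∧ IsLipHalfOn ℓ Φ univ ∧
      HasMeanOscLE (localizeOscConst m * A) (∇ₓ Φ) univ ∧
      ∀ w s, 0 < s → timeDifference Φ w s ≤ ofReal (localizeTimeConst m * A ^ 2) := by
  have hR0 : 0 < R := by rw [hR]; positivity
  have hA := h.pos
  have hZ := zygmundConst_pos m
  set Z := zygmundConst m with hZd
  have hZA : 0 < Z * A := by positivity
  have hℓ0 : 0 < ℓ := by linarith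
  set a := ⨍ q in 𝒬 z (16 * R), ∇ₓ φ q with ha
  set N := 8 * Z * A * R with hN
  have hN0 : 0 ≤ N := by positivity
  have haℓ : ‖a‖ ≤ ℓ := h.lip.norm_cubeAverage_spatialGradient_le z (by positivity)
  -- Since ℓθ = 8ZA, one has (ℓ + 4ZA)(1 - θ/2) = ℓ - 2θZA ≤ ℓ. The threshold 32 in the case
  -- distinction gives θ ≤ 1/4. The change of gradient is of order θℓ, again a multiple of A.
  set θ := 8 * Z * A / ℓ with hθd
  have hθ : 0 ≤ θ := by positivity
  have hθ1 : θ ≤ 1 / 4 := by rw [hθd, div_le_iff₀ hℓ0]; linarith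
  have hψ : ∀ p ∈ 𝒬 z (8 * R), |φ p - affineAt φ z a p.1| ≤ N := by
    intro p hp
    have e1 : 2 * (8 * R) = 16 * R := by ring
    have h1 := h.abs_subAffine_sub_le (z := z) (s := 8 * R) (by positivity) (by rw [e1]) hp
      (self_mem_parabolicCube z (by positivity)) z.1
    rw [e1, ← ha] at h1
    have h2 : φ p - affineAt φ z a p.1 = subAffine φ a z.1 p - subAffine φ a z.1 z := by
      simp only [subAffine, affineAt, sub_self, inner_zero_right]; ring
    rw [h2]
    exact h1.trans_eq (by rw [hN]; ring)
  have hz : ∀ x t τ, (x, t) ∈ 𝒬 z (4 * R) → √|t - τ| ≤ 2 * R →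
      |φ (x, t) - φ (x, τ)| ≤ Z * A * √|t - τ| := by
    intro x t τ hx hτ
    refine h.abs_time_sub_le_sqrt ?_
    exact parabolicCube_subset_of_mem hx (by linarith)
  have e2 : N / (2 * R) = 4 * (Z * A) := by rw [hN]; field_simp; ring
  have e3 : 2 * N / R = 16 * (Z * A) := by rw [hN]; field_simp; ring
  have e4 : N / R = 8 * (Z * A) := by rw [hN]; field_simp
  have hlip := isLipHalfOn_localizeContract (θ := θ) h.lip haℓ hR0 hN0 hZA.le hθ (by linarith) hψ hz
    (by rw [e3]; linarith) (by
      have h5 : ℓ * θ = 8 * (Z * A) := by rw [hθd]; field_simp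
      rw [e2]
      nlinarith [mul_nonneg hθ hZA.le])
  have hlip0 : IsLipHalfOn (ℓ + 4 * (Z * A)) (localize φ z a R) univ := by
    refine isLipHalfOn_univ_of_space_time (fun x y t => ?_) fun x t τ => ?_
    · rw [← e2]
      exact abs_localize_space_sub_le h.lip haℓ hR0 hN0 hψ x y t
    · refine (abs_localize_time_sub_le_sqrt hR0 hN0 hZA.le hψ hz x t τ).trans ?_
      refine mul_le_mul_of_nonneg_right ?_ (Real.sqrt_nonneg _)
      rw [e3]; linarith
  refine ⟨localizeContract φ z a R θ, localizeContract_eqOn hR0 hr hR.ge, hlip, ?_, fun w s hs => ?_⟩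
  · have h1 := hasMeanOscLE_of_exists hlip.isBddMeas
      (B := (pullbackConst m * localizeConst m + 32 * Z) * A) fun w s hs => ?_
    · intro w s hs hS
      refine (h1 w s hs hS).trans_eq (by rw [localizeOscConst]; ring)
    · obtain ⟨c, hc⟩ := h.exists_average_localize_le hR0 ha hlip0 hψ
        (spaceMap (contraction θ R z.1) w) (s := (m + 1) * s) (by positivity)
      refine ⟨c, (average_spatialGradient_comp_le hlip0 hθ hθ1 hR0 hlip hs hc).trans ?_⟩
      have h5 : θ * ℓ = 8 * (Z * A) := by rw [hθd]; field_simp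
      have h6 : θ * (Z * A) ≤ 1 / 4 * (Z * A) := by gcongr
      nlinarith
  · have hP := antilipschitzWith_contraction (c := z.1) hθ hθ1 hR0
    have hP1 := lipschitzWith_contraction (c := z.1) hθ (by linarith) hR0
    refine (timeDifference_comp_spaceMap_le hP hP1 hlip0.continuous w hs).trans ?_
    have h1 := timeDifference_localize_le hR0 hN0 h.lip hψ
      (fun w s hs hw => h.time w s hs (hw.trans (parabolicCube_mono (by linarith)))) hlip0
      (spaceMap (contraction θ R z.1) w) (s := (m + 1) * s) (by positivity)
    refine (mul_le_mul_right h1 _).trans ?_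
    rw [← ofReal_mul (pullbackConst_nonneg m), e4, localizeTimeConst]
    exact ofReal_le_ofReal (le_of_eq (by ring))

/-- The constant in the extension theorem. -/
def extensionConst (m : ℕ) : ℝ :=
  1 + 64 * zygmundConst m + |localizeOscConst m| + |truncateConst m| + |localizeTimeConst m|

theorem one_le_extensionConst (m : ℕ) : 1 ≤ extensionConst m := by
  have := zygmundConst_pos m
  rw [extensionConst]
  linarith [abs_nonneg (localizeOscConst m), abs_nonneg (truncateConst m), abs_nonneg (localizeTimeConst m)]

/-- Extension of a `Lip(1,1/2)` function with the same constant, with control of the oscillation of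
the gradient and of the time differences. -/
theorem OscControl.exists_extension (h : OscControl ℓ A φ (𝒬 z (16 * ((m + 1) * r))))
    (hr : 0 < r) :
    ∃ Φ, Set.EqOn Φ φ (𝒬 z r) ∧ OscControl ℓ (extensionConst m * A) Φ univ := by
  have hA := h.pos
  have hZ := zygmundConst_pos m
  have hE := one_le_extensionConst m
  have h1 := abs_nonneg (localizeOscConst m)
  have h2 := abs_nonneg (truncateConst m)
  have h3 := abs_nonneg (localizeTimeConst m)
  have h4 := le_abs_self (localizeOscConst m)
  have h5 := le_abs_self (truncateConst m)
  have h6 := le_abs_self (localizeTimeConst m)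
  have key : ∀ K, K ≤ extensionConst m → K * A ^ 2 ≤ (extensionConst m * A) ^ 2 := by
    intro K hK
    rw [mul_pow]
    have : extensionConst m ≤ extensionConst m ^ 2 := by nlinarith
    gcongr
    linarith
  rcases le_or_gt ℓ (32 * zygmundConst m * A) with hℓ | hℓ
  · obtain ⟨Φ, hEq, hlip, hosc, htime⟩ := h.exists_extension_of_le hr rfl hℓ
    refine ⟨Φ, hEq, hlip, by positivity, fun w s hs hS => (hosc w s hs hS).trans ?_, fun w s hs _ =>
      (htime w s hs).trans (ofReal_le_ofReal (key _ ?_))⟩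
    · gcongr
      rw [extensionConst]; linarith
    · rw [extensionConst]; linarith
  · obtain ⟨Φ, hEq, hlip, hosc, htime⟩ := h.exists_extension_of_lt hr rfl hℓ
    refine ⟨Φ, hEq, hlip, by positivity, fun w s hs hS => (hosc w s hs hS).trans ?_, fun w s hs _ =>
      (htime w s hs).trans (ofReal_le_ofReal (key _ ?_))⟩
    · gcongr
      rw [extensionConst]; linarith
    · rw [extensionConst]; linarith

end Extension

/-! ### Small oscillation at small scales -/

section SmallScale

variable {m : ℕ}

/-- By comparison of volumes. It passes scale restrictions on a cube to all the cubes contained in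
it. -/
theorem le_of_parabolicCube_subset {w z : SpaceTime m} {s ρ : ℝ} (hs : 0 < s)
    (h : 𝒬 w s ⊆ 𝒬 z ρ) : s ≤ ρ := by
  by_contra! hlt
  have hρ : 0 < ρ := by
    by_contra! h0
    have h1 : √|z.2 - w.2| < ρ := (h (self_mem_parabolicCube w hs)).2
    linarith [Real.sqrt_nonneg |z.2 - w.2|]
  have h1 := measureReal_mono h (volume_parabolicCube_lt_top z ρ).ne
  rw [measureReal_parabolicCube w hs, measureReal_parabolicCube z hρ] at h1
  have h2 : ρ ^ (m + 2) < s ^ (m + 2) := by gcongr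
  nlinarith [pow_pos (two_pos : (0:ℝ) < 2) (m + 1)]

theorem timeDifference_congr_on {Φ Ψ : SpaceTime m → ℝ} {w : SpaceTime m} {s : ℝ}
    (h : Set.EqOn Φ Ψ (𝒬 w s)) : timeDifference Φ w s = timeDifference Ψ w s := by
  rw [timeDifference_eq, timeDifference_eq]
  congr 1
  refine setLIntegral_congr_fun (measurableSet_parabolicCube w s) fun p hp => ?_
  refine setLIntegral_congr_fun (measurableSet_timeInterval w.2 s) fun τ hτ => ?_
  rw [timeQuotient, timeQuotient, h hp, h (show (p.1, τ) ∈ 𝒬 w s from ⟨hp.1, hτ⟩)]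

theorem spatialGradient_congr_on {Φ Ψ : SpaceTime m → ℝ} {S : Set (SpaceTime m)} (hS : IsOpen S)
    (h : Set.EqOn Φ Ψ S) {p : SpaceTime m} (hp : p ∈ S) :
    ∇ₓ Φ p = ∇ₓ Ψ p := by
  have h1 : (fun x => Φ (x, p.2)) =ᶠ[nhds p.1] fun x => Ψ (x, p.2) := by
    have h2 : Continuous fun x : 𝕏 m => (x, p.2) := by fun_prop
    filter_upwards [(hS.preimage h2).mem_nhds hp] with x hx
    exact h hx
  rw [spatialGradient, spatialGradient, gradient, gradient, h1.fderiv_eq]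

theorem nndist_toLp_le {p q : SpaceTime m} {s : ℝ} (hs : 0 < s) (h : q ∈ 𝒬 p s) :
    dist (WithLp.toLp 2 p) (WithLp.toLp 2 q) ≤ m * s + s ^ 2 := by
  rw [WithLp.prod_dist_eq_of_L2]
  have h1 := norm_sub_le_of_mem_spatialCube hs.le h.1
  have h2 := (mem_timeInterval hs).1 h.2
  rw [Real.sqrt_le_iff]
  refine ⟨by positivity, ?_⟩
  have h3 : dist p.1 q.1 ≤ m * s := by rw [dist_eq_norm]; exact h1
  have h4 : dist p.2 q.2 ≤ s ^ 2 := by rw [Real.dist_eq]; exact h2.le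
  change dist p.1 q.1 ^ 2 + dist p.2 q.2 ^ 2 ≤ _
  have h5 : dist p.1 q.1 ^ 2 ≤ (m * s) ^ 2 := by gcongr
  have h6 : dist p.2 q.2 ^ 2 ≤ (s ^ 2) ^ 2 := by gcongr
  have h7 : 0 ≤ (m * s) * s ^ 2 := by positivity
  nlinarith

theorem exists_modulus_bound {δ : ℝ≥0 → ℝ≥0} (h0 : δ 0 = 0) (hδ : ContinuousAt δ 0) {η : ℝ} (hη : 0 < η) :
    ∃ ε : ℝ, 0 < ε ∧ ∀ u : ℝ≥0, (u : ℝ) < ε → (δ u : ℝ) ≤ η := by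
  rw [Metric.continuousAt_iff] at hδ
  obtain ⟨ε, hε, h⟩ := hδ η hη
  refine ⟨ε, hε, fun u hu => ?_⟩
  have h1 : dist u 0 < ε := by
    rw [NNReal.dist_eq]; simpa using hu
  have h2 := h h1
  rw [h0, NNReal.dist_eq] at h2
  simp only [NNReal.coe_zero, sub_zero, NNReal.abs_eq] at h2
  exact h2.le

/-- Mean oscillation of the sum of a function with small oscillation and of a nearly constant one. -/
theorem average_norm_sub_le_of_bmo {f g h : SpaceTime m → 𝕏 m} {M η : ℝ} {w : SpaceTime m}
    {s : ℝ} (hs : 0 < s) (hη : 0 ≤ η) (hg : IsBddMeas g M) (hfg : Set.EqOn f g (𝒬 w s))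
    (hbmo : ⨍⁻ p in 𝒬 w s, ‖(f p - h p) - ⨍ q in 𝒬 w s, (f q - h q)‖ₑ ∂volume
      ≤ ofReal (2 * η))
    (hh : ∀ p ∈ 𝒬 w s, ‖h p - h w‖ ≤ η) :
    ∃ c, ⨍ p in 𝒬 w s, ‖g p - c‖ ≤ 3 * η := by
  set c₀ := ⨍ q in 𝒬 w s, (f q - h q)
  refine ⟨c₀ + h w, ?_⟩
  have hfin := (volume_parabolicCube_lt_top w s).ne
  have hne := (volume_parabolicCube_pos w hs).ne'
  have h1 := laverage_enorm_eq_ofReal hs (f := fun p => g p - (c₀ + h w))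
    ((hg.sub_const (c₀ + h w)).integrableOn hfin)
  have h2 : ⨍⁻ p in 𝒬 w s, ‖g p - (c₀ + h w)‖ₑ ∂volume ≤ ofReal (3 * η) := by
    calc _ ≤ (volume (𝒬 w s))⁻¹ * ∫⁻ p in 𝒬 w s,
          (‖(f p - h p) - c₀‖ₑ + ofReal η) := by
          rw [setLAverage_eq, ENNReal.div_eq_inv_mul]
          refine mul_le_mul_right (setLIntegral_mono' (measurableSet_parabolicCube w s) fun p hp => ?_) _
          have h3 : g p - (c₀ + h w) = ((f p - h p) - c₀) + (h p - h w) := by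
            rw [hfg hp]; abel
          rw [h3]
          refine (enorm_add_le _ _).trans ?_
          gcongr
          rw [← ofReal_norm]
          exact ofReal_le_ofReal (hh p hp)
      _ = (⨍⁻ p in 𝒬 w s, ‖(f p - h p) - c₀‖ₑ ∂volume) + ofReal η := by
          rw [lintegral_add_right _ measurable_const, setLIntegral_const, mul_add, setLAverage_eq,
            ENNReal.div_eq_inv_mul, mul_comm (ofReal η), ← mul_assoc _ _ (ofReal η),
            ENNReal.inv_mul_cancel hne hfin, one_mul]
      _ ≤ ofReal (2 * η) + ofReal η := by gcongr
      _ = _ := by rw [← ofReal_add (by positivity) hη]; congr 1; ring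
  rw [h1] at h2
  exact (ofReal_le_ofReal_iff (by positivity)).1 h2

/-- Below the scale ρ the function h from the modulus class varies by at most η on a cube, so ∇φ has
mean deviation at most 3η from a constant, hence oscillation at most 6η. The scale is fixed before φ
and ℓ appear. -/
theorem exists_oscControl_of_bmoDist (m : ℕ) {d r₁ η : ℝ} {δ : ℝ≥0 → ℝ≥0} (hd : 0 < d) (hr₁ : 0 < r₁)
    (hη : 0 < η) (h0 : δ 0 = 0) (hδ : ContinuousAt δ 0) :
    ∃ d' : ℝ, 0 < d' ∧ d' ≤ d ∧ ∀ (z₀ : SpaceTime m) (ℓ : ℝ) (φ : SpaceTime m → ℝ),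
      IsLipHalfOn ℓ φ (𝒬 z₀ (8 * d)) →
      (∀ (z : SpaceTime m) (s : ℝ), 0 < s → s ≤ r₁ →
        𝒬 z s ⊆ 𝒬 z₀ (8 * d) →
        timeDifference φ z s ≤ ofReal (η ^ 2)) →
      bmoDistModulusClass (∇ₓ φ) δ (𝒬 z₀ (8 * d)) ≤ ofReal η →
      ∀ (z : SpaceTime m) (r : ℝ), 0 < r → r ≤ d' → 𝒬 z r ⊆ 𝒬 z₀ (4 * d) →
        ∃ ψ : SpaceTime m → ℝ, Set.EqOn ψ φ (𝒬 z₀ (8 * d)) ∧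
          OscControl ℓ (6 * η) ψ (𝒬 z (16 * ((m + 1) * r))) := by
  obtain ⟨ε, hε, hεδ⟩ := exists_modulus_bound h0 hδ hη
  have hm : (0 : ℝ) < m + 1 := by positivity
  -- Each bound has one purpose: 1 gives s² ≤ s in the Euclidean diameter, 4d keeps the cubes inside
  -- the large one, r₁ admits the time hypothesis, and the last makes distances smaller than ε.
  set ρ := min (min 1 (4 * d)) (min r₁ (ε / (2 * (m + 1)))) with hρd
  have hρ : 0 < ρ := by positivity
  have hρ1 : ρ ≤ 1 := (min_le_left _ _).trans (min_le_left _ _)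
  have hρd4 : ρ ≤ 4 * d := (min_le_left _ _).trans (min_le_right _ _)
  have hρr : ρ ≤ r₁ := (min_le_right _ _).trans (min_le_left _ _)
  have hρε : ρ ≤ ε / (2 * (m + 1)) := (min_le_right _ _).trans (min_le_right _ _)
  refine ⟨ρ / (16 * (m + 1)), by positivity, ?_, ?_⟩
  · rw [div_le_iff₀ (by positivity)]
    nlinarith [mul_nonneg hd.le (Nat.cast_nonneg (α := ℝ) m)]
  intro z₀ ℓ φ hφ htime hbmo z r hr hrd hz
  have hrρ : 16 * ((m + 1) * r) ≤ ρ := by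
    rw [le_div_iff₀ (by positivity)] at hrd; linarith
  have hz4 : z ∈ 𝒬 z₀ (4 * d) := hz (self_mem_parabolicCube z hr)
  have hsub8 : 𝒬 z (16 * ((m + 1) * r)) ⊆ 𝒬 z₀ (8 * d) :=
    parabolicCube_subset_of_mem hz4 (by linarith)
  have hℓ := hφ.nonneg (by positivity)
  obtain ⟨ψ, hψ, hEq⟩ := hφ.exists_extension hℓ ⟨z₀, self_mem_parabolicCube z₀ (by positivity)⟩
  -- The infimum over the modulus class need not be attained, so a competitor within 2η is taken.
  have hlt : bmoDistModulusClass (∇ₓ φ) δ (𝒬 z₀ (8 * d))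
      < ofReal (2 * η) :=
    hbmo.trans_lt ((ENNReal.ofReal_lt_ofReal_iff (by positivity)).2 (by linarith))
  rw [bmoDistModulusClass, iInf_lt_iff] at hlt
  obtain ⟨h, hlt⟩ := hlt
  rw [iInf_lt_iff] at hlt
  obtain ⟨hh, hlt⟩ := hlt
  refine ⟨ψ, hEq, hψ, by positivity, fun w s hs hS => ?_, fun w s hs hS => ?_⟩
  · have hsρ : s ≤ ρ := (le_of_parabolicCube_subset hs hS).trans hrρ
    have hS8 := hS.trans hsub8
    have h1 : ⨍⁻ p in 𝒬 w s, ‖(∇ₓ φ p - h p)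
        - ⨍ q in 𝒬 w s, (∇ₓ φ q - h q)‖ₑ ∂volume ≤ ofReal (2 * η) := by
      refine le_trans ?_ hlt.le
      exact le_iSup₂_of_le w s (le_iSup₂_of_le hs hS8 le_rfl)
    have hclose : ∀ p ∈ 𝒬 w s, ‖h p - h w‖ ≤ η := by
      intro p hp
      have h2 := hh p (hS8 hp) w (hS8 (self_mem_parabolicCube w hs))
      have h3 : (nndist (h p) (h w) : ℝ) ≤ δ (nndist (WithLp.toLp 2 p) (WithLp.toLp 2 w)) := h2
      rw [coe_nndist, dist_eq_norm] at h3
      refine h3.trans (hεδ _ ?_)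
      rw [coe_nndist]
      refine (nndist_toLp_le hs (mem_parabolicCube_comm.1 hp)).trans_lt ?_
      have h4 : s ^ 2 ≤ s := by nlinarith
      calc (m : ℝ) * s + s ^ 2 ≤ (m + 1) * s := by linarith
        _ ≤ (m + 1) * (ε / (2 * (m + 1))) := by gcongr; exact hsρ.trans hρε
        _ = ε / 2 := by field_simp
        _ < ε := by linarith
    obtain ⟨c, hc⟩ := average_norm_sub_le_of_bmo hs hη.le hψ.isBddMeas
      (fun p hp => (spatialGradient_congr_on (isOpen_parabolicCube _ _) hEq (hS8 hp)).symm) h1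
      hclose
    have hfin := (volume_parabolicCube_lt_top w s).ne
    refine (setAverage_norm_sub_average_le (hψ.isBddMeas.integrableOn hfin) c hfin
      (volume_parabolicCube_pos w hs).ne').trans ?_
    linarith
  · have hsρ : s ≤ ρ := (le_of_parabolicCube_subset hs hS).trans hrρ
    have hS8 := hS.trans hsub8
    rw [timeDifference_congr_on (fun p hp => hEq (hS8 hp))]
    refine (htime w s hs (hsρ.trans hρr) hS8).trans (ofReal_le_ofReal ?_)
    nlinarith [sq_nonneg η]

end SmallScale

/-! ### Homogeneous kernels -/

section Kernel

open Module

variable {E : Type*} [NormedAddCommGroup E] [InnerProductSpace ℝ E] [FiniteDimensional ℝ E]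
  [MeasurableSpace E] [BorelSpace E]

/-- The kernel `|y|^{-(d+α)}` on a `d`-dimensional space. -/
def rieszKernel (α : ℝ) (y : E) : ℝ := ‖y‖ ^ (-(finrank ℝ E + α))

theorem rieszKernel_nonneg (α : ℝ) (y : E) : 0 ≤ rieszKernel α y := by
  unfold rieszKernel; positivity

theorem rieszKernel_neg (α : ℝ) (y : E) : rieszKernel α (-y) = rieszKernel α y := by
  rw [rieszKernel, norm_neg, rieszKernel]

theorem measurable_rieszKernel (α : ℝ) : Measurable (rieszKernel (E := E) α) := by
  unfold rieszKernel; fun_prop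

theorem rieszKernel_smul (α : ℝ) {c : ℝ} (hc : 0 < c) (y : E) :
    rieszKernel α (c • y) = c ^ (-(finrank ℝ E + α)) * rieszKernel α y := by
  rw [rieszKernel, norm_smul, Real.norm_of_nonneg hc.le, Real.mul_rpow hc.le (norm_nonneg _), rieszKernel]

/-- In polar coordinates the integrand is r^{1-α} near 0 and r^{-1-α} at infinity; this is where
both 0 < α and α < 2 are needed. -/
theorem integrable_min_mul_rieszKernel [Nontrivial E] {α : ℝ} (h0 : 0 < α) (h2 : α < 2) :
    Integrable fun y : E => min (‖y‖ ^ 2) 1 * rieszKernel α y := by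
  have hd : 0 < finrank ℝ E := finrank_pos
  have h := (integrable_fun_norm_addHaar (volume : Measure E)
    (f := fun y : ℝ => min (y ^ 2) 1 * y ^ (-(finrank ℝ E + α)))).2 ?_
  · exact h
  have hpow : ∀ y : ℝ, 0 < y → y ^ (finrank ℝ E - 1) * y ^ (-(finrank ℝ E + α)) = y ^ (-1 - α) := by
    intro y hy
    rw [← Real.rpow_natCast, ← Real.rpow_add hy, Nat.cast_sub hd]
    congr 1
    push_cast; ring
  rw [← Set.Ioc_union_Ioi_eq_Ioi (zero_le_one (α := ℝ))]
  refine IntegrableOn.union ?_ ?_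
  · have h1 : IntegrableOn (fun y : ℝ => y ^ (1 - α)) (Set.Ioc 0 1) := by
      rw [← intervalIntegrable_iff_integrableOn_Ioc_of_le zero_le_one]
      exact intervalIntegral.intervalIntegrable_rpow' (by linarith)
    refine h1.congr_fun (fun y hy => ?_) measurableSet_Ioc
    have hmin : min (y ^ 2) 1 = y ^ 2 := min_eq_left (pow_le_one₀ hy.1.le hy.2)
    rw [smul_eq_mul, hmin, mul_left_comm, hpow y hy.1, ← Real.rpow_natCast, ← Real.rpow_add hy.1]
    congr 1
    push_cast; ring
  · have h1 : IntegrableOn (fun y : ℝ => y ^ (-1 - α)) (Set.Ioi 1) :=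
      integrableOn_Ioi_rpow_of_lt (by linarith) one_pos
    refine h1.congr_fun (fun y hy => ?_) measurableSet_Ioi
    have hy0 : (0 : ℝ) < y := one_pos.trans hy
    have hmin : min (y ^ 2) 1 = 1 := min_eq_right (one_le_pow₀ (le_of_lt hy))
    rw [smul_eq_mul, hmin, one_mul, hpow y hy0]

theorem measurableSet_le_norm (ρ : ℝ) : MeasurableSet {y : E | ρ ≤ ‖y‖} :=
  measurableSet_le measurable_const measurable_norm

/-- The integral of the kernel of order `γ` outside the unit ball. -/
def kernelTailConst (E : Type*) [NormedAddCommGroup E] [InnerProductSpace ℝ E] [FiniteDimensional ℝ E]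
    [MeasurableSpace E] [BorelSpace E] (γ : ℝ) : ℝ :=
  ∫ y in {y : E | 1 ≤ ‖y‖}, rieszKernel γ y

theorem kernelTailConst_nonneg (γ : ℝ) : 0 ≤ kernelTailConst E γ :=
  setIntegral_nonneg (measurableSet_le_norm 1) fun y _ => rieszKernel_nonneg γ y

theorem integrableOn_rieszKernel {γ ρ : ℝ} (hγ : 0 < γ) (hρ : 0 < ρ) :
    IntegrableOn (rieszKernel (E := E) γ) {y | ρ ≤ ‖y‖} := by
  have h1 : IntegrableOn (fun y : E => (1 / ρ + 1) ^ (finrank ℝ E + γ) * (1 + ‖y‖) ^ (-(finrank ℝ E + γ)))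
      {y | ρ ≤ ‖y‖} :=
    ((integrable_one_add_norm (by linarith)).const_mul _).integrableOn
  refine h1.mono' (measurable_rieszKernel γ).aestronglyMeasurable ?_
  refine (ae_restrict_iff' (measurableSet_le_norm ρ)).2 (ae_of_all _ fun y hy => ?_)
  have hy : ρ ≤ ‖y‖ := hy
  have hy0 : 0 < ‖y‖ := hρ.trans_le hy
  have hs : 0 ≤ (finrank ℝ E : ℝ) + γ := by positivity
  rw [Real.norm_of_nonneg (rieszKernel_nonneg γ y), rieszKernel, Real.rpow_neg hy0.le,
    Real.rpow_neg (by positivity), ← div_eq_mul_inv, ← Real.div_rpow (by positivity) (by positivity),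
    ← Real.inv_rpow hy0.le]
  refine Real.rpow_le_rpow (by positivity) ?_ hs
  rw [le_div_iff₀ (by positivity), inv_mul_le_iff₀ hy0]
  have : 1 ≤ 1 / ρ * ‖y‖ := by rw [one_div, le_inv_mul_iff₀ hρ, mul_one]; exact hy
  nlinarith

/-- Homogeneity of the kernel. The exact power of ρ is what makes the far-field constant independent
of scale. -/
theorem setIntegral_rieszKernel {γ ρ : ℝ} (hρ : 0 < ρ) :
    ∫ y in {y : E | ρ ≤ ‖y‖}, rieszKernel γ y = kernelTailConst E γ * ρ ^ (-γ) := by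
  have h1 := Measure.integral_comp_inv_smul_of_nonneg (volume : Measure E)
    ({y : E | 1 ≤ ‖y‖}.indicator (rieszKernel γ)) (R := ρ) (hR := hρ.le)
  have h2 : (fun y : E => {y : E | 1 ≤ ‖y‖}.indicator (rieszKernel γ) (ρ⁻¹ • y))
      = fun y => ρ ^ (finrank ℝ E + γ) * {y : E | ρ ≤ ‖y‖}.indicator (rieszKernel γ) y := by
    funext y
    have hiff : 1 ≤ ‖ρ⁻¹ • y‖ ↔ ρ ≤ ‖y‖ := by
      rw [norm_smul, Real.norm_of_nonneg (by positivity), le_inv_mul_iff₀ hρ, mul_one]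
    by_cases hy : ρ ≤ ‖y‖
    · rw [indicator_of_mem (show ρ⁻¹ • y ∈ {y : E | 1 ≤ ‖y‖} from hiff.2 hy),
        indicator_of_mem (show y ∈ {y : E | ρ ≤ ‖y‖} from hy), rieszKernel_smul _ (by positivity),
        Real.inv_rpow hρ.le, Real.rpow_neg hρ.le, inv_inv]
    · rw [indicator_of_notMem (show ρ⁻¹ • y ∉ {y : E | 1 ≤ ‖y‖} from fun h => hy (hiff.1 h)),
        indicator_of_notMem (show y ∉ {y : E | ρ ≤ ‖y‖} from hy), mul_zero]
  rw [h2, integral_const_mul, integral_indicator (measurableSet_le_norm ρ),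
    integral_indicator (measurableSet_le_norm 1), smul_eq_mul] at h1
  change _ = _ * kernelTailConst E γ at h1
  rw [Real.rpow_add hρ, Real.rpow_natCast, mul_assoc] at h1
  have h3 := mul_left_cancel₀ (pow_ne_zero _ hρ.ne') h1
  rw [Real.rpow_neg hρ.le, ← h3]
  field_simp

/-! ### The symbol of the second difference operator -/

/-- The symbol of the second difference operator of order `α`. -/
def diffSymbol (α : ℝ) (ξ : E) : ℝ :=
  ∫ y, (2 - 2 * Real.cos (2 * Real.pi * inner ℝ ξ y)) * rieszKernel α y

theorem diffSymbol_integrand_nonneg (α : ℝ) (ξ y : E) :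
    0 ≤ (2 - 2 * Real.cos (2 * Real.pi * inner ℝ ξ y)) * rieszKernel α y :=
  mul_nonneg (by linarith [Real.cos_le_one (2 * Real.pi * inner ℝ ξ y)]) (rieszKernel_nonneg α y)

theorem measurable_diffSymbol_integrand (α : ℝ) : Measurable fun p : E × E =>
    (2 - 2 * Real.cos (2 * Real.pi * inner ℝ p.1 p.2)) * rieszKernel α p.2 :=
  Measurable.mul (Continuous.measurable (by fun_prop)) ((measurable_rieszKernel α).comp measurable_snd)

theorem integrable_diffSymbol [Nontrivial E] {α : ℝ} (h0 : 0 < α) (h2 : α < 2) (ξ : E) :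
    Integrable fun y : E => (2 - 2 * Real.cos (2 * Real.pi * inner ℝ ξ y)) * rieszKernel α y := by
  refine ((integrable_min_mul_rieszKernel (E := E) h0 h2).const_mul
    (4 + (2 * Real.pi * ‖ξ‖) ^ 2)).mono' ?_ (ae_of_all _ fun y => ?_)
  · exact ((measurable_diffSymbol_integrand α).comp (measurable_const.prodMk measurable_id)).aestronglyMeasurable
  · rw [Real.norm_of_nonneg (diffSymbol_integrand_nonneg α ξ y), ← mul_assoc]
    refine mul_le_mul_of_nonneg_right ?_ (rieszKernel_nonneg α y)
    have h3 := Real.neg_one_le_cos (2 * Real.pi * inner ℝ ξ y)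
    rcases le_total (‖y‖ ^ 2) 1 with h | h
    · rw [min_eq_left h]
      have h4 := Real.one_sub_sq_div_two_le_cos (x := 2 * Real.pi * inner ℝ ξ y)
      have h5 : (inner ℝ ξ y : ℝ) ^ 2 ≤ (‖ξ‖ * ‖y‖) ^ 2 := by
        rw [← sq_abs]
        gcongr
        exact abs_real_inner_le_norm ξ y
      have h6 : (2 * Real.pi * inner ℝ ξ y) ^ 2 ≤ (2 * Real.pi * ‖ξ‖) ^ 2 * ‖y‖ ^ 2 := by
        calc _ = (2 * Real.pi) ^ 2 * (inner ℝ ξ y : ℝ) ^ 2 := by ring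
          _ ≤ (2 * Real.pi) ^ 2 * (‖ξ‖ * ‖y‖) ^ 2 := by gcongr
          _ = _ := by ring
      nlinarith [sq_nonneg ‖y‖]
    · rw [min_eq_right h]
      nlinarith [sq_nonneg (2 * Real.pi * ‖ξ‖)]

theorem diffSymbol_isometry (α : ℝ) (R : E ≃ₗᵢ[ℝ] E) (ξ : E) : diffSymbol α (R ξ) = diffSymbol α ξ := by
  have h1 := R.measurePreserving.integral_comp' (f := R.toMeasurableEquiv)
    (g := fun y => (2 - 2 * Real.cos (2 * Real.pi * inner ℝ (R ξ) y)) * rieszKernel α y)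
  rw [diffSymbol, ← h1, diffSymbol]
  refine integral_congr_ae (ae_of_all _ fun y => ?_)
  simp [rieszKernel]

theorem diffSymbol_smul (α : ℝ) {c : ℝ} (hc : 0 < c) (ξ : E) :
    diffSymbol α (c • ξ) = c ^ α * diffSymbol α ξ := by
  have h1 := Measure.integral_comp_smul_of_nonneg (volume : Measure E)
    (fun y : E => (2 - 2 * Real.cos (2 * Real.pi * inner ℝ ξ y)) * rieszKernel α y) c (hR := hc.le)
  simp only [rieszKernel_smul α hc, inner_smul_right] at h1
  have h2 : (fun y : E => (2 - 2 * Real.cos (2 * Real.pi * (c * inner ℝ ξ y)))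
      * (c ^ (-(finrank ℝ E + α)) * rieszKernel α y)) = fun y => c ^ (-(finrank ℝ E + α)) *
        ((2 - 2 * Real.cos (2 * Real.pi * inner ℝ (c • ξ) y)) * rieszKernel α y) := by
    funext y
    rw [inner_smul_left]
    simp only [conj_trivial]
    ring
  rw [h2, integral_const_mul, smul_eq_mul, Real.rpow_neg hc.le, Real.rpow_add hc, Real.rpow_natCast] at h1
  change _ * diffSymbol α (c • ξ) = _ * diffSymbol α ξ at h1
  have hc1 : c ^ finrank ℝ E ≠ 0 := pow_ne_zero _ hc.ne'
  have hc2 : c ^ α ≠ 0 := (Real.rpow_pos_of_pos hc α).ne'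
  field_simp at h1
  linarith

theorem diffSymbol_pos [Nontrivial E] {α : ℝ} (h0 : 0 < α) (h2 : α < 2) {e : E} (he : ‖e‖ = 1) :
    0 < diffSymbol α e := by
  rw [diffSymbol, integral_pos_iff_support_of_nonneg (diffSymbol_integrand_nonneg α e)
    (integrable_diffSymbol h0 h2 e)]
  have hopen : IsOpen ({y : E | Real.cos (2 * Real.pi * inner ℝ e y) < 1} ∩ {y | y ≠ 0}) :=
    (isOpen_lt (by fun_prop) continuous_const).inter isOpen_ne
  have hmem : (1 / 2 : ℝ) • e ∈ ({y : E | Real.cos (2 * Real.pi * inner ℝ e y) < 1} ∩ {y | y ≠ 0}) := by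
    constructor
    · have : 2 * Real.pi * inner ℝ e ((1 / 2 : ℝ) • e) = Real.pi := by
        rw [inner_smul_right, real_inner_self_eq_norm_sq, he]; ring
      rw [Set.mem_ofPred_eq, this, Real.cos_pi]
      norm_num
    · have : e ≠ 0 := by rintro rfl; simp at he
      simpa using this
  refine (hopen.measure_pos volume ⟨_, hmem⟩).trans_le (measure_mono fun y hy => ?_)
  have h3 : 0 < ‖y‖ := norm_pos_iff.2 hy.2
  have h4 : Real.cos (2 * Real.pi * inner ℝ e y) < 1 := hy.1
  rw [Function.mem_support]
  refine (mul_pos (by linarith) ?_).ne'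
  exact Real.rpow_pos_of_pos h3 _

/-- The symbol is a multiple of `|ξ|^α`. -/
theorem exists_diffSymbol_eq [Nontrivial E] {α : ℝ} (h0 : 0 < α) (h2 : α < 2) :
    ∃ k : ℝ, 0 < k ∧ ∀ ξ : E, diffSymbol α ξ = k * ‖ξ‖ ^ α := by
  obtain ⟨e, he⟩ := exists_norm_eq E zero_le_one
  refine ⟨diffSymbol α e, diffSymbol_pos h0 h2 he, fun ξ => ?_⟩
  rcases eq_or_ne ξ 0 with rfl | hξ
  · simp [diffSymbol, Real.zero_rpow h0.ne']
  have hn : 0 < ‖ξ‖ := norm_pos_iff.2 hξ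
  set u := ‖ξ‖⁻¹ • ξ with hu
  have hun : ‖e‖ = ‖u‖ := by
    rw [he, hu, norm_smul, norm_inv, norm_norm, inv_mul_cancel₀ hn.ne']
  have h3 : diffSymbol α u = diffSymbol α e := by
    -- Any two unit vectors are exchanged by a reflection, so reflections already give rotation
    -- invariance.
    rw [← Submodule.reflection_sub hun, diffSymbol_isometry]
  have h4 : ξ = ‖ξ‖ • u := by rw [hu, smul_smul, mul_inv_cancel₀ hn.ne', one_smul]
  conv_lhs => rw [h4]
  rw [diffSymbol_smul α hn, h3, mul_comm]

end Kernel

/-! ### Fractional operators as singular integrals of second differences -/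

section FracOp

open Module

variable {E : Type*} [NormedAddCommGroup E] [InnerProductSpace ℝ E] [FiniteDimensional ℝ E]
  [MeasurableSpace E] [BorelSpace E]
  {P : Type*} [NormedAddCommGroup P] [NormedSpace ℝ P]

/-- Second difference of `G` in the directions of the range of `L`. -/
def secondDiff (L : E →L[ℝ] P) (G : P → ℂ) (p : P) (y : E) : ℂ := 2 * G p - G (p + L y) - G (p - L y)

/-- The singular integral of second differences against the kernel `|y|^{-(d+α)}`. -/
def fracOp (α : ℝ) (L : E →L[ℝ] P) (G : P → ℂ) (p : P) : ℂ :=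
  ∫ y, rieszKernel α y • secondDiff L G p y

variable {L : E →L[ℝ] P} {G : P → ℂ} {α : ℝ}

theorem continuous_secondDiff (hG : Continuous G) : Continuous fun q : P × E => secondDiff L G q.1 q.2 := by
  unfold secondDiff; fun_prop

/-- For large y the bound is trivial. For small y the mean value inequality is applied to q ↦ G(q) -
G(q - Ly), whose derivative is O(|y|) because that of G is Lipschitz; this yields the quadratic
order. -/
theorem exists_norm_secondDiff_le (L : E →L[ℝ] P) (hG : ContDiff ℝ ∞ G) (hc : HasCompactSupport G) :
    ∃ M : ℝ, 0 ≤ M ∧ ∀ p y, ‖secondDiff L G p y‖ ≤ M * min (‖y‖ ^ 2) 1 := by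
  obtain ⟨M₀, hM₀⟩ := hc.exists_bound_of_continuous hG.continuous
  have hD : ContDiff ℝ 1 (fderiv ℝ G) := (contDiff_infty.1 hG 2).fderiv_right (m := 1) (by norm_num)
  obtain ⟨K, hK⟩ := ContDiff.lipschitzWith_of_hasCompactSupport (hc.fderiv ℝ) hD one_ne_zero
  have hM₀' : 0 ≤ M₀ := (norm_nonneg _).trans (hM₀ 0)
  refine ⟨K * ‖L‖ ^ 2 + 4 * M₀, by positivity, fun p y => ?_⟩
  have h1 : ‖secondDiff L G p y‖ ≤ 4 * M₀ := by
    calc _ ≤ ‖2 * G p‖ + ‖G (p + L y)‖ + ‖G (p - L y)‖ :=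
          (norm_sub_le _ _).trans (add_le_add_left (norm_sub_le _ _) _)
      _ ≤ 2 * M₀ + M₀ + M₀ := by
          rw [norm_mul]
          have := hM₀ p
          have := hM₀ (p + L y)
          have := hM₀ (p - L y)
          norm_num
          linarith
      _ = _ := by ring
  have h2 : ‖secondDiff L G p y‖ ≤ K * ‖L‖ ^ 2 * ‖y‖ ^ 2 := by
    have hd : Differentiable ℝ G := hG.differentiable (by simp)
    have h3 := Convex.norm_image_sub_le_of_norm_hasFDerivWithin_le (𝕜 := ℝ)
      (f := fun q => G q - G (q - L y)) (f' := fun q => fderiv ℝ G q - fderiv ℝ G (q - L y))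
      (C := K * ‖L y‖) (s := univ) (x := p + L y) (y := p) (fun q _ => ?_) (fun q _ => ?_)
      convex_univ (Set.mem_univ _) (Set.mem_univ _)
    · have h4 : G p - G (p - L y) - (G (p + L y) - G (p + L y - L y)) = secondDiff L G p y := by
        rw [secondDiff, add_sub_cancel_right]; ring
      rw [h4] at h3
      refine h3.trans ?_
      have h5 := L.le_opNorm y
      have h6 : ‖p - (p + L y)‖ = ‖L y‖ := by rw [sub_add_cancel_left, norm_neg]
      rw [h6, mul_assoc, mul_assoc, ← mul_pow, ← sq]
      gcongr
    · have h4 : HasFDerivAt (fun q => G (q - L y)) (fderiv ℝ G (q - L y)) q := by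
        have := (hd (q - L y)).hasFDerivAt.comp q ((hasFDerivAt_id q).sub_const (L y))
        simpa using! this
      exact ((hd q).hasFDerivAt.sub h4).hasFDerivWithinAt
    · have h4 := hK.norm_sub_le q (q - L y)
      rwa [sub_sub_cancel] at h4
  rcases le_total (‖y‖ ^ 2) 1 with h | h
  · rw [min_eq_left h]
    nlinarith [sq_nonneg ‖y‖]
  · rw [min_eq_right h]
    nlinarith [mul_nonneg K.coe_nonneg (sq_nonneg ‖L‖)]

variable [Nontrivial E]

theorem integrable_kernel_smul_secondDiff (h0 : 0 < α) (h2 : α < 2) (hG : ContDiff ℝ ∞ G)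
    (hc : HasCompactSupport G) (p : P) : Integrable fun y : E => rieszKernel α y • secondDiff L G p y := by
  obtain ⟨M, hM, h⟩ := exists_norm_secondDiff_le L hG hc
  refine ((integrable_min_mul_rieszKernel (E := E) h0 h2).const_mul M).mono' ?_
    (ae_of_all _ fun y => ?_)
  · exact (measurable_rieszKernel α).aestronglyMeasurable.smul
      ((continuous_secondDiff hG.continuous).comp (Continuous.prodMk_right p)).aestronglyMeasurable
  · rw [norm_smul, Real.norm_of_nonneg (rieszKernel_nonneg α y), mul_comm, ← mul_assoc]
    exact mul_le_mul_of_nonneg_right (h p y) (rieszKernel_nonneg α y)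

theorem continuous_fracOp (L : E →L[ℝ] P) (h0 : 0 < α) (h2 : α < 2) (hG : ContDiff ℝ ∞ G)
    (hc : HasCompactSupport G) : Continuous (fracOp α L G) := by
  obtain ⟨M, hM, h⟩ := exists_norm_secondDiff_le L hG hc
  refine continuous_of_dominated (bound := fun y => M * (min (‖y‖ ^ 2) 1 * rieszKernel α y))
    (fun p => (integrable_kernel_smul_secondDiff h0 h2 hG hc p).aestronglyMeasurable)
    (fun p => Filter.Eventually.of_forall fun y => ?_)
    ((integrable_min_mul_rieszKernel (E := E) h0 h2).const_mul M)
    (ae_of_all _ fun y => ?_)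
  · rw [norm_smul, Real.norm_of_nonneg (rieszKernel_nonneg α y), mul_comm, ← mul_assoc]
    exact mul_le_mul_of_nonneg_right (h p y) (rieszKernel_nonneg α y)
  · exact ((continuous_secondDiff hG.continuous).comp (Continuous.prodMk_left y)).const_smul (rieszKernel α y)

variable [FiniteDimensional ℝ P] [MeasurableSpace P] [BorelSpace P] {μ : Measure P} [μ.IsAddHaarMeasure]

theorem integrable_secondDiff (hG : Continuous G) (hc : HasCompactSupport G) (y : E) :
    Integrable (fun p => secondDiff L G p y) μ := by
  have h := hG.integrable_of_hasCompactSupport hc (μ := μ)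
  exact ((h.const_mul 2).sub (h.comp_add_right (L y))).sub (h.comp_sub_right (L y))

/-- The integrated form needs a support argument: for |y| ≤ 1 the second difference lives in a fixed
compact thickening of the support of G. Joint integrability, and with it Fubini, follows. -/
theorem integral_norm_secondDiff_le (hG : ContDiff ℝ ∞ G) (hc : HasCompactSupport G) :
    ∃ M : ℝ, 0 ≤ M ∧ ∀ y : E, ∫ p, ‖secondDiff L G p y‖ ∂μ ≤ M * min (‖y‖ ^ 2) 1 := by
  obtain ⟨M, hM, h⟩ := exists_norm_secondDiff_le L hG hc
  have h1 := hG.continuous.integrable_of_hasCompactSupport hc (μ := μ)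
  have hK : IsCompact (Metric.cthickening ‖L‖ (tsupport G)) := hc.isCompact.cthickening
  have hKt : μ (Metric.cthickening ‖L‖ (tsupport G)) ≠ ⊤ := hK.measure_lt_top.ne
  refine ⟨M * μ.real (Metric.cthickening ‖L‖ (tsupport G)) + 4 * ∫ p, ‖G p‖ ∂μ,
    add_nonneg (by positivity) (mul_nonneg (by norm_num) (integral_nonneg fun _ => norm_nonneg _)), fun y => ?_⟩
  have hGi : 0 ≤ ∫ p, ‖G p‖ ∂μ := integral_nonneg fun _ => norm_nonneg _
  rcases le_total (‖y‖ ^ 2) 1 with hy | hy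
  · have hy1 : ‖y‖ ≤ 1 := by
      by_contra! hlt
      nlinarith
    have hLy : ‖L y‖ ≤ ‖L‖ := (L.le_opNorm y).trans (mul_le_of_le_one_right (norm_nonneg _) hy1)
    have hzero : ∀ p, p ∉ Metric.cthickening ‖L‖ (tsupport G) → ‖secondDiff L G p y‖ = 0 := by
      intro p hp
      have hz : ∀ q, dist p q ≤ ‖L‖ → G q = 0 := by
        intro q hq
        by_contra hne
        exact hp (Metric.mem_cthickening_of_dist_le p q _ _ (subset_tsupport _ hne) hq)
      rw [secondDiff, hz p (by simp), hz (p + L y) (by simpa using hLy), hz (p - L y) (by simpa using hLy)]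
      simp
    rw [min_eq_left hy, ← setIntegral_eq_integral_of_forall_compl_eq_zero hzero]
    calc _ ≤ ‖∫ p in Metric.cthickening ‖L‖ (tsupport G), ‖secondDiff L G p y‖ ∂μ‖ := le_abs_self _
      _ ≤ (M * ‖y‖ ^ 2) * μ.real (Metric.cthickening ‖L‖ (tsupport G)) := by
          refine norm_setIntegral_le_of_norm_le_const hKt.lt_top fun p _ => ?_
          rw [norm_norm]
          exact (h p y).trans (by rw [min_eq_left hy])
      _ ≤ _ := by nlinarith [mul_nonneg hGi (sq_nonneg ‖y‖)]
  · rw [min_eq_right hy]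
    have h3 : ∫ p, ‖secondDiff L G p y‖ ∂μ ≤ ∫ p, (2 * ‖G p‖ + ‖G (p + L y)‖ + ‖G (p - L y)‖) ∂μ := by
      refine integral_mono (integrable_secondDiff hG.continuous hc y).norm
        (((h1.norm.const_mul 2).add (h1.norm.comp_add_right (L y))).add (h1.norm.comp_sub_right (L y)))
        fun p => ?_
      calc _ ≤ ‖2 * G p‖ + ‖G (p + L y)‖ + ‖G (p - L y)‖ :=
          (norm_sub_le _ _).trans (add_le_add_left (norm_sub_le _ _) _)
        _ = _ := by rw [norm_mul]; norm_num
    rw [integral_add (f := fun p => 2 * ‖G p‖ + ‖G (p + L y)‖)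
        ((h1.norm.const_mul 2).add (h1.norm.comp_add_right (L y))) (h1.norm.comp_sub_right (L y)),
      integral_add (h1.norm.const_mul 2) (h1.norm.comp_add_right (L y)), integral_const_mul,
      integral_add_right_eq_self (fun p => ‖G p‖), integral_sub_right_eq_self (fun p => ‖G p‖)] at h3
    have h4 : 0 ≤ M * μ.real (Metric.cthickening ‖L‖ (tsupport G)) := by positivity
    linarith

theorem integrable_prod_secondDiff (h0 : 0 < α) (h2 : α < 2) (hG : ContDiff ℝ ∞ G)
    (hc : HasCompactSupport G) :
    Integrable (fun q : P × E => rieszKernel α q.2 • secondDiff L G q.1 q.2) (μ.prod volume) := by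
  obtain ⟨M, hM, h⟩ := integral_norm_secondDiff_le (L := L) (μ := μ) hG hc
  have hmeas : AEStronglyMeasurable (fun q : P × E => rieszKernel α q.2 • secondDiff L G q.1 q.2)
      (μ.prod volume) :=
    ((measurable_rieszKernel α).comp measurable_snd).aestronglyMeasurable.smul
      (continuous_secondDiff hG.continuous).aestronglyMeasurable
  rw [integrable_prod_iff' hmeas]
  refine ⟨Filter.Eventually.of_forall fun y => Integrable.smul (rieszKernel α y) (integrable_secondDiff hG.continuous hc y), ?_⟩
  refine ((integrable_min_mul_rieszKernel (E := E) h0 h2).const_mul M).mono'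
    (AEStronglyMeasurable.norm hmeas).prod_swap.integral_prod_right' (ae_of_all _ fun y => ?_)
  simp only [norm_smul, integral_const_mul]
  rw [norm_mul, norm_norm, Real.norm_of_nonneg (rieszKernel_nonneg α y),
    Real.norm_of_nonneg (integral_nonneg fun _ => norm_nonneg _), mul_comm, ← mul_assoc]
  exact mul_le_mul_of_nonneg_right (h y) (rieszKernel_nonneg α y)

theorem integrable_fracOp (h0 : 0 < α) (h2 : α < 2) (hG : ContDiff ℝ ∞ G) (hc : HasCompactSupport G) :
    Integrable (fracOp α L G) μ :=
  (integrable_prod_secondDiff h0 h2 hG hc).integral_prod_left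

/-- The operator acts by multiplication when tested against a character. -/
theorem integral_mul_fracOp (h0 : 0 < α) (h2 : α < 2) (hG : ContDiff ℝ ∞ G) (hc : HasCompactSupport G)
    {b : P → ℂ} (hb : Continuous b) (hb1 : ∀ p, ‖b p‖ ≤ 1) {χ : E → ℂ}
    (hχ : ∀ p y, b (p + L y) = χ y * b p) :
    ∫ p, b p * fracOp α L G p ∂μ = (∫ y, rieszKernel α y • (2 - χ y - χ (-y))) * ∫ p, b p * G p ∂μ := by
  have hi := integrable_prod_secondDiff (L := L) (μ := μ) h0 h2 hG hc
  have hbi : Integrable (fun q : P × E => b q.1 * (rieszKernel α q.2 • secondDiff L G q.1 q.2))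
      (μ.prod volume) :=
    hi.bdd_mul (c := 1) (hb.comp continuous_fst).aestronglyMeasurable
      (ae_of_all _ fun q => hb1 q.1)
  have hGi := hG.continuous.integrable_of_hasCompactSupport hc (μ := μ)
  have hbG : ∀ {H : P → ℂ}, Integrable H μ → Integrable (fun p => b p * H p) μ := fun hH =>
    hH.bdd_mul (c := 1) hb.aestronglyMeasurable (Filter.Eventually.of_forall hb1)
  have h1 : ∫ p, b p * fracOp α L G p ∂μ
      = ∫ p, (∫ y, b p * (rieszKernel α y • secondDiff L G p y)) ∂μ := by
    refine integral_congr_ae (ae_of_all _ fun p => ?_)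
    simp only [fracOp]
    rw [integral_const_mul]
  rw [h1, integral_integral_swap hbi, ← integral_mul_const]
  refine integral_congr_ae (ae_of_all _ fun y => ?_)
  have h3 : ∫ p, b p * G (p + L y) ∂μ = χ (-y) * ∫ p, b p * G p ∂μ := by
    rw [← integral_const_mul, ← integral_sub_right_eq_self (fun p => b p * G (p + L y)) (L y)]
    refine integral_congr_ae (ae_of_all _ fun p => ?_)
    simp only [sub_add_cancel]
    rw [← mul_assoc, ← hχ p (-y), map_neg, sub_eq_add_neg]
  have h4 : ∫ p, b p * G (p - L y) ∂μ = χ y * ∫ p, b p * G p ∂μ := by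
    rw [← integral_const_mul, ← integral_add_right_eq_self (fun p => b p * G (p - L y)) (L y)]
    refine integral_congr_ae (ae_of_all _ fun p => ?_)
    simp only [add_sub_cancel_right]
    rw [← mul_assoc, ← hχ p y]
  have h5 : (fun p => b p * (rieszKernel α y • secondDiff L G p y)) = fun p => rieszKernel α y •
      (2 * (b p * G p) - b p * G (p + L y) - b p * G (p - L y)) := by
    funext p
    rw [secondDiff, mul_smul_comm]
    congr 1; ring
  simp only
  rw [h5, integral_smul, integral_sub (f := fun p => 2 * (b p * G p) - b p * G (p + L y))
      (((hbG hGi).const_mul 2).sub (hbG (hGi.comp_add_right (L y))))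
    (hbG (hGi.comp_sub_right (L y))), integral_sub ((hbG hGi).const_mul 2) (hbG (hGi.comp_add_right (L y))),
    integral_const_mul, h3, h4, smul_mul_assoc]
  congr 1; ring

end FracOp

/-! ### Fourier representation of the fractional operators -/

section FourierSide

open Module

variable {E : Type*} [NormedAddCommGroup E] [InnerProductSpace ℝ E] [FiniteDimensional ℝ E]
  [MeasurableSpace E] [BorelSpace E]

theorem two_sub_fourierChar_sub (ξ y : E) :
    (2 : ℂ) - Real.fourierChar (-inner ℝ y ξ) - Real.fourierChar (-inner ℝ (-y) ξ)
      = ((2 - 2 * Real.cos (2 * Real.pi * inner ℝ ξ y) : ℝ) : ℂ) := by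
  rw [inner_neg_left, neg_neg, Real.fourierChar_apply, Real.fourierChar_apply, real_inner_comm ξ y]
  push_cast
  have h := Complex.two_cos (2 * Real.pi * ((inner ℝ ξ y : ℝ) : ℂ))
  rw [h]
  ring_nf

section

variable [Nontrivial E] {P : Type*} [NormedAddCommGroup P] [NormedSpace ℝ P] [FiniteDimensional ℝ P]
  [MeasurableSpace P] [BorelSpace P] {μ : Measure P} [μ.IsAddHaarMeasure] {α : ℝ}

/-- Characters are pulled back along a left inverse of L, so that one identity serves both the
Fourier transform on E and, for products, the transform of partial integrals. -/
theorem integral_fourierChar_smul_fracOp (h0 : 0 < α) (h2 : α < 2) {G : P → ℂ} (hG : ContDiff ℝ ∞ G)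
    (hc : HasCompactSupport G) {L : E →L[ℝ] P} {π : P →L[ℝ] E} (hπ : ∀ y, π (L y) = y) (ξ : E) :
    ∫ p, Real.fourierChar (-inner ℝ (π p) ξ) • fracOp α L G p ∂μ
      = (diffSymbol α ξ : ℂ) * ∫ p, Real.fourierChar (-inner ℝ (π p) ξ) • G p ∂μ := by
  have h := integral_mul_fracOp (L := L) (μ := μ) h0 h2 hG hc
    (b := fun p => (Real.fourierChar (-inner ℝ (π p) ξ) : ℂ))
    (χ := fun y => (Real.fourierChar (-inner ℝ y ξ) : ℂ))
    (by
      have h1 : Continuous fun p => -inner ℝ (π p) ξ := by fun_prop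
      exact continuous_subtype_val.comp (Real.continuous_fourierChar.comp h1))
    (fun p => (Circle.norm_coe _).le) (fun p y => ?_)
  · simp only [Circle.smul_def, smul_eq_mul]
    rw [h]
    congr 1
    rw [diffSymbol, ← integral_complex_ofReal]
    refine integral_congr_ae (ae_of_all _ fun y => ?_)
    simp only
    rw [two_sub_fourierChar_sub, Complex.real_smul, ← Complex.ofReal_mul, mul_comm]
  · rw [map_add, hπ, inner_add_left, neg_add, AddChar.map_add_eq_mul, Circle.coe_mul, mul_comm]

variable {G : E → ℂ} {k : ℝ}

theorem fourier_fracOp (h0 : 0 < α) (h2 : α < 2) (hG : ContDiff ℝ ∞ G) (hc : HasCompactSupport G)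
    (hk : ∀ ξ : E, diffSymbol α ξ = k * ‖ξ‖ ^ α) (ξ : E) :
    𝓕 (fracOp α (ContinuousLinearMap.id ℝ E) G) ξ = (k * ‖ξ‖ ^ α : ℝ) * 𝓕 G ξ := by
  have h := integral_fourierChar_smul_fracOp (μ := volume) h0 h2 hG hc (L := ContinuousLinearMap.id ℝ E)
    (π := ContinuousLinearMap.id ℝ E) (fun _ => rfl) ξ
  rw [Real.fourier_eq, Real.fourier_eq, ← hk]
  exact h

theorem integrable_rpow_mul_fourier (h0 : 0 ≤ α) (h2 : α ≤ 2) (hG : ContDiff ℝ ∞ G)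
    (hc : HasCompactSupport G) : Integrable fun ξ : E => ((‖ξ‖ ^ α : ℝ) : ℂ) * 𝓕 G ξ := by
  set s := 𝓕 (hc.toSchwartzMap hG) with hs
  have hcoe : (s : E → ℂ) = 𝓕 G := by rw [hs, SchwartzMap.fourier_coe]; rfl
  have h3 : Integrable fun ξ : E => ‖ξ‖ ^ 0 * ‖s ξ‖ + ‖ξ‖ ^ 2 * ‖s ξ‖ :=
    (s.integrable_pow_mul volume 0).add (s.integrable_pow_mul volume 2)
  rw [← hcoe]
  refine h3.mono' ?_ (ae_of_all _ fun ξ => ?_)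
  · have hm : Measurable fun ξ : E => ((‖ξ‖ ^ α : ℝ) : ℂ) := by fun_prop
    exact hm.aestronglyMeasurable.mul s.continuous.aestronglyMeasurable
  · rw [norm_mul, Complex.norm_real, Real.norm_of_nonneg (by positivity), ← add_mul]
    refine mul_le_mul_of_nonneg_right ?_ (norm_nonneg _)
    rcases le_total ‖ξ‖ 1 with h | h
    · have := Real.rpow_le_one (norm_nonneg ξ) h h0
      rw [pow_zero]; nlinarith [sq_nonneg ‖ξ‖]
    · have := Real.rpow_le_rpow_of_exponent_le h h2
      rw [Real.rpow_ofNat] at this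
      rw [pow_zero]; linarith

/-- The fractional operator is the Fourier multiplier with symbol `|ξ|^α`, up to a constant. -/
theorem fracOp_eq_fourierInv (h0 : 0 < α) (h2 : α < 2) (hG : ContDiff ℝ ∞ G) (hc : HasCompactSupport G)
    (hk : ∀ ξ : E, diffSymbol α ξ = k * ‖ξ‖ ^ α) (x : E) :
    fracOp α (ContinuousLinearMap.id ℝ E) G x = k * 𝓕⁻ (fun ξ : E => ((‖ξ‖ ^ α : ℝ) : ℂ) * 𝓕 G ξ) x := by
  have h1 : 𝓕 (fracOp α (ContinuousLinearMap.id ℝ E) G)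
      = fun ξ => (k : ℂ) * (((‖ξ‖ ^ α : ℝ) : ℂ) * 𝓕 G ξ) := by
    funext ξ
    rw [fourier_fracOp h0 h2 hG hc hk, Complex.ofReal_mul, mul_assoc]
  have h3 := (continuous_fracOp (ContinuousLinearMap.id ℝ E) h0 h2 hG hc).fourierInv_fourier_eq
    (integrable_fracOp h0 h2 hG hc) (by
      rw [h1]; exact (integrable_rpow_mul_fourier h0.le h2.le hG hc).const_mul _)
  rw [← congrFun h3 x, h1, Real.fourierInv_eq, Real.fourierInv_eq, ← integral_const_mul]
  refine integral_congr_ae (ae_of_all _ fun ξ => ?_)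
  simp only
  rw [mul_smul_comm]

end

/-! ### Plancherel for continuous functions of compact support -/

variable {w : E → ℂ}

/-- The functions to which Plancherel is applied are continuous of compact support but not Schwartz.
The L² transform and the integral are identified by testing against smooth functions, where both
pass to the test function. -/
theorem fourier_toLp_ae_eq (hw : Continuous w) (hc : HasCompactSupport w) :
    ((𝓕 ((hw.memLp_of_hasCompactSupport hc (p := 2)).toLp w : Lp ℂ 2 (volume : Measure E)) : Lp ℂ 2 (volume : Measure E)) : E → ℂ)
      =ᵐ[volume] 𝓕 w := by
  set W : Lp (α := E) ℂ 2 := (hw.memLp_of_hasCompactSupport hc (p := 2)).toLp w with hW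
  have hwi : Integrable w := hw.integrable_of_hasCompactSupport hc
  have hcont : Continuous (𝓕 w) := by
    have := VectorFourier.fourierIntegral_continuous (μ := volume) (L := innerₗ E)
      Real.continuous_fourierChar continuous_inner hwi
    exact this
  refine ae_eq_of_integral_contDiff_smul_eq
    ((Lp.memLp (𝓕 W : Lp ℂ 2 (volume : Measure E))).locallyIntegrable (by norm_num)) hcont.locallyIntegrable fun φ hφ hφc => ?_
  have hφ' : ContDiff ℝ ∞ fun x => (φ x : ℂ) := Complex.ofRealCLM.contDiff.comp hφ
  have hφc' : HasCompactSupport fun x => (φ x : ℂ) := hφc.comp_left Complex.ofReal_zero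
  set s := hφc'.toSchwartzMap hφ' with hs
  have h1 := congrArg (fun T => T s) (Lp.fourier_toTemperedDistribution_eq W)
  simp only [TemperedDistribution.fourier_apply, Lp.toTemperedDistribution_apply] at h1
  have h2 : ∫ x, s x • (𝓕 W : Lp ℂ 2 (volume : Measure E)) x = ∫ x, φ x • (𝓕 W : Lp ℂ 2 (volume : Measure E)) x := by
    refine integral_congr_ae (ae_of_all _ fun x => ?_)
    simp [hs]
  have h3 : ∫ x, (𝓕 s) x • W x = ∫ x, w x • 𝓕 (s : E → ℂ) x := by
    refine integral_congr_ae ?_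
    filter_upwards [MemLp.coeFn_toLp (hw.memLp_of_hasCompactSupport hc (p := 2))] with x hx
    rw [hW, hx, smul_eq_mul, smul_eq_mul, mul_comm, SchwartzMap.fourier_coe]
  have h4 : ∫ ξ, 𝓕 w ξ • s ξ = ∫ x, w x • 𝓕 (s : E → ℂ) x := by
    simpa using! VectorFourier.integral_fourierIntegral_smul_eq_flip (L := innerₗ E)
      Real.continuous_fourierChar continuous_inner hwi s.integrable
  rw [← h2, ← h1, h3, ← h4]
  refine integral_congr_ae (ae_of_all _ fun x => ?_)
  simp [hs, mul_comm]

theorem lintegral_enorm_fourier_sq (hw : Continuous w) (hc : HasCompactSupport w) :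
    ∫⁻ ξ, ‖𝓕 w ξ‖ₑ ^ 2 = ∫⁻ x, ‖w x‖ₑ ^ 2 := by
  have hm := hw.memLp_of_hasCompactSupport hc (p := 2) (μ := (volume : Measure E))
  have h1 := Lp.norm_fourier_eq (hm.toLp w)
  rw [Lp.norm_def, Lp.norm_def, ENNReal.toReal_eq_toReal_iff' (Lp.eLpNorm_ne_top _) (Lp.eLpNorm_ne_top _),
    eLpNorm_congr_ae (fourier_toLp_ae_eq hw hc), eLpNorm_congr_ae hm.coeFn_toLp,
    eLpNorm_eq_lintegral_rpow_enorm_toReal (by norm_num) (by norm_num),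
    eLpNorm_eq_lintegral_rpow_enorm_toReal (by norm_num) (by norm_num)] at h1
  simp only [ENNReal.toReal_ofNat, ENNReal.rpow_ofNat] at h1
  exact ENNReal.rpow_left_injective (by norm_num) h1

/-- Plancherel for translation differences. -/
theorem lintegral_cos_mul_enorm_fourier_sq (hw : Continuous w) (hc : HasCompactSupport w) (y : E) :
    ∫⁻ ξ, ofReal (2 - 2 * Real.cos (2 * Real.pi * inner ℝ ξ y)) * ‖𝓕 w ξ‖ₑ ^ 2
      = ∫⁻ x, ‖w (x + y) - w x‖ₑ ^ 2 := by
  have hwi : Integrable w := hw.integrable_of_hasCompactSupport hc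
  have hcy : HasCompactSupport fun x => w (x + y) := hc.comp_homeomorph (Homeomorph.addRight y)
  have hcy' : Continuous fun x => w (x + y) := by fun_prop
  rw [← lintegral_enorm_fourier_sq (w := fun x => w (x + y) - w x) (by fun_prop) (hcy.sub hc)]
  refine lintegral_congr fun ξ => ?_
  have h1 : 𝓕 (fun x => w (x + y) - w x) ξ = (Real.fourierChar (inner ℝ y ξ) - 1 : ℂ) * 𝓕 w ξ := by
    have h2 : 𝓕 (fun x => w (x + y)) ξ = (Real.fourierChar (inner ℝ y ξ) : ℂ) * 𝓕 w ξ := by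
      rw [Real.fourier_eq, Real.fourier_eq, ← integral_const_mul,
        ← integral_sub_right_eq_self _ y]
      refine integral_congr_ae (ae_of_all _ fun x => ?_)
      simp only [sub_add_cancel, Circle.smul_def, smul_eq_mul]
      rw [← mul_assoc, ← Circle.coe_mul, ← AddChar.map_add_eq_mul, inner_sub_left]
      congr 3; ring
    have h3 : 𝓕 (fun x => w (x + y) - w x) ξ = 𝓕 (fun x => w (x + y)) ξ - 𝓕 w ξ := by
      rw [Real.fourier_eq, Real.fourier_eq, Real.fourier_eq, ← integral_sub]
      · simp only [smul_sub]
      · exact (Real.fourierIntegral_convergent_iff ξ).2 (hwi.comp_add_right y)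
      · exact (Real.fourierIntegral_convergent_iff ξ).2 hwi
    rw [h3, h2]; ring
  rw [h1, enorm_mul, mul_pow]
  congr 1
  rw [← ofReal_norm_eq_enorm, ← ofReal_pow (norm_nonneg _)]
  congr 1
  rw [Complex.sq_norm, Complex.normSq_apply, Real.fourierChar_apply, real_inner_comm y ξ]
  have h5 : Complex.exp (↑(2 * Real.pi * inner ℝ y ξ) * Complex.I) =
    Complex.exp (((2 * Real.pi * inner ℝ y ξ : ℝ) : ℂ) * Complex.I) := rfl
  simp only [Complex.sub_re, Complex.sub_im, Complex.exp_ofReal_mul_I_re, Complex.exp_ofReal_mul_I_im,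
    Complex.one_re, Complex.one_im]
  nlinarith [Real.sin_sq_add_cos_sq (2 * Real.pi * inner ℝ y ξ)]

end FourierSide

/-! ### Energy estimates for the fractional operators -/

section Energy

open Module

variable {E : Type*} [NormedAddCommGroup E] [InnerProductSpace ℝ E] [FiniteDimensional ℝ E]
  [MeasurableSpace E] [BorelSpace E] {w G : E → ℂ} {α k : ℝ}

theorem continuous_fourier_of_integrable (hw : Integrable w) : Continuous (𝓕 w) :=
  VectorFourier.fourierIntegral_continuous (μ := volume) (L := innerₗ E)
    Real.continuous_fourierChar continuous_inner hw

/-- Duality estimate: a function of finite energy against the fractional operator. -/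
theorem enorm_integral_mul_fracOp_le [Nontrivial E] (h0 : 0 < α) (h2 : α < 2) (hG : ContDiff ℝ ∞ G)
    (hc : HasCompactSupport G) (hk : ∀ ξ : E, diffSymbol α ξ = k * ‖ξ‖ ^ α) (hk0 : 0 < k)
    (hw : Continuous w) (hwc : HasCompactSupport w) :
    ‖∫ x, w x * fracOp α (ContinuousLinearMap.id ℝ E) G x‖ₑ ≤ ofReal k *
      (∫⁻ ξ, ofReal (‖ξ‖ ^ (2 * α)) * ‖𝓕 w ξ‖ₑ ^ 2) ^ (1 / 2 : ℝ) *
        (∫⁻ x, ‖G x‖ₑ ^ 2) ^ (1 / 2 : ℝ) := by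
  have hwi : Integrable w := hw.integrable_of_hasCompactSupport hwc
  set H : E → ℂ := fun ξ => ((‖ξ‖ ^ α : ℝ) : ℂ) * 𝓕 G ξ with hH
  have hHi : Integrable H := integrable_rpow_mul_fourier h0.le h2.le hG hc
  -- The transform is moved onto w; Cauchy–Schwarz in frequency then puts the whole weight |ξ|^α on
  -- w, and only the L² norm of G remains.
  have hflip : ∫ x, 𝓕 (fun ξ => H (-ξ)) x • w x = ∫ ξ, H (-ξ) • 𝓕 w ξ := by
    simpa using! VectorFourier.integral_fourierIntegral_smul_eq_flip (L := innerₗ E)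
      Real.continuous_fourierChar continuous_inner hHi.comp_neg hwi
  have h1 : ∫ x, w x * fracOp α (ContinuousLinearMap.id ℝ E) G x = k * ∫ ξ, H (-ξ) • 𝓕 w ξ := by
    rw [← hflip, ← integral_const_mul]
    refine integral_congr_ae (ae_of_all _ fun x => ?_)
    simp only [smul_eq_mul]
    rw [fracOp_eq_fourierInv h0 h2 hG hc hk, Real.fourierInv_eq_fourier_comp_neg]
    ring
  have hkn : ‖(k : ℂ)‖ₑ = ofReal k := by
    rw [← ofReal_norm_eq_enorm, Complex.norm_real, Real.norm_of_nonneg hk0.le]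
  rw [h1, enorm_mul, hkn, mul_assoc]
  gcongr
  have hGm : ∫⁻ ξ, ‖𝓕 G (-ξ)‖ₑ ^ 2 = ∫⁻ x, ‖G x‖ₑ ^ 2 := by
    rw [← lintegral_enorm_fourier_sq hG.continuous hc]
    exact (Measure.measurePreserving_neg (volume : Measure E)).lintegral_comp_emb
      (MeasurableEquiv.neg E).measurableEmbedding (fun ξ => ‖𝓕 G ξ‖ₑ ^ 2)
  have hcG : Continuous (𝓕 G) :=
    continuous_fourier_of_integrable (hG.continuous.integrable_of_hasCompactSupport hc)
  have hcw : Continuous (𝓕 w) := continuous_fourier_of_integrable hwi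
  have hpm : Measurable fun ξ : E => ofReal (‖ξ‖ ^ α) := by fun_prop
  calc ‖∫ ξ, H (-ξ) • 𝓕 w ξ‖ₑ ≤ ∫⁻ ξ, ‖H (-ξ) • 𝓕 w ξ‖ₑ := enorm_integral_le_lintegral_enorm _
    _ = ∫⁻ ξ, ((fun ξ => ofReal (‖ξ‖ ^ α) * ‖𝓕 w ξ‖ₑ) * fun ξ => ‖𝓕 G (-ξ)‖ₑ) ξ := by
        refine lintegral_congr fun ξ => ?_
        have h3 : ‖((‖ξ‖ ^ α : ℝ) : ℂ)‖ₑ = ofReal (‖ξ‖ ^ α) := by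
          rw [← ofReal_norm_eq_enorm, Complex.norm_real, Real.norm_of_nonneg (by positivity)]
        simp only [hH, smul_eq_mul, enorm_mul, norm_neg, Pi.mul_apply, h3]
        ring
    _ ≤ (∫⁻ ξ, (ofReal (‖ξ‖ ^ α) * ‖𝓕 w ξ‖ₑ) ^ (2 : ℝ)) ^ (1 / 2 : ℝ) *
        (∫⁻ ξ, ‖𝓕 G (-ξ)‖ₑ ^ (2 : ℝ)) ^ (1 / 2 : ℝ) :=
        ENNReal.lintegral_mul_le_Lp_mul_Lq volume Real.HolderConjugate.two_two
          (hpm.mul hcw.measurable.enorm).aemeasurable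
          (hcG.comp continuous_neg).measurable.enorm.aemeasurable
    _ = _ := by
        simp only [ENNReal.rpow_ofNat, hGm, mul_pow]
        congr 4
        funext ξ
        rw [← ofReal_pow (by positivity), ← Real.rpow_natCast, ← Real.rpow_mul (norm_nonneg _)]
        norm_num [mul_comm]

/-- The energy of order `γ` as a Gagliardo seminorm. -/
theorem lintegral_rpow_mul_enorm_fourier_sq [Nontrivial E] {γ : ℝ} (h0 : 0 < γ) (h2 : γ < 2)
    (hk : ∀ ξ : E, diffSymbol γ ξ = k * ‖ξ‖ ^ γ) (hk0 : 0 < k) (hw : Continuous w)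
    (hwc : HasCompactSupport w) :
    ofReal k * ∫⁻ ξ, ofReal (‖ξ‖ ^ γ) * ‖𝓕 w ξ‖ₑ ^ 2
      = ∫⁻ y : E, ofReal (rieszKernel γ y) * ∫⁻ x, ‖w (x + y) - w x‖ₑ ^ 2 := by
  have hcw : Continuous (𝓕 w) :=
    continuous_fourier_of_integrable (hw.integrable_of_hasCompactSupport hwc)
  have hm : Measurable fun ξ : E => ofReal (‖ξ‖ ^ γ) * ‖𝓕 w ξ‖ₑ ^ 2 := by
    have := hcw.measurable
    fun_prop
  rw [← lintegral_const_mul _ hm]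
  have h1 : ∀ ξ : E, ofReal k * (ofReal (‖ξ‖ ^ γ) * ‖𝓕 w ξ‖ₑ ^ 2)
      = ∫⁻ y : E, ofReal ((2 - 2 * Real.cos (2 * Real.pi * inner ℝ ξ y)) * rieszKernel γ y) *
        ‖𝓕 w ξ‖ₑ ^ 2 := by
    intro ξ
    have h4 : Measurable fun y : E =>
        ofReal ((2 - 2 * Real.cos (2 * Real.pi * inner ℝ ξ y)) * rieszKernel γ y) :=
      ((measurable_diffSymbol_integrand γ).comp (measurable_const.prodMk measurable_id)).ennreal_ofReal
    rw [lintegral_mul_const _ h4, ← ofReal_integral_eq_lintegral_ofReal (integrable_diffSymbol h0 h2 ξ)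
        (Filter.Eventually.of_forall (diffSymbol_integrand_nonneg γ ξ)), ← mul_assoc,
      ← ofReal_mul hk0.le, ← hk ξ]
    rfl
  simp_rw [h1]
  rw [lintegral_lintegral_swap]
  · refine lintegral_congr fun y => ?_
    rw [← lintegral_cos_mul_enorm_fourier_sq hw hwc, ← lintegral_const_mul]
    · refine lintegral_congr fun ξ => ?_
      rw [ENNReal.ofReal_mul' (rieszKernel_nonneg γ y)]
      ring
    · have h3 : Measurable fun ξ : E => ofReal (2 - 2 * Real.cos (2 * Real.pi * inner ℝ ξ y)) :=
        (Continuous.measurable (by fun_prop)).ennreal_ofReal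
      exact h3.mul (hcw.measurable.enorm.pow_const 2)
  · exact ((measurable_diffSymbol_integrand γ).ennreal_ofReal.mul
      ((hcw.measurable.comp measurable_fst).enorm.pow_const 2)).aemeasurable

/-- Plancherel for difference quotients of step 1/(n+1): Fatou on the frequency side, dominated
convergence with Rademacher on the space side. No formula for the transform of a derivative is
required, and the Lipschitz constant enters only as a dominating bound. -/
theorem lintegral_inner_sq_mul_enorm_fourier_sq_le {K : ℝ≥0} (hw : LipschitzWith K w)
    (hwc : HasCompactSupport w) (e : E) :
    ∫⁻ ξ, ofReal ((inner ℝ ξ e) ^ 2) * ‖𝓕 w ξ‖ₑ ^ 2 ≤ ∫⁻ x, ‖fderiv ℝ w x e‖ₑ ^ 2 := by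
  have hcw : Continuous (𝓕 w) :=
    continuous_fourier_of_integrable (hw.continuous.integrable_of_hasCompactSupport hwc)
  set c : ℕ → ℝ := fun n => n + 1 with hc
  have hcpos : ∀ n, 0 < c n := fun n => by positivity
  have hctop : Filter.Tendsto c Filter.atTop Filter.atTop :=
    Filter.tendsto_atTop_add_const_right _ _ tendsto_natCast_atTop_atTop
  have hlim : Filter.Tendsto (fun n => ∫⁻ x, ‖c n • (w (x + (c n)⁻¹ • e) - w x)‖ₑ ^ 2) Filter.atTop
      (nhds (∫⁻ x, ‖fderiv ℝ w x e‖ₑ ^ 2)) := by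
    have hT : volume (Metric.cthickening ‖e‖ (tsupport w)) ≠ ⊤ :=
      hwc.isCompact.cthickening.measure_lt_top.ne
    refine tendsto_lintegral_of_dominated_convergence
      (fun x => (Metric.cthickening ‖e‖ (tsupport w)).indicator
        (fun _ => ofReal ((K * ‖e‖) ^ 2)) x)
      (fun n => ?_) (fun n => Filter.Eventually.of_forall fun x => ?_) ?_ ?_
    · have := hw.continuous
      have h3 : Continuous fun x => c n • (w (x + (c n)⁻¹ • e) - w x) := by fun_prop
      exact h3.measurable.enorm.pow_const 2
    · have hsmall : ‖(c n)⁻¹ • e‖ ≤ ‖e‖ := by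
        rw [norm_smul, norm_inv, Real.norm_of_nonneg (hcpos n).le]
        refine mul_le_of_le_one_left (norm_nonneg _) (inv_le_one_of_one_le₀ ?_)
        simp [hc]
      by_cases hx : x ∈ Metric.cthickening ‖e‖ (tsupport w)
      · simp only
        rw [indicator_of_mem hx, ← ofReal_norm_eq_enorm, ← ofReal_pow (norm_nonneg _)]
        refine ofReal_le_ofReal (pow_le_pow_left₀ (norm_nonneg _) ?_ 2)
        have h3 := hw.norm_sub_le (x + (c n)⁻¹ • e) x
        rw [add_sub_cancel_left, norm_smul, norm_inv, Real.norm_of_nonneg (hcpos n).le] at h3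
        rw [norm_smul, Real.norm_of_nonneg (hcpos n).le]
        calc _ ≤ c n * (K * ((c n)⁻¹ * ‖e‖)) := by gcongr
          _ = _ := by have := (hcpos n).ne'; field_simp
      · have hz : ∀ q, dist x q ≤ ‖e‖ → w q = 0 := by
          intro q hq
          by_contra hne
          exact hx (Metric.mem_cthickening_of_dist_le x q _ _ (subset_tsupport _ hne) hq)
        simp only
        rw [hz x (by simp), hz (x + (c n)⁻¹ • e) (by simpa using hsmall)]
        simp
    · rw [lintegral_indicator Metric.isClosed_cthickening.measurableSet, setLIntegral_const]
      exact ENNReal.mul_ne_top ofReal_ne_top hT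
    · filter_upwards [hw.ae_differentiableAt] with x hx
      have h3 := hx.hasFDerivAt.lim e (c := c) (l := Filter.atTop) (by
        refine hctop.congr fun n => ?_
        rw [Real.norm_of_nonneg (hcpos n).le])
      exact ((ENNReal.continuous_pow 2).tendsto _).comp ((continuous_enorm.tendsto _).comp h3)
  have hmeas : ∀ n, Measurable fun ξ : E =>
      ofReal (c n ^ 2 * (2 - 2 * Real.cos (2 * Real.pi * inner ℝ ξ ((c n)⁻¹ • e)))) *
        ‖𝓕 w ξ‖ₑ ^ 2 := fun n =>
    (Continuous.measurable (by fun_prop)).ennreal_ofReal.mul (hcw.measurable.enorm.pow_const 2)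
  have heq : ∀ n, ∫⁻ ξ, ofReal (c n ^ 2 * (2 - 2 * Real.cos (2 * Real.pi * inner ℝ ξ ((c n)⁻¹ • e)))) *
        ‖𝓕 w ξ‖ₑ ^ 2 = ∫⁻ x, ‖c n • (w (x + (c n)⁻¹ • e) - w x)‖ₑ ^ 2 := by
    intro n
    have h3 : ∀ x, ‖c n • (w (x + (c n)⁻¹ • e) - w x)‖ₑ ^ 2
        = ofReal (c n ^ 2) * ‖w (x + (c n)⁻¹ • e) - w x‖ₑ ^ 2 := by
      intro x
      rw [enorm_smul, mul_pow, Real.enorm_of_nonneg (hcpos n).le, ofReal_pow (hcpos n).le]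
    have hcont := hw.continuous
    simp_rw [h3]
    rw [lintegral_const_mul _ (by
        have h4 : Continuous fun x => w (x + (c n)⁻¹ • e) - w x := by fun_prop
        exact h4.measurable.enorm.pow_const 2), ← lintegral_cos_mul_enorm_fourier_sq hcont hwc,
      ← lintegral_const_mul]
    · refine lintegral_congr fun ξ => ?_
      rw [ofReal_mul (by positivity), mul_assoc]
    · exact (Continuous.measurable (by fun_prop)).ennreal_ofReal.mul (hcw.measurable.enorm.pow_const 2)
  calc _ ≤ ∫⁻ ξ, Filter.liminf (fun n => ofReal (c n ^ 2 * (2 - 2 * Real.cos (2 * Real.pi *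
        inner ℝ ξ ((c n)⁻¹ • e)))) * ‖𝓕 w ξ‖ₑ ^ 2) Filter.atTop := by
        refine lintegral_mono fun ξ => ?_
        refine Filter.le_liminf_of_le (by isBoundedDefault) ?_
        filter_upwards [hctop.eventually_ge_atTop (2 * |inner ℝ ξ e|)] with n hn
        gcongr
        set s : ℝ := inner ℝ ξ e with hs
        have h3 : |2 * Real.pi * inner ℝ ξ ((c n)⁻¹ • e)| ≤ Real.pi := by
          rw [inner_smul_right, ← hs, abs_mul, abs_of_pos Real.two_pi_pos, abs_mul,
            abs_of_pos (inv_pos.2 (hcpos n))]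
          have h4 : (c n)⁻¹ * (2 * |s|) ≤ 1 := by
            rw [inv_mul_le_iff₀ (hcpos n)]; linarith
          nlinarith [Real.pi_pos]
        -- From cos x ≤ 1 - 2x²/π² on |x| ≤ π, the rescaled symbol is at least 16 times the square
        -- of the inner product for large n; a factor 1 is enough.
        have h4 := Real.cos_le_one_sub_mul_cos_sq h3
        rw [inner_smul_right, ← hs] at h4 ⊢
        have h5 : 2 / Real.pi ^ 2 * (2 * Real.pi * ((c n)⁻¹ * s)) ^ 2 = 8 * s ^ 2 / c n ^ 2 := by
          have := Real.pi_ne_zero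
          have := (hcpos n).ne'
          field_simp
          ring
        rw [h5] at h4
        have h6 : 8 * s ^ 2 / c n ^ 2 ≤ 1 - Real.cos (2 * Real.pi * ((c n)⁻¹ * s)) := by linarith
        rw [div_le_iff₀ (by have := hcpos n; positivity)] at h6
        nlinarith [sq_nonneg s]
    _ ≤ Filter.liminf (fun n => ∫⁻ ξ, ofReal (c n ^ 2 * (2 - 2 * Real.cos (2 * Real.pi *
        inner ℝ ξ ((c n)⁻¹ • e)))) * ‖𝓕 w ξ‖ₑ ^ 2) Filter.atTop := lintegral_liminf_le hmeas
    _ = _ := by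
        simp_rw [heq]
        exact hlim.liminf_eq

/-- The energy of order two is controlled by the gradient. -/
theorem lintegral_sq_mul_enorm_fourier_sq_le {K : ℝ≥0} (hw : LipschitzWith K w)
    (hwc : HasCompactSupport w) :
    ∫⁻ ξ, ofReal (‖ξ‖ ^ 2) * ‖𝓕 w ξ‖ₑ ^ 2 ≤ finrank ℝ E * ∫⁻ x, ‖fderiv ℝ w x‖ₑ ^ 2 := by
  have hcw : Continuous (𝓕 w) :=
    continuous_fourier_of_integrable (hw.continuous.integrable_of_hasCompactSupport hwc)
  set b := stdOrthonormalBasis ℝ E with hb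
  calc _ = ∫⁻ ξ, ∑ i, ofReal ((inner ℝ ξ (b i)) ^ 2) * ‖𝓕 w ξ‖ₑ ^ 2 := by
        refine lintegral_congr fun ξ => ?_
        rw [← Finset.sum_mul, ← ENNReal.ofReal_sum_of_nonneg fun i _ => sq_nonneg _,
          ← b.sum_sq_norm_inner_left ξ]
        simp only [Real.norm_eq_abs, sq_abs]
    _ = ∑ i, ∫⁻ ξ, ofReal ((inner ℝ ξ (b i)) ^ 2) * ‖𝓕 w ξ‖ₑ ^ 2 := by
        refine lintegral_finsetSum _ fun i _ => ?_
        exact (Continuous.measurable (by fun_prop)).ennreal_ofReal.mul (hcw.measurable.enorm.pow_const 2)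
    _ ≤ ∑ _i : Fin (finrank ℝ E), ∫⁻ x, ‖fderiv ℝ w x‖ₑ ^ 2 := by
        refine Finset.sum_le_sum fun i _ => (lintegral_inner_sq_mul_enorm_fourier_sq_le hw hwc (b i)).trans ?_
        refine lintegral_mono fun x => ?_
        gcongr
        rw [← ofReal_norm_eq_enorm, ← ofReal_norm_eq_enorm]
        refine ofReal_le_ofReal (((fderiv ℝ w x).le_opNorm (b i)).trans ?_)
        rw [b.norm_eq_one, mul_one]
    _ = _ := by simp

end Energy

/-! ### Decay of the fractional operators away from the support -/

section Decay

open Module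

variable {E : Type*} [NormedAddCommGroup E] [InnerProductSpace ℝ E] [FiniteDimensional ℝ E]
  [MeasurableSpace E] [BorelSpace E]

theorem rieszKernel_le_of_norm_sub_le {α ρ : ℝ} (hα : 0 < α) (hρ : 0 < ρ) {u v : E} (hu : 2 * ρ ≤ ‖u‖)
    (huv : ‖v - u‖ ≤ ρ) : rieszKernel α v ≤ 2 ^ (finrank ℝ E + α) * rieszKernel α u := by
  have h1 := norm_sub_norm_le u v
  rw [norm_sub_rev] at h1
  have hu0 : 0 < ‖u‖ := by linarith
  have hv : ‖u‖ / 2 ≤ ‖v‖ := by linarith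
  have h2 : rieszKernel α v ≤ (‖u‖ / 2) ^ (-(finrank ℝ E + α)) :=
    Real.rpow_le_rpow_of_nonpos (by positivity) hv (by have : (0 : ℝ) ≤ finrank ℝ E := by positivity
                                                       linarith)
  refine h2.trans_eq ?_
  rw [Real.div_rpow hu0.le (by norm_num), Real.rpow_neg (by norm_num : (0 : ℝ) ≤ 2), rieszKernel, div_inv_eq_mul,
    mul_comm]

/-- The mean value theorem for s ↦ s^{-q}: moving the argument by ρ trades one power of |u| for ρ.
This is the source of the extra decay for mean-zero functions. -/
theorem abs_rieszKernel_sub_le {α ρ : ℝ} (hα : 0 < α) (hρ : 0 < ρ) {u v : E} (hu : 2 * ρ ≤ ‖u‖)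
    (huv : ‖v - u‖ ≤ ρ) : |rieszKernel α v - rieszKernel α u|
      ≤ (finrank ℝ E + α) * 2 ^ (finrank ℝ E + α + 1) * ρ * rieszKernel (α + 1) u := by
  have h1 := norm_sub_norm_le u v
  rw [norm_sub_rev] at h1
  have hu0 : 0 < ‖u‖ := by linarith
  have hv : ‖u‖ / 2 ≤ ‖v‖ := by linarith
  set q : ℝ := finrank ℝ E + α with hq
  have hq0 : 0 < q := by rw [hq]; positivity
  have h2 := Convex.norm_image_sub_le_of_norm_hasDerivWithin_le (f := fun s : ℝ => s ^ (-q))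
    (f' := fun s => -q * s ^ (-q - 1)) (C := q * (‖u‖ / 2) ^ (-q - 1)) (s := Set.Ici (‖u‖ / 2))
    (x := ‖u‖) (y := ‖v‖) (fun s hs => ?_) (fun s hs => ?_) (convex_Ici _)
    (by simp only [Set.mem_Ici]; linarith) hv
  · rw [Real.norm_eq_abs, Real.norm_eq_abs] at h2
    refine h2.trans ?_
    have h3 : |‖v‖ - ‖u‖| ≤ ρ := (abs_norm_sub_norm_le v u).trans huv
    calc _ ≤ q * (‖u‖ / 2) ^ (-q - 1) * ρ := by gcongr
      _ = _ := by
        rw [Real.div_rpow hu0.le (by norm_num), show -q - 1 = -(q + 1) by ring,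
          Real.rpow_neg (by norm_num : (0 : ℝ) ≤ 2), rieszKernel, div_inv_eq_mul, ← add_assoc, ← hq]
        ring
  · have hs0 : 0 < s := lt_of_lt_of_le (by positivity) hs
    exact (Real.hasDerivAt_rpow_const (Or.inl hs0.ne')).hasDerivWithinAt
  · have hs0 : 0 < s := lt_of_lt_of_le (by positivity) hs
    rw [norm_mul, norm_neg, Real.norm_of_nonneg hq0.le, Real.norm_of_nonneg (by positivity)]
    refine mul_le_mul_of_nonneg_left ?_ hq0.le
    exact Real.rpow_le_rpow_of_nonpos (by positivity) hs (by linarith)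

variable {F : Type*} [NormedAddCommGroup F] [NormedSpace ℝ F] {G : E × F → ℂ} {α : ℝ}

theorem fracOp_inl (G : E × F → ℂ) (p : E × F) :
    fracOp α (inl ℝ E F) G p
      = fracOp α (ContinuousLinearMap.id ℝ E) (fun e => G (e, p.2)) p.1 := by
  obtain ⟨e, f⟩ := p
  simp [fracOp, secondDiff]

theorem contDiff_section (hG : ContDiff ℝ ∞ G) (f : F) : ContDiff ℝ ∞ fun e => G (e, f) :=
  hG.comp (contDiff_id.prodMk contDiff_const)

theorem hasCompactSupport_section (hc : HasCompactSupport G) (f : F) :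
    HasCompactSupport fun e => G (e, f) := by
  refine HasCompactSupport.of_support_subset_isCompact (hc.isCompact.image continuous_fst) fun e he => ?_
  exact ⟨(e, f), subset_tsupport _ he, rfl⟩

theorem fracOp_inl_eq_zero {e : E} {f : F} (h : ∀ e, G (e, f) = 0) :
    fracOp α (inl ℝ E F) G (e, f) = 0 := by
  rw [fracOp_inl]
  simp [fracOp, secondDiff, h]

theorem hasCompactSupport_fracOp_inl (hc : HasCompactSupport G) (e : E) :
    HasCompactSupport fun f => fracOp α (inl ℝ E F) G (e, f) := by
  refine HasCompactSupport.of_support_subset_isCompact (hc.isCompact.image continuous_snd) fun f hf => ?_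
  by_contra hne
  refine hf (fracOp_inl_eq_zero fun e' => ?_)
  by_contra h0
  exact hne ⟨(e', f), subset_tsupport _ h0, rfl⟩

variable [Nontrivial E]

/-- The case of the trivial character, where the symbol vanishes. It lets any term independent of e
be subtracted from a function paired with the operator. -/
theorem integral_fracOp_id (h0 : 0 < α) (h2 : α < 2) {g : E → ℂ} (hg : ContDiff ℝ ∞ g)
    (hc : HasCompactSupport g) : ∫ e, fracOp α (ContinuousLinearMap.id ℝ E) g e = 0 := by
  have h := integral_mul_fracOp (L := ContinuousLinearMap.id ℝ E) (μ := volume) h0 h2 hg hc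
    (b := fun _ => 1) (χ := fun _ => 1) continuous_const (by simp) (by simp)
  norm_num at h
  exact h

/-- Away from the support the central term of the second difference vanishes and the two translates
contribute equally by symmetry of the kernel, so the singular integral becomes an absolutely
convergent convolution. -/
theorem fracOp_eq_of_far {g : E → ℂ} (hg : Continuous g) (hc : HasCompactSupport g) {e₀ e : E} {ρ : ℝ}
    (hα : 0 < α) (hρ : 0 < ρ) (hsupp : ∀ e, g e ≠ 0 → ‖e - e₀‖ ≤ ρ) (he : 2 * ρ ≤ ‖e - e₀‖) :
    Integrable (fun y => rieszKernel α (e - y) • g y) ∧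
    fracOp α (ContinuousLinearMap.id ℝ E) g e = -2 * ∫ y, rieszKernel α (e - y) • g y := by
  have hgi := hg.integrable_of_hasCompactSupport hc (μ := volume)
  have hge : g e = 0 := by
    by_contra hne
    linarith [hsupp e hne]
  have hint : Integrable (fun y => rieszKernel α (e - y) • g y) := by
    refine (hgi.norm.const_mul (2 ^ (finrank ℝ E + α) * rieszKernel α (e - e₀))).mono'
      (((measurable_rieszKernel α).comp (measurable_const.sub measurable_id)).aestronglyMeasurable.smul
        hg.aestronglyMeasurable) (ae_of_all _ fun y => ?_)
    rw [norm_smul, Real.norm_of_nonneg (rieszKernel_nonneg _ _)]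
    by_cases hy : g y = 0
    · simp [hy]
    · refine mul_le_mul_of_nonneg_right (rieszKernel_le_of_norm_sub_le hα hρ he ?_) (norm_nonneg _)
      rw [sub_sub_sub_cancel_left, norm_sub_rev]
      exact hsupp y hy
  refine ⟨hint, ?_⟩
  have h1 : ∫ y, rieszKernel α y • g (e - y) = ∫ y, rieszKernel α (e - y) • g y := by
    rw [← integral_sub_left_eq_self _ volume e]
    simp only [sub_sub_cancel]
  have h1i : Integrable fun y => rieszKernel α y • g (e - y) := by
    have := hint.comp_sub_left e
    simpa only [sub_sub_cancel] using this
  have h2 : ∫ y, rieszKernel α y • g (e + y) = ∫ y, rieszKernel α y • g (e - y) := by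
    rw [← integral_neg_eq_self]
    simp only [rieszKernel_neg, sub_eq_add_neg]
  have h2i : Integrable fun y => rieszKernel α y • g (e + y) := by
    have := h1i.comp_neg
    simpa only [rieszKernel_neg, sub_neg_eq_add] using this
  have h3 : fracOp α (ContinuousLinearMap.id ℝ E) g e
      = ∫ y, (-(rieszKernel α y • g (e + y)) - rieszKernel α y • g (e - y)) := by
    refine integral_congr_ae (ae_of_all _ fun y => ?_)
    simp only [secondDiff, hge, ContinuousLinearMap.id_apply, mul_zero, zero_sub, smul_sub, smul_neg]
  rw [h3, integral_sub (f := fun y => -(rieszKernel α y • g (e + y))) h2i.neg h1i, integral_neg, h2, h1]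
  ring

/-- Freezing the kernel at e₀ gives a leading term proportional to the mass of g, with an error of
one higher order of decay. -/
theorem norm_fracOp_add_le {g : E → ℂ} (hg : Continuous g) (hc : HasCompactSupport g) {e₀ e : E} {ρ : ℝ}
    (hα : 0 < α) (hρ : 0 < ρ) (hsupp : ∀ e, g e ≠ 0 → ‖e - e₀‖ ≤ ρ) (he : 2 * ρ ≤ ‖e - e₀‖) :
    ‖fracOp α (ContinuousLinearMap.id ℝ E) g e + 2 * (rieszKernel α (e - e₀) • ∫ y, g y)‖
      ≤ 2 * ((finrank ℝ E + α) * 2 ^ (finrank ℝ E + α + 1)) * ρ * rieszKernel (α + 1) (e - e₀) *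
        ∫ y, ‖g y‖ := by
  have hgi := hg.integrable_of_hasCompactSupport hc (μ := volume)
  obtain ⟨hi, heq⟩ := fracOp_eq_of_far hg hc hα hρ hsupp he
  have h5 : ∫ y, (rieszKernel α (e - y) - rieszKernel α (e - e₀)) • g y
      = (∫ y, rieszKernel α (e - y) • g y) - rieszKernel α (e - e₀) • ∫ y, g y := by
    rw [← integral_smul, ← integral_sub (g := fun y => rieszKernel α (e - e₀) • g y) hi
      (Integrable.smul (rieszKernel α (e - e₀)) hgi)]
    refine integral_congr_ae (ae_of_all _ fun y => ?_)
    simp only [sub_smul]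
  have h4 : fracOp α (ContinuousLinearMap.id ℝ E) g e + 2 * (rieszKernel α (e - e₀) • ∫ y, g y)
      = -2 * ∫ y, (rieszKernel α (e - y) - rieszKernel α (e - e₀)) • g y := by
    rw [heq, h5]
    ring
  rw [h4, norm_mul, show ‖(-2 : ℂ)‖ = 2 by simp, mul_assoc 2, mul_assoc 2, mul_assoc 2]
  refine mul_le_mul_of_nonneg_left ?_ zero_le_two
  rw [← integral_const_mul]
  refine norm_integral_le_of_norm_le (hgi.norm.const_mul _) (ae_of_all _ fun y => ?_)
  rw [norm_smul, Real.norm_eq_abs]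
  by_cases hy : g y = 0
  · simp [hy]
  · refine mul_le_mul_of_nonneg_right (abs_rieszKernel_sub_le hα hρ he ?_) (norm_nonneg _)
    rw [sub_sub_sub_cancel_left, norm_sub_rev]
    exact hsupp y hy

variable [FiniteDimensional ℝ F] [MeasurableSpace F] [BorelSpace F] {ν : Measure F} [ν.IsAddHaarMeasure]

theorem integrable_fracOp_inl_section (h0 : 0 < α) (h2 : α < 2) (hG : ContDiff ℝ ∞ G)
    (hc : HasCompactSupport G) {Φ : F → ℂ} (hΦ : Continuous Φ) (e : E) :
    Integrable (fun f => Φ f * fracOp α (inl ℝ E F) G (e, f)) ν := by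
  refine Continuous.integrable_of_hasCompactSupport ?_ (hasCompactSupport_fracOp_inl hc e).mul_left
  exact hΦ.mul ((continuous_fracOp _ h0 h2 hG hc).comp (Continuous.prodMk_right e))

/-- Decay of the fractional operator. -/
theorem integral_norm_fracOp_le (h0 : 0 < α) (h2 : α < 2) (hG : ContDiff ℝ ∞ G)
    (hc : HasCompactSupport G) {e₀ e : E} {ρ : ℝ} (hρ : 0 < ρ)
    (hsupp : ∀ e f, G (e, f) ≠ 0 → ‖e - e₀‖ ≤ ρ) (he : 2 * ρ ≤ ‖e - e₀‖) :
    ∫ f, ‖fracOp α (inl ℝ E F) G (e, f)‖ ∂ν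
      ≤ 2 * 2 ^ (finrank ℝ E + α) * rieszKernel α (e - e₀) * ∫ p, ‖G p‖ ∂(volume.prod ν) := by
  have hGi := (hG.continuous.integrable_of_hasCompactSupport hc (μ := (volume : Measure E).prod ν)).norm
  rw [integral_prod_symm _ hGi, ← integral_const_mul]
  refine integral_mono ?_ (hGi.integral_prod_right.const_mul _) fun f => ?_
  · have := (integrable_fracOp_inl_section (ν := ν) h0 h2 hG hc (continuous_const (y := (1 : ℂ))) e).norm
    simpa using this
  · have hgc := hasCompactSupport_section hc f
    have hgs := contDiff_section hG f
    have hgi := hgs.continuous.integrable_of_hasCompactSupport hgc (μ := volume)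
    obtain ⟨hi, heq⟩ := fracOp_eq_of_far hgs.continuous hgc h0 hρ (fun e he => hsupp e f he) he
    simp only
    rw [fracOp_inl, heq, norm_mul, show ‖(-2 : ℂ)‖ = 2 by simp, mul_assoc 2, mul_assoc 2]
    refine mul_le_mul_of_nonneg_left ?_ zero_le_two
    rw [← integral_const_mul]
    refine norm_integral_le_of_norm_le (hgi.norm.const_mul _) (ae_of_all _ fun y => ?_)
    rw [norm_smul, Real.norm_of_nonneg (rieszKernel_nonneg _ _)]
    by_cases hy : G (y, f) = 0
    · simp [hy]
    · refine mul_le_mul_of_nonneg_right (rieszKernel_le_of_norm_sub_le h0 hρ he ?_) (norm_nonneg _)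
      rw [sub_sub_sub_cancel_left, norm_sub_rev]
      exact hsupp y f hy

/-- Improved decay for functions of mean zero. -/
theorem norm_integral_fracOp_le (h0 : 0 < α) (h2 : α < 2) (hG : ContDiff ℝ ∞ G)
    (hc : HasCompactSupport G) {e₀ e : E} {ρ : ℝ} (hρ : 0 < ρ)
    (hsupp : ∀ e f, G (e, f) ≠ 0 → ‖e - e₀‖ ≤ ρ) (he : 2 * ρ ≤ ‖e - e₀‖)
    (hmean : ∫ p, G p ∂(volume.prod ν) = 0) :
    ‖∫ f, fracOp α (inl ℝ E F) G (e, f) ∂ν‖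
      ≤ 2 * ((finrank ℝ E + α) * 2 ^ (finrank ℝ E + α + 1)) * ρ * rieszKernel (α + 1) (e - e₀) *
        ∫ p, ‖G p‖ ∂(volume.prod ν) := by
  have hGi' := hG.continuous.integrable_of_hasCompactSupport hc (μ := (volume : Measure E).prod ν)
  have hGi := hGi'.norm
  -- The slices of G need not have mean zero, but their leading terms share the factor at e - e₀ and
  -- cancel after integration in f.
  have hm2 : ∫ f, 2 * (rieszKernel α (e - e₀) • ∫ y, G (y, f)) ∂ν = 0 := by
    have h3 : ∫ f, (∫ y, G (y, f)) ∂ν = 0 := by rw [← hmean]; exact (integral_prod_symm G hGi').symm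
    rw [integral_const_mul, integral_smul, h3, smul_zero, mul_zero]
  have hi1 : Integrable (fun f => fracOp α (inl ℝ E F) G (e, f)) ν := by
    have := integrable_fracOp_inl_section (ν := ν) h0 h2 hG hc (continuous_const (y := (1 : ℂ))) e
    simpa using this
  have hi2 : Integrable (fun f => 2 * (rieszKernel α (e - e₀) • ∫ y, G (y, f))) ν := by
    have h4 : Integrable (fun f => ∫ y, G (y, f)) ν := hGi'.integral_prod_right
    have h5 := Integrable.smul (rieszKernel α (e - e₀)) h4
    exact h5.const_mul 2
  have h3 : ∫ f, fracOp α (inl ℝ E F) G (e, f) ∂ν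
      = ∫ f, (fracOp α (inl ℝ E F) G (e, f)
        + 2 * (rieszKernel α (e - e₀) • ∫ y, G (y, f))) ∂ν := by
    rw [integral_add hi1 hi2, hm2, add_zero]
  rw [h3, integral_prod_symm _ hGi, ← integral_const_mul]
  refine norm_integral_le_of_norm_le (hGi.integral_prod_right.const_mul _)
    (ae_of_all _ fun f => ?_)
  rw [fracOp_inl]
  exact norm_fracOp_add_le (contDiff_section hG f).continuous (hasCompactSupport_section hc f) h0 hρ
    (fun e he => hsupp e f he) he

theorem integrable_integral_fracOp (h0 : 0 < α) (h2 : α < 2) (hG : ContDiff ℝ ∞ G)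
    (hc : HasCompactSupport G) :
    Integrable fun e => ∫ f, fracOp α (inl ℝ E F) G (e, f) ∂ν :=
  (integrable_fracOp (μ := (volume : Measure E).prod ν) h0 h2 hG hc).integral_prod_left

/-- Mean zero improves the decay to order d + α + 1, so one factor |e - e₀| is still integrable at
infinity. Pairings with functions that are affine in e rely on this. -/
theorem integrable_norm_mul_integral_fracOp (h0 : 0 < α) (h2 : α < 2) (hG : ContDiff ℝ ∞ G)
    (hc : HasCompactSupport G) {e₀ : E} {ρ : ℝ} (hρ : 0 < ρ)
    (hsupp : ∀ e f, G (e, f) ≠ 0 → ‖e - e₀‖ ≤ ρ) (hmean : ∫ p, G p ∂(volume.prod ν) = 0) :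
    Integrable fun e => ‖e - e₀‖ * ‖∫ f, fracOp α (inl ℝ E F) G (e, f) ∂ν‖ := by
  have hV := integrable_integral_fracOp (ν := ν) h0 h2 hG hc
  have hmeas : AEStronglyMeasurable (fun e => ‖e - e₀‖ *
      ‖∫ f, fracOp α (inl ℝ E F) G (e, f) ∂ν‖) volume :=
    (Continuous.aestronglyMeasurable (by fun_prop)).mul hV.aestronglyMeasurable.norm
  have hcomp := (integrable_indicator_iff (measurableSet_le_norm (2 * ρ))).2
    (integrableOn_rieszKernel (E := E) h0 (by positivity : 0 < 2 * ρ))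
  set C := 2 * ((finrank ℝ E + α) * 2 ^ (finrank ℝ E + α + 1)) * ρ * ∫ p, ‖G p‖ ∂(volume.prod ν) with hC
  refine ((hV.norm.const_mul (2 * ρ)).add ((hcomp.comp_sub_right e₀).const_mul C)).mono' hmeas
    (ae_of_all _ fun e => ?_)
  rw [norm_mul, norm_norm, norm_norm]
  have hC0 : 0 ≤ C := by
    have : 0 ≤ ∫ p, ‖G p‖ ∂((volume : Measure E).prod ν) := integral_nonneg fun _ => norm_nonneg _
    positivity
  by_cases he : 2 * ρ ≤ ‖e - e₀‖
  · have h3 := norm_integral_fracOp_le (ν := ν) h0 h2 hG hc hρ hsupp he hmean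
    have hpos : 0 < ‖e - e₀‖ := by linarith
    have h4 : ‖e - e₀‖ * rieszKernel (α + 1) (e - e₀) = rieszKernel α (e - e₀) := by
      rw [rieszKernel, rieszKernel, ← Real.rpow_one_add' hpos.le]
      · congr 1; ring
      · have : (0 : ℝ) ≤ finrank ℝ E := by positivity
        linarith
    have h5 : {y : E | 2 * ρ ≤ ‖y‖}.indicator (rieszKernel α) (e - e₀) = rieszKernel α (e - e₀) :=
      indicator_of_mem (show e - e₀ ∈ {y : E | 2 * ρ ≤ ‖y‖} from he) _
    simp only [Pi.add_apply]
    rw [h5, ← h4]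
    calc _ ≤ ‖e - e₀‖ * _ := mul_le_mul_of_nonneg_left h3 (norm_nonneg _)
      _ = 0 + C * (‖e - e₀‖ * rieszKernel (α + 1) (e - e₀)) := by rw [hC]; ring
      _ ≤ _ := by gcongr; positivity
  · have h3 : 0 ≤ {y : E | 2 * ρ ≤ ‖y‖}.indicator (rieszKernel α) (e - e₀) :=
      Set.indicator_nonneg (fun y _ => rieszKernel_nonneg α y) _
    have h4 : ‖e - e₀‖ ≤ 2 * ρ := (not_le.1 he).le
    simp only [Pi.add_apply]
    have h5 := mul_le_mul_of_nonneg_right h4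
      (norm_nonneg (∫ f, fracOp α (inl ℝ E F) G (e, f) ∂ν))
    nlinarith [mul_nonneg hC0 h3]

end Decay

/-! ### Pairing functions of moderate growth with the fractional operators -/

section Pairing

open Module

variable {E : Type*} [NormedAddCommGroup E] [InnerProductSpace ℝ E] [FiniteDimensional ℝ E]
  [MeasurableSpace E] [BorelSpace E] [Nontrivial E]
  {F : Type*} [NormedAddCommGroup F] [NormedSpace ℝ F] [FiniteDimensional ℝ F] [MeasurableSpace F]
  [BorelSpace F] {ν : Measure F} [ν.IsAddHaarMeasure] {G : E × F → ℂ} {α : ℝ}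

theorem fourier_integral_prod {H : E × F → ℂ} (hH : Integrable H (volume.prod ν)) (ξ : E) :
    𝓕 (fun e => ∫ f, H (e, f) ∂ν) ξ = ∫ p, Real.fourierChar (-inner ℝ p.1 ξ) • H p ∂(volume.prod ν) := by
  have hcont : Continuous fun p : E × F => (Real.fourierChar (-inner ℝ p.1 ξ) : ℂ) := by
    have h1 : Continuous fun p : E × F => -inner ℝ p.1 ξ := by fun_prop
    exact continuous_subtype_val.comp (Real.continuous_fourierChar.comp h1)
  have hi : Integrable (fun p : E × F => Real.fourierChar (-inner ℝ p.1 ξ) • H p) (volume.prod ν) :=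
    hH.bdd_mul (c := 1) hcont.aestronglyMeasurable (ae_of_all _ fun p =>
      (Circle.norm_coe _).le)
  rw [integral_prod _ hi, Real.fourier_eq]
  refine integral_congr_ae (ae_of_all _ fun e => ?_)
  simp only [Circle.smul_def]
  rw [integral_smul]

/-- The first moments of the operator of order one vanish on functions of mean zero. -/
theorem integral_inner_mul_integral_fracOp (hG : ContDiff ℝ ∞ G) (hc : HasCompactSupport G) {e₀ : E}
    {ρ : ℝ} (hρ : 0 < ρ) (hsupp : ∀ e f, G (e, f) ≠ 0 → ‖e - e₀‖ ≤ ρ)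
    (hmean : ∫ p, G p ∂(volume.prod ν) = 0) (a : E) :
    ∫ e, ((inner ℝ a (e - e₀) : ℝ) : ℂ) *
      ∫ f, fracOp 1 (inl ℝ E F) G (e, f) ∂ν = 0 := by
  have h0 : (0 : ℝ) < 1 := one_pos
  have h2 : (1 : ℝ) < 2 := one_lt_two
  set V : E → ℂ := fun e => ∫ f, fracOp 1 (inl ℝ E F) G (e, f) ∂ν with hVd
  set g : E → ℂ := fun e => ∫ f, G (e, f) ∂ν with hgd
  have hUi := integrable_fracOp (L := inl ℝ E F)
    (μ := (volume : Measure E).prod ν) h0 h2 hG hc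
  have hGi := hG.continuous.integrable_of_hasCompactSupport hc (μ := (volume : Measure E).prod ν)
  have hV : Integrable V := hUi.integral_prod_left
  have hg : Integrable g := hGi.integral_prod_left
  have hVn : Integrable fun e => ‖e‖ * ‖V e‖ := by
    have h3 := integrable_norm_mul_integral_fracOp (ν := ν) h0 h2 hG hc hρ hsupp hmean
    refine (h3.add (hV.norm.const_mul ‖e₀‖)).mono' (continuous_norm.aestronglyMeasurable.mul
      hV.aestronglyMeasurable.norm) (ae_of_all _ fun e => ?_)
    rw [norm_mul, norm_norm, norm_norm]
    simp only [Pi.add_apply]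
    rw [← add_mul]
    refine mul_le_mul_of_nonneg_right ?_ (norm_nonneg _)
    have := norm_add_le (e - e₀) e₀
    rwa [sub_add_cancel] at this
  obtain ⟨k, hk0, hk⟩ := exists_diffSymbol_eq (E := E) h0 h2
  have hFV : ∀ ξ, 𝓕 V ξ = (k * ‖ξ‖ : ℝ) * 𝓕 g ξ := by
    intro ξ
    have h3 := integral_fourierChar_smul_fracOp (μ := (volume : Measure E).prod ν) h0 h2 hG hc
      (L := inl ℝ E F) (π := ContinuousLinearMap.fst ℝ E F) (fun y => rfl) ξ
    rw [hVd, hgd, fourier_integral_prod hUi, fourier_integral_prod hGi]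
    rw [hk, Real.rpow_one] at h3
    exact h3
  have hg0 : 𝓕 g 0 = 0 := by
    rw [Real.fourier_eq]
    simp only [inner_zero_right, neg_zero, AddChar.map_zero_eq_one, one_smul]
    rw [hgd, ← hmean, integral_prod _ hGi]
  -- The transform of V is k|ξ| times that of g, and the latter vanishes at 0 because the mean is
  -- zero. Hence it is o(|ξ|), its derivative at the origin is zero, and that derivative is the
  -- first moment up to a constant.
  have hder : HasFDerivAt (𝓕 V) (0 : E →L[ℝ] ℂ) 0 := by
    rw [hasFDerivAt_iff_isLittleO_nhds_zero]
    have h3 : (fun h : E => ((k * ‖h‖ : ℝ) : ℂ)) =O[nhds 0] fun h => h := by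
      refine Asymptotics.IsBigO.of_bound k (.of_forall fun h => ?_)
      rw [Complex.norm_real, Real.norm_of_nonneg (by positivity)]
    have h4 : (fun h : E => 𝓕 g h) =o[nhds 0] fun _ => (1 : ℝ) := by
      rw [Asymptotics.isLittleO_one_iff, ← hg0]
      exact (continuous_fourier_of_integrable hg).tendsto 0
    have h5 := (h3.norm_right).mul_isLittleO h4
    simp only [mul_one] at h5
    refine (Asymptotics.isLittleO_norm_right.1 h5).congr_left fun h => ?_
    simp [hFV]
  have huniq := (Real.hasFDerivAt_fourier hV hVn 0).unique hder
  rw [Real.fourier_eq] at huniq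
  simp only [inner_zero_right, neg_zero, AddChar.map_zero_eq_one, one_smul] at huniq
  have hint : Integrable (VectorFourier.fourierSMulRight (innerSL ℝ (E := E)) V) := by
    refine (hVn.const_mul (2 * Real.pi * ‖innerSL ℝ (E := E)‖)).mono'
      hV.aestronglyMeasurable.fourierSMulRight (ae_of_all _ fun e => ?_)
    refine (VectorFourier.norm_fourierSMulRight_le _ _ _).trans_eq (by ring)
  have happ := congrArg (fun T : E →L[ℝ] ℂ => T a) huniq
  simp only [ContinuousLinearMap.zero_apply] at happ
  rw [ContinuousLinearMap.integral_apply hint] at happ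
  have h6 : ∀ e, VectorFourier.fourierSMulRight (innerSL ℝ (E := E)) V e a
      = (-(2 * Real.pi * Complex.I)) * (((inner ℝ a e : ℝ) : ℂ) * V e) := by
    intro e
    simp [VectorFourier.fourierSMulRight_apply]
    exact Or.inl (real_inner_comm _ _)
  simp only [h6] at happ
  rw [integral_const_mul] at happ
  have h7 : ∫ e, ((inner ℝ a e : ℝ) : ℂ) * V e = 0 := by
    refine (mul_eq_zero.1 happ).resolve_left ?_
    simp [Real.pi_ne_zero]
  have h8 : ∫ e, V e = 0 := by
    have h9 : 𝓕 V 0 = ∫ e, V e := by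
      rw [Real.fourier_eq]
      simp
    rw [← h9, hFV]
    simp
  have hi1 : Integrable fun e => ((inner ℝ a e : ℝ) : ℂ) * V e := by
    refine (hVn.const_mul ‖a‖).mono' ((Continuous.aestronglyMeasurable (by fun_prop)).mul
      hV.aestronglyMeasurable) (ae_of_all _ fun e => ?_)
    rw [norm_mul, Complex.norm_real, ← mul_assoc]
    exact mul_le_mul_of_nonneg_right (norm_inner_le_norm a e) (norm_nonneg _)
  have h10 : ∀ e, ((inner ℝ a (e - e₀) : ℝ) : ℂ) * V e
      = ((inner ℝ a e : ℝ) : ℂ) * V e - ((inner ℝ a e₀ : ℝ) : ℂ) * V e := by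
    intro e
    rw [inner_sub_right]; push_cast; ring
  change ∫ e, ((inner ℝ a (e - e₀) : ℝ) : ℂ) * V e = 0
  simp_rw [h10]
  rw [integral_sub hi1 (hV.const_mul _), integral_const_mul, h7, h8, mul_zero, sub_zero]

/-- The constant in the far field estimate. -/
def farConst (E : Type*) [NormedAddCommGroup E] [InnerProductSpace ℝ E] [FiniteDimensional ℝ E]
    [MeasurableSpace E] [BorelSpace E] (α γ₁ γ₂ : ℝ) : ℝ :=
  2 * 2 ^ (finrank ℝ E + α) * (kernelTailConst E γ₁ * 2 ^ (-γ₁)) +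
    2 * ((finrank ℝ E + α) * 2 ^ (finrank ℝ E + α + 1)) * (kernelTailConst E γ₂ * 2 ^ (-γ₂))

variable {Ψ : E × F → ℝ} {e₀ : E} {f₀ : F} {ρ B γ₁ γ₂ : ℝ} {S : Set F}

/-- Ψ is split at f₀. The difference in f meets the plain decay of the operator; the value at f₀
comes out of the f-integral and meets the improved decay. The growth exponents are set so that the
products are kernels of positive orders γ₁ and γ₂. -/
theorem norm_integral_mul_fracOp_le_of_far (h0 : 0 < α) (h2 : α < 2) (hG : ContDiff ℝ ∞ G)
    (hc : HasCompactSupport G) (hρ : 0 < ρ) (hB : 0 ≤ B)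
    (hsupp : ∀ e f, G (e, f) ≠ 0 → ‖e - e₀‖ ≤ ρ ∧ f ∈ S) (hmean : ∫ p, G p ∂(volume.prod ν) = 0)
    (hΨ : Continuous Ψ)
    (hΨ₁ : ∀ e f, 2 * ρ ≤ ‖e - e₀‖ → f ∈ S →
      |Ψ (e, f) - Ψ (e, f₀)| ≤ B * ρ ^ γ₁ * ‖e - e₀‖ ^ (α - γ₁))
    (hΨ₂ : ∀ e, 2 * ρ ≤ ‖e - e₀‖ → |Ψ (e, f₀)| ≤ B * ρ ^ (γ₂ - 1) * ‖e - e₀‖ ^ (α + 1 - γ₂))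
    {e : E} (he : 2 * ρ ≤ ‖e - e₀‖) :
    ‖∫ f, (Ψ (e, f) : ℂ) * fracOp α (inl ℝ E F) G (e, f) ∂ν‖ ≤
      B * (∫ p, ‖G p‖ ∂(volume.prod ν)) *
      (2 * 2 ^ (finrank ℝ E + α) * (ρ ^ γ₁ * rieszKernel γ₁ (e - e₀)) +
      2 * ((finrank ℝ E + α) * 2 ^ (finrank ℝ E + α + 1)) * (ρ ^ γ₂ * rieszKernel γ₂ (e - e₀))) := by
  set U := fun f => fracOp α (inl ℝ E F) G (e, f) with hU
  have hR : 0 < ‖e - e₀‖ := by linarith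
  have hsec : ∀ {Θ : F → ℂ}, Continuous Θ → Integrable (fun f => Θ f * U f) ν := fun hΘ =>
    integrable_fracOp_inl_section (ν := ν) h0 h2 hG hc hΘ e
  have hUi : Integrable U ν := by simpa using hsec (continuous_const (y := (1 : ℂ)))
  have hsplit : ∫ f, (Ψ (e, f) : ℂ) * U f ∂ν
      = (∫ f, ((Ψ (e, f) - Ψ (e, f₀) : ℝ) : ℂ) * U f ∂ν) + (Ψ (e, f₀) : ℂ) * ∫ f, U f ∂ν := by
    rw [← integral_const_mul, ← integral_add (hsec (by fun_prop)) (hUi.const_mul _)]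
    refine integral_congr_ae (ae_of_all _ fun f => ?_)
    push_cast
    ring
  have hb1 : ‖∫ f, ((Ψ (e, f) - Ψ (e, f₀) : ℝ) : ℂ) * U f ∂ν‖
      ≤ B * ρ ^ γ₁ * ‖e - e₀‖ ^ (α - γ₁) * ∫ f, ‖U f‖ ∂ν := by
    rw [← integral_const_mul]
    refine norm_integral_le_of_norm_le (hUi.norm.const_mul _) (ae_of_all _ fun f => ?_)
    rw [norm_mul, Complex.norm_real]
    by_cases hf : f ∈ S
    · exact mul_le_mul_of_nonneg_right (hΨ₁ e f he hf) (norm_nonneg _)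
    · have hz : U f = 0 := fracOp_inl_eq_zero fun e' => by
        by_contra hne
        exact hf (hsupp e' f hne).2
      simp [hz]
  have h3 := integral_norm_fracOp_le (ν := ν) h0 h2 hG hc hρ (fun e f h => (hsupp e f h).1) he
  have h4 := norm_integral_fracOp_le (ν := ν) h0 h2 hG hc hρ (fun e f h => (hsupp e f h).1) he hmean
  rw [hsplit]
  refine (norm_add_le _ _).trans ?_
  rw [norm_mul, Complex.norm_real]
  have hk1 : ‖e - e₀‖ ^ (α - γ₁) * rieszKernel α (e - e₀) = rieszKernel γ₁ (e - e₀) := by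
    rw [rieszKernel, rieszKernel, ← Real.rpow_add hR]
    congr 1; ring
  have hk2 : ‖e - e₀‖ ^ (α + 1 - γ₂) * rieszKernel (α + 1) (e - e₀) = rieszKernel γ₂ (e - e₀) := by
    rw [rieszKernel, rieszKernel, ← Real.rpow_add hR]
    congr 1; ring
  have hk3 : ρ ^ (γ₂ - 1) * ρ = ρ ^ γ₂ := by
    rw [← Real.rpow_add_one hρ.ne']
    congr 1; ring
  rw [mul_add, ← hk1, ← hk2, ← hk3]
  refine add_le_add (hb1.trans ?_) ?_
  · calc _ ≤ B * ρ ^ γ₁ * ‖e - e₀‖ ^ (α - γ₁) * _ := mul_le_mul_of_nonneg_left h3 (by positivity)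
      _ = _ := by ring
  · calc _ ≤ (B * ρ ^ (γ₂ - 1) * ‖e - e₀‖ ^ (α + 1 - γ₂)) * _ :=
          mul_le_mul (hΨ₂ e he) h4 (norm_nonneg _) (by positivity)
      _ = _ := by ring

/-- Estimate of the pairing of a function of moderate growth with the fractional operator. -/
theorem integrable_and_norm_integral_fracOp_le (h0 : 0 < α) (h2 : α < 2) (hG : ContDiff ℝ ∞ G)
    (hc : HasCompactSupport G) (hρ : 0 < ρ) (hB : 0 ≤ B) (hγ₁ : 0 < γ₁) (hγ₂ : 0 < γ₂)
    (hsupp : ∀ e f, G (e, f) ≠ 0 → ‖e - e₀‖ ≤ ρ ∧ f ∈ S) (hmean : ∫ p, G p ∂(volume.prod ν) = 0)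
    (hΨ : Continuous Ψ)
    (hΨ₁ : ∀ e f, 2 * ρ ≤ ‖e - e₀‖ → f ∈ S →
      |Ψ (e, f) - Ψ (e, f₀)| ≤ B * ρ ^ γ₁ * ‖e - e₀‖ ^ (α - γ₁))
    (hΨ₂ : ∀ e, 2 * ρ ≤ ‖e - e₀‖ → |Ψ (e, f₀)| ≤ B * ρ ^ (γ₂ - 1) * ‖e - e₀‖ ^ (α + 1 - γ₂))
    {b : F → ℝ} (hb : Continuous b) {a : E} (ha : a = 0 ∨ α = 1) {χ : E → ℝ} (hχ : Continuous χ)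
    (hχc : HasCompactSupport χ) (hχ1 : ∀ e, ‖e - e₀‖ ≤ 2 * ρ → χ e = 1) (hχ01 : ∀ e, 0 ≤ χ e ∧ χ e ≤ 1)
    {N : ℝ} (hN : ‖∫ p : E × F, ((χ p.1 * Ψ p : ℝ) : ℂ) * fracOp α (inl ℝ E F) G p
      ∂(volume.prod ν)‖ ≤ N) :
    (Integrable fun e => ∫ f, ((Ψ (e, f) + b f + inner ℝ a (e - e₀) : ℝ) : ℂ) *
        fracOp α (inl ℝ E F) G (e, f) ∂ν) ∧
    ‖∫ e, ∫ f, ((Ψ (e, f) + b f + inner ℝ a (e - e₀) : ℝ) : ℂ) *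
        fracOp α (inl ℝ E F) G (e, f) ∂ν‖
      ≤ N + B * (∫ p, ‖G p‖ ∂(volume.prod ν)) * farConst E α γ₁ γ₂ := by
  set U := fracOp α (inl ℝ E F) G with hU
  have hUc : Continuous U := continuous_fracOp _ h0 h2 hG hc
  have hUi : Integrable U (volume.prod ν) := integrable_fracOp h0 h2 hG hc
  have hsec : ∀ e : E, ∀ {Θ : F → ℂ}, Continuous Θ → Integrable (fun f => Θ f * U (e, f)) ν :=
    fun e Θ hΘ => integrable_fracOp_inl_section (ν := ν) h0 h2 hG hc hΘ e
  have hUsec : ∀ e : E, Integrable (fun f => U (e, f)) ν := fun e => by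
    simpa using hsec e (continuous_const (y := (1 : ℂ)))
  have hU0 : ∀ e f, f ∉ Prod.snd '' tsupport G → U (e, f) = 0 := fun e f hf =>
    fracOp_inl_eq_zero fun e' => by
      by_contra hne
      exact hf ⟨(e', f), subset_tsupport _ hne, rfl⟩
  have hKF : IsCompact (Prod.snd '' tsupport G) := hc.isCompact.image continuous_snd
  -- the part depending on `f` only
  have hbU : Integrable (fun p : E × F => (b p.2 : ℂ) * U p) (volume.prod ν) := by
    obtain ⟨M, hM⟩ := hKF.exists_bound_of_continuousOn hb.continuousOn
    refine (hUi.norm.const_mul M).mono' (Continuous.aestronglyMeasurable (by fun_prop))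
      (ae_of_all _ fun p => ?_)
    rw [norm_mul, Complex.norm_real]
    by_cases hp : p.2 ∈ Prod.snd '' tsupport G
    · exact mul_le_mul_of_nonneg_right (hM _ hp) (norm_nonneg _)
    · have : U p = 0 := hU0 p.1 p.2 hp
      simp [this]
  have hb0 : ∫ e, ∫ f, (b f : ℂ) * U (e, f) ∂ν = 0 := by
    rw [integral_integral_swap (f := fun e f => (b f : ℂ) * U (e, f)) hbU]
    have h3 : ∀ f, ∫ e, (b f : ℂ) * U (e, f) = 0 := by
      intro f
      rw [integral_const_mul, hU]
      simp only [fracOp_inl]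
      rw [integral_fracOp_id h0 h2 (contDiff_section hG f) (hasCompactSupport_section hc f), mul_zero]
    simp [h3]
  have hbi : Integrable fun e => ∫ f, (b f : ℂ) * U (e, f) ∂ν := hbU.integral_prod_left
  -- the affine part
  have hai : Integrable fun e => ((inner ℝ a (e - e₀) : ℝ) : ℂ) * ∫ f, U (e, f) ∂ν := by
    have h3 := integrable_norm_mul_integral_fracOp (ν := ν) h0 h2 hG hc hρ
      (fun e f h => (hsupp e f h).1) hmean
    refine (h3.const_mul ‖a‖).mono' ((Continuous.aestronglyMeasurable (by fun_prop)).mul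
      hUi.integral_prod_left.aestronglyMeasurable) (ae_of_all _ fun e => ?_)
    rw [norm_mul, Complex.norm_real, ← mul_assoc]
    exact mul_le_mul_of_nonneg_right (norm_inner_le_norm a _) (norm_nonneg _)
  -- Only the operator of order one is used against a nonzero affine term; in the other case the
  -- slope is zero by hypothesis.
  have ha0 : ∫ e, ((inner ℝ a (e - e₀) : ℝ) : ℂ) * ∫ f, U (e, f) ∂ν = 0 := by
    rcases ha with rfl | rfl
    · simp
    · exact integral_inner_mul_integral_fracOp hG hc hρ (fun e f h => (hsupp e f h).1) hmean a
  -- the main part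
  set I := fun e => ∫ f, (Ψ (e, f) : ℂ) * U (e, f) ∂ν with hI
  have hIm : AEStronglyMeasurable I volume := by
    have h3 : Continuous fun p : E × F => (Ψ p : ℂ) * U p := by fun_prop
    exact (h3.stronglyMeasurable.integral_prod_right' (ν := ν)).aestronglyMeasurable
  have hχU : Integrable (fun p : E × F => ((χ p.1 * Ψ p : ℝ) : ℂ) * U p) (volume.prod ν) := by
    refine Continuous.integrable_of_hasCompactSupport (by fun_prop) ?_
    refine HasCompactSupport.of_support_subset_isCompact (hχc.isCompact.prod hKF) fun p hp => ?_
    rw [Function.mem_support] at hp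
    refine ⟨?_, ?_⟩
    · refine subset_tsupport _ fun h => hp ?_
      simp [h]
    · by_contra hne
      exact hp (by rw [show U p = 0 from hU0 p.1 p.2 hne, mul_zero])
  have hχI : ∀ e, ∫ f, ((χ e * Ψ (e, f) : ℝ) : ℂ) * U (e, f) ∂ν = (χ e : ℂ) * I e := by
    intro e
    rw [hI, ← integral_const_mul]
    refine integral_congr_ae (ae_of_all _ fun f => ?_)
    push_cast
    ring
  have hχIi : Integrable fun e => (χ e : ℂ) * I e := by
    refine hχU.integral_prod_left.congr (ae_of_all _ fun e => ?_)
    exact hχI e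
  set m₁ := 2 * (2 : ℝ) ^ (finrank ℝ E + α) with hm₁
  set m₂ := 2 * ((finrank ℝ E + α) * (2 : ℝ) ^ (finrank ℝ E + α + 1)) with hm₂
  set T := {y : E | 2 * ρ ≤ ‖y‖} with hT
  have hTm : MeasurableSet T := measurableSet_le_norm _
  set A := B * ∫ p, ‖G p‖ ∂((volume : Measure E).prod ν) with hA
  set h := fun y : E => A * (m₁ * (ρ ^ γ₁ * rieszKernel γ₁ y) + m₂ * (ρ ^ γ₂ * rieszKernel γ₂ y)) with hh
  have hi1 : IntegrableOn (fun y : E => m₁ * (ρ ^ γ₁ * rieszKernel γ₁ y)) T :=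
    ((integrableOn_rieszKernel hγ₁ (by positivity)).const_mul _).const_mul _
  have hi2 : IntegrableOn (fun y : E => m₂ * (ρ ^ γ₂ * rieszKernel γ₂ y)) T :=
    ((integrableOn_rieszKernel hγ₂ (by positivity)).const_mul _).const_mul _
  have hhi : IntegrableOn h T := (hi1.add hi2).const_mul _
  have hhI : ∫ y in T, h y = A * farConst E α γ₁ γ₂ := by
    rw [hh, integral_const_mul, integral_add hi1 hi2, integral_const_mul, integral_const_mul,
      integral_const_mul, integral_const_mul, hT, setIntegral_rieszKernel (by positivity),
      setIntegral_rieszKernel (by positivity), farConst]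
    -- All powers of ρ cancel, so the far-field bound does not depend on the size of the cube.
    have h3 : ∀ γ : ℝ, ρ ^ γ * (2 * ρ) ^ (-γ) = 2 ^ (-γ) := by
      intro γ
      rw [Real.mul_rpow (by norm_num) hρ.le, mul_left_comm, ← Real.rpow_add hρ, add_neg_cancel,
        Real.rpow_zero, mul_one]
    rw [mul_left_comm (ρ ^ γ₁), mul_left_comm (ρ ^ γ₂), h3, h3]
  have hind : Integrable fun e => T.indicator h (e - e₀) :=
    ((integrable_indicator_iff hTm).2 hhi).comp_sub_right e₀
  have hfar : ∀ e, ‖((1 - χ e : ℝ) : ℂ) * I e‖ ≤ T.indicator h (e - e₀) := by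
    intro e
    rw [norm_mul, Complex.norm_real]
    by_cases he : 2 * ρ ≤ ‖e - e₀‖
    · have h4 : T.indicator h (e - e₀) = h (e - e₀) :=
        indicator_of_mem (show e - e₀ ∈ T from he) _
      rw [h4]
      refine (mul_le_of_le_one_left (norm_nonneg _) ?_).trans
        (norm_integral_mul_fracOp_le_of_far h0 h2 hG hc hρ hB hsupp hmean hΨ hΨ₁ hΨ₂ he)
      rw [Real.norm_of_nonneg (by linarith [(hχ01 e).2])]
      linarith [(hχ01 e).1]
    · have h4 : T.indicator h (e - e₀) = 0 :=
        indicator_of_notMem (show e - e₀ ∉ T from he) _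
      rw [h4, hχ1 e (not_le.1 he).le]
      simp
  have hfarm : AEStronglyMeasurable (fun e => ((1 - χ e : ℝ) : ℂ) * I e) volume :=
    (Continuous.aestronglyMeasurable (by fun_prop)).mul hIm
  have hfari : Integrable fun e => ((1 - χ e : ℝ) : ℂ) * I e :=
    hind.mono' hfarm (Filter.Eventually.of_forall hfar)
  have hIsplit : I = fun e => (χ e : ℂ) * I e + ((1 - χ e : ℝ) : ℂ) * I e := by
    funext e
    push_cast
    ring
  have hIi : Integrable I := by
    rw [hIsplit]
    exact hχIi.add hfari
  have hfull : ∀ e, ∫ f, ((Ψ (e, f) + b f + inner ℝ a (e - e₀) : ℝ) : ℂ) * U (e, f) ∂ν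
      = I e + (∫ f, (b f : ℂ) * U (e, f) ∂ν) + ((inner ℝ a (e - e₀) : ℝ) : ℂ) * ∫ f, U (e, f) ∂ν := by
    intro e
    have hs1 : Integrable (fun f => (Ψ (e, f) : ℂ) * U (e, f)) ν := hsec e (by fun_prop)
    have hs2 : Integrable (fun f => (b f : ℂ) * U (e, f)) ν := hsec e (by fun_prop)
    have hs3 : Integrable (fun f => ((inner ℝ a (e - e₀) : ℝ) : ℂ) * U (e, f)) ν := (hUsec e).const_mul _
    rw [hI, ← integral_const_mul, ← integral_add hs1 hs2,
      ← integral_add (f := fun f => (Ψ (e, f) : ℂ) * U (e, f) + (b f : ℂ) * U (e, f)) (hs1.add hs2) hs3]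
    refine integral_congr_ae (ae_of_all _ fun f => ?_)
    push_cast
    ring
  simp_rw [hfull]
  refine ⟨(hIi.add hbi).add hai, ?_⟩
  rw [integral_add (f := fun e => I e + ∫ f, (b f : ℂ) * U (e, f) ∂ν) (hIi.add hbi) hai,
    integral_add hIi hbi, hb0, ha0, add_zero, add_zero, hIsplit, integral_add hχIi hfari]
  refine (norm_add_le _ _).trans (add_le_add ?_ ?_)
  · have h5 : ∫ e, (χ e : ℂ) * I e
        = ∫ p : E × F, ((χ p.1 * Ψ p : ℝ) : ℂ) * U p ∂(volume.prod ν) := by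
      rw [integral_prod _ hχU]
      exact integral_congr_ae (ae_of_all _ fun e => (hχI e).symm)
    rw [h5]
    exact hN
  · refine (norm_integral_le_of_norm_le hind (Filter.Eventually.of_forall hfar)).trans_eq ?_
    rw [integral_sub_right_eq_self (T.indicator h), integral_indicator hTm, hhI]

end Pairing

/-! ### The near field -/

section NearField

open Module

variable {E : Type*} [NormedAddCommGroup E] [InnerProductSpace ℝ E] [FiniteDimensional ℝ E]
  [MeasurableSpace E] [BorelSpace E] [Nontrivial E]
  {F : Type*} [NormedAddCommGroup F] [NormedSpace ℝ F] [FiniteDimensional ℝ F] [MeasurableSpace F]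
  [BorelSpace F] {ν : Measure F} [ν.IsAddHaarMeasure] {G : E × F → ℂ} {α k : ℝ}

theorem sqrt_ofReal_sq {D : ℝ} (hD : 0 ≤ D) : ofReal (D ^ 2) ^ (1 / 2 : ℝ) = ofReal D := by
  rw [ENNReal.ofReal_rpow_of_nonneg (by positivity) (by norm_num), ← Real.sqrt_eq_rpow, Real.sqrt_sq hD]

/-- Pairing of a compactly supported function of finite energy with the fractional operator. -/
theorem norm_integral_mul_fracOp_le_of_energy (h0 : 0 < α) (h2 : α < 2) (hG : ContDiff ℝ ∞ G)
    (hc : HasCompactSupport G) (hk : ∀ ξ : E, diffSymbol α ξ = k * ‖ξ‖ ^ α) (hk0 : 0 < k)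
    {S : Set F} (hS : MeasurableSet S) (hsupp : ∀ e f, G (e, f) ≠ 0 → f ∈ S)
    {W : E × F → ℝ} (hW : Continuous W) {K : Set E} (hK : IsCompact K)
    (hWK : ∀ e f, e ∉ K → W (e, f) = 0) {X : F → ℝ≥0∞} (hX : Measurable X)
    (hWX : ∀ f ∈ S, ∫⁻ ξ, ofReal (‖ξ‖ ^ (2 * α)) * ‖𝓕 (fun e => (W (e, f) : ℂ)) ξ‖ₑ ^ 2 ≤ X f)
    {D M : ℝ} (hD : 0 ≤ D) (hM : 0 ≤ M) (hXD : ∫⁻ f in S, X f ∂ν ≤ ofReal (D ^ 2))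
    (hGM : ∫⁻ p, ‖G p‖ₑ ^ 2 ∂(volume.prod ν) ≤ ofReal (M ^ 2)) :
    ‖∫ p, (W p : ℂ) * fracOp α (inl ℝ E F) G p ∂(volume.prod ν)‖ ≤ k * D * M := by
  set U := fracOp α (inl ℝ E F) G with hU
  have hUc : Continuous U := continuous_fracOp _ h0 h2 hG hc
  have hKF : IsCompact (Prod.snd '' tsupport G) := hc.isCompact.image continuous_snd
  have hWU : Integrable (fun p => (W p : ℂ) * U p) (volume.prod ν) := by
    refine Continuous.integrable_of_hasCompactSupport (by fun_prop) ?_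
    refine HasCompactSupport.of_support_subset_isCompact (hK.prod hKF) fun p hp => ?_
    rw [Function.mem_support] at hp
    refine ⟨?_, ?_⟩
    · by_contra hne
      exact hp (by rw [show W p = 0 from hWK p.1 p.2 hne]; simp)
    · by_contra hne
      have hz : U p = 0 := fracOp_inl_eq_zero (e := p.1) (f := p.2) fun e' => by
        by_contra h
        exact hne ⟨(e', p.2), subset_tsupport _ h, rfl⟩
      exact hp (by rw [hz, mul_zero])
  set Y : F → ℝ≥0∞ := fun f => ∫⁻ e, ‖G (e, f)‖ₑ ^ 2 with hY
  have hGm : Measurable fun p => ‖G p‖ₑ ^ 2 := hG.continuous.measurable.enorm.pow_const 2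
  have hYm : Measurable Y := hGm.lintegral_prod_left'
  have hYM : ∫⁻ f in S, Y f ∂ν ≤ ofReal (M ^ 2) := by
    refine (setLIntegral_le_lintegral S Y).trans (le_trans (le_of_eq ?_) hGM)
    exact (lintegral_prod_symm' _ hGm).symm
  have hpt : ∀ f, ‖∫ e, (W (e, f) : ℂ) * U (e, f)‖ₑ
      ≤ S.indicator (fun f => ofReal k * (X f ^ (1 / 2 : ℝ) * Y f ^ (1 / 2 : ℝ))) f := by
    intro f
    by_cases hf : f ∈ S
    · rw [indicator_of_mem hf, hU]
      simp only [fracOp_inl]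
      have hw : Continuous fun e => (W (e, f) : ℂ) := by fun_prop
      have hwc : HasCompactSupport fun e => (W (e, f) : ℂ) := by
        refine HasCompactSupport.of_support_subset_isCompact hK fun e he => ?_
        by_contra hne
        exact he (by simp [hWK e f hne])
      refine (enorm_integral_mul_fracOp_le h0 h2 (contDiff_section hG f) (hasCompactSupport_section hc f)
        hk hk0 hw hwc).trans ?_
      rw [mul_assoc]
      gcongr
      exact hWX f hf
    · rw [indicator_of_notMem hf]
      have hz : ∀ e, U (e, f) = 0 := fun e => fracOp_inl_eq_zero fun e' => by
        by_contra hne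
        exact hf (hsupp e' f hne)
      simp [hz]
  have hmain : ‖∫ p, (W p : ℂ) * U p ∂(volume.prod ν)‖ₑ ≤ ofReal (k * D * M) := by
    rw [integral_prod_symm _ hWU]
    calc _ ≤ ∫⁻ f, ‖∫ e, (W (e, f) : ℂ) * U (e, f)‖ₑ ∂ν := enorm_integral_le_lintegral_enorm _
      _ ≤ ∫⁻ f, S.indicator (fun f => ofReal k * (X f ^ (1 / 2 : ℝ) * Y f ^ (1 / 2 : ℝ))) f ∂ν :=
          lintegral_mono hpt
      _ = ofReal k * ∫⁻ f in S,
            ((fun f => X f ^ (1 / 2 : ℝ)) * fun f => Y f ^ (1 / 2 : ℝ)) f ∂ν := by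
          rw [lintegral_indicator hS]
          exact lintegral_const_mul _ ((hX.pow_const _).mul (hYm.pow_const _))
      _ ≤ ofReal k * ((∫⁻ f in S, (X f ^ (1 / 2 : ℝ)) ^ (2 : ℝ) ∂ν) ^ (1 / 2 : ℝ) *
            (∫⁻ f in S, (Y f ^ (1 / 2 : ℝ)) ^ (2 : ℝ) ∂ν) ^ (1 / 2 : ℝ)) := by
          gcongr
          exact ENNReal.lintegral_mul_le_Lp_mul_Lq _ Real.HolderConjugate.two_two
            (hX.pow_const _).aemeasurable (hYm.pow_const _).aemeasurable
      _ ≤ ofReal k * (ofReal (D ^ 2) ^ (1 / 2 : ℝ) * ofReal (M ^ 2) ^ (1 / 2 : ℝ)) := by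
          simp only [← ENNReal.rpow_mul, one_div, inv_mul_cancel₀ (two_ne_zero (α := ℝ)), ENNReal.rpow_one]
          gcongr
      _ = _ := by
          rw [sqrt_ofReal_sq hD, sqrt_ofReal_sq hM, ← ofReal_mul hD, ← ofReal_mul hk0.le,
            mul_assoc]
  rw [← ofReal_norm_eq_enorm] at hmain
  exact (ofReal_le_ofReal_iff (by positivity)).1 hmain

end NearField

/-! ### Pointwise growth estimates -/

section Growth

variable {m : ℕ} {ℓ A : ℝ} {Φ : SpaceTime m → ℝ}

/-- A symmetric second difference annihilates affine functions, so only the approximation error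
survives: a Zygmund condition with constant A in place of ℓ. -/
theorem OscControl.abs_secondDiff_le (h : OscControl ℓ A Φ univ) (x y : 𝕏 m) (t : ℝ)
    {s : ℝ} (hs : 0 < s) (hy : x + y ∈ spatialCube x s) :
    |Φ (x + y, t) + Φ (x - y, t) - 2 * Φ (x, t)| ≤ 2 * zygmundConst m * A * s := by
  have hz : ((x, t) : SpaceTime m) ∈ 𝒬 (x, t) s := self_mem_parabolicCube _ hs
  have hp : ((x + y, t) : SpaceTime m) ∈ 𝒬 (x, t) s := ⟨hy, by simpa [timeInterval] using hs⟩
  have hq : ((x - y, t) : SpaceTime m) ∈ 𝒬 (x, t) s := by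
    refine ⟨fun i => ?_, by simpa [timeInterval] using hs⟩
    have := hy i
    simp only [PiLp.add_apply, PiLp.sub_apply, sub_add_cancel_left, abs_neg, sub_sub_cancel] at this ⊢
    exact this
  have h1 := h.abs_subAffine_sub_le hs (Set.subset_univ _) hp hz x
  have h2 := h.abs_subAffine_sub_le hs (Set.subset_univ _) hq hz x
  set a := ⨍ q in 𝒬 ((x, t) : SpaceTime m) (2 * s), ∇ₓ Φ q
  simp only [_root_.subAffine, add_sub_cancel_left, sub_self, inner_zero_right, sub_zero,
    sub_sub_cancel_left, inner_neg_right, sub_neg_eq_add] at h1 h2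
  rw [abs_le] at *
  constructor <;> linarith [h1.1, h1.2, h2.1, h2.2]

theorem OscControl.abs_time_sub_le_mul_sqrt (h : OscControl ℓ A Φ univ) (x : 𝕏 m)
    (t τ : ℝ) : |Φ (x, t) - Φ (x, τ)| ≤ zygmundConst m * A * √|t - τ| :=
  h.abs_time_sub_le_sqrt (Set.subset_univ _)

/-- The Zygmund bound at both times shows that the mixed difference at y is half that at 2y up to
2ZAs. Starting from scales comparable to R = √|t - τ|, where the Hölder bound applies, and
descending gives s log(R/s); the weaker √(sR) closes the induction since √2 ≤ 3/2. -/
theorem OscControl.abs_mixed_sub_le (h : OscControl ℓ A Φ univ) (t τ : ℝ) (k : ℕ) :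
    ∀ s : ℝ, 0 < s → s ≤ √|t - τ| → √|t - τ| ≤ 2 ^ k * s →
    ∀ x y : 𝕏 m, x + y ∈ spatialCube x s →
    |Φ (x + y, t) - Φ (x + y, τ) - (Φ (x, t) - Φ (x, τ))|
      ≤ 8 * zygmundConst m * A * √(s * √|t - τ|) := by
  set R := √|t - τ| with hR
  have hZA : 0 < zygmundConst m * A := mul_pos (zygmundConst_pos m) h.pos
  have hsmall : ∀ s : ℝ, 0 < s → R ≤ 2 * s → ∀ x y : 𝕏 m,
      |Φ (x + y, t) - Φ (x + y, τ) - (Φ (x, t) - Φ (x, τ))|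
        ≤ 8 * zygmundConst m * A * √(s * R) := by
    intro s hs hRs x y
    have h1 := h.abs_time_sub_le_mul_sqrt (x + y) t τ
    have h2 := h.abs_time_sub_le_mul_sqrt x t τ
    rw [← hR] at h1 h2
    have hR0 : 0 ≤ R := Real.sqrt_nonneg _
    have h3 : R ≤ 2 * √(s * R) := by
      have h4 : R ^ 2 ≤ 4 * (s * R) := by nlinarith
      have h5 := Real.sqrt_le_sqrt h4
      rw [Real.sqrt_sq hR0, Real.sqrt_mul (by norm_num), show (4 : ℝ) = 2 ^ 2 by norm_num,
        Real.sqrt_sq (by norm_num)] at h5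
      exact h5
    have h4 : |Φ (x + y, t) - Φ (x + y, τ) - (Φ (x, t) - Φ (x, τ))| ≤ 2 * (zygmundConst m * A * R) := by
      rw [abs_le] at *
      constructor <;> linarith [h1.1, h1.2, h2.1, h2.2]
    nlinarith [Real.sqrt_nonneg (s * R)]
  induction k with
  | zero =>
    intro s hs _ hRs x y _
    exact hsmall s hs (by rw [pow_zero] at hRs; linarith) x y
  | succ k ih =>
    intro s hs hsR hRs x y hy
    rcases le_or_gt R (2 * s) with hlt | hlt
    · exact hsmall s hs hlt x y
    have hy2 : x + (2 : ℝ) • y ∈ spatialCube x (2 * s) := by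
      intro i
      have := hy i
      simp only [PiLp.add_apply, PiLp.smul_apply, smul_eq_mul, sub_add_cancel_left, abs_neg] at this ⊢
      rw [abs_mul, abs_two]
      linarith
    have h1 := ih (2 * s) (by positivity) hlt.le (by rw [pow_succ] at hRs; linarith) x ((2 : ℝ) • y) hy2
    have hy' : x + y + y ∈ spatialCube (x + y) s := by
      intro i
      have := hy i
      simp only [PiLp.add_apply, sub_add_cancel_left, abs_neg] at this ⊢
      exact this
    have h2 := h.abs_secondDiff_le (x + y) y t hs hy'
    have h3 := h.abs_secondDiff_le (x + y) y τ hs hy'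
    rw [add_sub_cancel_right, add_assoc, ← two_smul ℝ y] at h2 h3
    have h4 : √(2 * s * R) ≤ 3 / 2 * √(s * R) := by
      rw [mul_assoc, Real.sqrt_mul (by norm_num)]
      refine mul_le_mul_of_nonneg_right ?_ (Real.sqrt_nonneg _)
      rw [Real.sqrt_le_left (by norm_num)]
      norm_num
    have h5 : s ≤ √(s * R) := by
      rw [Real.le_sqrt' hs]
      nlinarith
    have h6 : 8 * zygmundConst m * A * √(2 * s * R) ≤ 12 * (zygmundConst m * A * √(s * R)) := by
      nlinarith
    have h7 : zygmundConst m * A * s ≤ zygmundConst m * A * √(s * R) :=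
      mul_le_mul_of_nonneg_left h5 hZA.le
    rw [abs_le] at *
    constructor <;> linarith [h1.1, h1.2, h2.1, h2.2, h3.1, h3.2]

/-- The deviation from the affine function at y is at most twice that at y/2 plus ZAσ. Iterating
would give σ log(σ/s); the weaker σ√(σ/s) closes the induction because 2·4·(1/2)·(3/4) + 1 = 4. The
index k only counts doublings. -/
theorem OscControl.abs_affine_sub_le (h : OscControl ℓ A Φ univ) (z : SpaceTime m) {s : ℝ} (hs : 0 < s)
    (k : ℕ) : ∀ σ : ℝ, s ≤ σ → σ ≤ 2 ^ k * s →
    ∀ y : 𝕏 m, z.1 + y ∈ spatialCube z.1 σ →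
    |Φ (z.1 + y, z.2) - Φ z - inner ℝ (⨍ q in 𝒬 z (2 * s), ∇ₓ Φ q) y|
      ≤ 4 * zygmundConst m * A * σ * √(σ / s) := by
  have hZA : 0 < zygmundConst m * A := mul_pos (zygmundConst_pos m) h.pos
  set a := ⨍ q in 𝒬 z (2 * s), ∇ₓ Φ q with ha
  have hbase : ∀ y : 𝕏 m, z.1 + y ∈ spatialCube z.1 s →
      |Φ (z.1 + y, z.2) - Φ z - inner ℝ a y| ≤ zygmundConst m * A * s := by
    intro y hy
    have hp : ((z.1 + y, z.2) : SpaceTime m) ∈ 𝒬 z s :=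
      ⟨hy, by simpa [timeInterval] using hs⟩
    have h1 := h.abs_subAffine_sub_le hs (Set.subset_univ _) hp (self_mem_parabolicCube z hs) z.1
    rw [← ha] at h1
    simp only [_root_.subAffine, add_sub_cancel_left, sub_self, inner_zero_right, sub_zero] at h1
    convert h1 using 2
    ring
  have hhalf : ∀ σ : ℝ, 0 < σ → ∀ y : 𝕏 m, z.1 + y ∈ spatialCube z.1 σ →
      z.1 + (2 : ℝ)⁻¹ • y ∈ spatialCube z.1 (σ / 2) ∧
      |Φ (z.1 + y, z.2) - Φ z - inner ℝ a y|
        ≤ 2 * |Φ (z.1 + (2 : ℝ)⁻¹ • y, z.2) - Φ z - inner ℝ a ((2 : ℝ)⁻¹ • y)|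
          + zygmundConst m * A * σ := by
    intro σ hσ y hy
    have hy2 : ∀ x : 𝕏 m, x + (2 : ℝ)⁻¹ • y ∈ spatialCube x (σ / 2) := by
      intro x i
      have := hy i
      simp only [PiLp.add_apply, PiLp.smul_apply, smul_eq_mul, sub_add_cancel_left, abs_neg] at this ⊢
      rw [abs_mul, abs_of_pos (by norm_num : (0 : ℝ) < 2⁻¹)]
      linarith
    refine ⟨hy2 _, ?_⟩
    have h2 := h.abs_secondDiff_le (z.1 + (2 : ℝ)⁻¹ • y) ((2 : ℝ)⁻¹ • y) z.2 (half_pos hσ) (hy2 _)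
    rw [add_sub_cancel_right, add_assoc, ← two_smul ℝ ((2 : ℝ)⁻¹ • y), smul_inv_smul₀ two_ne_zero] at h2
    rw [inner_smul_right]
    have h3 : Φ (z.1 + y, z.2) - Φ z - inner ℝ a y =
        2 * (Φ (z.1 + (2 : ℝ)⁻¹ • y, z.2) - Φ z - 2⁻¹ * inner ℝ a y)
          + (Φ (z.1 + y, z.2) + Φ (z.1, z.2) - 2 * Φ (z.1 + (2 : ℝ)⁻¹ • y, z.2)) := by
      rw [Prod.mk.eta]; ring
    rw [h3]
    refine (abs_add_le _ _).trans ?_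
    rw [abs_mul, abs_two]
    linarith
  have hsmall : ∀ σ : ℝ, s ≤ σ → σ ≤ 2 * s → ∀ y : 𝕏 m, z.1 + y ∈ spatialCube z.1 σ →
      |Φ (z.1 + y, z.2) - Φ z - inner ℝ a y| ≤ 4 * zygmundConst m * A * σ * √(σ / s) := by
    intro σ hσ hσ2 y hy
    obtain ⟨h1, h2⟩ := hhalf σ (hs.trans_le hσ) y hy
    have h3 := hbase ((2 : ℝ)⁻¹ • y) (fun i => (h1 i).trans_le (by linarith))
    have h4 : 1 ≤ √(σ / s) := by
      rw [Real.one_le_sqrt, le_div_iff₀ hs]; linarith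
    have h5 : zygmundConst m * A * s ≤ zygmundConst m * A * σ := mul_le_mul_of_nonneg_left hσ hZA.le
    have h6 : 4 * zygmundConst m * A * σ * 1 ≤ 4 * zygmundConst m * A * σ * √(σ / s) :=
      mul_le_mul_of_nonneg_left h4 (by nlinarith)
    nlinarith
  induction k with
  | zero =>
    intro σ hσ hσk y hy
    exact hsmall σ hσ (by rw [pow_zero] at hσk; linarith) y hy
  | succ k ih =>
    intro σ hσ hσk y hy
    rcases le_or_gt σ (2 * s) with hlt | hlt
    · exact hsmall σ hσ hlt y hy
    obtain ⟨h1, h2⟩ := hhalf σ (hs.trans_le hσ) y hy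
    have h3 := ih (σ / 2) (by linarith) (by rw [pow_succ] at hσk; linarith) _ h1
    have hσ0 : 0 < σ := hs.trans_le hσ
    have h4 : √(σ / 2 / s) ≤ 3 / 4 * √(σ / s) := by
      rw [div_right_comm, div_eq_mul_inv _ (2 : ℝ), mul_comm, Real.sqrt_mul (by norm_num)]
      refine mul_le_mul_of_nonneg_right ?_ (Real.sqrt_nonneg _)
      rw [Real.sqrt_le_left (by norm_num)]
      norm_num
    have h5 : 1 ≤ √(σ / s) := by
      rw [Real.one_le_sqrt, le_div_iff₀ hs]; linarith
    have hZs : 0 < zygmundConst m * A * σ := mul_pos hZA hσ0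
    have h6 : zygmundConst m * A * σ * √(σ / 2 / s) ≤ zygmundConst m * A * σ * (3 / 4 * √(σ / s)) :=
      mul_le_mul_of_nonneg_left h4 hZs.le
    have h7 : zygmundConst m * A * σ * 1 ≤ zygmundConst m * A * σ * √(σ / s) :=
      mul_le_mul_of_nonneg_left h5 hZs.le
    nlinarith

end Growth

/-! ### Pairing with the operators in space -/

section SpacePairing

open Module

variable {m : ℕ} {ℓ A : ℝ} {Φ : SpaceTime m → ℝ}

theorem integral_norm_le_of_support {g : SpaceTime m → ℂ} (hg : Continuous g) (hc : HasCompactSupport g)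
    {z : SpaceTime m} {r M : ℝ} (hM : 0 ≤ M) (hsupp : ∀ p, g p ≠ 0 → p ∈ 𝒬 z r)
    (hgM : ∫⁻ p, ‖g p‖ₑ ^ 2 ≤ ofReal (M ^ 2)) :
    ∫ p, ‖g p‖ ≤ √(volume.real (𝒬 z r)) * M := by
  have hgi : Integrable g := hg.integrable_of_hasCompactSupport hc
  have hQ := (volume_parabolicCube_lt_top z r).ne
  have hmain : ∫⁻ p, ‖g p‖ₑ ≤ ofReal (√(volume.real (𝒬 z r)) * M) := by
    have h1 : ∫⁻ p, ‖g p‖ₑ = ∫⁻ p in 𝒬 z r, ((fun _ : SpaceTime m => (1 : ℝ≥0∞)) * fun p : SpaceTime m => ‖g p‖ₑ) p := by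
      rw [← lintegral_indicator (measurableSet_parabolicCube z r)]
      refine lintegral_congr fun p => ?_
      by_cases hp : p ∈ 𝒬 z r
      · rw [indicator_of_mem hp]; simp
      · rw [indicator_of_notMem hp]
        have : g p = 0 := by_contra fun h => hp (hsupp p h)
        simp [this]
    rw [h1]
    refine (ENNReal.lintegral_mul_le_Lp_mul_Lq _ Real.HolderConjugate.two_two aemeasurable_const
      hg.measurable.enorm.aemeasurable).trans ?_
    simp only [ENNReal.one_rpow, lintegral_one, Measure.restrict_apply_univ, ENNReal.rpow_ofNat]
    rw [ofReal_mul (Real.sqrt_nonneg _), ← sqrt_ofReal_sq hM, ← sqrt_ofReal_sq (Real.sqrt_nonneg _),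
      Real.sq_sqrt measureReal_nonneg, Measure.real, ofReal_toReal hQ]
    refine mul_le_mul' (le_of_eq ?_) (ENNReal.rpow_le_rpow ((setLIntegral_le_lintegral _ _).trans hgM)
      (by norm_num))
    simp
  rw [← ofReal_integral_norm_eq_lintegral_enorm hgi] at hmain
  exact (ofReal_le_ofReal_iff (by positivity)).1 hmain

theorem OscControl.abs_subAffine_center_le (h : OscControl ℓ A Φ univ) (z : SpaceTime m) {s : ℝ}
    (hs : 0 < s) {x : 𝕏 m} {t : ℝ} (hx : x ∈ spatialCube z.1 s)
    (ht : t ∈ timeInterval z.2 s) :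
    |Φ (x, t) - Φ (z.1, t) - inner ℝ (⨍ q in 𝒬 z (2 * s), ∇ₓ Φ q) (x - z.1)|
      ≤ zygmundConst m * A * s := by
  have hp : ((x, t) : SpaceTime m) ∈ 𝒬 z s := ⟨hx, ht⟩
  have hq : ((z.1, t) : SpaceTime m) ∈ 𝒬 z s := ⟨fun i => by simpa using hs, ht⟩
  have h1 := h.abs_subAffine_sub_le hs (Set.subset_univ _) hp hq z.1
  simp only [_root_.subAffine, sub_self, inner_zero_right, sub_zero] at h1
  convert h1 using 2
  ring

theorem lipschitzWith_spaceCutoff (c : 𝕏 m) {R : ℝ} (hR : 0 < R) :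
    LipschitzWith (1 / (2 * R)).toNNReal (spaceCutoff c R) :=
  LipschitzWith.of_dist_le_mul fun x y => by
    rw [Real.coe_toNNReal _ (by positivity), Real.dist_eq, dist_eq_norm]
    exact (abs_spaceCutoff_sub_le c hR x y).trans_eq (by ring)

theorem continuous_spaceCutoff (c : 𝕏 m) (R : ℝ) : Continuous (spaceCutoff c R) := by
  unfold spaceCutoff; fun_prop

/-- Only the existence of a Lipschitz constant matters: it licenses the energy inequality, whose
bound is in terms of the gradient. -/
theorem exists_lipschitzWith_cutoff_mul {E : Type*} [NormedAddCommGroup E] {χ ψ : E → ℝ} {K₁ K₂ : ℝ≥0}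
    (hχ : LipschitzWith K₁ χ) (hψ : LipschitzWith K₂ ψ) (h01 : ∀ x, 0 ≤ χ x ∧ χ x ≤ 1) {S : Set E}
    (hS : IsCompact S) (hχS : ∀ x, x ∉ S → χ x = 0) :
    ∃ K : ℝ≥0, LipschitzWith K fun x => ((χ x * ψ x : ℝ) : ℂ) := by
  obtain ⟨N, hN⟩ := hS.exists_bound_of_continuousOn hψ.continuous.continuousOn
  have hkey : ∀ x y, y ∈ S → |χ x * ψ x - χ y * ψ y| ≤ (|N| * K₁ + K₂) * ‖x - y‖ := by
    intro x y hy
    have h1 := hχ.dist_le_mul x y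
    have h2 := hψ.dist_le_mul x y
    rw [Real.dist_eq, dist_eq_norm] at h1 h2
    have h3 : χ x * ψ x - χ y * ψ y = χ x * (ψ x - ψ y) + ψ y * (χ x - χ y) := by ring
    rw [h3]
    refine (abs_add_le _ _).trans ?_
    rw [abs_mul, abs_mul, abs_of_nonneg (h01 x).1]
    have h4 : χ x * |ψ x - ψ y| ≤ K₂ * ‖x - y‖ := (mul_le_of_le_one_left (abs_nonneg _) (h01 x).2).trans h2
    have h5 : |ψ y| * |χ x - χ y| ≤ |N| * (K₁ * ‖x - y‖) :=
      mul_le_mul ((hN y hy).trans (le_abs_self N)) h1 (abs_nonneg _) (abs_nonneg _)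
    linarith
  refine ⟨(|N| * K₁ + K₂).toNNReal, LipschitzWith.of_dist_le_mul fun x y => ?_⟩
  rw [Real.coe_toNNReal _ (by positivity), Complex.dist_eq, ← Complex.ofReal_sub, Complex.norm_real,
    Real.norm_eq_abs, dist_eq_norm]
  by_cases hy : y ∈ S
  · exact hkey x y hy
  · by_cases hx : x ∈ S
    · rw [abs_sub_comm, norm_sub_rev]
      exact hkey y x hx
    · rw [hχS x hx, hχS y hy]
      simp only [zero_mul, sub_zero, abs_zero]
      positivity

/-- The pointwise gradient bound for a truncated affine remainder. -/
theorem OscControl.norm_fderiv_truncated_le (h : OscControl ℓ A Φ univ) (z : SpaceTime m) {ρ : ℝ}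
    (hρ : 0 < ρ) {t : ℝ} (ht : t ∈ timeInterval z.2 (8 * ρ)) {x : 𝕏 m}
    (hd : DifferentiableAt ℝ (fun x => Φ (x, t)) x) (hdχ : DifferentiableAt ℝ (spaceCutoff z.1 ρ) x) :
    ‖fderiv ℝ (fun x => ((spaceCutoff z.1 ρ x * (Φ (x, t) - Φ (z.1, t) -
      inner ℝ (⨍ q in 𝒬 z (2 * (8 * ρ)), ∇ₓ Φ q) (x - z.1)) : ℝ) : ℂ)) x‖
      ≤ (spatialCube z.1 (8 * ρ)).indicator (fun x => 4 * zygmundConst m * A +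
        ‖∇ₓ Φ (x, t) - ⨍ q in 𝒬 z (2 * (8 * ρ)), ∇ₓ Φ q‖) x := by
  set a := ⨍ q in 𝒬 z (2 * (8 * ρ)), ∇ₓ Φ q with ha
  have hZA : 0 < zygmundConst m * A := mul_pos (zygmundConst_pos m) h.pos
  by_cases hx : ‖x - z.1‖ < 8 * ρ
  · have hxs : x ∈ spatialCube z.1 (8 * ρ) := mem_spatialCube_of_norm_lt (by rwa [norm_sub_rev])
    rw [indicator_of_mem hxs]
    set ψ := fun x => Φ (x, t) - Φ (z.1, t) - inner ℝ a (x - z.1) with hψ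
    have hψd : HasFDerivAt ψ (fderiv ℝ (fun x => Φ (x, t)) x - innerSL ℝ a) x := by
      refine (hd.hasFDerivAt.sub_const (Φ (z.1, t))).fun_sub ?_
      exact ((innerSL ℝ a).hasFDerivAt (x := x - z.1)).comp x ((hasFDerivAt_id x).sub_const z.1)
    have hw' : HasFDerivAt (fun x => ((spaceCutoff z.1 ρ x * (Φ (x, t) - Φ (z.1, t) - inner ℝ a (x - z.1)) : ℝ) : ℂ))
        (Complex.ofRealCLM.comp (spaceCutoff z.1 ρ x • (fderiv ℝ (fun x => Φ (x, t)) x - innerSL ℝ a) +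
          ψ x • fderiv ℝ (spaceCutoff z.1 ρ) x)) x :=
      (Complex.ofRealCLM.hasFDerivAt).comp x (hdχ.hasFDerivAt.mul hψd)
    rw [hw'.fderiv]
    refine (ContinuousLinearMap.opNorm_comp_le _ _).trans ?_
    rw [Complex.ofRealCLM_norm, one_mul]
    refine (norm_add_le _ _).trans ?_
    rw [norm_smul, norm_smul, add_comm]
    refine add_le_add ?_ ?_
    · have h1 := norm_fderiv_le_of_lipschitz ℝ (lipschitzWith_spaceCutoff z.1 hρ) (x₀ := x)
      rw [Real.coe_toNNReal _ (by positivity)] at h1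
      have h2 : ‖ψ x‖ ≤ zygmundConst m * A * (8 * ρ) :=
        h.abs_subAffine_center_le z (by positivity) hxs ht
      calc _ ≤ zygmundConst m * A * (8 * ρ) * (1 / (2 * ρ)) := mul_le_mul h2 h1 (norm_nonneg _) (by positivity)
        _ = _ := by field_simp; ring
    · have h1 : ‖fderiv ℝ (fun x => Φ (x, t)) x - innerSL ℝ a‖ = ‖∇ₓ Φ (x, t) - a‖ := by
        rw [← (InnerProductSpace.toDual ℝ 𝕏 m).norm_map, map_sub, spatialGradient,
          gradient, LinearIsometryEquiv.apply_symm_apply]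
        rfl
      have h2 : 0 ≤ spaceCutoff z.1 ρ x := (unitClamp_mem _).1
      rw [h1, Real.norm_of_nonneg h2]
      exact mul_le_of_le_one_left (norm_nonneg _) (unitClamp_mem _).2
  · have hev : (fun x => ((spaceCutoff z.1 ρ x * (Φ (x, t) - Φ (z.1, t) - inner ℝ a (x - z.1)) : ℝ) : ℂ))
        =ᶠ[nhds x] fun _ => 0 := by
      have hopen : IsOpen {y : 𝕏 m | 4 * ρ < ‖y - z.1‖} :=
        isOpen_lt continuous_const (by fun_prop)
      filter_upwards [hopen.mem_nhds (show 4 * ρ < ‖x - z.1‖ by linarith [not_lt.1 hx])] with y hy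
      rw [spaceCutoff_eq_zero hρ (le_of_lt hy)]
      simp
    rw [hev.fderiv_eq]
    simp only [fderiv_fun_const, Pi.zero_apply, norm_zero]
    exact Set.indicator_nonneg (fun y _ => add_nonneg (by nlinarith [hZA]) (norm_nonneg _)) _

/-- The constant of the John–Nirenberg inequality in `L²`. -/
def jnConst (m : ℕ) : ℝ := 4 * (8 * (2 ^ (m + 2)) ^ 4 + 2 ^ (m + 2)) ^ 2

theorem OscControl.lintegral_gradient_sq_le (h : OscControl ℓ A Φ univ) (z : SpaceTime m) {s : ℝ}
    (hs : 0 < s) : ∫⁻ p in 𝒬 z s,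
      ‖∇ₓ Φ p - ⨍ q in 𝒬 z s, ∇ₓ Φ q‖ₑ ^ 2
        ≤ ofReal (jnConst m * A ^ 2 * volume.real (𝒬 z s)) := by
  have h1 := HasMeanOscLE.sq_average_le h.lip.isBddMeas h.pos h.osc z hs
  set a := ⨍ q in 𝒬 z s, ∇ₓ Φ q
  have hb := h.lip.isBddMeas
  have hi : IntegrableOn (fun p => ‖∇ₓ Φ p - a‖ ^ 2) (𝒬 z s) := by
    refine IsBddMeas.integrableOn (M := (ℓ + ‖a‖) ^ 2) ⟨?_, fun p => ?_⟩ (volume_parabolicCube_lt_top z s).ne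
    · exact ((hb.meas.sub stronglyMeasurable_const).norm.pow 2)
    · rw [Real.norm_of_nonneg (by positivity)]
      exact pow_le_pow_left₀ (norm_nonneg _) ((norm_sub_le _ _).trans (add_le_add_left (hb.bound p) _)) 2
  have h2 : ∀ p, ‖∇ₓ Φ p - a‖ₑ ^ 2 = ofReal (‖∇ₓ Φ p - a‖ ^ 2) := by
    intro p
    rw [ofReal_pow (norm_nonneg _), ofReal_norm_eq_enorm]
  simp_rw [h2]
  rw [← ofReal_integral_eq_lintegral_ofReal hi (ae_of_all _ fun p => by positivity)]
  refine ofReal_le_ofReal ?_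
  have hpos := measureReal_parabolicCube_pos z hs
  rw [setAverage_eq, smul_eq_mul, inv_mul_le_iff₀ hpos] at h1
  rw [jnConst]
  linarith

/-- Subtracted from Φ are its values on the axis x = z.1, a function of t alone, and the affine
function with slope equal to the mean gradient on a cube of radius 16ρ. Neither changes the pairing,
the second because first moments vanish. The truncated remainder has its energy bounded by the L²
oscillation of the gradient; its growth is O(ρ) across times of the cube and O(|x|√(|x|/ρ)) in
space. -/
theorem OscControl.exists_space_pairing (m : ℕ) [Nontrivial 𝕏 m] :
    ∃ C : ℝ, 0 ≤ C ∧ ∀ (ℓ A : ℝ) (Φ : SpaceTime m → ℝ), OscControl ℓ A Φ univ →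
      ∀ (g : SpaceTime m → ℂ) (z : SpaceTime m) (r M : ℝ), ContDiff ℝ ∞ g → HasCompactSupport g →
      0 < r → 0 ≤ M → (∀ p, g p ≠ 0 → p ∈ 𝒬 z r) → ∫ p, g p = 0 →
      ∫⁻ p, ‖g p‖ₑ ^ 2 ≤ ofReal (M ^ 2) →
      (Integrable fun x => ∫ t : ℝ, (Φ (x, t) : ℂ) *
        fracOp 1 (inl ℝ 𝕏 m ℝ) g (x, t)) ∧
      ‖∫ x, ∫ t : ℝ, (Φ (x, t) : ℂ) *
        fracOp 1 (inl ℝ 𝕏 m ℝ) g (x, t)‖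
        ≤ C * A * (√(volume.real (𝒬 z r)) * M) := by
  obtain ⟨k, hk0, hk⟩ := exists_diffSymbol_eq (E := 𝕏 m) one_pos one_lt_two
  set Z := zygmundConst m with hZd
  have hZ : 0 < Z := zygmundConst_pos m
  have hJ : 0 ≤ jnConst m := by unfold jnConst; positivity
  -- The factor m is from summing coordinate energies; the bracket is from (4ZA + |∇Φ - a|)² ≤
  -- 32Z²A² + 2|∇Φ - a|²; the power is the volume ratio of cubes of radii 16ρ and r.
  set κ : ℝ := m * ((32 * Z ^ 2 + 2 * jnConst m) * (16 * (m + 1)) ^ (m + 2)) with hκ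
  have hκ0 : 0 ≤ κ := by positivity
  have hfc : 0 ≤ farConst 𝕏 m 1 1 (1 / 2) := by
    have := kernelTailConst_nonneg (E := 𝕏 m) 1
    have := kernelTailConst_nonneg (E := 𝕏 m) (1 / 2)
    unfold farConst
    positivity
  refine ⟨k * √κ + 16 * Z * farConst 𝕏 m 1 1 (1 / 2), by positivity, ?_⟩
  intro ℓ A Φ h g z r M hg hc hr hM hsupp hmean hgM
  have hA := h.pos
  have hΦ := h.lip.continuous
  -- The Euclidean ball of this radius contains the spatial cube of radius r, and ρ stays positive
  -- when measured against r.
  set ρ : ℝ := (m + 1) * r with hρd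
  have hρ : 0 < ρ := by positivity
  have hrρ : r ≤ ρ := by
    rw [hρd]; nlinarith [(Nat.cast_nonneg m : (0 : ℝ) ≤ m)]
  have h8ρ : 0 < 8 * ρ := by positivity
  set a := ⨍ q in 𝒬 z (2 * (8 * ρ)), ∇ₓ Φ q with ha
  set Ψ : SpaceTime m → ℝ := fun p => Φ p - Φ (z.1, p.2) - inner ℝ a (p.1 - z.1) with hΨ
  have hΨc : Continuous Ψ := by fun_prop
  set V := volume.real (𝒬 z r) with hV
  have hV0 : 0 < V := measureReal_parabolicCube_pos z hr
  have hg1 := integral_norm_le_of_support hg.continuous hc hM hsupp hgM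
  have hsupp' : ∀ x t, g (x, t) ≠ 0 → ‖x - z.1‖ ≤ ρ ∧ t ∈ timeInterval z.2 r := by
    intro x t hne
    have hQ := hsupp _ hne
    refine ⟨?_, hQ.2⟩
    have h1 := norm_sub_le_of_mem_spatialCube hr.le hQ.1
    rw [norm_sub_rev] at h1
    refine h1.trans ?_
    rw [hρd]; nlinarith
  have hsub : timeInterval z.2 r ⊆ timeInterval z.2 (8 * ρ) := fun t ht =>
    lt_of_lt_of_le (show √|z.2 - t| < r from ht) (by linarith)
  have h5 : ∀ x : ℝ, (2 : ℝ≥0∞) * ofReal x = ofReal (2 * x) := fun x => by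
    rw [ofReal_mul (by norm_num)]; simp
  -- the near field
  have hnear : ‖∫ p : SpaceTime m, ((spaceCutoff z.1 ρ p.1 * Ψ p : ℝ) : ℂ) *
      fracOp 1 (inl ℝ 𝕏 m ℝ) g p
        ∂((volume : Measure 𝕏 m).prod volume)‖ ≤ k * (√κ * A * √V) * M := by
    set b : 𝕏 m → ℝ → ℝ≥0∞ := fun x t => (spatialCube z.1 (8 * ρ)).indicator
      (fun x => ofReal (32 * Z ^ 2 * A ^ 2) + 2 * ‖∇ₓ Φ (x, t) - a‖ₑ ^ 2) x with hb
    have hgm : Measurable fun p : SpaceTime m =>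
        ofReal (32 * Z ^ 2 * A ^ 2) + 2 * ‖∇ₓ Φ p - a‖ₑ ^ 2 := by
      have h1 : Measurable fun p => ‖∇ₓ Φ p - a‖ₑ :=
        (h.lip.isBddMeas.meas.sub stronglyMeasurable_const).enorm
      exact measurable_const.add ((h1.pow_const 2).const_mul 2)
    have hbm : Measurable (Function.uncurry b) := by
      have h1 : Function.uncurry b = (spatialCube z.1 (8 * ρ) ×ˢ (univ : Set ℝ)).indicator fun p =>
          ofReal (32 * Z ^ 2 * A ^ 2) + 2 * ‖∇ₓ Φ p - a‖ₑ ^ 2 := by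
        funext ⟨x, t⟩
        by_cases hx : x ∈ spatialCube z.1 (8 * ρ) <;> simp [hb, hx, Function.uncurry, Set.indicator]
      rw [h1]
      exact hgm.indicator ((measurableSet_spatialCube _ _).prod MeasurableSet.univ)
    refine norm_integral_mul_fracOp_le_of_energy one_pos one_lt_two hg hc hk hk0
      (measurableSet_timeInterval z.2 r) (fun x t hne => (hsupp' x t hne).2)
      (W := fun p => spaceCutoff z.1 ρ p.1 * Ψ p)
      (((continuous_spaceCutoff _ _).comp continuous_fst).mul hΨc) (K := Metric.closedBall z.1 (4 * ρ))
      (isCompact_closedBall _ _) (fun x t hx => ?_) (X := fun t => m * ∫⁻ x, b x t) ?_ (fun t ht => ?_)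
      (by positivity) hM ?_ hgM
    · have h1 : 4 * ρ ≤ ‖x - z.1‖ := by
        rw [Metric.mem_closedBall, dist_eq_norm, not_le] at hx
        exact hx.le
      simp only [spaceCutoff_eq_zero hρ h1, zero_mul]
    · exact (Measurable.lintegral_prod_left hbm).const_mul _
    · have hlipΨ : LipschitzWith (ℓ + ‖a‖).toNNReal fun x => Ψ (x, t) := by
        refine LipschitzWith.of_dist_le_mul fun x y => ?_
        rw [Real.coe_toNNReal _ (add_nonneg h.lip.nonneg_of_univ (norm_nonneg _)), Real.dist_eq, dist_eq_norm]
        have h1 : Ψ (x, t) - Ψ (y, t) = (Φ (x, t) - Φ (y, t)) - inner ℝ a (x - y) := by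
          simp only [hΨ, inner_sub_right]
          ring
        rw [h1, add_mul]
        exact (abs_sub _ _).trans (add_le_add (h.lip.space x y t) (abs_real_inner_le_norm _ _))
      have hcs : HasCompactSupport fun x => ((spaceCutoff z.1 ρ x * Ψ (x, t) : ℝ) : ℂ) := by
        refine HasCompactSupport.of_support_subset_isCompact (isCompact_closedBall z.1 (4 * ρ)) fun x hx => ?_
        by_contra hne
        rw [Metric.mem_closedBall, dist_eq_norm, not_le] at hne
        exact hx (by simp [spaceCutoff_eq_zero hρ hne.le])
      obtain ⟨K, hK⟩ := exists_lipschitzWith_cutoff_mul (lipschitzWith_spaceCutoff z.1 hρ) hlipΨ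
        (fun x => unitClamp_mem _) (isCompact_closedBall z.1 (4 * ρ)) fun x hx => by
          rw [Metric.mem_closedBall, dist_eq_norm, not_le] at hx
          exact spaceCutoff_eq_zero hρ hx.le
      refine le_trans ?_ (((lintegral_sq_mul_enorm_fourier_sq_le hK hcs).trans_eq (by rw [finrank_euclideanSpace_fin])).trans ?_)
      · norm_num
      · refine mul_le_mul_right ?_ _
        refine lintegral_mono_ae ?_
        filter_upwards [(h.lip.lipschitzWith t).ae_differentiableAt,
          (lipschitzWith_spaceCutoff z.1 hρ).ae_differentiableAt] with x hx1 hx2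
        have h1 := h.norm_fderiv_truncated_le z hρ (hsub ht) hx1 hx2
        rw [← ha] at h1
        simp only [hb]
        by_cases hx : x ∈ spatialCube z.1 (8 * ρ)
        · rw [indicator_of_mem hx] at h1 ⊢
          rw [← ofReal_norm_eq_enorm, ← ofReal_norm_eq_enorm, ← ofReal_pow (norm_nonneg _),
            ← ofReal_pow (norm_nonneg _), h5, ← ofReal_add (by positivity) (by positivity)]
          refine ofReal_le_ofReal ((pow_le_pow_left₀ (norm_nonneg _) h1 2).trans ?_)
          nlinarith [sq_nonneg (4 * Z * A - ‖∇ₓ Φ (x, t) - a‖)]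
        · rw [indicator_of_notMem hx] at h1 ⊢
          rw [← ofReal_norm_eq_enorm, le_antisymm h1 (norm_nonneg _)]
          simp
    · rw [lintegral_const_mul _ (Measurable.lintegral_prod_left hbm)]
      have h1 : ∫⁻ t in timeInterval z.2 r, ∫⁻ x, b x t ≤ ∫⁻ p in 𝒬 z (8 * ρ),
          (ofReal (32 * Z ^ 2 * A ^ 2) + 2 * ‖∇ₓ Φ p - a‖ₑ ^ 2) := by
        refine (lintegral_mono_set hsub).trans_eq ?_
        rw [restrict_parabolicCube, lintegral_prod_symm' _ hgm]
        refine lintegral_congr fun t => ?_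
        rw [hb, lintegral_indicator (measurableSet_spatialCube _ _)]
      have h2 : ∫⁻ p in 𝒬 z (8 * ρ),
          (ofReal (32 * Z ^ 2 * A ^ 2) + 2 * ‖∇ₓ Φ p - a‖ₑ ^ 2)
          ≤ ofReal ((32 * Z ^ 2 + 2 * jnConst m) * A ^ 2 *
            volume.real (𝒬 z (2 * (8 * ρ)))) := by
        refine (lintegral_mono_set (parabolicCube_mono (by linarith : 8 * ρ ≤ 2 * (8 * ρ)))).trans ?_
        rw [lintegral_add_left measurable_const, setLIntegral_const, lintegral_const_mul' _ _ (by norm_num)]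
        have h3 := h.lintegral_gradient_sq_le z (s := 2 * (8 * ρ)) (by positivity)
        rw [← ha] at h3
        refine (add_le_add_right (mul_le_mul_right h3 2) _).trans_eq ?_
        rw [h5, ← ofReal_toReal (volume_parabolicCube_lt_top z (2 * (8 * ρ))).ne,
          ← ofReal_mul (by positivity), ← Measure.real,
          ← ofReal_add (by positivity) (by positivity)]
        congr 1; ring
      refine (mul_le_mul_right (h1.trans h2) _).trans_eq ?_
      have h4 : volume.real (𝒬 z (2 * (8 * ρ))) = (16 * (m + 1)) ^ (m + 2) * V := by
        rw [measureReal_parabolicCube_mul z z (by positivity : 0 < 2 * (8 * ρ)) hr, hρd]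
        congr 2
        field_simp
        ring
      rw [h4, show ((m : ℝ≥0∞)) = ofReal m by simp, ← ofReal_mul (by positivity)]
      congr 1
      have h6 : (√κ * A * √V) ^ 2 = κ * A ^ 2 * V := by
        rw [mul_pow, mul_pow, Real.sq_sqrt hκ0, Real.sq_sqrt hV0.le]
      rw [h6, hκ]
      ring
  -- the far field
  have hfar₁ : ∀ x t, 2 * ρ ≤ ‖x - z.1‖ → t ∈ timeInterval z.2 r →
      |Ψ (x, t) - Ψ (x, z.2)| ≤ 16 * Z * A * ρ ^ (1 : ℝ) * ‖x - z.1‖ ^ ((1 : ℝ) - 1) := by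
    intro x t _ ht
    rw [Real.rpow_one, sub_self, Real.rpow_zero, mul_one]
    have h1 := h.abs_time_sub_le_mul_sqrt x t z.2
    have h2 := h.abs_time_sub_le_mul_sqrt z.1 t z.2
    have h3 : √|t - z.2| ≤ ρ := by
      rw [abs_sub_comm]
      exact (le_of_lt (show √|z.2 - t| < r from ht)).trans hrρ
    have h4 : Z * A * √|t - z.2| ≤ Z * A * ρ := mul_le_mul_of_nonneg_left h3 (by positivity)
    have h5 : Ψ (x, t) - Ψ (x, z.2) = (Φ (x, t) - Φ (x, z.2)) - (Φ (z.1, t) - Φ (z.1, z.2)) := by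
      simp only [hΨ]; ring
    rw [h5]
    refine (abs_sub _ _).trans ?_
    have h6 : 0 ≤ Z * A * ρ := by positivity
    linarith
  have hfar₂ : ∀ x, 2 * ρ ≤ ‖x - z.1‖ →
      |Ψ (x, z.2)| ≤ 16 * Z * A * ρ ^ ((1 / 2 : ℝ) - 1) * ‖x - z.1‖ ^ ((1 : ℝ) + 1 - 1 / 2) := by
    intro x hx
    set R := ‖x - z.1‖ with hR
    have hR0 : 0 < R := by linarith
    -- The growth estimate is applied at scale 4R, which is at least 8ρ because R ≥ 2ρ; n is the
    -- number of doublings and does not enter the bound.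
    obtain ⟨n, hn⟩ := pow_unbounded_of_one_lt (4 * R / (8 * ρ)) (one_lt_two (α := ℝ))
    have h1 := h.abs_affine_sub_le z h8ρ n (4 * R) (by linarith) ((div_le_iff₀ h8ρ).1 hn.le) (x - z.1)
      (mem_spatialCube_of_norm_lt (by
        rw [sub_add_cancel_left, norm_neg, ← hR]; linarith))
    rw [← ha, add_sub_cancel] at h1
    have h2 : Ψ (x, z.2) = Φ (x, z.2) - Φ z - inner ℝ a (x - z.1) := rfl
    rw [h2]
    refine h1.trans ?_
    have h3 : √(4 * R / (8 * ρ)) ≤ √R / √ρ := by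
      rw [← Real.sqrt_div hR0.le]
      refine Real.sqrt_le_sqrt ?_
      rw [div_le_div_iff₀ h8ρ hρ]
      nlinarith
    have h4 : R ^ ((1 : ℝ) + 1 - 1 / 2) = R * √R := by
      rw [Real.sqrt_eq_rpow, ← Real.rpow_one_add' hR0.le (by norm_num)]; norm_num
    have h5 : ρ ^ ((1 / 2 : ℝ) - 1) = (√ρ)⁻¹ := by
      rw [Real.sqrt_eq_rpow, ← Real.rpow_neg hρ.le]; norm_num
    rw [h4, h5]
    refine (mul_le_mul_of_nonneg_left h3 (by positivity)).trans_eq ?_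
    rw [div_eq_mul_inv]; ring
  have hmain := integrable_and_norm_integral_fracOp_le (E := 𝕏 m) (F := ℝ)
    (ν := volume) (G := g) (e₀ := z.1) (f₀ := z.2) (S := timeInterval z.2 r) (B := 16 * Z * A)
    (γ₁ := 1) (γ₂ := 1 / 2) (Ψ := Ψ) one_pos one_lt_two hg hc hρ (by positivity) one_pos (by norm_num)
    hsupp' hmean hΨc hfar₁ hfar₂ (b := fun t => Φ (z.1, t)) (by fun_prop) (a := a) (Or.inr rfl)
    (continuous_spaceCutoff z.1 ρ)
    (HasCompactSupport.of_support_subset_isCompact (isCompact_closedBall z.1 (4 * ρ)) fun x hx => by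
      by_contra hne
      rw [Metric.mem_closedBall, dist_eq_norm, not_le] at hne
      exact hx (spaceCutoff_eq_zero hρ hne.le))
    (fun x hx => spaceCutoff_eq_one hρ hx) (fun x => unitClamp_mem _) hnear
  have hsplit : ∀ x t, Ψ (x, t) + Φ (z.1, t) + inner ℝ a (x - z.1) = Φ (x, t) := fun x t => by
    simp only [hΨ]; ring
  simp only [hsplit] at hmain
  refine ⟨hmain.1, hmain.2.trans ?_⟩
  have h1 : 16 * Z * A * (∫ p, ‖g p‖ ∂((volume : Measure 𝕏 m).prod volume)) *
      farConst 𝕏 m 1 1 (1 / 2) ≤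
      16 * Z * A * (√V * M) * farConst 𝕏 m 1 1 (1 / 2) := by
    refine mul_le_mul_of_nonneg_right (mul_le_mul_of_nonneg_left hg1 (by positivity)) hfc
  refine (add_le_add_right h1 _).trans_eq ?_
  ring

end SpacePairing

/-! ### Pairing with the operators in time -/

section TimePairing

open Module

variable {m : ℕ} {ℓ A : ℝ} {Φ : SpaceTime m → ℝ}

theorem continuous_timeCutoff (t₀ R : ℝ) : Continuous (timeCutoff t₀ R) := by
  unfold timeCutoff; fun_prop

theorem rieszKernel_one_real (y : ℝ) : rieszKernel 1 y = (|y| ^ 2)⁻¹ := by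
  rw [rieszKernel, Real.norm_eq_abs, finrank_self, Nat.cast_one, one_add_one_eq_two,
    Real.rpow_neg (abs_nonneg y), Real.rpow_two]

theorem lintegral_rieszKernel_mul_eq {w : ℝ → ℝ} (hw : Continuous w) :
    ∫⁻ y : ℝ, ofReal (rieszKernel 1 y) * ∫⁻ t : ℝ, ‖(w (t + y) : ℂ) - w t‖ₑ ^ 2
      = ∫⁻ t, ∫⁻ τ, ofReal (|w t - w τ| ^ 2 / |t - τ| ^ 2) := by
  have h1 : ∀ y t : ℝ, ofReal (rieszKernel 1 y) * ‖(w (t + y) : ℂ) - w t‖ₑ ^ 2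
      = ofReal (|w t - w (t + y)| ^ 2 / |t - (t + y)| ^ 2) := by
    intro y t
    rw [← Complex.ofReal_sub, ← ofReal_norm_eq_enorm, Complex.norm_real, Real.norm_eq_abs,
      ← ofReal_pow (abs_nonneg _), ← ofReal_mul (rieszKernel_nonneg _ _),
      rieszKernel_one_real, sub_add_cancel_left, abs_neg, abs_sub_comm, div_eq_inv_mul]
  have h2 : ∀ y : ℝ, ofReal (rieszKernel 1 y) * ∫⁻ t : ℝ, ‖(w (t + y) : ℂ) - w t‖ₑ ^ 2
      = ∫⁻ t, ofReal (|w t - w (t + y)| ^ 2 / |t - (t + y)| ^ 2) := by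
    intro y
    rw [← lintegral_const_mul' _ _ ofReal_ne_top]
    exact lintegral_congr (h1 y)
  simp_rw [h2]
  rw [lintegral_lintegral_swap]
  · exact lintegral_congr fun t =>
      lintegral_add_left_eq_self (fun τ => ofReal (|w t - w τ| ^ 2 / |t - τ| ^ 2)) t
  · refine Measurable.aemeasurable (Measurable.ennreal_ofReal (Measurable.div ?_ ?_))
    · exact Continuous.measurable (by fun_prop)
    · exact Continuous.measurable (by fun_prop)

/-- The energy of the truncation over the whole line is localised to I × I up to O(B²|I|). Inside,
the product rule and the growth of ψ bound the increments. If one time lies outside I, the cutoff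
vanishes there and the other time is at distance at least 2R² or contributes nothing, so a tail
integral suffices. -/
theorem lintegral_truncated_time_le {ψ : ℝ → ℝ} (hψ : Continuous ψ) {B R t₀ : ℝ} (hB : 0 ≤ B) (hR : 0 < R)
    (hψB : ∀ t, |ψ t| ≤ B * √|t - t₀|) :
    ∫⁻ t, ∫⁻ τ, ofReal (|timeCutoff t₀ R t * ψ t - timeCutoff t₀ R τ * ψ τ| ^ 2 / |t - τ| ^ 2)
      ≤ ∫⁻ t in timeInterval t₀ (2 * R), ((∫⁻ τ in timeInterval t₀ (2 * R),
        2 * ofReal (|ψ t - ψ τ| ^ 2 / |t - τ| ^ 2)) + ofReal (72 * B ^ 2)) := by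
  set I := timeInterval t₀ (2 * R) with hI
  have hIm : MeasurableSet I := measurableSet_timeInterval _ _
  have hIv : volume I = ofReal (8 * R ^ 2) := by
    rw [hI, volume_timeInterval t₀ (by positivity)]; congr 1; ring
  have hBR : 0 ≤ 2 * B * R := by positivity
  set a : ℝ → ℝ → ℝ≥0∞ := fun t τ => 2 * ofReal (|ψ t - ψ τ| ^ 2 / |t - τ| ^ 2) with ha
  have ham : Measurable (Function.uncurry a) := by
    refine (Measurable.ennreal_ofReal (Measurable.div ?_ ?_)).const_mul 2
    · exact Continuous.measurable (by fun_prop)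
    · exact Continuous.measurable (by fun_prop)
  set c : ℝ≥0∞ := ofReal (8 * B ^ 2 / R ^ 2) with hc
  set T : ℝ → ℝ → ℝ≥0∞ := fun t τ => {τ : ℝ | 2 * R ^ 2 ≤ |t - τ|}.indicator
    (fun τ => ofReal ((2 * B * R) ^ 2 / |t - τ| ^ 2)) τ with hT
  have hTsymm : ∀ t τ, T t τ = T τ t := fun t τ => by
    simp only [hT, Set.indicator, Set.mem_ofPred_eq, abs_sub_comm t τ]
  have hTm : Measurable (Function.uncurry T) := by
    have h1 : Function.uncurry T = {p : ℝ × ℝ | 2 * R ^ 2 ≤ |p.1 - p.2|}.indicator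
        fun p => ofReal ((2 * B * R) ^ 2 / |p.1 - p.2| ^ 2) := rfl
    rw [h1]
    refine Measurable.indicator (Measurable.ennreal_ofReal (Measurable.div measurable_const ?_))
      (isClosed_le continuous_const (by fun_prop)).measurableSet
    exact Continuous.measurable (by fun_prop)
  have hTint : ∀ t, ∫⁻ τ, T t τ ≤ ofReal (4 * B ^ 2) := by
    intro t
    have h2R : 0 < 2 * R ^ 2 := by positivity
    rw [hT, lintegral_indicator (isClosed_le continuous_const (by fun_prop)).measurableSet]
    refine (lintegral_tail_inv_sq t h2R).trans_eq ?_
    congr 1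
    field_simp
    ring
  have hsmall : ∀ t, |timeCutoff t₀ R t * ψ t| ≤ 2 * B * R := by
    intro t
    rcases le_or_gt (2 * R ^ 2) |t - t₀| with h | h
    · rw [timeCutoff_eq_zero hR h, zero_mul, abs_zero]; exact hBR
    · rw [abs_mul]
      have h0 : 0 ≤ timeCutoff t₀ R t ∧ timeCutoff t₀ R t ≤ 1 := unitClamp_mem _
      rw [abs_of_nonneg h0.1]
      refine (mul_le_of_le_one_left (abs_nonneg _) h0.2).trans ((hψB t).trans ?_)
      have h1 : √|t - t₀| ≤ 2 * R := by
        rw [Real.sqrt_le_left (by positivity)]; nlinarith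
      nlinarith
  have hout : ∀ t, t ∉ I → timeCutoff t₀ R t = 0 ∧ 4 * R ^ 2 ≤ |t - t₀| := by
    intro t ht
    rw [hI, mem_timeInterval (by positivity), not_lt, abs_sub_comm] at ht
    have h1 : 4 * R ^ 2 ≤ |t - t₀| := by linarith
    exact ⟨timeCutoff_eq_zero hR (by nlinarith), h1⟩
  have hoff : ∀ t τ, τ ∉ I → ofReal (|timeCutoff t₀ R t * ψ t - timeCutoff t₀ R τ * ψ τ| ^ 2 /
      |t - τ| ^ 2) ≤ T t τ := by
    intro t τ hτ
    obtain ⟨h1, h2⟩ := hout τ hτ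
    rw [h1, zero_mul, sub_zero]
    rcases le_or_gt (2 * R ^ 2) |t - t₀| with h | h
    · rw [timeCutoff_eq_zero hR h]; simp
    · have h3 : 2 * R ^ 2 ≤ |t - τ| := by
        have := abs_sub_abs_le_abs_sub (τ - t₀) (t - t₀)
        rw [sub_sub_sub_cancel_right, abs_sub_comm τ t] at this
        linarith
      simp only [hT]
      rw [indicator_of_mem (show τ ∈ {τ : ℝ | 2 * R ^ 2 ≤ |t - τ|} from h3)]
      exact ofReal_le_ofReal (div_le_div_of_nonneg_right
        (pow_le_pow_left₀ (abs_nonneg _) (hsmall t) 2) (by positivity))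
  have hin : ∀ t τ, τ ∈ I → ofReal (|timeCutoff t₀ R t * ψ t - timeCutoff t₀ R τ * ψ τ| ^ 2 /
      |t - τ| ^ 2) ≤ a t τ + c := by
    intro t τ hτ
    rw [hI, mem_timeInterval (by positivity), abs_sub_comm] at hτ
    have h1 : |ψ τ| ≤ 2 * B * R := by
      refine (hψB τ).trans ?_
      have h1 : √|τ - t₀| ≤ 2 * R := by
        rw [Real.sqrt_le_left (by positivity)]; exact hτ.le
      nlinarith
    have h2 := abs_timeCutoff_sub_le t₀ hR t τ
    have h0 : 0 ≤ timeCutoff t₀ R t ∧ timeCutoff t₀ R t ≤ 1 := unitClamp_mem _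
    have h3 : |timeCutoff t₀ R t * ψ t - timeCutoff t₀ R τ * ψ τ| ≤
        |ψ t - ψ τ| + 2 * B / R * |t - τ| := by
      have h4 : timeCutoff t₀ R t * ψ t - timeCutoff t₀ R τ * ψ τ =
        timeCutoff t₀ R t * (ψ t - ψ τ) + ψ τ * (timeCutoff t₀ R t - timeCutoff t₀ R τ) := by ring
      rw [h4]
      refine (abs_add_le _ _).trans ?_
      rw [abs_mul, abs_mul, abs_of_nonneg h0.1]
      refine add_le_add (mul_le_of_le_one_left (abs_nonneg _) h0.2)
        ((mul_le_mul h1 h2 (abs_nonneg _) hBR).trans_eq ?_)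
      field_simp
    have h5 : ∀ x : ℝ, (2 : ℝ≥0∞) * ofReal x = ofReal (2 * x) := fun x => by
      rw [ofReal_mul (by norm_num)]; simp
    rw [ha, hc]
    simp only [h5]
    rw [← ofReal_add (by positivity) (by positivity)]
    refine ofReal_le_ofReal ?_
    rcases eq_or_ne t τ with rfl | hne
    · simp; positivity
    · have hpos : 0 < |t - τ| := abs_pos.2 (sub_ne_zero.2 hne)
      rw [div_le_iff₀ (by positivity)]
      refine (pow_le_pow_left₀ (abs_nonneg _) h3 2).trans ?_
      have h6 : (2 * (|ψ t - ψ τ| ^ 2 / |t - τ| ^ 2) + 8 * B ^ 2 / R ^ 2) * |t - τ| ^ 2 =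
        2 * |ψ t - ψ τ| ^ 2 + 2 * (2 * B / R * |t - τ|) ^ 2 := by
        field_simp
        ring
      rw [h6]
      nlinarith [sq_nonneg (|ψ t - ψ τ| - 2 * B / R * |t - τ|)]
  have hpt : ∀ t τ, ofReal (|timeCutoff t₀ R t * ψ t - timeCutoff t₀ R τ * ψ τ| ^ 2 / |t - τ| ^ 2)
      ≤ I.indicator (fun t => I.indicator (fun τ => a t τ + c) τ + T t τ) t +
        I.indicator (fun τ => T τ t) τ := by
    intro t τ
    by_cases ht : t ∈ I
    · rw [indicator_of_mem ht]
      by_cases hτ : τ ∈ I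
      · rw [indicator_of_mem hτ]
        exact ((hin t τ hτ).trans le_self_add).trans le_self_add
      · exact ((hoff t τ hτ).trans le_add_self).trans le_self_add
    · by_cases hτ : τ ∈ I
      · rw [indicator_of_mem hτ]
        refine le_trans ?_ le_add_self
        rw [abs_sub_comm, abs_sub_comm t τ]
        exact hoff τ t ht
      · rw [(hout t ht).1, (hout τ hτ).1]; simp
  have hT3m : Measurable (Function.uncurry fun t τ => I.indicator (fun τ => T τ t) τ) := by
    have h1 : (Function.uncurry fun t τ => I.indicator (fun τ => T τ t) τ) =
        (univ ×ˢ I).indicator fun p : ℝ × ℝ => Function.uncurry T p.swap := by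
      funext ⟨t, τ⟩
      by_cases hτ : τ ∈ I <;> simp [hτ, Set.indicator]
    rw [h1]
    exact (hTm.comp measurable_swap).indicator (MeasurableSet.univ.prod hIm)
  have hm1 : ∀ t, Measurable fun τ => I.indicator (fun τ => T τ t) τ := fun t =>
    hT3m.comp measurable_prodMk_left
  have hm2 : Measurable fun t => ∫⁻ τ, I.indicator (fun τ => T τ t) τ := hT3m.lintegral_prod_right'
  have haI : ∀ t, Measurable fun τ => I.indicator (fun τ => a t τ + c) τ := fun t =>
    ((ham.comp measurable_prodMk_left).add_const c).indicator hIm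
  calc _ ≤ ∫⁻ t, ∫⁻ τ, (I.indicator (fun t => I.indicator (fun τ => a t τ + c) τ + T t τ) t +
        I.indicator (fun τ => T τ t) τ) := lintegral_mono fun t => lintegral_mono fun τ => hpt t τ
    _ = ∫⁻ t, (I.indicator (fun t => ∫⁻ τ, (I.indicator (fun τ => a t τ + c) τ + T t τ)) t +
        ∫⁻ τ, I.indicator (fun τ => T τ t) τ) := by
        refine lintegral_congr fun t => ?_
        rw [lintegral_add_right _ (hm1 t)]
        by_cases ht : t ∈ I <;> simp [ht]
    _ = (∫⁻ t in I, ∫⁻ τ, (I.indicator (fun τ => a t τ + c) τ + T t τ)) +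
        ∫⁻ t, ∫⁻ τ, I.indicator (fun τ => T τ t) τ := by
        rw [lintegral_add_right _ hm2, lintegral_indicator hIm]
    _ = (∫⁻ t in I, ∫⁻ τ, (I.indicator (fun τ => a t τ + c) τ + T t τ)) +
        ∫⁻ τ in I, ∫⁻ t, T τ t := by
        rw [lintegral_lintegral_swap hT3m.aemeasurable]
        congr 1
        rw [← lintegral_indicator hIm]
        refine lintegral_congr fun τ => ?_
        by_cases hτ : τ ∈ I <;> simp [hτ]
    -- Here 68 = 64 + 4, with 64B² = (8B²/R²)·8R² from the cutoff increments over I and 4B² from one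
    -- tail. The tail with the two times exchanged gives the last 4 of 72.
    _ ≤ (∫⁻ t in I, ((∫⁻ τ in I, a t τ) + ofReal (68 * B ^ 2))) +
        ∫⁻ τ in I, ofReal (4 * B ^ 2) := by
        refine add_le_add (lintegral_mono fun t => ?_) (lintegral_mono fun t => hTint t)
        rw [lintegral_add_left (haI t), lintegral_indicator hIm, lintegral_add_right _ measurable_const,
          setLIntegral_const, hIv, hc, ← ofReal_mul (by positivity), add_assoc]
        refine add_le_add_right ((add_le_add_right (hTint t) _).trans_eq ?_) _
        rw [← ofReal_add (by positivity) (by positivity)]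
        congr 1
        field_simp
        ring
    _ = _ := by
        rw [← lintegral_add_right _ measurable_const]
        refine lintegral_congr fun t => ?_
        rw [add_assoc, ← ofReal_add (by positivity) (by positivity)]
        congr 2
        ring

/-- Time now plays the singular role, hence the swapped coordinates and the radius r². Subtracting Φ
at the central time, a function of x alone, costs nothing. The energy of order 2·(1/2) = 1 in time
is the Gagliardo form of `timeDifference`, so the hypothesis on Φ bounds it directly; the far field
uses the Hölder bound and `OscControl.abs_mixed_sub_le`. -/
theorem OscControl.exists_time_pairing (m : ℕ) :
    ∃ C : ℝ, 0 ≤ C ∧ ∀ (ℓ A : ℝ) (Φ : SpaceTime m → ℝ), OscControl ℓ A Φ univ →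
      ∀ (g : SpaceTime m → ℂ) (z : SpaceTime m) (r M : ℝ), ContDiff ℝ ∞ g → HasCompactSupport g →
      0 < r → 0 ≤ M → (∀ p, g p ≠ 0 → p ∈ 𝒬 z r) → ∫ p, g p = 0 →
      ∫⁻ p, ‖g p‖ₑ ^ 2 ≤ ofReal (M ^ 2) →
      (Integrable fun t : ℝ => ∫ x, (Φ (x, t) : ℂ) *
        fracOp (1 / 2) (inl ℝ ℝ 𝕏 m) (g ∘ Prod.swap) (t, x)) ∧
      ‖∫ t : ℝ, ∫ x, (Φ (x, t) : ℂ) *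
        fracOp (1 / 2) (inl ℝ ℝ 𝕏 m) (g ∘ Prod.swap) (t, x)‖
        ≤ C * A * (√(volume.real (𝒬 z r)) * M) := by
  have hα0 : (0 : ℝ) < 1 / 2 := by norm_num
  have hα2 : (1 / 2 : ℝ) < 2 := by norm_num
  obtain ⟨k, hk0, hk⟩ := exists_diffSymbol_eq (E := ℝ) hα0 hα2
  obtain ⟨k₁, hk₁0, hk₁⟩ := exists_diffSymbol_eq (E := ℝ) one_pos one_lt_two
  set Z := zygmundConst m with hZd
  have hZ : 0 < Z := zygmundConst_pos m
  set κ : ℝ := k₁⁻¹ * ((2 + 72 * Z ^ 2) * 4 ^ (m + 2)) with hκ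
  have hκ0 : 0 ≤ κ := by positivity
  have hfc : 0 ≤ farConst ℝ (1 / 2) (1 / 4) 1 := by
    have := kernelTailConst_nonneg (E := ℝ) (1 / 4)
    have := kernelTailConst_nonneg (E := ℝ) 1
    unfold farConst
    positivity
  refine ⟨k * √κ + 8 * Z * farConst ℝ (1 / 2) (1 / 4) 1, by positivity, ?_⟩
  intro ℓ A Φ h g z r M hg hc hr hM hsupp hmean hgM
  have hA := h.pos
  have hΦ := h.lip.continuous
  set G : ℝ × 𝕏 m → ℂ := g ∘ Prod.swap with hGd
  have hG : ContDiff ℝ ∞ G := hg.comp (contDiff_snd.prodMk contDiff_fst)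
  have hGc : HasCompactSupport G := hc.comp_homeomorph (Homeomorph.prodComm ℝ 𝕏 m)
  have hGmean : ∫ p, G p ∂((volume : Measure ℝ).prod volume) = 0 := by
    rw [← hmean]
    exact integral_prod_swap g
  have hGM : ∫⁻ p, ‖G p‖ₑ ^ 2 ∂((volume : Measure ℝ).prod volume) ≤ ofReal (M ^ 2) := by
    refine le_of_eq_of_le ?_ hgM
    exact lintegral_prod_swap (fun p => ‖g p‖ₑ ^ 2)
  set V := volume.real (𝒬 z r) with hV
  have hV0 : 0 < V := measureReal_parabolicCube_pos z hr
  have hG1 : ∫ p, ‖G p‖ ∂((volume : Measure ℝ).prod volume) ≤ √V * M := by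
    refine le_of_eq_of_le ?_ (integral_norm_le_of_support hg.continuous hc hM hsupp hgM)
    exact integral_prod_swap (fun p => ‖g p‖)
  set Ψ : ℝ × 𝕏 m → ℝ := fun p => Φ (p.2, p.1) - Φ (p.2, z.2) with hΨ
  have hΨc : Continuous Ψ := by fun_prop
  have hρ : 0 < r ^ 2 := by positivity
  have hsupp' : ∀ (t : ℝ) x, G (t, x) ≠ 0 → ‖t - z.2‖ ≤ r ^ 2 ∧ x ∈ spatialCube z.1 r := by
    intro t x hne
    have hQ := hsupp _ hne
    refine ⟨?_, hQ.1⟩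
    have h1 := (mem_timeInterval hr).1 hQ.2
    rw [Real.norm_eq_abs, abs_sub_comm]
    exact h1.le
  set I := timeInterval z.2 (2 * (2 * r)) with hI
  have hR : 0 < 2 * r := by positivity
  have hqm := measurable_timeQuotient hΦ
  -- the near field
  have hχ0 : ∀ t : ℝ, t ∉ Metric.closedBall z.2 (2 * (2 * r) ^ 2) → timeCutoff z.2 (2 * r) t = 0 := by
    intro t ht
    rw [Metric.mem_closedBall, Real.dist_eq, not_le] at ht
    exact timeCutoff_eq_zero hR ht.le
  have hnear : ‖∫ p : ℝ × 𝕏 m, ((timeCutoff z.2 (2 * r) p.1 * Ψ p : ℝ) : ℂ) *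
      fracOp (1 / 2) (inl ℝ ℝ 𝕏 m) G p
        ∂((volume : Measure ℝ).prod volume)‖ ≤ k * (√κ * A * √V) * M := by
    set b : SpaceTime m → ℝ≥0∞ := fun p => (∫⁻ τ in I, 2 * timeQuotient Φ p τ) +
      ofReal (72 * (Z * A) ^ 2) with hb
    have hbm : Measurable b := (hqm.const_mul 2).lintegral_prod_right'.add_const _
    have hXm : Measurable fun x => ∫⁻ t in I, b (x, t) := hbm.lintegral_prod_right'
    refine norm_integral_mul_fracOp_le_of_energy hα0 hα2 hG hGc hk hk0
      (measurableSet_spatialCube z.1 r) (fun t x hne => (hsupp' t x hne).2)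
      (W := fun p => timeCutoff z.2 (2 * r) p.1 * Ψ p)
      (((continuous_timeCutoff _ _).comp continuous_fst).mul hΨc)
      (isCompact_closedBall z.2 (2 * (2 * r) ^ 2)) (fun t x ht => ?_)
      (X := fun x => ofReal k₁⁻¹ * ∫⁻ t in I, b (x, t)) (hXm.const_mul _) (fun x _ => ?_)
      (by positivity) hM ?_ hGM
    · simp only [hχ0 t ht, zero_mul]
    · set w : ℝ → ℝ := fun t => timeCutoff z.2 (2 * r) t * Ψ (t, x) with hw
      have hwc : Continuous w := (continuous_timeCutoff _ _).mul (by fun_prop)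
      have hws : HasCompactSupport fun t => (w t : ℂ) := by
        refine HasCompactSupport.of_support_subset_isCompact
          (isCompact_closedBall z.2 (2 * (2 * r) ^ 2)) fun t ht => ?_
        by_contra hne
        exact ht (by simp [hw, hχ0 t hne])
      have h1 := lintegral_rpow_mul_enorm_fourier_sq one_pos one_lt_two hk₁ hk₁0
        (Complex.continuous_ofReal.comp hwc) hws
      have h2 := lintegral_truncated_time_le (ψ := fun t => Ψ (t, x)) (by fun_prop)
        (by positivity : 0 ≤ Z * A) hR (t₀ := z.2) fun t => h.abs_time_sub_le_mul_sqrt x t z.2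
      have h3 := h1.trans_le ((lintegral_rieszKernel_mul_eq hwc).trans_le h2)
      have h4 : ∀ t τ, |Ψ (t, x) - Ψ (τ, x)| ^ 2 / |t - τ| ^ 2 = |Φ (x, t) - Φ (x, τ)| ^ 2 / |t - τ| ^ 2 := by
        intro t τ
        simp only [hΨ, sub_sub_sub_cancel_right]
      simp only [h4] at h3
      rw [show (2 : ℝ) * (1 / 2) = 1 by norm_num, ENNReal.ofReal_inv_of_pos hk₁0,
        ← ENNReal.div_eq_inv_mul,
        ENNReal.le_div_iff_mul_le (Or.inl (by simpa using hk₁0)) (Or.inl ofReal_ne_top)]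
      exact (mul_comm _ _).trans_le h3
    · rw [lintegral_const_mul _ hXm]
      have h1 : ∫⁻ x in spatialCube z.1 r, ∫⁻ t in I, b (x, t) ≤ ∫⁻ p in 𝒬 z (2 * (2 * r)), b p := by
        refine (lintegral_mono_set (fun y hy i => (hy i).trans (by linarith) :
          spatialCube z.1 r ⊆ spatialCube z.1 (2 * (2 * r)))).trans_eq ?_
        rw [restrict_parabolicCube, lintegral_prod _ hbm.aemeasurable]
        rfl
      have h2 : ∫⁻ p in 𝒬 z (2 * (2 * r)), b p
          ≤ ofReal ((2 + 72 * Z ^ 2) * A ^ 2 * volume.real (𝒬 z (2 * (2 * r)))) := by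
        have h3 := (timeDifference_le_iff Φ z (by positivity : 0 < 2 * (2 * r)) _).1
          (h.time z (2 * (2 * r)) (by positivity) (Set.subset_univ _))
        rw [hb, lintegral_add_right _ measurable_const, setLIntegral_const]
        have h4 : ∫⁻ p in 𝒬 z (2 * (2 * r)), ∫⁻ τ in I, 2 * timeQuotient Φ p τ
            ≤ 2 * (ofReal (A ^ 2) * volume (𝒬 z (2 * (2 * r)))) := by
          refine le_trans (le_of_eq ?_) (mul_le_mul_right h3 2)
          rw [← lintegral_const_mul' _ _ (by norm_num)]
          exact lintegral_congr fun p => lintegral_const_mul' _ _ (by norm_num)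
        refine (add_le_add_left h4 _).trans_eq ?_
        have h5 : ∀ x : ℝ, (2 : ℝ≥0∞) * ofReal x = ofReal (2 * x) := fun x => by
          rw [ofReal_mul (by norm_num)]; simp
        rw [← ofReal_toReal (volume_parabolicCube_lt_top z (2 * (2 * r))).ne,
          ← ofReal_mul (by positivity), ← ofReal_mul (by positivity), h5, ← Measure.real,
          ← ofReal_add (by positivity) (by positivity)]
        congr 1; ring
      refine (mul_le_mul_right (h1.trans h2) _).trans_eq ?_
      have h4 : volume.real (𝒬 z (2 * (2 * r))) = 4 ^ (m + 2) * V := by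
        rw [measureReal_parabolicCube_mul z z (by positivity : 0 < 2 * (2 * r)) hr]
        congr 2
        field_simp
        norm_num
      rw [h4, ← ofReal_mul (by positivity)]
      congr 1
      have h6 : (√κ * A * √V) ^ 2 = κ * A ^ 2 * V := by
        rw [mul_pow, mul_pow, Real.sq_sqrt hκ0, Real.sq_sqrt hV0.le]
      rw [h6, hκ]
      ring
  -- the far field
  have hfar₁ : ∀ (t : ℝ) x, 2 * r ^ 2 ≤ ‖t - z.2‖ → x ∈ spatialCube z.1 r →
      |Ψ (t, x) - Ψ (t, z.1)| ≤ 8 * Z * A * (r ^ 2) ^ (1 / 4 : ℝ) * ‖t - z.2‖ ^ ((1 / 2 : ℝ) - 1 / 4) := by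
    intro t x ht hx
    set R := ‖t - z.2‖ with hRd
    have hR0 : 0 < R := by linarith
    obtain ⟨n, hn⟩ := pow_unbounded_of_one_lt (√|t - z.2| / r) (one_lt_two (α := ℝ))
    have h1 := h.abs_mixed_sub_le t z.2 n r hr (Real.le_sqrt_of_sq_le (by
      rw [← Real.norm_eq_abs]; linarith)) ((div_le_iff₀ hr).1 hn.le) z.1 (x - z.1) (by
        rwa [add_sub_cancel])
    rw [add_sub_cancel] at h1
    refine h1.trans_eq ?_
    -- The mixed difference is O(√(r√|t - z.2|)), that is, (r²)^{1/4} |t - z.2|^{1/4}; this dictates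
    -- γ₁ = 1/4 for α = 1/2.
    have h2 : (r ^ 2) ^ (1 / 4 : ℝ) = √r := by
      rw [Real.sqrt_eq_rpow, ← Real.rpow_natCast, ← Real.rpow_mul hr.le]; norm_num
    have h3 : R ^ ((1 / 2 : ℝ) - 1 / 4) = √(√R) := by
      rw [Real.sqrt_eq_rpow, Real.sqrt_eq_rpow, ← Real.rpow_mul hR0.le]; norm_num
    rw [h2, h3, Real.sqrt_mul hr.le, hRd, Real.norm_eq_abs]
    ring
  have hfar₂ : ∀ t : ℝ, 2 * r ^ 2 ≤ ‖t - z.2‖ →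
      |Ψ (t, z.1)| ≤ 8 * Z * A * (r ^ 2) ^ ((1 : ℝ) - 1) * ‖t - z.2‖ ^ ((1 / 2 : ℝ) + 1 - 1) := by
    intro t _
    rw [sub_self, Real.rpow_zero, mul_one, add_sub_cancel_right, ← Real.sqrt_eq_rpow, Real.norm_eq_abs]
    have h1 := h.abs_time_sub_le_mul_sqrt z.1 t z.2
    have h2 : 0 ≤ Z * A * √|t - z.2| := by positivity
    refine h1.trans ?_
    linarith
  have hmain := integrable_and_norm_integral_fracOp_le (E := ℝ) (F := 𝕏 m)
    (ν := volume) (G := G) (e₀ := z.2) (f₀ := z.1) (S := spatialCube z.1 r) (B := 8 * Z * A)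
    (γ₁ := 1 / 4) (γ₂ := 1) (Ψ := Ψ) hα0 hα2 hG hGc hρ (by positivity) (by norm_num) one_pos
    hsupp' hGmean hΨc hfar₁ hfar₂ (b := fun x => Φ (x, z.2)) (by fun_prop) (a := 0) (Or.inl rfl)
    (continuous_timeCutoff z.2 (2 * r))
    (HasCompactSupport.of_support_subset_isCompact (isCompact_closedBall z.2 (2 * (2 * r) ^ 2))
      fun t ht => by
        by_contra hne
        exact ht (hχ0 t hne))
    (fun t ht => timeCutoff_eq_one hR (by rw [Real.norm_eq_abs] at ht; nlinarith))
    (fun x => unitClamp_mem _) hnear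
  have hsplit : ∀ t x, Ψ (t, x) + Φ (x, z.2) + inner ℝ (0 : ℝ) (t - z.2) = Φ (x, t) := fun t x => by
    simp only [hΨ, inner_zero_left]; ring
  simp only [hsplit] at hmain
  refine ⟨hmain.1, hmain.2.trans ?_⟩
  have h1 : 8 * Z * A * (∫ p, ‖G p‖ ∂((volume : Measure ℝ).prod volume)) * farConst ℝ (1 / 2) (1 / 4) 1 ≤
      8 * Z * A * (√V * M) * farConst ℝ (1 / 2) (1 / 4) 1 :=
    mul_le_mul_of_nonneg_right (mul_le_mul_of_nonneg_left hG1 (by positivity)) hfc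
  refine (add_le_add_right h1 _).trans_eq ?_
  ring

end TimePairing

/-! ### The parabolic derivative as a functional on test functions of mean zero -/

section FracOpLinear

open Module

variable {E : Type*} [NormedAddCommGroup E] [InnerProductSpace ℝ E] [FiniteDimensional ℝ E]
  [MeasurableSpace E] [BorelSpace E] [Nontrivial E]
variable {P : Type*} [NormedAddCommGroup P] [NormedSpace ℝ P] [FiniteDimensional ℝ P]
  {L : E →L[ℝ] P} {G G' : P → ℂ} {α : ℝ}

theorem fracOp_add (h0 : 0 < α) (h2 : α < 2) (hG : ContDiff ℝ ∞ G) (hc : HasCompactSupport G)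
    (hG' : ContDiff ℝ ∞ G') (hc' : HasCompactSupport G') (p : P) :
    fracOp α L (G + G') p = fracOp α L G p + fracOp α L G' p := by
  rw [fracOp, fracOp, fracOp, ← integral_add (integrable_kernel_smul_secondDiff h0 h2 hG hc p)
    (integrable_kernel_smul_secondDiff h0 h2 hG' hc' p)]
  refine integral_congr_ae (ae_of_all _ fun y => ?_)
  simp only [secondDiff, Pi.add_apply, ← smul_add]
  congr 1
  ring

theorem fracOp_const_smul (c : ℂ) (G : P → ℂ) (p : P) : fracOp α L (c • G) p = c * fracOp α L G p := by
  rw [fracOp, fracOp, ← integral_const_mul]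
  refine integral_congr_ae (ae_of_all _ fun y => ?_)
  simp only [secondDiff, Pi.smul_apply, smul_eq_mul, Complex.real_smul]
  ring

theorem exists_fracOp_ofReal (α : ℝ) (L : E →L[ℝ] P) (h : P → ℝ) :
    ∃ u : P → ℝ, ∀ p, fracOp α L (fun q => (h q : ℂ)) p = u p := by
  refine ⟨fun p => ∫ y, rieszKernel α y * (2 * h p - h (p + L y) - h (p - L y)), fun p => ?_⟩
  simp only
  rw [fracOp, ← integral_complex_ofReal]
  refine integral_congr_ae (ae_of_all _ fun y => ?_)
  simp [secondDiff]

end FracOpLinear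

/-! ### Linearity and reality of the pairing with a fractional operator. -/

section Pairing

variable {E : Type*} [NormedAddCommGroup E] [InnerProductSpace ℝ E] [FiniteDimensional ℝ E]
  [MeasurableSpace E] [BorelSpace E] [Nontrivial E]
variable {F : Type*} [NormedAddCommGroup F] [NormedSpace ℝ F] [FiniteDimensional ℝ F]
  [MeasurableSpace F] [BorelSpace F] {ν : Measure F} [ν.IsAddHaarMeasure]
  {G G' : E × F → ℂ} {α : ℝ} {Φ : E → F → ℝ}

/-- The pairing of a function with the fractional operator applied to a test function. -/
def fracPairing (ν : Measure F) (α : ℝ) (Φ : E → F → ℝ) (G : E × F → ℂ) : ℂ :=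
  ∫ e, ∫ f, (Φ e f : ℂ) * fracOp α (inl ℝ E F) G (e, f) ∂ν

theorem fracPairing_add (h0 : 0 < α) (h2 : α < 2) (hΦ : ∀ e, Continuous (Φ e))
    (hG : ContDiff ℝ ∞ G) (hc : HasCompactSupport G) (hG' : ContDiff ℝ ∞ G') (hc' : HasCompactSupport G')
    (hi : Integrable fun e => ∫ f, (Φ e f : ℂ) * fracOp α (inl ℝ E F) G (e, f) ∂ν)
    (hi' : Integrable fun e => ∫ f, (Φ e f : ℂ) * fracOp α (inl ℝ E F) G' (e, f) ∂ν) :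
    fracPairing ν α Φ (G + G') = fracPairing ν α Φ G + fracPairing ν α Φ G' := by
  rw [fracPairing, fracPairing, fracPairing, ← integral_add hi hi']
  refine integral_congr_ae (ae_of_all _ fun e => ?_)
  have hc : Continuous fun f => (Φ e f : ℂ) := Complex.continuous_ofReal.comp (hΦ e)
  simp only
  rw [← integral_add (integrable_fracOp_inl_section h0 h2 hG ‹_› hc e)
    (integrable_fracOp_inl_section h0 h2 hG' hc' hc e)]
  refine integral_congr_ae (ae_of_all _ fun f => ?_)
  simp only [fracOp_add h0 h2 hG ‹_› hG' hc', mul_add]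

theorem fracPairing_const_smul (ν : Measure F) (α : ℝ) (Φ : E → F → ℝ) (c : ℂ) (G : E × F → ℂ) :
    fracPairing ν α Φ (c • G) = c * fracPairing ν α Φ G := by
  rw [fracPairing, fracPairing, ← integral_const_mul]
  refine integral_congr_ae (ae_of_all _ fun e => ?_)
  simp only
  rw [← integral_const_mul]
  refine integral_congr_ae (ae_of_all _ fun f => ?_)
  simp only [fracOp_const_smul]
  ring

/-- Reality on real test functions is what allows the representing function to be real-valued. -/
theorem fracPairing_ofReal_im (ν : Measure F) (α : ℝ) (Φ : E → F → ℝ) (h : E × F → ℝ) :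
    (fracPairing ν α Φ fun p => (h p : ℂ)).im = 0 := by
  obtain ⟨u, hu⟩ := exists_fracOp_ofReal α (inl ℝ E F) h
  have h1 : fracPairing ν α Φ (fun p => (h p : ℂ)) = ((∫ e, ∫ f, Φ e f * u (e, f) ∂ν : ℝ) : ℂ) := by
    rw [fracPairing, ← integral_complex_ofReal]
    refine integral_congr_ae (ae_of_all _ fun e => ?_)
    simp only
    rw [← integral_complex_ofReal]
    refine integral_congr_ae (ae_of_all _ fun f => ?_)
    simp only [hu]
    push_cast
    rfl
  rw [h1, Complex.ofReal_im]

end Pairing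

/-! ### The two multipliers as fractional operators. -/

section FourierInv

variable {V : Type*} [NormedAddCommGroup V] [InnerProductSpace ℝ V] [FiniteDimensional ℝ V]
  [MeasurableSpace V] [BorelSpace V]

theorem fourierInv_const_mul (c : ℂ) (f : V → ℂ) (w : V) : 𝓕⁻ (fun v => c * f v) w = c * 𝓕⁻ f w := by
  rw [Real.fourierInv_eq, Real.fourierInv_eq, ← integral_const_mul]
  refine integral_congr_ae (ae_of_all _ fun v => ?_)
  simp only [Circle.smul_def, smul_eq_mul]
  ring

/-- The constant √(2π)/k converts angular frequency to the normalisation of the Fourier transform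
and removes the constant k of the difference symbol. -/
theorem exists_timeHalfDerivative_eq (m : ℕ) : ∃ c : ℝ, 0 ≤ c ∧ ∀ g : SpaceTime m → ℂ, ContDiff ℝ ∞ g →
    HasCompactSupport g → ∀ (x : 𝕏 m) (t : ℝ), timeHalfDerivative g (x, t) =
      c * fracOp (1 / 2) (inl ℝ ℝ 𝕏 m) (g ∘ Prod.swap) (t, x) := by
  obtain ⟨k, hk0, hk⟩ := exists_diffSymbol_eq (E := ℝ) (by norm_num : (0 : ℝ) < 1 / 2) (by norm_num)
  refine ⟨√(2 * Real.pi) / k, by positivity, fun g hg hc x t => ?_⟩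
  have hg' : ContDiff ℝ ∞ fun s : ℝ => g (x, s) := hg.comp (contDiff_const.prodMk contDiff_id)
  have hc' : HasCompactSupport fun s : ℝ => g (x, s) := by
    refine HasCompactSupport.of_support_subset_isCompact (hc.isCompact.image continuous_snd) fun s hs => ?_
    exact ⟨(x, s), subset_tsupport _ hs, rfl⟩
  rw [fracOp_inl]
  simp only [Function.comp_apply, Prod.swap_prod_mk]
  rw [fracOp_eq_fourierInv (by norm_num) (by norm_num) hg' hc' hk, timeHalfDerivative, ← mul_assoc,
    ← Complex.ofReal_mul, div_mul_cancel₀ _ hk0.ne', ← fourierInv_const_mul]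
  refine congrFun (congrArg FourierTransformInv.fourierInv (funext fun τ => ?_)) t
  rw [Real.sqrt_mul (by positivity), Real.sqrt_eq_rpow |τ|, Real.norm_eq_abs]
  push_cast
  ring

theorem exists_spaceAbsDerivative_eq (m : ℕ) [Nontrivial 𝕏 m] :
    ∃ c : ℝ, 0 ≤ c ∧ ∀ g : SpaceTime m → ℂ, ContDiff ℝ ∞ g → HasCompactSupport g → ∀ p : SpaceTime m,
      spaceAbsDerivative g p = c * fracOp 1 (inl ℝ 𝕏 m ℝ) g p := by
  obtain ⟨k, hk0, hk⟩ := exists_diffSymbol_eq (E := 𝕏 m) one_pos one_lt_two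
  refine ⟨2 * Real.pi / k, by positivity, fun g hg hc p => ?_⟩
  rw [fracOp_inl, fracOp_eq_fourierInv one_pos one_lt_two (contDiff_section hg p.2)
    (hasCompactSupport_section hc p.2) hk, spaceAbsDerivative, ← mul_assoc,
    ← Complex.ofReal_mul, div_mul_cancel₀ _ hk0.ne', ← fourierInv_const_mul]
  refine congrFun (congrArg FourierTransformInv.fourierInv (funext fun ξ => ?_)) p.1
  rw [Real.rpow_one]
  push_cast
  ring

/-- With no space variables the only frequency is 0, where the symbol vanishes. The kernel arguments
require a nontrivial space, so this case is treated apart. -/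
theorem spaceAbsDerivative_eq_zero {m : ℕ} [Subsingleton 𝕏 m] (g : SpaceTime m → ℂ)
    (p : SpaceTime m) : spaceAbsDerivative g p = 0 := by
  have h : ∀ ξ : 𝕏 m, ξ = 0 := fun ξ => Subsingleton.elim _ _
  rw [spaceAbsDerivative, Real.fourierInv_eq]
  refine integral_eq_zero_of_ae (ae_of_all _ fun ξ => ?_)
  simp [h ξ]

end FourierInv

/-! ### Bounded functionals on test functions of mean zero. -/

section TestFunctional

variable {m : ℕ}

/-- Smooth compactly supported functions of mean zero. -/
structure IsMeanZeroTest {𝕜 : Type*} [RCLike 𝕜] (g : SpaceTime m → 𝕜) : Prop where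
  smooth : ContDiff ℝ ∞ g
  compact : HasCompactSupport g
  mean : ∫ p, g p = 0

/-- A linear functional on test functions of mean zero, real on real functions and bounded by the `L²` norm
on every parabolic cube. -/
structure IsTestFunctional (B : ℝ) (T : (SpaceTime m → ℂ) → ℂ) : Prop where
  add : ∀ g g', IsMeanZeroTest g → IsMeanZeroTest g' → T (g + g') = T g + T g'
  smul : ∀ (c : ℂ) g, IsMeanZeroTest g → T (c • g) = c * T g
  real : ∀ h : SpaceTime m → ℝ, IsMeanZeroTest h → (T fun p => (h p : ℂ)).im = 0
  bound : ∀ g, IsMeanZeroTest g → ∀ (z : SpaceTime m) (r M : ℝ), 0 < r → 0 ≤ M →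
    (∀ p, g p ≠ 0 → p ∈ 𝒬 z r) → ∫⁻ p, ‖g p‖ₑ ^ 2 ≤ ofReal (M ^ 2) →
    ‖T g‖ ≤ B * (√(volume.real (𝒬 z r)) * M)

theorem Bornology.IsBounded.exists_subset_parabolicCube {S : Set (SpaceTime m)} (hS : Bornology.IsBounded S) :
    ∃ r : ℝ, 0 < r ∧ S ⊆ 𝒬 0 r := by
  obtain ⟨R, hR⟩ := hS.subset_closedBall (0 : SpaceTime m)
  refine ⟨|R| + 1, by positivity, fun p hp => ?_⟩
  have h1 := hR hp
  rw [Metric.mem_closedBall, dist_zero_right, Prod.norm_def, max_le_iff] at h1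
  have h2 := le_abs_self R
  refine ⟨mem_spatialCube_of_norm_lt ?_, (mem_timeInterval (by positivity)).2 ?_⟩
  · rw [Prod.fst_zero, zero_sub, norm_neg]; linarith
  · rw [Prod.snd_zero, zero_sub, abs_neg, ← Real.norm_eq_abs]
    nlinarith [abs_nonneg R]

theorem exists_support_subset_parabolicCube {V : Type*} [Zero V] {g : SpaceTime m → V}
    (hc : HasCompactSupport g) : ∃ r : ℝ, 0 < r ∧ ∀ p, g p ≠ 0 → p ∈ 𝒬 (0 : SpaceTime m) r := by
  obtain ⟨r, hr, h⟩ := hc.isCompact.isBounded.exists_subset_parabolicCube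
  exact ⟨r, hr, fun p hp => h (subset_tsupport _ hp)⟩

theorem exists_lintegral_sq_le {g : SpaceTime m → ℂ} (hg : Continuous g) (hc : HasCompactSupport g) :
    ∃ M : ℝ, 0 ≤ M ∧ ∫⁻ p, ‖g p‖ₑ ^ 2 ≤ ofReal (M ^ 2) := by
  have h1 := (hg.memLp_of_hasCompactSupport (p := 2) (μ := volume) hc).2
  rw [eLpNorm_lt_top_iff_lintegral_rpow_enorm_lt_top two_ne_zero ENNReal.ofNat_ne_top] at h1
  simp only [ENNReal.toReal_ofNat, ENNReal.rpow_ofNat] at h1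
  refine ⟨√(∫⁻ p, ‖g p‖ₑ ^ 2).toReal, Real.sqrt_nonneg _, ?_⟩
  rw [Real.sq_sqrt ENNReal.toReal_nonneg, ofReal_toReal h1.ne]

variable {B B' : ℝ} {T T' : (SpaceTime m → ℂ) → ℂ}

theorem IsTestFunctional.sum (h : IsTestFunctional B T) (h' : IsTestFunctional B' T') :
    IsTestFunctional (B + B') fun g => T g + T' g where
  add g g' hg hg' := by rw [h.add g g' hg hg', h'.add g g' hg hg']; ring
  smul c g hg := by rw [h.smul c g hg, h'.smul c g hg]; ring
  real u hu := by rw [Complex.add_im, h.real u hu, h'.real u hu, add_zero]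
  bound g hg z r M hr hM hs hgM := by
    refine (norm_add_le _ _).trans ?_
    have h1 := h.bound g hg z r M hr hM hs hgM
    have h2 := h'.bound g hg z r M hr hM hs hgM
    linarith

/-- The common passage from a pairing estimate to a functional; σ only reorders the coordinates.
Integrability of the outer integrand is not cosmetic: additivity of the iterated integrals depends
on it. -/
theorem isTestFunctional_of_fracPairing {E : Type*} [NormedAddCommGroup E] [InnerProductSpace ℝ E]
    [FiniteDimensional ℝ E] [MeasurableSpace E] [BorelSpace E] [Nontrivial E]
    {F : Type*} [NormedAddCommGroup F] [NormedSpace ℝ F] [FiniteDimensional ℝ F]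
    [MeasurableSpace F] [BorelSpace F] {ν : Measure F} [ν.IsAddHaarMeasure] {α c C : ℝ} {Ψ : E → F → ℝ}
    (h0 : 0 < α) (h2 : α < 2) (hΨ : ∀ e, Continuous (Ψ e)) (σ : (E × F) ≃L[ℝ] SpaceTime m) (hc : 0 ≤ c)
    (hT : ∀ g : SpaceTime m → ℂ, ContDiff ℝ ∞ g → HasCompactSupport g → T g = c * fracPairing ν α Ψ (g ∘ σ))
    (hpair : ∀ (g : SpaceTime m → ℂ) (z : SpaceTime m) (r M : ℝ), ContDiff ℝ ∞ g → HasCompactSupport g →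
      0 < r → 0 ≤ M → (∀ p, g p ≠ 0 → p ∈ 𝒬 z r) → ∫ p, g p = 0 →
      ∫⁻ p, ‖g p‖ₑ ^ 2 ≤ ofReal (M ^ 2) →
      (Integrable fun e => ∫ f, (Ψ e f : ℂ) * fracOp α (inl ℝ E F) (g ∘ σ) (e, f) ∂ν) ∧
      ‖fracPairing ν α Ψ (g ∘ σ)‖ ≤ C * (√(volume.real (𝒬 z r)) * M)) :
    IsTestFunctional (c * C) T := by
  have hi : ∀ g, IsMeanZeroTest g →
      Integrable fun e => ∫ f, (Ψ e f : ℂ) * fracOp α (inl ℝ E F) (g ∘ σ) (e, f) ∂ν := by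
    intro g hg
    obtain ⟨r, hr, hsr⟩ := exists_support_subset_parabolicCube hg.compact
    obtain ⟨M, hM, hgM⟩ := exists_lintegral_sq_le hg.smooth.continuous hg.compact
    exact (hpair g 0 r M hg.smooth hg.compact hr hM hsr hg.mean hgM).1
  have hsm : ∀ g : SpaceTime m → ℂ, ContDiff ℝ ∞ g → ContDiff ℝ ∞ (g ∘ σ) := fun g hg =>
    hg.comp σ.contDiff
  have hcs : ∀ g : SpaceTime m → ℂ, HasCompactSupport g → HasCompactSupport (g ∘ σ) := fun g hg =>
    hg.comp_homeomorph σ.toHomeomorph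
  refine ⟨fun g g' hg hg' => ?_, fun a g hg => ?_, fun u hu => ?_, fun g hg z r M hr hM hs hgM => ?_⟩
  · rw [hT (g + g') (hg.smooth.add hg'.smooth) (hg.compact.add hg'.compact), hT g hg.smooth hg.compact,
      hT g' hg'.smooth hg'.compact, ← mul_add]
    congr 1
    exact fracPairing_add h0 h2 hΨ (hsm g hg.smooth) (hcs g hg.compact) (hsm g' hg'.smooth)
      (hcs g' hg'.compact) (hi g hg) (hi g' hg')
  · rw [hT (a • g) (contDiff_const.smul hg.smooth) hg.compact.smul_left, hT g hg.smooth hg.compact,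
      mul_left_comm]
    exact congrArg _ (fracPairing_const_smul ν α Ψ a (g ∘ σ))
  · rw [hT (fun p => (u p : ℂ)) (Complex.ofRealCLM.contDiff.comp hu.smooth)
      (hu.compact.comp_left Complex.ofReal_zero), Complex.im_ofReal_mul]
    exact mul_eq_zero_of_right _ (fracPairing_ofReal_im ν α Ψ (u ∘ σ))
  · rw [hT g hg.smooth hg.compact, norm_mul, Complex.norm_real, Real.norm_of_nonneg hc, mul_assoc]
    exact mul_le_mul_of_nonneg_left (hpair g z r M hg.smooth hg.compact hr hM hs hg.mean hgM).2 hc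

theorem OscControl.exists_isTestFunctional_time (m : ℕ) : ∃ C : ℝ, 0 ≤ C ∧
    ∀ (ℓ A : ℝ) (Φ : SpaceTime m → ℝ), OscControl ℓ A Φ univ → IsTestFunctional (C * A)
      fun g => ∫ t : ℝ, ∫ x : 𝕏 m, (Φ (x, t) : ℂ) * timeHalfDerivative g (x, t) := by
  obtain ⟨C, hC, hpair⟩ := OscControl.exists_time_pairing m
  obtain ⟨c, hc0, hc⟩ := exists_timeHalfDerivative_eq m
  refine ⟨c * C, by positivity, fun ℓ A Φ h => ?_⟩
  have hΦ := h.lip.continuous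
  rw [mul_assoc]
  refine isTestFunctional_of_fracPairing (by norm_num : (0 : ℝ) < 1 / 2) (by norm_num)
    (Ψ := fun t x => Φ (x, t)) (fun t => by fun_prop)
    (ContinuousLinearEquiv.prodComm ℝ ℝ 𝕏 m) hc0 (fun g hg hgc => ?_) (hpair ℓ A Φ h)
  simp only [fracPairing, ← integral_const_mul, hc g hg hgc, mul_left_comm]
  rfl

theorem OscControl.exists_isTestFunctional_space (m : ℕ) : ∃ C : ℝ, 0 ≤ C ∧
    ∀ (ℓ A : ℝ) (Φ : SpaceTime m → ℝ), OscControl ℓ A Φ univ → IsTestFunctional (C * A)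
      fun g => ∫ x : 𝕏 m, ∫ t : ℝ, (Φ (x, t) : ℂ) * spaceAbsDerivative g (x, t) := by
  rcases subsingleton_or_nontrivial 𝕏 m with hE | hE
  · refine ⟨0, le_rfl, fun ℓ A Φ h => ?_⟩
    simp only [spaceAbsDerivative_eq_zero, mul_zero, integral_zero]
    exact ⟨by simp, by simp, by simp, by simp⟩
  obtain ⟨C, hC, hpair⟩ := OscControl.exists_space_pairing m
  obtain ⟨c, hc0, hc⟩ := exists_spaceAbsDerivative_eq m
  refine ⟨c * C, by positivity, fun ℓ A Φ h => ?_⟩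
  have hΦ := h.lip.continuous
  rw [mul_assoc]
  refine isTestFunctional_of_fracPairing one_pos one_lt_two (Ψ := fun x t => Φ (x, t)) (fun x => by fun_prop)
    (ContinuousLinearEquiv.refl ℝ (SpaceTime m)) hc0 (fun g hg hgc => ?_) (hpair ℓ A Φ h)
  simp only [fracPairing, ← integral_const_mul, hc g hg hgc, mul_left_comm]
  rfl

end TestFunctional

/-! ### Representation of functionals on test functions of mean zero -/

section Representation

variable {m : ℕ}

/-- The bound forces τ to factor through the range of ι. There it is a continuous functional,
extended by Hahn–Banach with the same norm and represented by the Riesz theorem. -/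
theorem LinearMap.exists_inner_eq_of_abs_le {V H : Type*} [AddCommGroup V] [Module ℝ V] [NormedAddCommGroup H]
    [InnerProductSpace ℝ H] [CompleteSpace H] (ι : V →ₗ[ℝ] H) (τ : V →ₗ[ℝ] ℝ) {C : ℝ} (hC : 0 ≤ C)
    (h : ∀ v, |τ v| ≤ C * ‖ι v‖) : ∃ u : H, ‖u‖ ≤ C ∧ ∀ v, τ v = inner ℝ u (ι v) := by
  obtain ⟨s, hs⟩ := ι.rangeRestrict.exists_rightInverse_of_surjective ι.range_rangeRestrict
  have hs' : ∀ w : LinearMap.range ι, ι (s w) = w := fun w => by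
    have := LinearMap.congr_fun hs w
    simpa using congrArg Subtype.val this
  let f : StrongDual ℝ (LinearMap.range ι) := (τ.comp s).mkContinuous C fun w => by
    have := h (s w)
    rwa [hs'] at this
  obtain ⟨φ, hφ, hn⟩ := exists_extension_norm_eq (LinearMap.range ι) f
  refine ⟨(InnerProductSpace.toDual ℝ H).symm φ, ?_, fun v => ?_⟩
  · rw [LinearIsometryEquiv.norm_map, hn]
    exact LinearMap.mkContinuous_norm_le _ hC _
  · rw [InnerProductSpace.toDual_symm_apply, hφ ⟨ι v, LinearMap.mem_range_self ι v⟩]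
    have h1 := h (v - s ⟨ι v, LinearMap.mem_range_self ι v⟩)
    rw [map_sub, map_sub, hs', sub_self, norm_zero, mul_zero] at h1
    exact sub_eq_zero.1 (abs_nonpos_iff.1 h1)

theorem IsMeanZeroTest.integrable {𝕜 : Type*} [RCLike 𝕜] {g : SpaceTime m → 𝕜} (hg : IsMeanZeroTest g) :
    Integrable g := hg.smooth.continuous.integrable_of_hasCompactSupport hg.compact

theorem IsMeanZeroTest.ofReal {h : SpaceTime m → ℝ} (hh : IsMeanZeroTest h) :
    IsMeanZeroTest fun p => (h p : ℂ) where
  smooth := Complex.ofRealCLM.contDiff.comp hh.smooth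
  compact := hh.compact.comp_left Complex.ofReal_zero
  mean := by rw [integral_complex_ofReal, hh.mean, Complex.ofReal_zero]

theorem IsMeanZeroTest.re {g : SpaceTime m → ℂ} (hg : IsMeanZeroTest g) : IsMeanZeroTest fun p => (g p).re where
  smooth := Complex.reCLM.contDiff.comp hg.smooth
  compact := hg.compact.comp_left Complex.zero_re
  mean := by
    have h := Complex.reCLM.integral_comp_comm hg.integrable
    rw [hg.mean] at h
    simpa using h

theorem IsMeanZeroTest.im {g : SpaceTime m → ℂ} (hg : IsMeanZeroTest g) : IsMeanZeroTest fun p => (g p).im where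
  smooth := Complex.imCLM.contDiff.comp hg.smooth
  compact := hg.compact.comp_left Complex.zero_im
  mean := by
    have h := Complex.imCLM.integral_comp_comm hg.integrable
    rw [hg.mean] at h
    simpa using h

/-- Real test functions of mean zero supported in a given set. -/
def meanZeroTests (S : Set (SpaceTime m)) : Submodule ℝ (SpaceTime m → ℝ) where
  carrier := {h | IsMeanZeroTest h ∧ ∀ p, h p ≠ 0 → p ∈ S}
  zero_mem' := ⟨⟨contDiff_const, HasCompactSupport.zero, by simp⟩, fun p hp => absurd rfl hp⟩
  add_mem' {h h'} hh hh' := ⟨⟨hh.1.smooth.add hh'.1.smooth, hh.1.compact.add hh'.1.compact, by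
    have := integral_add (f := h) (g := h') hh.1.integrable hh'.1.integrable
    simp only [Pi.add_apply]
    rw [this, hh.1.mean, hh'.1.mean, add_zero]⟩, fun p hp => by
      by_contra hS
      have h1 : h p = 0 := by_contra fun hne => hS (hh.2 p hne)
      have h2 : h' p = 0 := by_contra fun hne => hS (hh'.2 p hne)
      exact hp (by rw [Pi.add_apply, h1, h2, add_zero])⟩
  smul_mem' c h hh := ⟨⟨contDiff_const.smul hh.1.smooth, hh.1.compact.smul_left, by
    have := integral_const_mul c h (μ := volume)
    simp only [Pi.smul_apply, smul_eq_mul]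
    rw [this, hh.1.mean, mul_zero]⟩, fun p hp => hh.2 p fun h0 => hp (by
      rw [Pi.smul_apply, h0, smul_zero])⟩

theorem IsMeanZeroTest.memLp {h : SpaceTime m → ℝ} (hh : IsMeanZeroTest h) : MemLp h 2 volume :=
  hh.smooth.continuous.memLp_of_hasCompactSupport hh.compact

variable {B : ℝ} {T : (SpaceTime m → ℂ) → ℂ}

/-- Riesz representation in L² gives a function of norm at most B|Q|^{1/2}, and Cauchy–Schwarz on Q
turns this into the L¹ bound B|Q|. Mean-zero tests determine the function on Q only up to a
constant. -/
theorem IsTestFunctional.exists_representation_cube (hT : IsTestFunctional B T) (hB : 0 ≤ B) (z : SpaceTime m)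
    {r : ℝ} (hr : 0 < r) : ∃ f : SpaceTime m → ℝ, IntegrableOn f (𝒬 z r) ∧
      ∫ p in 𝒬 z r, ‖f p‖ ≤ B * volume.real (𝒬 z r) ∧
      ∀ h ∈ meanZeroTests (𝒬 z r), ∫ p in 𝒬 z r, f p * h p = (T fun p => (h p : ℂ)).re := by
  set Q := 𝒬 z r with hQ
  set V := volume.real Q with hV
  have hV0 : 0 < V := measureReal_parabolicCube_pos z hr
  have hQt : volume Q ≠ ⊤ := (volume_parabolicCube_lt_top z r).ne
  let ι : meanZeroTests Q →ₗ[ℝ] Lp ℝ 2 (volume : Measure (SpaceTime m)) :=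
    { toFun := fun h => h.2.1.memLp.toLp h.1
      map_add' := fun h h' => rfl
      map_smul' := fun c h => rfl }
  let τ : meanZeroTests Q →ₗ[ℝ] ℝ :=
    { toFun := fun h => (T fun p => (h.1 p : ℂ)).re
      map_add' := fun h h' => by
        rw [← Complex.add_re, ← hT.add _ _ h.2.1.ofReal h'.2.1.ofReal]
        congr 2
        funext p
        simp
      map_smul' := fun c h => by
        have h1 := hT.smul (c : ℂ) _ h.2.1.ofReal
        have h2 : (fun p => (((c • h).1 p : ℝ) : ℂ)) = (c : ℂ) • fun p => (h.1 p : ℂ) := by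
          funext p
          simp
        rw [h2, h1, Complex.re_ofReal_mul]
        rfl }
  have hbound : ∀ h, |τ h| ≤ B * √V * ‖ι h‖ := by
    intro h
    have h1 : ∫⁻ p, ‖((h.1 p : ℝ) : ℂ)‖ₑ ^ 2 ≤ ofReal (‖ι h‖ ^ 2) := by
      have h2 := eLpNorm_nnreal_pow_eq_lintegral (f := h.1) (μ := volume) (p := 2) two_ne_zero
      have h3 : ‖ι h‖ = (eLpNorm h.1 2 volume).toReal := Lp.norm_toLp _ h.2.1.memLp
      rw [h3, ← ENNReal.toReal_pow, ofReal_toReal (ENNReal.pow_ne_top h.2.1.memLp.2.ne)]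
      simp only [NNReal.coe_ofNat, ENNReal.rpow_ofNat, ENNReal.coe_ofNat] at h2
      rw [h2]
      refine le_of_eq (lintegral_congr fun p => ?_)
      rw [← ofReal_norm_eq_enorm, Complex.norm_real, ofReal_norm_eq_enorm]
    have h2 := hT.bound _ h.2.1.ofReal z r ‖ι h‖ hr (norm_nonneg _)
      (fun p hp => h.2.2 p (fun h0 => hp (by simp [h0]))) h1
    refine (Complex.abs_re_le_norm _).trans (h2.trans_eq ?_)
    ring
  obtain ⟨u, hu, hrep⟩ := ι.exists_inner_eq_of_abs_le τ (by positivity) hbound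
  have hum := Lp.memLp u
  have hQ1 : volume.restrict Q univ = volume Q := Measure.restrict_apply_univ Q
  have hui : IntegrableOn u Q := by
    haveI : IsFiniteMeasure (volume.restrict Q) := ⟨by rw [hQ1]; exact hQt.lt_top⟩
    exact (hum.restrict Q).integrable (by norm_num)
  refine ⟨u, hui, ?_, fun h hh => ?_⟩
  · have h1 := eLpNorm_le_eLpNorm_mul_rpow_measure_univ (μ := volume.restrict Q) (p := 1) (q := 2) (f := u)
      (by norm_num) hum.1.restrict
    rw [eLpNorm_one_eq_lintegral_enorm, hQ1] at h1
    have h2 : eLpNorm u 2 (volume.restrict Q) ≤ ofReal (B * √V) := by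
      refine (eLpNorm_mono_measure _ Measure.restrict_le_self).trans ?_
      rw [← ofReal_toReal hum.2.ne]
      exact ofReal_le_ofReal (by rwa [← Lp.norm_def])
    have h3 : volume Q ^ (1 / (1 : ℝ≥0∞).toReal - 1 / (2 : ℝ≥0∞).toReal) = ofReal √V := by
      have hVe : volume Q = ofReal V := (ofReal_toReal hQt).symm
      rw [hVe, ENNReal.ofReal_rpow_of_pos hV0, Real.sqrt_eq_rpow]
      norm_num
    rw [h3] at h1
    have h4 := h1.trans (mul_le_mul_left h2 _)
    rw [← ofReal_mul (by positivity), mul_assoc, Real.mul_self_sqrt hV0.le,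
      ← ofReal_integral_norm_eq_lintegral_enorm hui] at h4
    exact (ofReal_le_ofReal_iff (by positivity)).1 h4
  · have h1 := hrep ⟨h, hh⟩
    rw [L2.inner_def] at h1
    have h2 : τ ⟨h, hh⟩ = (T fun p => (h p : ℂ)).re := rfl
    rw [← h2, h1, setIntegral_eq_integral_of_forall_compl_eq_zero]
    · refine integral_congr_ae ?_
      filter_upwards [hh.1.memLp.coeFn_toLp] with p hp
      have h3 : (ι ⟨h, hh⟩ : SpaceTime m → ℝ) p = h p := hp
      rw [h3, real_inner_comm]
      rfl
    · intro p hp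
      have : h p = 0 := by_contra fun hne => hp (hh.2 p hne)
      rw [this, mul_zero]

theorem integrableOn_mul_test {f h : SpaceTime m → ℝ} {U : Set (SpaceTime m)} (hf : IntegrableOn f U)
    (hh : Continuous h) (hc : HasCompactSupport h) : IntegrableOn (fun p => f p * h p) U := by
  obtain ⟨M, hM⟩ := hc.exists_bound_of_continuous hh
  exact Integrable.mul_bdd hf hh.aestronglyMeasurable (Filter.Eventually.of_forall hM)

/-- The du Bois-Reymond argument: an arbitrary test function becomes mean-zero after subtraction of
a multiple of one fixed bump, and c is the weighted average of f against that bump. -/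
theorem exists_ae_eq_const_of_integral_mul_eq_zero {U : Set (SpaceTime m)} (hU : IsOpen U) {x : SpaceTime m}
    (hx : x ∈ U) {f : SpaceTime m → ℝ} (hf : IntegrableOn f U)
    (h : ∀ g ∈ meanZeroTests U, ∫ p in U, f p * g p = 0) :
    ∃ c, f =ᵐ[volume.restrict U] fun _ => c := by
  obtain ⟨h₀, hs, hc, hsm, hr, h1⟩ := exists_contDiff_tsupport_subset (n := ⊤) (hU.mem_nhds hx)
  have hpos : 0 < ∫ p, h₀ p := hsm.continuous.integral_pos_of_hasCompactSupport_nonneg_nonzero hc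
    (fun p => (hr ⟨p, rfl⟩).1) (x := x) (by rw [h1]; exact one_ne_zero)
  set I := ∫ p, h₀ p with hI
  have hi₀ : Integrable h₀ := hsm.continuous.integrable_of_hasCompactSupport hc
  set c := (∫ p in U, f p * h₀ p) / I with hcd
  refine ⟨c, ?_⟩
  have hkey : ∀ g : SpaceTime m → ℝ, ContDiff ℝ ∞ g → HasCompactSupport g → tsupport g ⊆ U →
      ∫ p, g p • (f p - c) = 0 := by
    intro g hg hgc hgs
    have hgi : Integrable g := hg.continuous.integrable_of_hasCompactSupport hgc
    set J := ∫ p, g p with hJ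
    have hmem : g + (-(J / I)) • h₀ ∈ meanZeroTests U := by
      refine ⟨⟨hg.add (contDiff_const.smul hsm), hgc.add hc.smul_left, ?_⟩, fun p hp => ?_⟩
      · simp only [Pi.add_apply, Pi.smul_apply, smul_eq_mul]
        rw [integral_add hgi (hi₀.const_mul _), integral_const_mul, ← hI, ← hJ]
        field_simp
        ring
      · by_contra hpU
        have e1 : g p = 0 := image_eq_zero_of_notMem_tsupport fun hne => hpU (hgs hne)
        have e2 : h₀ p = 0 := image_eq_zero_of_notMem_tsupport fun hne => hpU (hs hne)
        exact hp (by simp [e1, e2])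
    have h2 := h _ hmem
    have h3 : ∀ p, f p * (g + (-(J / I)) • h₀) p = f p * g p - J / I * (f p * h₀ p) := fun p => by
      simp only [Pi.add_apply, Pi.smul_apply, smul_eq_mul]
      ring
    simp only [h3] at h2
    have i1 := integrableOn_mul_test hf hg.continuous hgc
    have i2 := integrableOn_mul_test hf hsm.continuous hc
    rw [integral_sub i1 (Integrable.const_mul i2 _), integral_const_mul] at h2
    have hout : ∀ p, p ∉ U → g p = 0 := fun p hp => image_eq_zero_of_notMem_tsupport fun hne => hp (hgs hne)
    have h4 : ∫ p, g p • (f p - c) = ∫ p in U, (f p * g p - c * g p) := by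
      rw [← setIntegral_eq_integral_of_forall_compl_eq_zero (s := U) fun p hp => by rw [hout p hp, zero_smul]]
      refine integral_congr_ae (ae_of_all _ fun p => ?_)
      simp only [smul_eq_mul]
      ring
    rw [h4, integral_sub i1 (hgi.integrableOn.const_mul _), integral_const_mul,
      setIntegral_eq_integral_of_forall_compl_eq_zero hout, ← hJ, hcd]
    rw [← h2]
    ring
  have hloc : LocallyIntegrableOn (fun p => f p - c) U volume :=
    hf.locallyIntegrableOn.sub ((locallyIntegrable_const c).locallyIntegrableOn U)
  have h5 := hU.ae_eq_zero_of_integral_contDiff_smul_eq_zero hloc hkey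
  refine (ae_restrict_iff' hU.measurableSet).2 ?_
  filter_upwards [h5] with p hp hpU
  exact sub_eq_zero.1 (hp hpU)

/-- Representatives on nested cubes agree up to constants and are glued along an exhaustion. The
additive constants that remain on a given cube are harmless, because mean oscillation does not see
them; replacing a constant by the mean costs the factor 2. -/
theorem IsTestFunctional.exists_representation (hT : IsTestFunctional B T) (hB : 0 ≤ B) :
    ∃ F : SpaceTime m → ℝ, LocallyIntegrable F volume ∧
      (∀ g : SpaceTime m → ℂ, IsMeanZeroTest g → ∫ p, (F p : ℂ) * g p = T g) ∧
      bmoNorm F ≤ ofReal (2 * B) := by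
  choose u hui hun hu using fun (z : SpaceTime m) (r : {r : ℝ // 0 < r}) =>
    hT.exists_representation_cube hB z r.2
  -- two representatives differ by a constant
  have hdiff : ∀ (z : SpaceTime m) (r : ℝ), 0 < r → ∀ f f' : SpaceTime m → ℝ,
      IntegrableOn f (𝒬 z r) → IntegrableOn f' (𝒬 z r) →
      (∀ h ∈ meanZeroTests (𝒬 z r),
        ∫ p in 𝒬 z r, f p * h p = ∫ p in 𝒬 z r, f' p * h p) →
      ∃ c, (fun p => f p - f' p) =ᵐ[volume.restrict (𝒬 z r)] fun _ => c := by
    intro z r hr f f' hf hf' h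
    refine exists_ae_eq_const_of_integral_mul_eq_zero (isOpen_parabolicCube z r)
      (self_mem_parabolicCube z hr) (hf.sub hf') fun g hg => ?_
    have h1 := h g hg
    simp only [sub_mul]
    rw [integral_sub (integrableOn_mul_test hf hg.1.smooth.continuous hg.1.compact)
      (integrableOn_mul_test hf' hg.1.smooth.continuous hg.1.compact), h1, sub_self]
  have hrestr : ∀ (S S' : Set (SpaceTime m)) (f h : SpaceTime m → ℝ), S ⊆ S' → h ∈ meanZeroTests S →
      ∫ p in S', f p * h p = ∫ p in S, f p * h p := by
    intro S S' f h hSS hh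
    have h0 : ∀ p, p ∉ S → f p * h p = 0 := fun p hp => by
      rw [show h p = 0 from by_contra fun hne => hp (hh.2 p hne), mul_zero]
    rw [setIntegral_eq_integral_of_forall_compl_eq_zero h0,
      setIntegral_eq_integral_of_forall_compl_eq_zero fun p hp => h0 p fun hS => hp (hSS hS)]
  have hmono : ∀ {S S' : Set (SpaceTime m)} {h : SpaceTime m → ℝ}, S ⊆ S' → h ∈ meanZeroTests S →
      h ∈ meanZeroTests S' := fun hSS hh => ⟨hh.1, fun p hp => hSS (hh.2 p hp)⟩
  -- an exhausting sequence of cubes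
  set Q : ℕ → Set (SpaceTime m) := fun n => 𝒬 0 (n + 1 : ℝ) with hQ
  have hn0 : ∀ n : ℕ, (0 : ℝ) < n + 1 := fun n => by positivity
  have hQm : ∀ {n k : ℕ}, n ≤ k → Q n ⊆ Q k := fun {n k} h =>
    parabolicCube_mono (by have : (n : ℝ) ≤ k := Nat.cast_le.2 h
                           linarith)
  set v : ℕ → SpaceTime m → ℝ := fun n => u 0 ⟨n + 1, hn0 n⟩ with hv
  have hvi : ∀ n, IntegrableOn (v n) (Q n) := fun n => hui 0 ⟨n + 1, hn0 n⟩
  have hvT : ∀ n, ∀ h ∈ meanZeroTests (Q n), ∫ p in Q n, v n p * h p = (T fun p => (h p : ℂ)).re :=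
    fun n => hu 0 ⟨n + 1, hn0 n⟩
  -- Normalising to mean zero on the smallest cube fixes the free constants, so that successive
  -- representatives agree almost everywhere.
  set w : ℕ → SpaceTime m → ℝ := fun n p => v n p - ⨍ q in Q 0, v n q with hw
  have hQt : ∀ n, volume (Q n) ≠ ⊤ := fun n => (volume_parabolicCube_lt_top _ _).ne
  have hwi : ∀ n, IntegrableOn (w n) (Q n) := fun n => (hvi n).sub (integrableOn_const (hQt n))
  have hwT : ∀ n, ∀ h ∈ meanZeroTests (Q n), ∫ p in Q n, w n p * h p = (T fun p => (h p : ℂ)).re := by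
    intro n h hh
    simp only [hw, sub_mul]
    rw [integral_sub (integrableOn_mul_test (hvi n) hh.1.smooth.continuous hh.1.compact)
      (hh.1.integrable.integrableOn.const_mul _), integral_const_mul, hvT n h hh,
      setIntegral_eq_integral_of_forall_compl_eq_zero fun p hp => by_contra fun hne => hp (hh.2 p hne),
      hh.1.mean, mul_zero, sub_zero]
  have hcomp : ∀ n k, n ≤ k → w k =ᵐ[volume.restrict (Q n)] w n := by
    intro n k hnk
    obtain ⟨c, hc⟩ := hdiff 0 (n + 1) (hn0 n) (v k) (v n) ((hvi k).mono_set (hQm hnk)) (hvi n) fun h hh => by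
      rw [hvT n h hh, ← hvT k h (hmono (hQm hnk) hh)]
      exact (hrestr _ _ _ _ (hQm hnk) hh).symm
    have h0 : (fun p => v k p) =ᵐ[volume.restrict (Q 0)] fun p => v n p + c := by
      filter_upwards [ae_mono (Measure.restrict_mono (hQm (Nat.zero_le n)) le_rfl) hc] with p hp
      linarith
    have h1 : ⨍ q in Q 0, v k q = (⨍ q in Q 0, v n q) + c := by
      have hpos : 0 < volume.real (Q 0) := measureReal_parabolicCube_pos _ (hn0 0)
      rw [average_congr h0, setAverage_eq, setAverage_eq,
        integral_add ((hvi n).mono_set (hQm (Nat.zero_le n))) (integrableOn_const (hQt 0)),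
        setIntegral_const, smul_add, smul_smul, inv_mul_cancel₀ hpos.ne', one_smul]
    filter_upwards [hc] with p hp
    simp only [hw, h1]
    linarith
  have hex : ∀ p : SpaceTime m, ∃ n, p ∈ Q n := by
    intro p
    obtain ⟨r, _, hrS⟩ := (Bornology.isBounded_singleton (x := p)).exists_subset_parabolicCube
    obtain ⟨n, hn⟩ := exists_nat_ge r
    exact ⟨n, parabolicCube_mono (by linarith) (hrS rfl)⟩
  classical
  set F : SpaceTime m → ℝ := fun p => w (Nat.find (hex p)) p with hF
  have hFw : ∀ n, F =ᵐ[volume.restrict (Q n)] w n := by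
    intro n
    have h1 : ∀ j : ℕ, ∀ᵐ p, j ≤ n → p ∈ Q j → w n p = w j p := fun j => by
      by_cases hj : j ≤ n
      · filter_upwards [(ae_restrict_iff' (measurableSet_parabolicCube _ _)).1 (hcomp j n hj)] with p hp _
        exact hp
      · exact Filter.Eventually.of_forall fun p h => absurd h hj
    refine (ae_restrict_iff' (measurableSet_parabolicCube _ _)).2 ?_
    filter_upwards [ae_all_iff.2 h1] with p hp hpQ
    exact (hp _ (Nat.find_min' (hex p) hpQ) (Nat.find_spec (hex p))).symm
  have hFi : ∀ n, IntegrableOn F (Q n) := fun n => (hwi n).congr (hFw n).symm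
  have hFloc : LocallyIntegrable F volume := fun p => by
    obtain ⟨n, hn⟩ := hex p
    exact ⟨Q n, (isOpen_parabolicCube _ _).mem_nhds hn, hFi n⟩
  have hFT : ∀ h : SpaceTime m → ℝ, IsMeanZeroTest h → ∫ p, F p * h p = (T fun p => (h p : ℂ)).re := by
    intro h hh
    obtain ⟨r, _, hrS⟩ := exists_support_subset_parabolicCube hh.compact
    obtain ⟨n, hn⟩ := exists_nat_ge r
    have hmem : h ∈ meanZeroTests (Q n) := ⟨hh, fun p hp => parabolicCube_mono (by linarith) (hrS p hp)⟩
    rw [← hwT n h hmem, ← setIntegral_eq_integral_of_forall_compl_eq_zero (s := Q n) fun p hp => by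
      rw [show h p = 0 from by_contra fun hne => hp (hmem.2 p hne), mul_zero]]
    refine integral_congr_ae ?_
    filter_upwards [hFw n] with p hp
    rw [hp]
  have hFTc : ∀ h : SpaceTime m → ℝ, IsMeanZeroTest h →
      ((∫ p, F p * h p : ℝ) : ℂ) = T fun p => (h p : ℂ) := by
    intro h hh
    rw [hFT h hh]
    exact Complex.ext (Complex.ofReal_re _) (by rw [Complex.ofReal_im, hT.real h hh])
  have hFint : ∀ h : SpaceTime m → ℝ, IsMeanZeroTest h → Integrable fun p => F p * h p := by
    intro h hh
    exact hFloc.integrable_smul_right_of_hasCompactSupport hh.smooth.continuous hh.compact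
  refine ⟨F, hFloc, fun g hg => ?_, ?_⟩
  · have hre := hFTc _ hg.re
    have him := hFTc _ hg.im
    have hsplit : g = (fun p => ((g p).re : ℂ)) + Complex.I • fun p => ((g p).im : ℂ) := by
      funext p
      simp only [Pi.add_apply, Pi.smul_apply, smul_eq_mul]
      rw [mul_comm]
      exact (Complex.re_add_im (g p)).symm
    have himI : IsMeanZeroTest (Complex.I • fun p => ((g p).im : ℂ)) :=
      ⟨contDiff_const.smul hg.im.ofReal.smooth, hg.im.ofReal.compact.smul_left, by
        simp only [Pi.smul_apply, smul_eq_mul]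
        rw [integral_const_mul, hg.im.ofReal.mean, mul_zero]⟩
    have hTg : T g = (T fun p => ((g p).re : ℂ)) + Complex.I * T fun p => ((g p).im : ℂ) := by
      conv_lhs => rw [hsplit]
      rw [hT.add _ _ hg.re.ofReal himI, hT.smul _ _ hg.im.ofReal]
    rw [hTg, ← hre, ← him, ← integral_complex_ofReal, ← integral_complex_ofReal, ← integral_const_mul,
      ← integral_add (hFint _ hg.re).ofReal ((hFint _ hg.im).ofReal.const_mul _)]
    refine integral_congr_ae (ae_of_all _ fun p => ?_)
    simp only
    conv_lhs => rw [← Complex.re_add_im (g p)]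
    push_cast
    ring
  · refine (hasMeanOscLE_iff (by positivity) hFloc).1 fun z r hr _ => ?_
    have hFz := hFloc.integrableOn_parabolicCube z r
    -- On an arbitrary cube, F is that cube's own representative plus a constant, and the
    -- representative has average modulus at most B.
    obtain ⟨c, hc⟩ := hdiff z r hr F (u z ⟨r, hr⟩) hFz (hui z ⟨r, hr⟩) fun h hh => by
      rw [hu z ⟨r, hr⟩ h hh, ← hFT h hh.1]
      exact setIntegral_eq_integral_of_forall_compl_eq_zero fun p hp => by
        rw [show h p = 0 from by_contra fun hne => hp (hh.2 p hne), mul_zero]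
    have hpos := measureReal_parabolicCube_pos z hr
    refine (setAverage_norm_sub_average_le hFz c (volume_parabolicCube_lt_top z r).ne
      (volume_parabolicCube_pos z hr).ne').trans (mul_le_mul_of_nonneg_left ?_ (by norm_num))
    rw [setAverage_eq, smul_eq_mul, inv_mul_le_iff₀ hpos, mul_comm]
    refine le_of_eq_of_le (integral_congr_ae ?_) (hun z ⟨r, hr⟩)
    filter_upwards [hc] with p hp
    rw [← hp, sub_sub_cancel]

end Representation

/-! ### The extension theorem -/

/-- The trivial bound, needed only when η ≥ 1 and ℓ < 1. -/
theorem IsLipHalfOn.bmoNorm_spatialGradient_le {m : ℕ} {ℓ : ℝ} {Φ : SpaceTime m → ℝ}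
    (h : IsLipHalfOn ℓ Φ univ) : bmoNorm (∇ₓ Φ) ≤ ofReal (2 * ℓ) := by
  have hb := h.isBddMeas
  refine (hasMeanOscLE_iff (by linarith [h.nonneg_of_univ]) hb.locallyIntegrable).1 fun z r hr _ => ?_
  have hQt := (volume_parabolicCube_lt_top z r).ne
  have hQ0 := (volume_parabolicCube_pos z hr).ne'
  refine (setAverage_norm_sub_average_le (hb.integrableOn hQt) 0 hQt hQ0).trans
    (mul_le_mul_of_nonneg_left ?_ (by norm_num))
  simp only [sub_zero]
  exact setAverage_le_const (measurableSet_parabolicCube z r) (hb.norm.integrableOn hQt) hQt hQ0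
    fun p _ => hb.bound p

theorem OscControl.exists_parabolicDerivative (m : ℕ) : ∃ C : ℝ, 0 ≤ C ∧
    ∀ (ℓ A : ℝ) (Φ : SpaceTime m → ℝ), OscControl ℓ A Φ univ →
      ∃ F, IsParabolicDerivative Φ F ∧ bmoNorm F ≤ ofReal (C * A) := by
  obtain ⟨C, hC, htime⟩ := OscControl.exists_isTestFunctional_time m
  obtain ⟨C', hC', hspace⟩ := OscControl.exists_isTestFunctional_space m
  refine ⟨2 * (C + C'), by positivity, fun ℓ A Φ h => ?_⟩
  have hA := h.pos
  obtain ⟨F, hF, hFT, hbmo⟩ := ((htime ℓ A Φ h).sum (hspace ℓ A Φ h)).exists_representation (by positivity)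
  refine ⟨F, ⟨hF, fun g hg hc hmean => hFT g ⟨hg, hc, hmean⟩⟩, hbmo.trans_eq ?_⟩
  congr 1
  ring

theorem theorem2p7 (m : ℕ) :
    -- the implied constants: `C ε` depends on `m` and `ε`, `C₀` on `m` only
    ∃ (C : ℝ → ℝ) (C₀ : ℝ),
      ∀ (d r₁ η : ℝ) (δ : ℝ≥0 → ℝ≥0), 0 < d → 0 < r₁ → 0 < η → δ 0 = 0 → ContinuousAt δ 0 →
      ∃ d' : ℝ, 0 < d' ∧ d' ≤ d ∧
        ∀ (z₀ : SpaceTime m) (ℓ : ℝ) (φ : SpaceTime m → ℝ),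
          IsLipHalfOn ℓ φ (parabolicCube z₀ (8 * d)) →
          (∀ (z : SpaceTime m) (s : ℝ), 0 < s → s ≤ r₁ →
            parabolicCube z s ⊆ parabolicCube z₀ (8 * d) →
            timeDifference φ z s ≤ ENNReal.ofReal (η ^ 2)) →
          bmoDistModulusClass (spatialGradient φ) δ (parabolicCube z₀ (8 * d))
            ≤ ENNReal.ofReal η →
          ∀ (z : SpaceTime m) (r : ℝ), 0 < r → r ≤ d' →
            parabolicCube z r ⊆ parabolicCube z₀ (4 * d) →
            ∃ Φ : SpaceTime m → ℝ,
              Set.EqOn Φ φ (parabolicCube z r) ∧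
              IsLipHalfOn ℓ Φ Set.univ ∧
              (∀ ε : ℝ, 0 < ε → ε < 1 →
                bmoNorm (spatialGradient Φ)
                  ≤ ENNReal.ofReal (C ε * (η ^ (1 - ε) + η * ℓ))) ∧
              (∀ (w : SpaceTime m) (s : ℝ), 0 < s →
                timeDifference Φ w s ≤ ENNReal.ofReal (C₀ * η ^ 2)) ∧
              ∃ F : SpaceTime m → ℝ, IsParabolicDerivative Φ F ∧
                (η < 1 → ∀ ε : ℝ, 0 < ε → ε < 1 →
                  bmoNorm F ≤ ENNReal.ofReal (C ε * (η ^ (1 - ε) + η * ℓ))) ∧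
                (1 ≤ η → bmoNorm F ≤ ENNReal.ofReal (C₀ * (η + ℓ))) := by
  obtain ⟨K, hK, hder⟩ := OscControl.exists_parabolicDerivative m
  set e := extensionConst m with he
  have he1 : 1 ≤ e := one_le_extensionConst m
  have he0 : 0 < e := by linarith
  set c : ℝ := 36 * e ^ 2 + 6 * e + K * (6 * e) + 2 with hc
  have hc0 : 0 < c := by positivity
  have hce : 6 * e ≤ c := by rw [hc]; nlinarith [mul_nonneg hK he0.le]
  have hc2 : 2 ≤ c := by rw [hc]; nlinarith [mul_nonneg hK he0.le]
  have hcK : K * (6 * e) ≤ c := by rw [hc]; nlinarith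
  have hce2 : 36 * e ^ 2 ≤ c := by rw [hc]; nlinarith [mul_nonneg hK he0.le]
  -- One constant serves every ε: the oscillations of the gradient and of the parabolic derivative
  -- have already been bounded linearly in η.
  refine ⟨fun _ => c, c, fun d r₁ η δ hd hr₁ hη h0 hδ => ?_⟩
  obtain ⟨d', hd', hd'd, hφ⟩ := exists_oscControl_of_bmoDist m hd hr₁ hη h0 hδ
  refine ⟨d', hd', hd'd, fun z₀ ℓ φ hlip htime hbmo z r hr hrd hz => ?_⟩
  obtain ⟨ψ, hψ, hosc⟩ := hφ z₀ ℓ φ hlip htime hbmo z r hr hrd hz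
  obtain ⟨Φ, hΦψ, hΦ⟩ := hosc.exists_extension hr
  have hsub : parabolicCube z r ⊆ parabolicCube z₀ (8 * d) := hz.trans (parabolicCube_mono (by linarith))
  have hℓ : 0 ≤ ℓ := hΦ.lip.nonneg_of_univ
  obtain ⟨F, hF, hFb⟩ := hder ℓ _ Φ hΦ
  have hpow : ∀ ε : ℝ, 0 < ε → ε < 1 → η < 1 → η ≤ η ^ (1 - ε) := by
    intro ε h1 h2 h3
    have := Real.rpow_le_rpow_of_exponent_ge hη h3.le (by linarith : 1 - ε ≤ 1)
    rwa [Real.rpow_one] at this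
  refine ⟨Φ, fun p hp => (hΦψ hp).trans (hψ (hsub hp)), hΦ.lip, fun ε h1 h2 => ?_, fun w s hs => ?_,
    F, hF, fun h3 ε h1 h2 => ?_, fun h3 => ?_⟩
  · have hp : 0 < η ^ (1 - ε) := Real.rpow_pos_of_pos hη _
    have hgrad : bmoNorm (spatialGradient Φ) ≤ ENNReal.ofReal (e * (6 * η)) :=
      (hasMeanOscLE_iff (by positivity) hΦ.lip.isBddMeas.locallyIntegrable).1 hΦ.osc
    -- For η < 1, η ≤ η^{1-ε}. For η ≥ 1 the linear bound is absorbed by ηℓ if ℓ ≥ 1, and otherwise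
    -- the trivial bound 2ℓ is at most 2η^{1-ε}.
    rcases lt_or_ge η 1 with h3 | h3
    · refine hgrad.trans (ENNReal.ofReal_le_ofReal ?_)
      have h4 := hpow ε h1 h2 h3
      calc e * (6 * η) = 6 * e * η := by ring
        _ ≤ c * (η ^ (1 - ε) + η * ℓ) :=
          mul_le_mul hce (h4.trans (le_add_of_nonneg_right (by positivity))) hη.le hc0.le
    · rcases le_or_gt 1 ℓ with h4 | h4
      · refine hgrad.trans (ENNReal.ofReal_le_ofReal ?_)
        calc e * (6 * η) = 6 * e * η := by ring
          _ ≤ c * (η ^ (1 - ε) + η * ℓ) :=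
            mul_le_mul hce ((le_mul_of_one_le_right hη.le h4).trans (le_add_of_nonneg_left hp.le)) hη.le hc0.le
      · refine hΦ.lip.bmoNorm_spatialGradient_le.trans (ENNReal.ofReal_le_ofReal ?_)
        have h5 : 1 ≤ η ^ (1 - ε) := Real.one_le_rpow h3 (by linarith)
        refine mul_le_mul hc2 ?_ hℓ hc0.le
        have : 0 ≤ η * ℓ := by positivity
        linarith
  · refine (hΦ.time w s hs (Set.subset_univ _)).trans (ENNReal.ofReal_le_ofReal ?_)
    calc (e * (6 * η)) ^ 2 = 36 * e ^ 2 * η ^ 2 := by ring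
      _ ≤ c * η ^ 2 := mul_le_mul_of_nonneg_right hce2 (by positivity)
  · refine hFb.trans (ENNReal.ofReal_le_ofReal ?_)
    calc K * (e * (6 * η)) = K * (6 * e) * η := by ring
      _ ≤ c * (η ^ (1 - ε) + η * ℓ) :=
        mul_le_mul hcK ((hpow ε h1 h2 h3).trans (le_add_of_nonneg_right (by positivity))) hη.le hc0.le
  · refine hFb.trans (ENNReal.ofReal_le_ofReal ?_)
    calc K * (e * (6 * η)) = K * (6 * e) * η := by ring
      _ ≤ c * (η + ℓ) := mul_le_mul hcK (by linarith) hη.le hc0.le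

end
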